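/- Let $M$ be a smooth ($C^\infty$, Hausdorff, second countable, finite-dimensional) manifold without boundary, let $r,k\ge 0$ be integers, and let $(S,P)$ be an $r$-Poisson structure on $M$. That is, $S\to M$ is a smooth vector subbundle of constant rank $s$ of $\oplus_r T^*M=T^*M\otimes\mathbb R^r=\mathrm{Hom}(TM,\mathbb R^r)$ and $P:S\to TM$ is a smooth vector bundle morphism over the identity such that 1. $i_{P(\eta)}\eta=0$ for all $\eta\in S$; 2. $S^\circ=\{v\in TM:\ i_v\eta=0\ \text{for all}\ \eta\in S\}=0$; 3. $\Gamma(S)$ is closed under the bracket $\lfloor\eta,\gamma\rfloor=\mathcal L_{P(\eta)}\gamma-i_{P(\gamma)}d\eta$, and this bracket satisfies the Jacobi identity on $\Gamma(S)$. Let $\oplus_r T^*(PM)$ be the set of pairs $(X,\eta)$ with $X:[0,1]\to M$ of class $C^{k+1}$ and $\eta$ a $C^k$ section of $X^*(\oplus_r T^*M)$. It carries its standard smooth Banach manifold structure, modelled on $C^{k+1}([0,1],\mathbb R^{m})\times C^k([0,1],\mathrm{Hom}(\mathbb R^{m},\mathbb R^r))$ with $m=\dim M$. Its charts are induced by the smooth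 time-dependent charts $\tau_t$ of $M$: $(X,\eta)\mapsto(u,\zeta)$ with $u(t)=\tau_t(X(t))$ and $\eta(t)=\zeta(t)\circ d\tau_t$. Let $$\bar\omega(v,w)=\int_0^1\omega_{can}(v(t),w(t))\,dt\in\mathbb R^r,$$ where $v(t)$, $w(t)$ are the images of the tangent vectors $v,w$ under the differential of the evaluation $(X,\eta)\mapsto(X(t),\eta(t))$, and $\omega_{can}$ is the canonical $\mathbb R^r$-valued 2-form of $\oplus_r T^*M$, in cotangent coordinates $\omega_{can}(\delta_1,\delta_2)=\delta_2p(\delta_1x)-\delta_1p(\delta_2x)$. Then the above charts do form a smooth atlas for such a Banach manifold structure, and the following hold. (a) The space of $S$-paths $P(S)=\{(X,\eta):\eta(t)\in S_{X(t)}\ \text{for all}\ t\}$ is a (split, embedded) smooth Banach submanifold of $\oplus_rT^*(PM)$, modelled on $C^{k+1}([0,1],\mathbb R^m)\times C^k([0,1],\mathbb R^s)$. With $\omega=\iota^*\bar\omega$, where $\iota$ is the inclusion, it is weak $r$-symplectic: $\omega$ is a smooth closed $\mathbb R^r$-valued 2-form, and the induced map $T P(S)\to T^*P(S)\otimes\mathbb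 R^r$ is injective. (b) The space $$C_{(S,P)}=\{(X,\eta)\in P(S):\ dX+P_X(\eta)=0\}$$ is a (split, embedded) smooth Banach submanifold of $P(S)$, modelled on $\mathbb R^m\times C^k([0,1],\mathbb R^s)$. It is coisotropic: for each $c\in C_{(S,P)}$ the orthogonal $(T_cC_{(S,P)})^{\omega}=\{v\in T_cP(S):\omega(v,w)=0\ \text{for all}\ w\in T_cC_{(S,P)}\}$ is contained in $T_cC_{(S,P)}$. Its characteristic distribution $(TC_{(S,P)})^\omega$ has finite codimension in $TC_{(S,P)}$: there is an integer $d\geq 0$ such that $\dim\big(T_cC_{(S,P)}/(T_cC_{(S,P)})^{\omega}\big)=d$ for every $c\in C_{(S,P)}$. -/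

import Mathlib

open Set Bundle Manifold MeasureTheory
open scoped Manifold ContDiff Topology unitInterval

universe u v

noncomputable section

/-! ### The Banach space `C^k([0,1], F)` -/

section Curves

variable (k : ℕ) (F : Type u) [NormedAddCommGroup F] [NormedSpace ℝ F]

/-- The space `C^k([0,1], F)`. A curve is stored with its derivatives, as the tuple
`(f, f', …, f^(k))` of continuous functions; the norm is the maximum of the sup norms
of `f, f', …, f^(k)`. -/
def ckSubmodule : Submodule ℝ (Fin (k + 1) → C(I, F)) where
  carrier := {f | ∀ (i : Fin k) (t : I),
    HasDerivWithinAt (fun τ : ℝ => f i.castSucc (projIcc 0 1 zero_le_one τ)) (f i.succ t)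
      (Icc 0 1) t}
  add_mem' := fun {f g} hf hg i t => (hf i t).add (hg i t)
  zero_mem' := fun i t => by
    simpa using hasDerivWithinAt_const (t : ℝ) (Icc (0 : ℝ) 1) (0 : F)
  smul_mem' := fun c f hf i t => (hf i t).const_smul c

/-- The Banach space `C^k([0,1], F)`. -/
def CkCurve : Type u := ckSubmodule k F

instance : NormedAddCommGroup (CkCurve k F) :=
  inferInstanceAs (NormedAddCommGroup (ckSubmodule k F))

instance : NormedSpace ℝ (CkCurve k F) :=
  inferInstanceAs (NormedSpace ℝ (ckSubmodule k F))

variable {k F}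

/-- The value of the curve `f` at the time `t`. -/
def CkCurve.eval (f : CkCurve k F) (t : I) : F :=
  (show ckSubmodule k F from f).1 0 t

theorem mem_ckSubmodule_iff_integral [CompleteSpace F] (f : Fin (k + 1) → C(I, F)) :
    f ∈ ckSubmodule k F ↔ ∀ (i : Fin k) (t : I), f i.castSucc t = f i.castSucc 0 +
      ∫ τ in (0 : ℝ)..t, f i.succ (projIcc 0 1 zero_le_one τ) := by
  have hc : ∀ j, Continuous (fun τ : ℝ => f j (projIcc 0 1 zero_le_one τ)) := fun j =>
    (f j).continuous.comp continuous_projIcc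
  constructor
  · intro hf i t
    have key : ∫ τ in (0 : ℝ)..t, f i.succ (projIcc 0 1 zero_le_one τ) =
        f i.castSucc (projIcc 0 1 zero_le_one (t : ℝ)) -
          f i.castSucc (projIcc 0 1 zero_le_one (0 : ℝ)) := by
      refine intervalIntegral.integral_eq_sub_of_hasDerivAt_of_le t.2.1
        (hc i.castSucc).continuousOn (fun x hx => ?_) ((hc i.succ).intervalIntegrable _ _)
      have hx1 : x ∈ Ioo (0 : ℝ) 1 := ⟨hx.1, hx.2.trans_le t.2.2⟩
      have hx2 : x ∈ Icc (0 : ℝ) 1 := Ioo_subset_Icc_self hx1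
      have h := (hf i ⟨x, hx2⟩).hasDerivAt (Icc_mem_nhds hx1.1 hx1.2)
      rw [projIcc_of_mem zero_le_one hx2]
      exact h
    rw [key, projIcc_val, projIcc_left]
    exact (add_sub_cancel _ _).symm
  · intro hf i t
    have h1 : HasDerivAt (fun s : ℝ => f i.castSucc 0 +
        ∫ τ in (0 : ℝ)..s, f i.succ (projIcc 0 1 zero_le_one τ)) (f i.succ t) t := by
      have := (intervalIntegral.integral_hasDerivAt_right
        ((hc i.succ).intervalIntegrable 0 (t : ℝ))
        ((hc i.succ).stronglyMeasurableAtFilter _ _) (hc i.succ).continuousAt).const_add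
          (f i.castSucc 0)
      rwa [projIcc_val] at this
    refine h1.hasDerivWithinAt.congr (fun x hx => ?_) ?_
    · rw [projIcc_of_mem zero_le_one hx]
      exact hf i ⟨x, hx⟩
    · rw [projIcc_val]
      exact hf i t

instance CkCurve.instCompleteSpace [CompleteSpace F] : CompleteSpace (CkCurve k F) := by
  have hcl : IsClosed ((ckSubmodule k F : Submodule ℝ (Fin (k + 1) → C(I, F))) :
      Set (Fin (k + 1) → C(I, F))) := by
    have : ((ckSubmodule k F : Submodule ℝ (Fin (k + 1) → C(I, F))) :
        Set (Fin (k + 1) → C(I, F))) = ⋂ (i : Fin k) (t : I),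
          {f | f i.castSucc t = f i.castSucc 0 +
            ∫ τ in (0 : ℝ)..t, f i.succ (projIcc 0 1 zero_le_one τ)} := by
      ext f
      simp only [SetLike.mem_coe, mem_ckSubmodule_iff_integral, mem_iInter, mem_ofPred_eq]
    rw [this]
    refine isClosed_iInter fun i => isClosed_iInter fun t => ?_
    have e : ∀ (j : Fin (k + 1)) (s : I),
        Continuous fun f : Fin (k + 1) → C(I, F) => f j s := fun j s =>
      (ContinuousEvalConst.continuous_eval_const s).comp (continuous_apply j)
    refine isClosed_eq (e _ _) ((e _ _).add ?_)
    refine intervalIntegral.continuous_parametric_intervalIntegral_of_continuous' ?_ _ _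
    have : Continuous fun p : C(I, F) × ℝ =>
        p.1 (projIcc (0 : ℝ) 1 zero_le_one p.2) :=
      continuous_eval.comp (continuous_fst.prodMk
        ((continuous_projIcc (h := zero_le_one (α := ℝ))).comp continuous_snd))
    have h2 : Continuous fun q : (Fin (k + 1) → C(I, F)) × ℝ => (q.1 i.succ, q.2) :=
      ((continuous_apply i.succ).comp continuous_fst).prodMk continuous_snd
    exact this.comp h2
  exact hcl.completeSpace_coe

end Curves

variable (E : Type u) [NormedAddCommGroup E] [NormedSpace ℝ E]
  (M : Type v) [TopologicalSpace M] [ChartedSpace E M]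

/-! ### The bundle of covelocities and poly-Poisson structures -/

/-- The fibre at `x` of `⊕_r T^*M = T^*M ⊗ ℝ^r`, that is, `Hom(T_x M, ℝ^r)`. -/
abbrev CoVel (r : ℕ) (x : M) : Type u :=
  TangentSpace 𝓘(ℝ, E) x →L[ℝ] Trivial M (Fin r → ℝ) x

/-- The total space of `⊕_r T^*M`. -/
abbrev CoVelSpace (r : ℕ) : Type (max v u) :=
  TotalSpace (E →L[ℝ] (Fin r → ℝ)) (CoVel E M r)

/-- The model with corners of the manifold `⊕_r T^*M`. -/
abbrev coVelModel (r : ℕ) :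
    ModelWithCorners ℝ (E × (E →L[ℝ] (Fin r → ℝ))) (ModelProd E (E →L[ℝ] (Fin r → ℝ))) :=
  𝓘(ℝ, E).prod 𝓘(ℝ, E →L[ℝ] (Fin r → ℝ))

variable {E M} in
/-- The canonical `ℝ^r`-valued 2-form `(p_1^* ω_can, …, p_r^* ω_can)` of `⊕_r T^*M` at `p`.
A tangent vector at `p` is, by the conventions of Mathlib, the pair `(δx, δp)` of its components in
the cotangent coordinates induced by the preferred chart of `M` at the base point of `p`. -/
def coVelForm {r : ℕ} [IsManifold 𝓘(ℝ, E) ∞ M] (p : CoVelSpace E M r)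
    (v w : TangentSpace (coVelModel E r) p) : Fin r → ℝ :=
  let v' : E × (E →L[ℝ] (Fin r → ℝ)) := v
  let w' : E × (E →L[ℝ] (Fin r → ℝ)) := w
  w'.2 v'.1 - v'.2 w'.1

section PolyPoisson

variable {E M}

/-- A vector field in the preferred chart at `x₀`. -/
def fieldInChart (x₀ : M) (V : ∀ x : M, TangentSpace 𝓘(ℝ, E) x) : E → E := fun y =>
  mfderiv 𝓘(ℝ, E) 𝓘(ℝ, E) (extChartAt 𝓘(ℝ, E) x₀) ((extChartAt 𝓘(ℝ, E) x₀).symm y)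
    (V ((extChartAt 𝓘(ℝ, E) x₀).symm y))

/-- An `ℝ^r`-valued 1-form in the preferred chart at `x₀`. -/
def formInChart {r : ℕ} (x₀ : M) (γ : ∀ x : M, CoVel E M r x) : E → E →L[ℝ] (Fin r → ℝ) :=
  fun y => (γ ((extChartAt 𝓘(ℝ, E) x₀).symm y)).comp
    (mfderiv 𝓘(ℝ, E) 𝓘(ℝ, E) (extChartAt 𝓘(ℝ, E) x₀).symm y)

/-- The Lie derivative `ℒ_V γ` of an `ℝ^r`-valued 1-form at `x`; in coordinates,
`(ℒ_V γ)(z) = (D_V γ)(z) + γ(D_z V)`. -/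
def lieDerivForm {r : ℕ} (V : ∀ x : M, TangentSpace 𝓘(ℝ, E) x) (γ : ∀ x : M, CoVel E M r x)
    (x : M) : CoVel E M r x :=
  (fderiv ℝ (formInChart x γ) (extChartAt 𝓘(ℝ, E) x x)
      (fieldInChart x V (extChartAt 𝓘(ℝ, E) x x)) +
    (formInChart x γ (extChartAt 𝓘(ℝ, E) x x)).comp
      (fderiv ℝ (fieldInChart x V) (extChartAt 𝓘(ℝ, E) x x))).comp
  (mfderiv 𝓘(ℝ, E) 𝓘(ℝ, E) (extChartAt 𝓘(ℝ, E) x) x)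

/-- The contraction `i_W dη` of the exterior derivative of an `ℝ^r`-valued 1-form at `x`; in
coordinates, `(i_W dη)(z) = (D_W η)(z) - (D_z η)(W)`. -/
def contractExtDeriv {r : ℕ} (W : ∀ x : M, TangentSpace 𝓘(ℝ, E) x) (η : ∀ x : M, CoVel E M r x)
    (x : M) : CoVel E M r x :=
  (fderiv ℝ (formInChart x η) (extChartAt 𝓘(ℝ, E) x x)
      (fieldInChart x W (extChartAt 𝓘(ℝ, E) x x)) -
    (fderiv ℝ (formInChart x η) (extChartAt 𝓘(ℝ, E) x x)).flip
      (fieldInChart x W (extChartAt 𝓘(ℝ, E) x x))).comp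
  (mfderiv 𝓘(ℝ, E) 𝓘(ℝ, E) (extChartAt 𝓘(ℝ, E) x) x)

variable [IsManifold 𝓘(ℝ, E) ∞ M]

/-- `α` is smooth on `U`, as a section of `⊕_r T^*M`. -/
def SmoothFormOn {r : ℕ} (α : ∀ x : M, CoVel E M r x) (U : Set M) : Prop :=
  ContMDiffOn 𝓘(ℝ, E) (coVelModel E r) ∞
    (fun x => (TotalSpace.mk' (E →L[ℝ] (Fin r → ℝ)) x (α x) : CoVelSpace E M r)) U

/-- `V` is a smooth vector field on `U`. -/
def SmoothFieldOn (V : ∀ x : M, TangentSpace 𝓘(ℝ, E) x) (U : Set M) : Prop :=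
  ContMDiffOn 𝓘(ℝ, E) 𝓘(ℝ, E).tangent ∞
    (fun x => (TotalSpace.mk' E x (V x) : TangentBundle 𝓘(ℝ, E) M)) U

variable {r : ℕ} (S : ∀ x : M, Submodule ℝ (CoVel E M r x))
  (P : ∀ x : M, S x →ₗ[ℝ] TangentSpace 𝓘(ℝ, E) x)

/-- `S` is a smooth vector subbundle of `⊕_r T^*M` of rank `s`: locally it has smooth frames. -/
def IsSubbundle (s : ℕ) : Prop :=
  ∀ x₀ : M, ∃ U ∈ 𝓝 x₀, ∃ e : Fin s → ∀ x : M, CoVel E M r x,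
    (∀ i, SmoothFormOn (e i) U) ∧
    ∀ x ∈ U, LinearIndependent ℝ (fun i => e i x) ∧
      Submodule.span ℝ (Set.range fun i => e i x) = S x

/-- The global smooth sections `Γ(S)`. -/
def IsSmoothSection (η : ∀ x : M, S x) : Prop := SmoothFormOn (fun x => (η x).1) univ

variable {S} in
/-- The bracket `⌊η, γ⌋ = ℒ_{P(η)} γ - i_{P(γ)} dη`. -/
def ppBracket (η γ : ∀ x : M, S x) (x : M) : CoVel E M r x :=
  lieDerivForm (fun y => P y (η y)) (fun y => (γ y).1) x -
    contractExtDeriv (fun y => P y (γ y)) (fun y => (η y).1) x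

/-- `(S, P)` is an `r`-Poisson structure on `M`, with `S` of rank `s`. -/
structure IsPolyPoisson (s : ℕ) : Prop where
  subbundle : IsSubbundle S s
  /-- `P : S → TM` is a smooth bundle morphism: it maps smooth local sections to smooth ones. -/
  smooth_anchor : ∀ (U : Set M) (η : ∀ x : M, S x), IsOpen U →
    SmoothFormOn (fun x => (η x).1) U → SmoothFieldOn (fun x => P x (η x)) U
  contraction : ∀ (x : M) (η : S x), η.1 (P x η) = 0
  annihilator : ∀ (x : M) (v : TangentSpace 𝓘(ℝ, E) x), (∀ η : S x, η.1 v = 0) → v = 0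
  closed : ∀ η γ : ∀ x : M, S x, IsSmoothSection S η → IsSmoothSection S γ →
    ∀ x, ppBracket P η γ x ∈ S x
  jacobi : ∀ (η γ κ : ∀ x : M, S x) (hη : IsSmoothSection S η) (hγ : IsSmoothSection S γ)
    (hκ : IsSmoothSection S κ) (x : M),
    ppBracket P (fun y => ⟨ppBracket P η γ y, closed η γ hη hγ y⟩) κ x +
    ppBracket P (fun y => ⟨ppBracket P γ κ y, closed γ κ hγ hκ y⟩) η x +
    ppBracket P (fun y => ⟨ppBracket P κ η y, closed κ η hκ hη y⟩) γ x = 0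

end PolyPoisson

/-! ### The path space `⊕_r T^*(PM) = P(⊕_r T^*M)` -/

variable [IsManifold 𝓘(ℝ, E) ∞ M]

/-- The points of `⊕_r T^*(PM)`: pairs `(X, η)` of a path `X : [0,1] → M` of class `C^{k+1}` and
a section `η` of class `C^k` of `X^*(⊕_r T^*M)`, given as a path `t ↦ (X(t), η(t))`. -/
structure CoPath (r k : ℕ) where
  /-- the path `t ↦ (X(t), η(t))` in `⊕_r T^*M` -/
  path : I → CoVelSpace E M r
  contMDiff_base : ContMDiff (𝓡∂ 1) 𝓘(ℝ, E) ((k + 1 : ℕ) : ℕ∞ω) (fun t => (path t).proj)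
  contMDiff_path : ContMDiff (𝓡∂ 1) (coVelModel E r) (k : ℕ∞ω) path

/-- The model Banach space of `⊕_r T^*(PM)`. -/
abbrev CoPathModel (r k : ℕ) : Type u :=
  CkCurve (k + 1) E × CkCurve k (E →L[ℝ] (Fin r → ℝ))

/-- A smooth time-dependent chart of `M`: a family of charts `x ↦ τ_t(x)`, smooth in `(t, x)` with
smooth inverse, defined for `(t, x)` in an open subset of `ℝ × M`. -/
structure TubeChart where
  /-- the map `(t, x) ↦ (t, τ_t(x))` -/
  toHomeo : OpenPartialHomeomorph (ℝ × M) (ℝ × E)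
  fst_eq : ∀ q ∈ toHomeo.source, (toHomeo q).1 = q.1
  smooth : ContMDiffOn (𝓘(ℝ, ℝ).prod 𝓘(ℝ, E)) 𝓘(ℝ, ℝ × E) ∞ toHomeo toHomeo.source
  smooth_symm :
    ContMDiffOn 𝓘(ℝ, ℝ × E) (𝓘(ℝ, ℝ).prod 𝓘(ℝ, E)) ∞ toHomeo.symm toHomeo.target

variable {E M}

/-- The chart `τ_t` of `M` at the time `t`. -/
def TubeChart.slice (τ : TubeChart E M) (t : ℝ) (x : M) : E := (τ.toHomeo (t, x)).2

/-- `e` is the chart of the path space that is induced by the time-dependent chart `τ`: it is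
defined at those `(X, η)` for which `X` stays in the domain of `τ`, and it maps `(X, η)` to
`(u, ζ)` with `u(t) = τ_t(X(t))` and `ζ(t)` the coordinate expression of `η(t)` in the chart `τ_t`,
that is, `η(t) = ζ(t) ∘ d(τ_t)`. -/
def IsTubeChartFor {r k : ℕ} [TopologicalSpace (CoPath E M r k)] (τ : TubeChart E M)
    (e : OpenPartialHomeomorph (CoPath E M r k) (CoPathModel E r k)) : Prop :=
  e.source = {γ | ∀ t : I, ((t : ℝ), (γ.path t).proj) ∈ τ.toHomeo.source} ∧
  e.target = {p | ∀ t : I, ((t : ℝ), p.1.eval t) ∈ τ.toHomeo.target} ∧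
  ∀ γ ∈ e.source, ∀ t : I,
    (e γ).1.eval t = τ.slice t (γ.path t).proj ∧
    ((e γ).2.eval t).comp (mfderiv 𝓘(ℝ, E) 𝓘(ℝ, E) (τ.slice t) (γ.path t).proj) = (γ.path t).2

variable (E M) in
/-- The given topology and charts on the path space are its standard smooth Banach manifold
structure: the charts induced by the smooth time-dependent charts of `M` cover the path space and
are smoothly compatible with it. This determines the topology and the maximal smooth atlas. -/
def IsPathManifold (r k : ℕ) [TopologicalSpace (CoPath E M r k)]
    [ChartedSpace (CoPathModel E r k) (CoPath E M r k)] : Prop :=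
  IsManifold 𝓘(ℝ, CoPathModel E r k) ∞ (CoPath E M r k) ∧
  (∀ γ : CoPath E M r k, ∃ τ : TubeChart E M,
    ∀ t : I, ((t : ℝ), (γ.path t).proj) ∈ τ.toHomeo.source) ∧
  ∀ τ : TubeChart E M, ∃ e ∈ IsManifold.maximalAtlas 𝓘(ℝ, CoPathModel E r k) ∞ (CoPath E M r k),
    IsTubeChartFor τ e

/-- The `ℝ^r`-valued 2-form `ω̄(v, w) = ∫₀¹ ω_can(v(t), w(t)) dt` on the path space, where `v(t)` is
the image of `v` under the differential of the evaluation `γ ↦ γ(t)`. -/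
def pathForm {r k : ℕ} [TopologicalSpace (CoPath E M r k)]
    [ChartedSpace (CoPathModel E r k) (CoPath E M r k)] (γ : CoPath E M r k)
    (v w : TangentSpace 𝓘(ℝ, CoPathModel E r k) γ) : Fin r → ℝ :=
  ∫ t : I, coVelForm (γ.path t)
    (mfderiv 𝓘(ℝ, CoPathModel E r k) (coVelModel E r)
      (fun δ : CoPath E M r k => δ.path t) γ v)
    (mfderiv 𝓘(ℝ, CoPathModel E r k) (coVelModel E r)
      (fun δ : CoPath E M r k => δ.path t) γ w)

/-! ### Weak `r`-symplectic forms on Banach manifolds -/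

section WeakForms

variable {H : Type*} [NormedAddCommGroup H] [NormedSpace ℝ H]
  {B : Type*} [TopologicalSpace B] [ChartedSpace H B]

/-- The coordinate expression of a 2-form in a chart. -/
def twoFormInChart {r : ℕ} (Ω : ∀ b : B, TangentSpace 𝓘(ℝ, H) b [⋀^Fin 2]→L[ℝ] (Fin r → ℝ))
    (e : OpenPartialHomeomorph B H) : H → H [⋀^Fin 2]→L[ℝ] (Fin r → ℝ) := fun y =>
  (Ω (e.symm y)).compContinuousLinearMap (mfderiv 𝓘(ℝ, H) 𝓘(ℝ, H) e.symm y)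

/-- `α` is a weak `r`-symplectic structure: a smooth, closed, `ℝ^r`-valued 2-form `Ω` for which the
induced map `TB → T^*B ⊗ ℝ^r` is injective. -/
def IsWeakPolySymplectic {r : ℕ}
    (α : ∀ b : B, TangentSpace 𝓘(ℝ, H) b → TangentSpace 𝓘(ℝ, H) b → (Fin r → ℝ)) : Prop :=
  ∃ Ω : ∀ b : B, TangentSpace 𝓘(ℝ, H) b [⋀^Fin 2]→L[ℝ] (Fin r → ℝ),
    (∀ b v w, Ω b ![v, w] = α b v w) ∧
    (∀ e ∈ IsManifold.maximalAtlas 𝓘(ℝ, H) ∞ B,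
      ContDiffOn ℝ ∞ (twoFormInChart Ω e) e.target ∧
      ∀ y ∈ e.target, extDeriv (twoFormInChart Ω e) y = 0) ∧
    ∀ b v, (∀ w, α b v w = 0) → v = 0

end WeakForms

/-- `L` is coisotropic, i.e. `L^α ⊆ L`, and `L^α` has codimension `d < ∞` in `L`. Here `K` is the
orthogonal `L^α`
with respect to the bilinear form `α`. -/
def IsCoisotropicOfCodim {V W : Type*} [AddCommGroup V] [Module ℝ V] [AddCommGroup W]
    (α : V → V → W) (L : Submodule ℝ V) (d : ℕ) : Prop :=
  ∃ K : Submodule ℝ V, (∀ v, v ∈ K ↔ ∀ w ∈ L, α v w = 0) ∧ K ≤ L ∧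
    FiniteDimensional ℝ (L ⧸ K.submoduleOf L) ∧ Module.finrank ℝ (L ⧸ K.submoduleOf L) = d

/-! ### The spaces `P(S)` and `C_(S,P)` -/

/-- The space `P(S)` of `S`-paths: the `(X, η)` with `η(t) ∈ S` for all `t`. -/
def SPath {r : ℕ} (S : ∀ x : M, Submodule ℝ (CoVel E M r x)) (k : ℕ) : Set (CoPath E M r k) :=
  {γ | ∀ t : I, (γ.path t).2 ∈ S (γ.path t).proj}

/-- The space `C_(S,P)` of the `S`-paths with `dX + P_X(η) = 0`. -/
def SolutionSpace {r : ℕ} (S : ∀ x : M, Submodule ℝ (CoVel E M r x))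
    (P : ∀ x : M, S x →ₗ[ℝ] TangentSpace 𝓘(ℝ, E) x) (k : ℕ) : Set (SPath S k) :=
  {γ | ∀ t : I, mfderiv (𝓡∂ 1) 𝓘(ℝ, E) (fun t' => (γ.1.path t').proj) t 1 +
    P (γ.1.path t).proj ⟨(γ.1.path t).2, γ.2 t⟩ = 0}

/-- The restriction `ι^* ω̄` of the form of the path space to `P(S)`, for a manifold structure on
`P(S)` with model space `H`. -/
def sPathForm {r k : ℕ} [TopologicalSpace (CoPath E M r k)]
    [ChartedSpace (CoPathModel E r k) (CoPath E M r k)]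
    (S : ∀ x : M, Submodule ℝ (CoVel E M r x))
    {H : Type*} [NormedAddCommGroup H] [NormedSpace ℝ H] [ChartedSpace H (SPath S k)]
    (γ : SPath S k) (v w : TangentSpace 𝓘(ℝ, H) γ) : Fin r → ℝ :=
  pathForm γ.1
    (mfderiv 𝓘(ℝ, H) 𝓘(ℝ, CoPathModel E r k) (Subtype.val : SPath S k → CoPath E M r k) γ v)
    (mfderiv 𝓘(ℝ, H) 𝓘(ℝ, CoPathModel E r k) (Subtype.val : SPath S k → CoPath E M r k) γ w)

end

/-! In coordinates adapted to a single path, every claim becomes a statement about superposition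
operators on spaces of curves and about one linear ordinary differential equation.

Coordinates. A path in `M` need not lie in one chart, but it always lies in a time-dependent chart
(`exists_tubeChart`). The coordinate changes between the induced charts of the path space are
superposition operators `f ↦ (t ↦ g(t, f(t)))` with smooth `g`, and these are smooth on `C^k`
(`contDiffOn_nemytskii`). Cotangent lifts preserve the canonical form, so the form on the path space
has constant coefficients in each such chart (`TubeChart.pathForm_eq`). Smoothness and closedness of
its restriction to `P(S)` follow, because pullbacks commute with the exterior derivative.

`S`-paths. Since the parameter space is an interval, `S` has a smooth frame `ε` along the path,
completed by a frame of a complement (`exists_anchoredFrame`). A path belongs to `P(S)` exactly when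
its complementary components vanish, so `P(S)` is a coordinate slice, with coordinates `(u, a)` and
`η = ε(t, u) a`. At a point the form is `∫ ε(β_w) y_v - ε(β_v) y_w + B(y_w, y_v)`, where `B` is the
antisymmetrized derivative of the frame. By the fundamental lemma of the calculus of variations, `S°
= 0` and the independence of the frame give weak nondegeneracy.

Solutions. Let `V` be the anchor of the frame and `T` the velocity of the time-dependent chart. The
equation `dX + P(η) = 0` reads `u' = T(t, u) - V(t, u) a`. Its linearization `y' = A y - V β` is
solvable for every initial value, every `β` and every inhomogeneous term (`CkCurve.linearIVP`). The
inverse function theorem then provides coordinates of `P(S)` in which the solutions are a slice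
parametrized by `(u(0), a)`.

Coisotropy. The algebraic input is that the anchor is a homomorphism
(`IsLocalSection.anchor_bracket`). It follows from the Jacobi identity for `η`, `γ` and `f κ` with
`f` vanishing at the point, together with the Leibniz rule and `S° = 0`. Along a solution it yields
the structure equations `ε' q + ε(q) A + B(V q) = ε(Ξ q)` and `V' - A V = V Ξ`
(`PathFrame.isStructureCurve`). Consequently every curve `b` generates a gauge direction `(V b, -(b'
+ Ξ b))`, which solves the linearized equation and pairs with any solution `(y, β)` to the boundary
term `ε(b)(y)` taken between `0` and `1`. Gauge directions with `b(0) = b(1) = 0` are therefore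
orthogonal to the tangent space. Conversely, a duality argument with the adjoint equation shows that
every orthogonal vector is of this kind (`IsStructureCurve.orthogonal_mem_gaugeZero`). The
orthogonal is thus contained in the tangent space, and the quotient is identified with `E × ℝ^s` by
the initial value `y(0)` and the end value of the gauge parameter that starts at `0` and generates
`β`. The codimension is `dim M + s` at every point. -/

set_option linter.unusedSectionVars false

noncomputable section

/-! ### Calculus in `C^k([0,1], F)` -/

namespace CkCurve

variable {k : ℕ} {F : Type*} [NormedAddCommGroup F] [NormedSpace ℝ F]
  {G : Type*} [NormedAddCommGroup G] [NormedSpace ℝ G]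

/-- The underlying tuple of derivatives. -/
def jet (f : CkCurve k F) : Fin (k + 1) → C(I, F) := (show ckSubmodule k F from f).1

theorem jet_mem (f : CkCurve k F) : f.jet ∈ ckSubmodule k F := (show ckSubmodule k F from f).2

/-- The curve with the given tuple of derivatives. -/
def mk (f : Fin (k + 1) → C(I, F)) (hf : f ∈ ckSubmodule k F) : CkCurve k F :=
  (⟨f, hf⟩ : ckSubmodule k F)

theorem jet_injective : Function.Injective (jet : CkCurve k F → _) := fun _ _ h => Subtype.ext h

theorem hasDerivWithinAt_jet (f : CkCurve k F) (i : Fin k) (t : I) :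
    HasDerivWithinAt (fun τ : ℝ => f.jet i.castSucc (projIcc 0 1 zero_le_one τ)) (f.jet i.succ t)
      (Icc 0 1) t := f.jet_mem i t

variable (k F) in
/-- The tuple of derivatives as a continuous linear map. -/
def jetL : CkCurve k F →L[ℝ] (Fin (k + 1) → C(I, F)) := (ckSubmodule k F).subtypeL

/-- Evaluation at a time as a continuous linear map. -/
def evalL (t : I) : CkCurve k F →L[ℝ] F :=
  (ContinuousMap.evalCLM ℝ t).comp ((ContinuousLinearMap.proj 0).comp (jetL k F))

@[simp] theorem evalL_apply (t : I) (f : CkCurve k F) : evalL t f = f.eval t := rfl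

@[simp] theorem eval_add (f g : CkCurve k F) (t : I) : (f + g).eval t = f.eval t + g.eval t := rfl
@[simp] theorem eval_sub (f g : CkCurve k F) (t : I) : (f - g).eval t = f.eval t - g.eval t := rfl
@[simp] theorem eval_neg (f : CkCurve k F) (t : I) : (-f).eval t = -f.eval t := rfl
@[simp] theorem eval_smul (c : ℝ) (f : CkCurve k F) (t : I) : (c • f).eval t = c • f.eval t := rfl
@[simp] theorem eval_zero (t : I) : (0 : CkCurve k F).eval t = 0 := rfl

theorem continuous_eval (f : CkCurve k F) : Continuous f.eval := (f.jet 0).continuous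

variable (k F) in
/-- The underlying continuous curve. -/
def toContL : CkCurve k F →L[ℝ] C(I, F) := (ContinuousLinearMap.proj 0).comp (jetL k F)

@[simp] theorem toContL_apply (f : CkCurve k F) (t : I) : toContL k F f t = f.eval t := rfl

theorem norm_eval_le (f : CkCurve k F) (t : I) : ‖f.eval t‖ ≤ ‖f‖ :=
  ((f.jet 0).norm_coe_le_norm t).trans (norm_le_pi_norm f.jet 0)

theorem uniqueDiff_unit (t : I) : UniqueDiffWithinAt ℝ (Icc (0 : ℝ) 1) t :=
  uniqueDiffOn_Icc zero_lt_one _ t.2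

-- Derivatives within `[0,1]` are unique, also at the end points, so each entry of the tuple
-- determines the next one and the stored derivatives carry no extra information.
@[ext] theorem ext {f g : CkCurve k F} (h : ∀ t, f.eval t = g.eval t) : f = g := by
  apply jet_injective
  have key : ∀ (n : ℕ) (hn : n < k + 1), f.jet ⟨n, hn⟩ = g.jet ⟨n, hn⟩ := by
    intro n
    induction n with
    | zero => intro hn; ext t; exact h t
    | succ n ih =>
      intro hn
      ext t
      have hn' : n < k := by omega
      have e1 := f.hasDerivWithinAt_jet ⟨n, hn'⟩ t
      have e2 := g.hasDerivWithinAt_jet ⟨n, hn'⟩ t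
      have e3 : f.jet (Fin.castSucc ⟨n, hn'⟩) = g.jet (Fin.castSucc ⟨n, hn'⟩) := ih (by omega)
      rw [e3] at e1
      exact (uniqueDiff_unit t).eq_deriv _ e1 e2
  funext i
  exact key i.1 i.2

/-- A curve of class `C^(k+1)`, as a curve of class `C^k`. -/
def incl : CkCurve (k + 1) F →L[ℝ] CkCurve k F :=
  ((ContinuousLinearMap.pi fun i : Fin (k + 1) => ContinuousLinearMap.proj i.castSucc).comp
    (jetL (k + 1) F)).codRestrict (ckSubmodule k F) fun f i t => f.hasDerivWithinAt_jet i.castSucc t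

@[simp] theorem incl_eval (f : CkCurve (k + 1) F) (t : I) : (incl f).eval t = f.eval t := rfl

/-- The derivative of a curve of class `C^(k+1)`. -/
def derivL : CkCurve (k + 1) F →L[ℝ] CkCurve k F :=
  ((ContinuousLinearMap.pi fun i : Fin (k + 1) => ContinuousLinearMap.proj i.succ).comp
    (jetL (k + 1) F)).codRestrict (ckSubmodule k F) fun f i t => f.hasDerivWithinAt_jet i.succ t

theorem hasDerivWithinAt (f : CkCurve (k + 1) F) (t : I) :
    HasDerivWithinAt (fun τ : ℝ => f.eval (projIcc 0 1 zero_le_one τ)) ((derivL f).eval t)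
      (Icc 0 1) t := f.hasDerivWithinAt_jet 0 t

theorem derivL_eval_eq (f : CkCurve (k + 1) F) (t : I) {d : F}
    (h : HasDerivWithinAt (fun τ : ℝ => f.eval (projIcc 0 1 zero_le_one τ)) d (Icc 0 1) t) :
    (derivL f).eval t = d :=
  (uniqueDiff_unit t).eq_deriv _ (f.hasDerivWithinAt t) h

/-- A curve of class `C^(k+1)` from its antiderivative data. -/
theorem exists_of_hasDerivWithinAt (x : C(I, F)) (g : CkCurve k F)
    (h : ∀ t : I, HasDerivWithinAt (fun τ : ℝ => x (projIcc 0 1 zero_le_one τ)) (g.eval t)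
      (Icc 0 1) t) :
    ∃ f : CkCurve (k + 1) F, (∀ t, f.eval t = x t) ∧ derivL f = g := by
  refine ⟨mk (Fin.cons x g.jet) ?_, fun t => rfl, ?_⟩
  · intro i t
    induction i using Fin.cases with
    | zero => exact h t
    | succ i => exact g.hasDerivWithinAt_jet i t
  · apply jet_injective
    funext i
    rfl

theorem exists_primitive [CompleteSpace F] (x₀ : F) (g : C(I, F)) :
    ∃ x : C(I, F), x 0 = x₀ ∧ ∀ t : I,
      HasDerivWithinAt (fun τ : ℝ => x (projIcc 0 1 zero_le_one τ)) (g t) (Icc 0 1) t := by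
  have hc : Continuous fun τ : ℝ => g (projIcc 0 1 zero_le_one τ) :=
    g.continuous.comp continuous_projIcc
  have hd : ∀ t : ℝ, HasDerivAt (fun s : ℝ => x₀ + ∫ τ in (0 : ℝ)..s, g (projIcc 0 1 zero_le_one τ))
      (g (projIcc 0 1 zero_le_one t)) t := fun t =>
    (intervalIntegral.integral_hasDerivAt_right (hc.intervalIntegrable 0 t)
      (hc.stronglyMeasurableAtFilter _ _) hc.continuousAt).const_add x₀
  refine ⟨⟨fun s => x₀ + ∫ τ in (0 : ℝ)..s, g (projIcc 0 1 zero_le_one τ), ?_⟩, ?_, ?_⟩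
  · exact (continuous_iff_continuousAt.2 fun t => (hd t).continuousAt).comp continuous_subtype_val
  · change x₀ + ∫ τ in (0 : ℝ)..0, g (projIcc 0 1 zero_le_one τ) = x₀
    rw [intervalIntegral.integral_same, add_zero]
  · intro t
    have := (hd t).hasDerivWithinAt (s := Icc 0 1)
    rw [projIcc_val] at this
    refine this.congr (fun x hx => ?_) ?_
    · rw [projIcc_of_mem zero_le_one hx]; rfl
    · rw [projIcc_val]; rfl

/-- A curve of class `C^(k+1)` is determined by its initial value and its derivative. -/
def splitEquiv [CompleteSpace F] : CkCurve (k + 1) F ≃L[ℝ] F × CkCurve k F :=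
  ContinuousLinearEquiv.ofBijective ((evalL 0).prod derivL)
    (by
      refine LinearMap.ker_eq_bot'.2 fun f hf => ?_
      have h0 : f.eval 0 = 0 := congrArg Prod.fst hf
      have h1 : derivL f = 0 := congrArg Prod.snd hf
      have hd : ∀ t : I, HasDerivWithinAt (fun τ : ℝ => f.eval (projIcc 0 1 zero_le_one τ)) 0
          (Icc 0 1) t := fun t => by simpa [h1] using f.hasDerivWithinAt t
      ext t
      have := constant_of_derivWithin_zero (f := fun τ : ℝ => f.eval (projIcc 0 1 zero_le_one τ))
        (a := 0) (b := 1) (fun x hx => (hd ⟨x, hx⟩).differentiableWithinAt)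
        (fun x hx => (hd ⟨x, Ico_subset_Icc_self hx⟩).derivWithin (uniqueDiff_unit ⟨x, Ico_subset_Icc_self hx⟩)) t t.2
      simp only [projIcc_val, projIcc_left] at this
      exact this.trans h0)
    (by
      refine LinearMap.range_eq_top.2 fun p => ?_
      obtain ⟨x, hx0, hx⟩ := exists_primitive p.1 (toContL k F p.2)
      obtain ⟨f, hf, hf'⟩ := exists_of_hasDerivWithinAt x p.2 hx
      exact ⟨f, Prod.ext ((hf 0).trans hx0) hf'⟩)

@[simp] theorem splitEquiv_apply [CompleteSpace F] (f : CkCurve (k + 1) F) :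
    splitEquiv f = (f.eval 0, derivL f) := rfl

/-- This is the bridge between stored tuples of derivatives and the usual notion of class `C^k`. The
induction peels off the first derivative; in the converse direction the tuple of `f'` is extended by
`f` itself. -/
theorem exists_iff_contDiffOn {f : I → F} : (∃ c : CkCurve k F, ∀ t, c.eval t = f t) ↔
    ContDiffOn ℝ k (fun τ : ℝ => f (projIcc 0 1 zero_le_one τ)) (Icc 0 1) := by
  induction k generalizing f with
  | zero =>
    simp only [Nat.cast_zero, contDiffOn_zero]
    constructor
    · rintro ⟨c, hc⟩
      obtain rfl : c.eval = f := funext hc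
      exact (c.continuous_eval.comp continuous_projIcc).continuousOn
    · intro h
      have hc : Continuous f := by
        have := h.comp_continuous continuous_subtype_val (fun t : I => t.2)
        simpa [projIcc_val, Function.comp_def] using this
      exact ⟨mk (fun _ => ⟨f, hc⟩) fun i => i.elim0, fun t => rfl⟩
  | succ k ih =>
    rw [Nat.cast_succ, contDiffOn_succ_iff_derivWithin (uniqueDiffOn_Icc zero_lt_one)]
    constructor
    · rintro ⟨c, hc⟩
      obtain rfl : c.eval = f := funext hc
      refine ⟨fun x hx => (c.hasDerivWithinAt ⟨x, hx⟩).differentiableWithinAt, by simp, ?_⟩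
      refine (ih.1 ⟨derivL c, fun t => rfl⟩).congr fun x hx => ?_
      rw [projIcc_of_mem zero_le_one hx]
      exact (c.hasDerivWithinAt ⟨x, hx⟩).derivWithin (uniqueDiff_unit ⟨x, hx⟩)
    · rintro ⟨hd, -, h⟩
      have hc : Continuous f := by
        have := hd.continuousOn.comp_continuous continuous_subtype_val (fun t : I => t.2)
        simpa [projIcc_val, Function.comp_def] using this
      obtain ⟨g, hg⟩ := (ih (f := fun t => derivWithin
        (fun τ : ℝ => f (projIcc 0 1 zero_le_one τ)) (Icc 0 1) t)).2
          (h.congr fun x hx => by rw [projIcc_of_mem zero_le_one hx])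
      obtain ⟨c, hc, -⟩ := exists_of_hasDerivWithinAt ⟨f, hc⟩ g (fun t => by
        rw [hg]; exact (hd t t.2).hasDerivWithinAt)
      exact ⟨c, hc⟩

theorem contDiffOn (f : CkCurve k F) :
    ContDiffOn ℝ k (fun τ : ℝ => f.eval (projIcc 0 1 zero_le_one τ)) (Icc 0 1) :=
  exists_iff_contDiffOn.1 ⟨f, fun _ => rfl⟩

/-- Postcomposition with a continuous linear map. -/
def map (L : F →L[ℝ] G) : CkCurve k F →L[ℝ] CkCurve k G :=
  ((ContinuousLinearMap.pi fun i : Fin (k + 1) =>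
    (ContinuousLinearMap.compLeftContinuous ℝ I L).comp (ContinuousLinearMap.proj i)).comp
    (jetL k F)).codRestrict (ckSubmodule k G)
      fun f i t => L.hasFDerivAt.comp_hasDerivWithinAt (t : ℝ) (f.hasDerivWithinAt_jet i t)

@[simp] theorem map_eval (L : F →L[ℝ] G) (f : CkCurve k F) (t : I) :
    (map L f).eval t = L (f.eval t) := rfl

/-- A pair of curves as a curve in the product. -/
def pairL : CkCurve k F × CkCurve k G →L[ℝ] CkCurve k (F × G) :=
  (map (ContinuousLinearMap.inl ℝ F G)).comp (ContinuousLinearMap.fst ℝ _ _) +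
    (map (ContinuousLinearMap.inr ℝ F G)).comp (ContinuousLinearMap.snd ℝ _ _)

@[simp] theorem pairL_eval (p : CkCurve k F × CkCurve k G) (t : I) :
    (pairL p).eval t = (p.1.eval t, p.2.eval t) := by
  change (p.1.eval t, (0 : G)) + ((0 : F), p.2.eval t) = _
  simp

/-! ### Superposition operators -/

variable (k) in
/-- The curves of class `C^k` with graph in `O`. -/
def graphIn (O : Set (ℝ × F)) : Set (CkCurve k F) := {f | ∀ t : I, ((t : ℝ), f.eval t) ∈ O}

/-- The graph of a curve over the compact interval is compact, so the condition is open already in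
the compact-open topology of the underlying continuous curve. -/
theorem isOpen_graphIn {O : Set (ℝ × F)} (hO : IsOpen O) : IsOpen (graphIn k O) := by
  have h1 : IsOpen {f : C(I, F) | MapsTo ((ContinuousMap.mk (Subtype.val : I → ℝ)).prodMk f) univ O} := by
    have hc : Continuous fun f : C(I, F) => (ContinuousMap.mk (Subtype.val : I → ℝ)).prodMk f :=
      ContinuousMap.continuous_of_continuous_uncurry _ (by
        change Continuous fun p : C(I, F) × I => ((p.2 : ℝ), p.1 p.2)
        fun_prop)
    exact (ContinuousMap.isOpen_setOfPred_mapsTo isCompact_univ hO).preimage hc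
  convert h1.preimage (toContL k F).continuous using 1
  ext f
  simp [graphIn, MapsTo]

open Classical in
variable (k) in
/-- The superposition operator `f ↦ (t ↦ g(t, f(t)))`. -/
def nemytskii (g : ℝ × F → G) (f : CkCurve k F) : CkCurve k G :=
  if h : ∃ c : CkCurve k G, ∀ t : I, c.eval t = g (t, f.eval t) then h.choose else 0

/-- The default value `0` in the definition is never seen where the graph stays in `O`, because the
composite is again of class `C^k` there. -/
theorem nemytskii_eval {O : Set (ℝ × F)} {g : ℝ × F → G} (hg : ContDiffOn ℝ k g O)
    {f : CkCurve k F} (hf : f ∈ graphIn k O) (t : I) :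
    (nemytskii k g f).eval t = g (t, f.eval t) := by
  have h : ∃ c : CkCurve k G, ∀ t : I, c.eval t = g (t, f.eval t) := by
    rw [exists_iff_contDiffOn]
    have h1 : ContDiffOn ℝ k (fun τ : ℝ => g (τ, f.eval (projIcc 0 1 zero_le_one τ))) (Icc 0 1) :=
      hg.comp (contDiffOn_id.prodMk f.contDiffOn) fun x hx => by
        simpa only [projIcc_of_mem zero_le_one hx] using hf ⟨x, hx⟩
    refine h1.congr fun x hx => ?_
    rw [projIcc_of_mem zero_le_one hx]
  rw [nemytskii, dif_pos h]
  exact h.choose_spec t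

omit [NormedSpace ℝ F] [NormedSpace ℝ G] in
/-- The superposition operator on continuous curves is continuous. -/
theorem continuousOn_superposition {O : Set (ℝ × F)} {g : ℝ × F → G} (hg : ContinuousOn g O)
    {N : C(I, F) → C(I, G)} {U : Set C(I, F)} (hU : ∀ f ∈ U, ∀ t : I, ((t : ℝ), f t) ∈ O)
    (hN : ∀ f ∈ U, ∀ t : I, N f t = g (t, f t)) : ContinuousOn N U := by
  rw [continuousOn_iff_continuous_domRestrict]
  refine ContinuousMap.continuous_of_continuous_uncurry _ ?_
  have : Function.uncurry (fun (x : U) (y : I) => (U.domRestrict N x) y) =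
      fun p : U × I => g ((p.2 : ℝ), p.1.1 p.2) := by
    funext p
    exact hN p.1.1 p.1.2 p.2
  rw [this]
  refine hg.comp_continuous ?_ fun p => hU _ p.1.2 _
  exact (continuous_subtype_val.comp continuous_snd).prodMk
    (ContinuousEval.continuous_eval.comp
      ((continuous_subtype_val.comp continuous_fst).prodMk continuous_snd))

/-- A bilinear map, applied pointwise to continuous curves. -/
def contBilin {X F G : Type*} [NormedAddCommGroup X] [NormedSpace ℝ X] [NormedAddCommGroup F]
    [NormedSpace ℝ F] [NormedAddCommGroup G] [NormedSpace ℝ G] (L : X →L[ℝ] F →L[ℝ] G) :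
    C(I, X) →L[ℝ] C(I, F) →L[ℝ] C(I, G) :=
  LinearMap.mkContinuous₂ (LinearMap.mk₂ ℝ
    (fun (A : C(I, X)) (x : C(I, F)) => (⟨fun t => L (A t) (x t), by fun_prop⟩ : C(I, G)))
    (fun _ _ _ => by ext; simp) (fun _ _ _ => by ext; simp)
    (fun _ _ _ => by ext; simp) (fun _ _ _ => by ext; simp)) ‖L‖ fun A x => by
      refine (ContinuousMap.norm_le _ (by positivity)).2 fun t => ?_
      refine (L.le_opNorm₂ _ _).trans ?_
      gcongr
      · exact A.norm_coe_le_norm t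
      · exact x.norm_coe_le_norm t

/-- Pointwise application of continuous curves of linear maps. -/
def contApplyL (F G : Type*) [NormedAddCommGroup F] [NormedSpace ℝ F] [NormedAddCommGroup G]
    [NormedSpace ℝ G] : C(I, F →L[ℝ] G) →L[ℝ] C(I, F) →L[ℝ] C(I, G) :=
  contBilin (ContinuousLinearMap.id ℝ (F →L[ℝ] G))

@[simp] theorem contApplyL_apply (A : C(I, F →L[ℝ] G)) (x : C(I, F)) (t : I) :
    contApplyL F G A x t = A t (x t) := rfl

theorem norm_apply_sub_lt_of_mem_ball {X : Type*} [NormedAddCommGroup X] {a b : C(I, X)} {ε : ℝ}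
    (h : a ∈ Metric.ball b ε) (t : I) : ‖a t - b t‖ < ε := by
  rw [mem_ball_iff_norm] at h
  exact ((a - b).norm_coe_le_norm t).trans_lt h

-- The mean value inequality is applied to `w ↦ g(t, f(t) + w)` for each `t` separately. The
-- estimate is uniform in `t` because the derivative field `N'` depends continuously on the curve in
-- the sup norm.
set_option synthInstance.maxHeartbeats 400000 in
theorem hasFDerivAt_superposition {O : Set (ℝ × F)} (hO : IsOpen O) {g : ℝ × F → G}
    (hg : ContDiffOn ℝ 1 g O) {N : C(I, F) → C(I, G)} {N' : C(I, F) → C(I, F →L[ℝ] G)}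
    {U : Set C(I, F)} (hUo : IsOpen U) (hU : ∀ f ∈ U, ∀ t : I, ((t : ℝ), f t) ∈ O)
    (hN : ∀ f ∈ U, ∀ t : I, N f t = g (t, f t))
    (hN' : ∀ f ∈ U, ∀ t : I, N' f t = (fderiv ℝ g (t, f t)).comp (.inr ℝ ℝ F))
    {f : C(I, F)} (hf : f ∈ U) :
    HasFDerivAt N (contApplyL F G (N' f)) f := by
  have hcont : ContinuousOn N' U := by
    refine continuousOn_superposition (O := O)
      (g := fun p => (fderiv ℝ g p).comp (.inr ℝ ℝ F)) ?_ hU hN'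
    exact (hg.continuousOn_fderiv_of_isOpen hO le_rfl).clm_comp continuousOn_const
  rw [hasFDerivAt_iff_isLittleO_nhds_zero, Asymptotics.isLittleO_iff]
  intro ε hε
  have hc := (hcont f hf).continuousAt (hUo.mem_nhds hf)
  obtain ⟨δ, hδ, hball⟩ := Metric.mem_nhds_iff.1
    (Filter.inter_mem (hc (Metric.ball_mem_nhds (N' f) hε)) (hUo.mem_nhds hf))
  filter_upwards [Metric.ball_mem_nhds (0 : C(I, F)) hδ] with v hv
  refine (ContinuousMap.norm_le _ (by positivity)).2 fun t => ?_
  -- Constant shifts of `f` suffice as test curves. The sup-norm continuity of `N'` on them bounds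
  -- the oscillation of the spatial derivative of `g` on the `δ`-ball about `f(t)` by `ε` for all
  -- `t` at once.
  have hmem : ∀ w ∈ Metric.ball (0 : F) δ, f + ContinuousMap.const I w ∈ Metric.ball f δ := by
    intro w hw
    rw [mem_ball_iff_norm, add_sub_cancel_left]
    rw [mem_ball_zero_iff] at hw
    refine lt_of_le_of_lt ((ContinuousMap.norm_le _ (norm_nonneg w)).2 fun t => le_rfl) hw
  have hvt : v t ∈ Metric.ball (0 : F) δ := by
    rw [mem_ball_zero_iff] at hv ⊢
    exact (v.norm_coe_le_norm t).trans_lt hv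
  have hfv : f + v ∈ U := (hball (by simpa [mem_ball_iff_norm] using hv)).2
  have main := Convex.norm_image_sub_le_of_norm_hasFDerivWithin_le'
    (f := fun w => g (t, f t + w)) (φ := N' f t) (C := ε) (x := 0) (y := v t)
    (f' := fun w => (fderiv ℝ g (t, f t + w)).comp (.inr ℝ ℝ F))
    (s := Metric.ball (0 : F) δ) (fun w hw => ?_) (fun w hw => ?_) (convex_ball _ _)
    (Metric.mem_ball_self hδ) hvt
  · have e1 : (N (f + v) - N f - contApplyL F G (N' f) v) t =
        g (t, f t + v t) - g (t, f t + 0) - N' f t (v t - 0) := by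
      simp [hN _ hfv, hN _ hf]
    rw [e1]
    refine main.trans ?_
    rw [sub_zero]
    gcongr
    exact v.norm_coe_le_norm t
  · have hm := hball (hmem w hw)
    have hO' : ((t : ℝ), f t + w) ∈ O := hU _ hm.2 t
    have hd : HasFDerivAt g (fderiv ℝ g (t, f t + w)) (t, f t + w) :=
      ((hg.contDiffAt (hO.mem_nhds hO')).differentiableAt one_ne_zero).hasFDerivAt
    have hi : HasFDerivAt (fun w : F => ((t : ℝ), f t + w)) (.inr ℝ ℝ F) w := by
      have := (hasFDerivAt_const (𝕜 := ℝ) (t : ℝ) w).prodMk ((hasFDerivAt_id (𝕜 := ℝ) w).const_add (f t))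
      exact this
    exact (hd.comp w hi).hasFDerivWithinAt
  · have hm := hball (hmem w hw)
    have h3 := norm_apply_sub_lt_of_mem_ball hm.1 t
    rw [hN' _ hm.2 t] at h3
    exact h3.le

-- The derivative of a superposition operator is again one, with symbol the spatial derivative of
-- `g`, followed by a fixed bounded linear map. The induction on `n` replaces `G` by `F →L[ℝ] G`;
-- the universe of `G` is chosen to be stable under this.
set_option synthInstance.maxHeartbeats 400000 in
theorem contDiffOn_superposition_aux (n : ℕ) {F : Type u} [NormedAddCommGroup F] [NormedSpace ℝ F]
    {G : Type (max u v)} [NormedAddCommGroup G] [NormedSpace ℝ G]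
    {O : Set (ℝ × F)} (hO : IsOpen O) {g : ℝ × F → G} (hg : ContDiffOn ℝ n g O)
    {N : C(I, F) → C(I, G)} {U : Set C(I, F)} (hUo : IsOpen U)
    (hU : ∀ f ∈ U, ∀ t : I, ((t : ℝ), f t) ∈ O)
    (hN : ∀ f ∈ U, ∀ t : I, N f t = g (t, f t)) : ContDiffOn ℝ n N U := by
  induction n generalizing G with
  | zero =>
    simp only [Nat.cast_zero, contDiffOn_zero] at hg ⊢
    exact continuousOn_superposition hg hU hN
  | succ n ih =>
    have hg' : ContDiffOn ℝ n (fun p => (fderiv ℝ g p).comp (.inr ℝ ℝ F)) O :=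
      (hg.fderiv_of_isOpen hO (by simp)).clm_comp contDiffOn_const
    classical
    have hex : ∀ f ∈ U, ∃ c : C(I, F →L[ℝ] G), ∀ t : I,
        c t = (fderiv ℝ g (t, f t)).comp (.inr ℝ ℝ F) := fun f hf =>
      ⟨⟨fun t => (fderiv ℝ g (t, f t)).comp (.inr ℝ ℝ F),
        hg'.continuousOn.comp_continuous (by fun_prop) (fun t => hU f hf t)⟩, fun t => rfl⟩
    let N' : C(I, F) → C(I, F →L[ℝ] G) := fun f => if hf : f ∈ U then (hex f hf).choose else 0
    have hN' : ∀ f ∈ U, ∀ t : I, N' f t = (fderiv ℝ g (t, f t)).comp (.inr ℝ ℝ F) := by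
      intro f hf t
      simp only [N', dif_pos hf]
      exact (hex f hf).choose_spec t
    have hd : ∀ f ∈ U, HasFDerivAt N (contApplyL F G (N' f)) f := fun f hf =>
      hasFDerivAt_superposition hO (hg.of_le (by simp)) hUo hU hN hN' hf
    rw [Nat.cast_succ, contDiffOn_succ_iff_fderiv_of_isOpen hUo]
    refine ⟨fun f hf => (hd f hf).differentiableAt.differentiableWithinAt, by simp, ?_⟩
    refine ((contApplyL F G).contDiff.comp_contDiffOn (ih hg' hN')).congr fun f hf => ?_
    exact (hd f hf).fderiv

/-- Lifting `G` to a larger universe by a linear isometry-like equivalence `e` removes the universe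
constraint of the auxiliary version. -/
theorem contDiffOn_superposition (n : ℕ) {F : Type u} [NormedAddCommGroup F] [NormedSpace ℝ F]
    {G : Type v} [NormedAddCommGroup G] [NormedSpace ℝ G]
    {O : Set (ℝ × F)} (hO : IsOpen O) {g : ℝ × F → G} (hg : ContDiffOn ℝ n g O)
    {N : C(I, F) → C(I, G)} {U : Set C(I, F)} (hUo : IsOpen U)
    (hU : ∀ f ∈ U, ∀ t : I, ((t : ℝ), f t) ∈ O)
    (hN : ∀ f ∈ U, ∀ t : I, N f t = g (t, f t)) : ContDiffOn ℝ n N U := by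
  let e : ULift.{u} G ≃L[ℝ] G := ContinuousLinearEquiv.ulift
  have h := contDiffOn_superposition_aux n hO (g := fun p => e.symm (g p))
    (e.symm.contDiff.comp_contDiffOn hg)
    (N := fun f => ContinuousLinearMap.compLeftContinuous ℝ I (e.symm : G →L[ℝ] ULift.{u} G) (N f))
    hUo hU (fun f hf t => congrArg e.symm (hN f hf t))
  refine ((ContinuousLinearMap.compLeftContinuous ℝ I
    (e : ULift.{u} G →L[ℝ] G)).contDiff.comp_contDiffOn h).congr fun f hf => ?_
  ext t
  rfl

/-- Superposition operators with smooth symbol are smooth on `C^k`. -/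
theorem contDiffOn_nemytskii {G : Type*} [NormedAddCommGroup G] [NormedSpace ℝ G]
    {F : Type*} [NormedAddCommGroup F] [NormedSpace ℝ F]
    [CompleteSpace F] [CompleteSpace G] {O : Set (ℝ × F)} (hO : IsOpen O)
    {g : ℝ × F → G} (hg : ContDiffOn ℝ ∞ g O) :
    ContDiffOn ℝ ∞ (nemytskii k g) (graphIn k O) := by
  induction k generalizing F G with
  | zero =>
    let e : C(I, G) →L[ℝ] CkCurve 0 G :=
      (ContinuousLinearMap.pi fun _ : Fin 1 => ContinuousLinearMap.id ℝ C(I, G)).codRestrict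
        (ckSubmodule 0 G) fun f i => i.elim0
    let e' : C(I, F) →L[ℝ] CkCurve 0 F :=
      (ContinuousLinearMap.pi fun _ : Fin 1 => ContinuousLinearMap.id ℝ C(I, F)).codRestrict
        (ckSubmodule 0 F) fun f i => i.elim0
    let U : Set C(I, F) := e' ⁻¹' graphIn 0 O
    have h1 : ContDiffOn ℝ ∞ (fun f => toContL 0 G (nemytskii 0 g (e' f))) U := by
      rw [contDiffOn_infty]
      intro n
      refine contDiffOn_superposition n hO (hg.of_le (mod_cast le_top))
        ((isOpen_graphIn hO).preimage e'.continuous) (fun f hf t => hf t) fun f hf t => ?_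
      exact nemytskii_eval (hg.of_le (by simp)) hf t
    have h2 := e.contDiff.comp_contDiffOn (h1.comp (toContL 0 F).contDiff.contDiffOn
      (s := graphIn 0 O) fun f hf => hf)
    refine h2.congr fun f hf => ?_
    ext t
    rfl
  | succ k ih =>
    let O' : Set (ℝ × (F × F)) := (fun p => (p.1, p.2.1)) ⁻¹' O
    have hO' : IsOpen O' := hO.preimage (by fun_prop)
    -- The chain rule gives `(g(t, f))' = Dg(t, f)(1, f')`. The derivative of the composite is
    -- therefore a superposition operator of the pair `(f, f')`, which is one order less regular,
    -- and the induction hypothesis applies to it.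
    let g' : ℝ × (F × F) → G := fun p => fderiv ℝ g (p.1, p.2.1) (1, p.2.2)
    have hg' : ContDiffOn ℝ ∞ g' O' := by
      have h1 : ContDiffOn ℝ ∞ (fderiv ℝ g) O := hg.fderiv_of_isOpen hO (by simp)
      have h2 : ContDiffOn ℝ ∞ (fun p : ℝ × (F × F) => fderiv ℝ g (p.1, p.2.1)) O' :=
        h1.comp (by fun_prop) fun p hp => hp
      exact h2.clm_apply (by fun_prop)
    have h3 := ih hO' hg'
    have h4 : ContDiffOn ℝ ∞ (fun f : CkCurve (k + 1) F => nemytskii k g' (pairL (incl f, derivL f)))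
        (graphIn (k + 1) O) := by
      refine h3.comp (t := graphIn k O') ?_ fun f hf t => ?_
      · exact (pairL.comp (incl.prod derivL)).contDiff.contDiffOn
      · simpa [O'] using hf t
    have h5 : ContDiffOn ℝ ∞ (fun f : CkCurve (k + 1) F => g (0, f.eval 0)) (graphIn (k + 1) O) := by
      refine hg.comp (t := O) ?_ fun f hf => hf 0
      exact contDiffOn_const.prodMk (evalL 0).contDiff.contDiffOn
    -- A curve of class `C^(k+1)` is the pair of its initial value and its derivative, and both have
    -- been shown to depend smoothly on `f`.
    refine (splitEquiv.symm.contDiff.comp_contDiffOn (h5.prodMk h4)).congr fun f hf => ?_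
    rw [Function.comp_apply, ContinuousLinearEquiv.eq_symm_apply, splitEquiv_apply]
    have hgk : ContDiffOn ℝ (k + 1 : ℕ) g O := hg.of_le (mod_cast le_top)
    refine Prod.ext ?_ ?_
    · exact nemytskii_eval hgk hf 0
    · ext t
      have hmem : pairL (incl f, derivL f) ∈ graphIn k O' := fun t => by simpa [O'] using hf t
      rw [nemytskii_eval (hg'.of_le (mod_cast le_top)) hmem t]
      refine derivL_eval_eq _ t ?_
      have hd : HasFDerivAt g (fderiv ℝ g (t, f.eval t)) (t, f.eval t) :=
        ((hg.contDiffAt (hO.mem_nhds (hf t))).differentiableAt (by simp)).hasFDerivAt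
      have hcurve := (hasDerivWithinAt_id (t : ℝ) (Icc 0 1)).prodMk (f.hasDerivWithinAt t)
      have hd' : HasFDerivAt g (fderiv ℝ g (t, f.eval t))
          (id (t : ℝ), f.eval (projIcc 0 1 zero_le_one (t : ℝ))) := by
        rw [projIcc_val]; exact hd
      have := hd'.comp_hasDerivWithinAt (t : ℝ) hcurve
      simp only [pairL_eval, g', incl_eval]
      refine this.congr (fun x hx => ?_) ?_
      · rw [nemytskii_eval hgk hf]
        simp only [Function.comp_apply, id, projIcc_of_mem zero_le_one hx]
      · rw [nemytskii_eval hgk hf, projIcc_val]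
        simp

/-- The derivative of a superposition operator. -/
theorem fderiv_nemytskii_eval [CompleteSpace F] [CompleteSpace G] {O : Set (ℝ × F)} (hO : IsOpen O)
    {g : ℝ × F → G} (hg : ContDiffOn ℝ ∞ g O) {f : CkCurve k F} (hf : f ∈ graphIn k O)
    (v : CkCurve k F) (t : I) :
    (fderiv ℝ (nemytskii k g) f v).eval t = fderiv ℝ g (t, f.eval t) (0, v.eval t) := by
  have h1 : HasFDerivAt (nemytskii k g) (fderiv ℝ (nemytskii k g) f) f :=
    (((contDiffOn_nemytskii hO hg).contDiffAt ((isOpen_graphIn hO).mem_nhds hf)).differentiableAt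
      (by simp)).hasFDerivAt
  have h2 := (evalL (k := k) (F := G) t).hasFDerivAt.comp f h1
  have hd : HasFDerivAt g (fderiv ℝ g (t, f.eval t)) (t, f.eval t) :=
    ((hg.contDiffAt (hO.mem_nhds (hf t))).differentiableAt (by simp)).hasFDerivAt
  have h3 : HasFDerivAt (fun f : CkCurve k F => g (t, f.eval t))
      ((fderiv ℝ g (t, f.eval t)).comp
        ((0 : CkCurve k F →L[ℝ] ℝ).prod (evalL t))) f :=
    hd.comp f ((hasFDerivAt_const (t : ℝ) f).prodMk (evalL t).hasFDerivAt)
  have h4 := h3.congr_of_eventuallyEq (f₁ := (evalL t) ∘ nemytskii k g) (by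
    filter_upwards [(isOpen_graphIn hO).mem_nhds hf] with f' hf'
    exact nemytskii_eval (hg.of_le (mod_cast le_top)) hf' t)
  exact DFunLike.congr_fun (h2.unique h4) v

/-- Pointwise application of a curve of linear maps. -/
def applyL [CompleteSpace F] [CompleteSpace G] (A : CkCurve k (F →L[ℝ] G)) :
    CkCurve k F →L[ℝ] CkCurve k G :=
  let g : ℝ × ((F →L[ℝ] G) × F) → G := fun p => p.2.1 p.2.2
  have hg : ContDiff ℝ ∞ g := by fun_prop
  have he : ∀ x t, (nemytskii k g (pairL (A, x))).eval t = A.eval t (x.eval t) := fun x t => by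
    rw [nemytskii_eval (O := univ) (hg.of_le (mod_cast le_top)).contDiffOn (fun _ => mem_univ _)]
    simp [g]
  { toFun := fun x => nemytskii k g (pairL (A, x))
    map_add' := fun x y => by ext t; simp [he]
    map_smul' := fun c x => by ext t; simp [he]
    cont := by
      have h1 := (contDiffOn_nemytskii (k := k) isOpen_univ hg.contDiffOn).continuousOn
      exact h1.comp_continuous (pairL.continuous.comp (by fun_prop)) fun x t => mem_univ _ }

@[simp] theorem applyL_eval [CompleteSpace F] [CompleteSpace G] (A : CkCurve k (F →L[ℝ] G))
    (x : CkCurve k F) (t : I) : (applyL A x).eval t = A.eval t (x.eval t) := by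
  have hg : ContDiff ℝ ∞ (fun p : ℝ × ((F →L[ℝ] G) × F) => p.2.1 p.2.2) := by fun_prop
  change (nemytskii k _ (pairL (A, x))).eval t = _
  rw [nemytskii_eval (O := univ) (hg.of_le (mod_cast le_top)).contDiffOn (fun _ => mem_univ _)]
  simp

end CkCurve

/-! ### Linear differential equations on the unit interval -/

section LinearODE

variable {k : ℕ} {F : Type*} [NormedAddCommGroup F] [NormedSpace ℝ F]
  {G : Type*} [NormedAddCommGroup G] [NormedSpace ℝ G]

/-- The curve `x` on the unit interval has the derivative `d` at the time `t`. -/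
abbrev HasUnitDeriv (x : I → F) (d : F) (t : I) : Prop :=
  HasDerivWithinAt (fun τ : ℝ => x (projIcc 0 1 zero_le_one τ)) d (Icc 0 1) t

theorem HasUnitDeriv.hasDerivWithinAt_Ici {x : I → F} {d : F} {t : I} (h : HasUnitDeriv x d t)
    (ht : (t : ℝ) < 1) :
    HasDerivWithinAt (fun τ : ℝ => x (projIcc 0 1 zero_le_one τ)) d (Ici (t : ℝ)) t :=
  h.mono_of_mem_nhdsWithin
    (Filter.mem_of_superset (Icc_mem_nhdsGE ht) (Icc_subset_Icc_left t.2.1))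

theorem continuous_of_hasUnitDeriv {x x' : I → F} (h : ∀ t, HasUnitDeriv x (x' t) t) :
    Continuous x := by
  have h1 : ContinuousOn (fun τ : ℝ => x (projIcc 0 1 zero_le_one τ)) (Icc 0 1) :=
    fun τ hτ => (h ⟨τ, hτ⟩).continuousWithinAt
  have h2 := h1.comp_continuous continuous_subtype_val (fun t : I => t.2)
  simpa [projIcc_val, Function.comp_def] using h2

/-- Grönwall's inequality. It provides uniqueness for the linear initial value problems, including
the vanishing of the adjoint variable in the coisotropy argument. -/
theorem eq_zero_of_hasUnitDeriv {x x' : I → F} (h : ∀ t, HasUnitDeriv x (x' t) t) (h0 : x 0 = 0)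
    {K : ℝ} (hK : ∀ t, ‖x' t‖ ≤ K * ‖x t‖) (t : I) : x t = 0 := by
  have := eq_zero_of_abs_deriv_le_mul_abs_self_of_eq_zero_right
    (f := fun τ : ℝ => x (projIcc 0 1 zero_le_one τ))
    (f' := fun τ : ℝ => x' (projIcc 0 1 zero_le_one τ)) (K := K) (a := 0) (b := 1)
    ((continuous_of_hasUnitDeriv h).comp continuous_projIcc).continuousOn
    (fun τ hτ => by
      have h1 := (h ⟨τ, Ico_subset_Icc_self hτ⟩).hasDerivWithinAt_Ici hτ.2
      rwa [projIcc_of_mem zero_le_one (Ico_subset_Icc_self hτ)])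
    (by simpa using h0) (fun τ _ => hK _) t t.2
  simpa using this

theorem norm_le_of_hasUnitDeriv {x x' : I → F} (h : ∀ t, HasUnitDeriv x (x' t) t) (h0 : x 0 = 0)
    {B B' : ℝ → ℝ} (hB0 : 0 ≤ B 0) (hB : ∀ t, HasDerivAt B (B' t) t)
    (hb : ∀ t : I, ‖x' t‖ ≤ B' t) (t : I) : ‖x t‖ ≤ B t := by
  have := image_norm_le_of_norm_deriv_right_le_deriv_boundary'
    (f := fun τ : ℝ => x (projIcc 0 1 zero_le_one τ))
    (f' := fun τ : ℝ => x' (projIcc 0 1 zero_le_one τ)) (a := 0) (b := 1) (B := B) (B' := B')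
    ((continuous_of_hasUnitDeriv h).comp continuous_projIcc).continuousOn
    (fun τ hτ => by
      have h1 := (h ⟨τ, Ico_subset_Icc_self hτ⟩).hasDerivWithinAt_Ici hτ.2
      rwa [projIcc_of_mem zero_le_one (Ico_subset_Icc_self hτ)])
    (by simpa [h0] using hB0)
    (continuous_iff_continuousAt.2 fun t => (hB t).continuousAt).continuousOn
    (fun τ _ => (hB τ).hasDerivWithinAt)
    (fun τ hτ => by
      rw [projIcc_of_mem zero_le_one (Ico_subset_Icc_self hτ)]
      exact hb ⟨τ, Ico_subset_Icc_self hτ⟩) t.2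
  simpa using this

/-- Existence for linear initial value problems. -/
theorem exists_linear_solution [CompleteSpace F] (A : C(I, F →L[ℝ] F)) (h : C(I, F)) (x₀ : F) :
    ∃ x : C(I, F), x 0 = x₀ ∧ ∀ t, HasUnitDeriv x (A t (x t) + h t) t := by
  choose P hP0 hP using CkCurve.exists_primitive (F := F) x₀
  let T : C(I, F) → C(I, F) := fun x => P (CkCurve.contApplyL F F A x + h)
  obtain ⟨M, hM0, hM⟩ : ∃ M : ℝ, 0 ≤ M ∧ ∀ t, ‖A t‖ ≤ M :=
    ⟨‖A‖, norm_nonneg A, A.norm_coe_le_norm⟩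
  -- The factorial in the Picard bound comes from integrating `M (M t)^n / n!` once per iteration.
  -- It makes a high iterate contracting on the whole interval, whatever the size of `M`.
  have hiter : ∀ (n : ℕ) (x y : C(I, F)) (t : I),
      ‖T^[n] x t - T^[n] y t‖ ≤ (M * t) ^ n / n.factorial * ‖x - y‖ := by
    intro n x y
    induction n with
    | zero => intro t; simpa using (x - y).norm_coe_le_norm t
    | succ n ih =>
      rw [Function.iterate_succ_apply', Function.iterate_succ_apply']
      refine norm_le_of_hasUnitDeriv (x := fun t => T (T^[n] x) t - T (T^[n] y) t)
        (x' := fun t => A t (T^[n] x t - T^[n] y t)) (fun t => ?_) ?_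
        (B := fun t => (M * t) ^ (n + 1) / (n + 1).factorial * ‖x - y‖)
        (B' := fun t => M * ((M * t) ^ n / n.factorial * ‖x - y‖)) (by simp) (fun t => ?_)
        (fun t => ?_)
      · have := (hP (CkCurve.contApplyL F F A (T^[n] x) + h) t).sub
          (hP (CkCurve.contApplyL F F A (T^[n] y) + h) t)
        have e : A t (T^[n] x t - T^[n] y t) = (CkCurve.contApplyL F F A (T^[n] x) + h) t -
            (CkCurve.contApplyL F F A (T^[n] y) + h) t := by simp
        simp only [e]
        exact this
      · simp [T, hP0]
      · have h1 := (((hasDerivAt_id t).const_mul M).pow (n + 1)).div_const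
          ((n + 1).factorial : ℝ) |>.mul_const ‖x - y‖
        refine h1.congr_deriv ?_
        have : ((n + 1).factorial : ℝ) = (n + 1) * n.factorial := by
          rw [Nat.factorial_succ]; push_cast; ring
        rw [this]
        have hn : ((n : ℝ) + 1) ≠ 0 := by positivity
        have hf : (n.factorial : ℝ) ≠ 0 := by positivity
        simp only [id, mul_one, Nat.cast_add, Nat.cast_one, Nat.add_sub_cancel]
        field_simp
      · refine ((A t).le_opNorm _).trans ?_
        exact mul_le_mul (hM t) (ih t) (norm_nonneg _) hM0
  -- The sequence `M^n / n!` tends to `0`, so some iterate has Lipschitz constant below `1`.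
  obtain ⟨n, hn⟩ := ((FloorSemiring.tendsto_pow_div_factorial_atTop M).eventually
    (gt_mem_nhds (zero_lt_one' ℝ))).exists
  have hpos : 0 ≤ M ^ n / n.factorial := by positivity
  have hc : ContractingWith ⟨M ^ n / n.factorial, hpos⟩ T^[n] := by
    refine ⟨hn, LipschitzWith.of_dist_le_mul fun x y => ?_⟩
    rw [dist_eq_norm, dist_eq_norm]
    refine (ContinuousMap.norm_le _ (by positivity)).2 fun t => ?_
    refine (hiter n x y t).trans ?_
    change _ ≤ M ^ n / n.factorial * ‖x - y‖
    have ht : M * t ≤ M := mul_le_of_le_one_right hM0 t.2.2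
    have ht' : 0 ≤ M * t := mul_nonneg hM0 t.2.1
    gcongr
  refine ⟨hc.fixedPoint, ?_⟩
  -- The fixed point of the contracting iterate is unique, and `T` commutes with its iterates; hence
  -- it is fixed by `T` itself.
  have hfix : T hc.fixedPoint = hc.fixedPoint := hc.isFixedPt_fixedPoint_iterate
  refine ⟨by rw [← hfix]; exact hP0 _, fun t => ?_⟩
  have := hP (CkCurve.contApplyL F F A hc.fixedPoint + h) t
  change HasUnitDeriv (T hc.fixedPoint) _ t at this
  rw [hfix] at this
  exact this

/-- Time reversal, which turns terminal value problems into initial value problems. The adjoint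
equation below is prescribed at `t = 1`. -/
theorem HasUnitDeriv.comp_symm {x : I → F} {d : F} {t : I} (h : HasUnitDeriv x d t) :
    HasUnitDeriv (fun s => x (unitInterval.symm s)) (-d) (unitInterval.symm t) := by
  have h1 : HasDerivWithinAt (fun s : ℝ => 1 - s) (-1) (Icc 0 1) (unitInterval.symm t : ℝ) := by
    simpa using (hasDerivWithinAt_id _ _).const_sub (1 : ℝ)
  have h2 : HasDerivWithinAt (fun τ : ℝ => x (projIcc 0 1 zero_le_one τ)) d (Icc 0 1)
      (1 - (unitInterval.symm t : ℝ)) := by simpa using h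
  have := h2.scomp (unitInterval.symm t : ℝ) h1 (fun s hs => ⟨by linarith [hs.2], by linarith [hs.1]⟩)
  rw [neg_one_smul] at this
  refine this.congr (fun s hs => ?_) ?_
  · rw [projIcc_of_mem zero_le_one hs, Function.comp_apply,
      projIcc_of_mem zero_le_one (x := 1 - s) ⟨by linarith [hs.2], by linarith [hs.1]⟩]
    rfl
  · simp

/-- Existence for linear terminal value problems. -/
theorem exists_linear_solution_terminal [CompleteSpace F] (A : C(I, F →L[ℝ] F)) (h : C(I, F))
    (x₁ : F) : ∃ x : C(I, F), x 1 = x₁ ∧ ∀ t, HasUnitDeriv x (A t (x t) + h t) t := by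
  let rev : C(I, I) := ⟨unitInterval.symm, unitInterval.continuous_symm⟩
  obtain ⟨y, hy0, hy⟩ := exists_linear_solution (-(A.comp rev)) (-(h.comp rev)) x₁
  refine ⟨y.comp rev, by simpa [rev] using hy0, fun t => ?_⟩
  have := (hy (unitInterval.symm t)).comp_symm
  rw [unitInterval.symm_symm] at this
  have e : A t (y.comp rev t) + h t =
      -((-(A.comp rev)) (unitInterval.symm t) (y (unitInterval.symm t)) +
        (-(h.comp rev)) (unitInterval.symm t)) := by
    simp [rev, add_comm]
  rw [e]
  exact this

namespace CkCurve

/-- Bootstrapping: if `x` is of class `C^i` with `i ≤ k`, the right-hand side `A x + h` is too, so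
`x` is of class `C^(i+1)`. -/
theorem contDiffOn_of_linear {A : CkCurve k (F →L[ℝ] F)} {h : CkCurve k F} {x : C(I, F)}
    (hx : ∀ t, HasUnitDeriv x (A.eval t (x t) + h.eval t) t) (j : ℕ) (hj : j ≤ k) :
    ContDiffOn ℝ (j + 1 : ℕ) (fun τ : ℝ => x (projIcc 0 1 zero_le_one τ)) (Icc 0 1) := by
  have hstep : ∀ i : ℕ, i ≤ k →
      ContDiffOn ℝ i (fun τ : ℝ => x (projIcc 0 1 zero_le_one τ)) (Icc 0 1) →
      ContDiffOn ℝ (i + 1 : ℕ) (fun τ : ℝ => x (projIcc 0 1 zero_le_one τ)) (Icc 0 1) := by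
    intro i hi hxi
    rw [Nat.cast_succ, contDiffOn_succ_iff_derivWithin (uniqueDiffOn_Icc zero_lt_one)]
    refine ⟨fun τ hτ => (hx ⟨τ, hτ⟩).differentiableWithinAt, by simp, ?_⟩
    have hA := A.contDiffOn.of_le (m := (i : ℕ∞ω)) (mod_cast hi)
    have hh := h.contDiffOn.of_le (m := (i : ℕ∞ω)) (mod_cast hi)
    refine ((hA.clm_apply hxi).add hh).congr fun τ hτ => ?_
    rw [(hx ⟨τ, hτ⟩).derivWithin (uniqueDiff_unit ⟨τ, hτ⟩), projIcc_of_mem zero_le_one hτ]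
  induction j with
  | zero =>
    refine hstep 0 hj ?_
    simp only [Nat.cast_zero, contDiffOn_zero]
    exact (x.continuous.comp continuous_projIcc).continuousOn
  | succ j ih => exact hstep _ hj (ih (by omega))

/-- The linear initial value problem `x ↦ (x(0), x' - A x)` is uniquely solvable in `C^(k+1)`. -/
def linearIVP [CompleteSpace F] (A : CkCurve k (F →L[ℝ] F)) :
    CkCurve (k + 1) F ≃L[ℝ] F × CkCurve k F :=
  ContinuousLinearEquiv.ofBijective ((evalL 0).prod (derivL - (applyL A).comp incl))
    (by
      refine LinearMap.ker_eq_bot'.2 fun f hf => ?_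
      have h0 : f.eval 0 = 0 := congrArg Prod.fst hf
      have h1 : derivL f - applyL A (incl f) = 0 := congrArg Prod.snd hf
      obtain ⟨K, hK⟩ : ∃ K : ℝ, ∀ t, ‖A.eval t‖ ≤ K := ⟨‖A‖, A.norm_eval_le⟩
      ext t
      refine eq_zero_of_hasUnitDeriv f.hasDerivWithinAt h0 (K := K) (fun t => ?_) t
      have := congrArg (fun c => CkCurve.eval c t) h1
      simp only [eval_sub, applyL_eval, incl_eval, eval_zero, sub_eq_zero] at this
      rw [this]
      exact ((A.eval t).le_opNorm _).trans (by gcongr; exact hK t))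
    (by
      refine LinearMap.range_eq_top.2 fun p => ?_
      obtain ⟨x, hx0, hx⟩ := exists_linear_solution (toContL k _ A) (toContL k F p.2) p.1
      obtain ⟨f, hf⟩ := exists_iff_contDiffOn.2 (contDiffOn_of_linear hx k le_rfl)
      refine ⟨f, Prod.ext ((hf 0).trans hx0) ?_⟩
      ext t
      change (derivL f).eval t - (applyL A (incl f)).eval t = p.2.eval t
      have hd : HasUnitDeriv f.eval (A.eval t (x t) + p.2.eval t) t := by
        have : f.eval = x := funext hf
        rw [this]; exact hx t
      rw [derivL_eval_eq f t hd]
      simp [hf])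

@[simp] theorem linearIVP_apply [CompleteSpace F] (A : CkCurve k (F →L[ℝ] F))
    (f : CkCurve (k + 1) F) : linearIVP A f = (f.eval 0, derivL f - applyL A (incl f)) := rfl

/-- The restriction of a smooth function on the line to the unit interval. -/
def ofSmooth (g : ℝ → F) (hg : ContDiff ℝ ∞ g) : CkCurve k F :=
  (exists_iff_contDiffOn (k := k) (f := fun t : I => g t).2
    ((hg.of_le (mod_cast le_top)).contDiffOn.congr fun x hx => by
      rw [projIcc_of_mem zero_le_one hx])).choose

@[simp] theorem ofSmooth_eval (g : ℝ → F) (hg : ContDiff ℝ ∞ g) (t : I) :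
    (ofSmooth g hg : CkCurve k F).eval t = g t :=
  (exists_iff_contDiffOn (k := k) (f := fun t : I => g t).2
    ((hg.of_le (mod_cast le_top)).contDiffOn.congr fun x hx => by
      rw [projIcc_of_mem zero_le_one hx])).choose_spec t

end CkCurve

/-- The fundamental lemma of the calculus of variations on the unit interval. -/
theorem eq_zero_of_integral_smul_eq_zero [CompleteSpace F] {β : I → F} (hβ : Continuous β)
    (h : ∀ g : ℝ → ℝ, ContDiff ℝ ∞ g → ∫ t : I, g t • β t = 0) (t : I) : β t = 0 := by
  let βe : ℝ → F := fun τ => β (projIcc 0 1 zero_le_one τ)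
  have hc : Continuous βe := hβ.comp continuous_projIcc
  have h1 := isOpen_Ioo.ae_eq_zero_of_integral_contDiff_smul_eq_zero (U := Ioo (0 : ℝ) 1)
    (μ := volume) (f := βe) (hc.locallyIntegrable.locallyIntegrableOn _) (fun g hg _ hs => by
      have e1 : ∫ x, g x • βe x = ∫ x in Icc (0 : ℝ) 1, g x • βe x := by
        refine (setIntegral_eq_integral_of_forall_compl_eq_zero fun x hx => ?_).symm
        have : g x = 0 := image_eq_zero_of_notMem_tsupport fun hx' =>
          hx (Ioo_subset_Icc_self (hs hx'))
        rw [this, zero_smul]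
      rw [e1, ← integral_subtype measurableSet_Icc]
      refine Eq.trans (integral_congr_ae (Filter.Eventually.of_forall fun t => ?_)) (h g hg)
      simp [βe])
  -- For a continuous function, vanishing almost everywhere on the open interval is vanishing
  -- everywhere on it, and the two end points follow by closure.
  have h2 : EqOn βe 0 (Ioo 0 1) := by
    refine Measure.eqOn_open_of_ae_eq (μ := volume) ?_ isOpen_Ioo hc.continuousOn continuousOn_const
    exact (ae_restrict_iff' measurableSet_Ioo).2 h1
  have h3 : EqOn βe 0 (Icc 0 1) := by
    have := h2.closure hc continuous_const
    rwa [closure_Ioo (zero_ne_one' ℝ)] at this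
  simpa [βe] using h3 t.2

/-- A continuous family of linear maps that annihilates all curves of class `C^k` in the mean
vanishes. -/
theorem eq_zero_of_integral_apply_eq_zero [CompleteSpace G] {Λ : I → F →L[ℝ] G}
    (hΛ : Continuous Λ) (h : ∀ b : CkCurve k F, ∫ t : I, Λ t (b.eval t) = 0) (t : I) : Λ t = 0 := by
  ext q
  refine eq_zero_of_integral_smul_eq_zero (β := fun t => Λ t q) (by fun_prop) (fun g hg => ?_) t
  have := h (CkCurve.ofSmooth (fun s => g s • q) (hg.smul contDiff_const))
  simpa using this

/-- The fundamental theorem of calculus on the unit interval. -/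
theorem integral_eq_sub_of_hasUnitDeriv [CompleteSpace F] {x x' : I → F}
    (h : ∀ t, HasUnitDeriv x (x' t) t) (hx' : Continuous x') : ∫ t : I, x' t = x 1 - x 0 := by
  have e : ∫ t : I, x' t = ∫ τ in (0 : ℝ)..1, x' (projIcc 0 1 zero_le_one τ) := by
    rw [intervalIntegral.integral_of_le zero_le_one, ← integral_Icc_eq_integral_Ioc,
      ← integral_subtype measurableSet_Icc]
    simp
  rw [e, intervalIntegral.integral_eq_sub_of_hasDerivAt_of_le zero_le_one
    (f := fun τ => x (projIcc 0 1 zero_le_one τ)) (f' := fun τ => x' (projIcc 0 1 zero_le_one τ))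
    ((continuous_of_hasUnitDeriv h).comp continuous_projIcc).continuousOn (fun τ hτ => ?_)
    ((hx'.comp continuous_projIcc).intervalIntegrable _ _)]
  · simp
  · have h2 := (h ⟨τ, Ioo_subset_Icc_self hτ⟩).hasDerivAt (Icc_mem_nhds hτ.1 hτ.2)
    rwa [projIcc_of_mem zero_le_one (Ioo_subset_Icc_self hτ)]

end LinearODE

/-! ### Submanifolds defined by slice charts -/

section Slice

variable {H : Type*} [NormedAddCommGroup H] [NormedSpace ℝ H]
  {B : Type*} [TopologicalSpace B] [ChartedSpace H B]

theorem contDiffOn_transition {e e' : OpenPartialHomeomorph B H}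
    (he : e ∈ IsManifold.maximalAtlas 𝓘(ℝ, H) ∞ B)
    (he' : e' ∈ IsManifold.maximalAtlas 𝓘(ℝ, H) ∞ B) :
    ContDiffOn ℝ ∞ (e' ∘ e.symm) (e.target ∩ e.symm ⁻¹' e'.source) := by
  rw [← contMDiffOn_iff_contDiffOn]
  exact (contMDiffOn_of_mem_maximalAtlas he').comp
    ((contMDiffOn_symm_of_mem_maximalAtlas he).mono inter_subset_left) fun y hy => hy.2

/-- A chart `e` of the manifold `B` in which the subset `Z` is a coordinate slice. -/
structure SliceChart (H : Type*) [NormedAddCommGroup H] [NormedSpace ℝ H]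
    (H₁ H₂ : Type*) [NormedAddCommGroup H₁] [NormedSpace ℝ H₁]
    [NormedAddCommGroup H₂] [NormedSpace ℝ H₂] {B : Type*} [TopologicalSpace B] [ChartedSpace H B]
    (Z : Set B) where
  /-- the chart -/
  e : OpenPartialHomeomorph B H
  mem : e ∈ IsManifold.maximalAtlas 𝓘(ℝ, H) ∞ B
  /-- the splitting of the model space -/
  L : H ≃L[ℝ] H₁ × H₂
  slice : ∀ b ∈ e.source, b ∈ Z ↔ (L (e b)).2 = 0

namespace SliceChart

variable {H₁ H₂ : Type*} [NormedAddCommGroup H₁] [NormedSpace ℝ H₁]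
  [NormedAddCommGroup H₂] [NormedSpace ℝ H₂] {Z : Set B}

theorem symm_mem (s : SliceChart H H₁ H₂ Z) {y : H₁} (hy : s.L.symm (y, 0) ∈ s.e.target) :
    s.e.symm (s.L.symm (y, 0)) ∈ Z := by
  rw [s.slice _ (s.e.map_target hy), s.e.right_inv hy]
  simp

theorem L_symm_fst (s : SliceChart H H₁ H₂ Z) {z : B} (hz : z ∈ Z) (hs : z ∈ s.e.source) :
    s.L.symm ((s.L (s.e z)).1, 0) = s.e z := by
  rw [ContinuousLinearEquiv.symm_apply_eq]
  exact Prod.ext rfl ((s.slice _ hs).1 hz).symm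

open Classical in
/-- The chart of `Z` that is induced by a slice chart. -/
def restr (s : SliceChart H H₁ H₂ Z) (z₀ : Z) : OpenPartialHomeomorph Z H₁ where
  toFun z := (s.L (s.e z)).1
  invFun y := if hy : s.L.symm (y, 0) ∈ s.e.target then
    ⟨s.e.symm (s.L.symm (y, 0)), s.symm_mem hy⟩ else z₀
  source := Subtype.val ⁻¹' s.e.source
  target := {y | s.L.symm (y, 0) ∈ s.e.target}
  map_source' z hz := by
    change s.L.symm ((s.L (s.e z)).1, 0) ∈ s.e.target
    rw [s.L_symm_fst z.2 hz]
    exact s.e.map_source hz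
  map_target' y hy := by
    have hy' : s.L.symm (y, 0) ∈ s.e.target := hy
    simp only [dif_pos hy']
    exact s.e.map_target hy
  left_inv' z hz := by
    have h1 := s.L_symm_fst z.2 hz
    have h2 : s.e z ∈ s.e.target := s.e.map_source hz
    simp only [h1, h2, dif_pos]
    exact Subtype.ext (s.e.left_inv hz)
  right_inv' y hy := by
    have hy' : s.L.symm (y, 0) ∈ s.e.target := hy
    simp only [dif_pos hy', s.e.right_inv hy', ContinuousLinearEquiv.apply_symm_apply]
  open_source := s.e.open_source.preimage continuous_subtype_val
  open_target := s.e.open_target.preimage (s.L.symm.continuous.comp (by fun_prop))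
  continuousOn_toFun := by
    refine (continuous_fst.comp s.L.continuous).comp_continuousOn ?_
    exact s.e.continuousOn.comp continuous_subtype_val.continuousOn fun z hz => hz
  continuousOn_invFun := by
    rw [Topology.IsInducing.subtypeVal.continuousOn_iff]
    have h1 : ContinuousOn (fun y : H₁ => s.e.symm (s.L.symm (y, 0)))
        {y | s.L.symm (y, 0) ∈ s.e.target} :=
      s.e.continuousOn_symm.comp (s.L.symm.continuous.comp (by fun_prop)).continuousOn
        fun y hy => hy
    refine h1.congr fun y hy => ?_
    have hy' : s.L.symm (y, 0) ∈ s.e.target := hy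
    simp only [Function.comp_apply, dif_pos hy']

@[simp] theorem restr_apply (s : SliceChart H H₁ H₂ Z) (z₀ z : Z) :
    s.restr z₀ z = (s.L (s.e z)).1 := rfl

theorem restr_symm_val (s : SliceChart H H₁ H₂ Z) (z₀ : Z) {y : H₁}
    (hy : y ∈ (s.restr z₀).target) :
    ((s.restr z₀).symm y : B) = s.e.symm (s.L.symm (y, 0)) := by
  have hy' : s.L.symm (y, 0) ∈ s.e.target := hy
  exact congrArg Subtype.val (dif_pos hy')

/-- The charted space structure on `Z` given by slice charts. -/
@[reducible] def chartedSpace (h : ∀ z : Z, ∃ s : SliceChart H H₁ H₂ Z, (z : B) ∈ s.e.source) :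
    ChartedSpace H₁ Z where
  atlas := {e | ∃ (s : SliceChart H H₁ H₂ Z) (z₀ : Z), e = s.restr z₀}
  chartAt z := (h z).choose.restr z
  mem_chart_source z := (h z).choose_spec
  chart_mem_atlas _ := ⟨_, _, rfl⟩

variable (h : ∀ z : Z, ∃ s : SliceChart H H₁ H₂ Z, (z : B) ∈ s.e.source)

theorem isManifold : @IsManifold ℝ _ H₁ _ _ H₁ _ 𝓘(ℝ, H₁) ∞ Z _ (chartedSpace h) := by
  let _ := chartedSpace h
  refine isManifold_of_contDiffOn 𝓘(ℝ, H₁) ∞ Z ?_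
  rintro _ _ ⟨s, z, rfl⟩ ⟨s', z', rfl⟩
  simp only [modelWithCornersSelf_coe, modelWithCornersSelf_coe_symm, Function.id_comp,
    Function.comp_id, range_id, inter_univ, preimage_id]
  have h1 : ContDiffOn ℝ ∞ (fun y : H₁ => (s'.L ((s'.e ∘ s.e.symm) (s.L.symm (y, 0)))).1)
      ((s.restr z).symm.trans (s'.restr z')).source := by
    have h2 := (contDiffOn_transition s.mem s'.mem).comp (s := ((s.restr z).symm.trans (s'.restr z')).source)
      (f := fun y : H₁ => s.L.symm (y, 0))
      (s.L.symm.contDiff.comp (by fun_prop)).contDiffOn ?_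
    · exact (contDiff_fst.comp s'.L.contDiff).comp_contDiffOn h2
    · intro y hy
      rw [OpenPartialHomeomorph.trans_source] at hy
      have hy2 : ((s.restr z).symm y : B) ∈ s'.e.source := hy.2
      rw [s.restr_symm_val z hy.1] at hy2
      exact ⟨hy.1, hy2⟩
  refine h1.congr fun y hy => ?_
  rw [OpenPartialHomeomorph.trans_source] at hy
  rw [OpenPartialHomeomorph.trans_apply, restr_apply, s.restr_symm_val z hy.1]
  rfl

theorem restr_mem_maximalAtlas (s : SliceChart H H₁ H₂ Z) (z₀ : Z) :
    letI := chartedSpace h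
    s.restr z₀ ∈ IsManifold.maximalAtlas 𝓘(ℝ, H₁) ∞ Z := by
  let _ := chartedSpace h
  have := isManifold h
  exact IsManifold.subset_maximalAtlas ⟨s, z₀, rfl⟩

/-- In a slice chart of `B` and the induced chart of `Z` the inclusion is `y ↦ L⁻¹(y, 0)`. It is an
immersion whose complement `H₂` is part of the splitting. -/
theorem isSmoothEmbedding :
    letI := chartedSpace h
    IsSmoothEmbedding 𝓘(ℝ, H₁) 𝓘(ℝ, H) ∞ (Subtype.val : Z → B) := by
  let _ := chartedSpace h
  have := isManifold h
  refine ⟨?_, Topology.IsEmbedding.subtypeVal⟩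
  refine IsImmersionOfComplement.isImmersion (F := H₂) fun z => ?_
  obtain ⟨s, hs⟩ := h z
  refine IsImmersionAtOfComplement.mk_of_charts s.L.symm (s.restr z) s.e hs hs
    (restr_mem_maximalAtlas h s z) s.mem (fun z hz => hz) ?_
  intro y hy
  have hy' : y ∈ (s.restr z).target := by simpa using hy
  have e1 : ((s.restr z).symm y : B) = s.e.symm (s.L.symm (y, 0)) := s.restr_symm_val z hy'
  simp only [Function.comp_apply, OpenPartialHomeomorph.extend, modelWithCornersSelf_partialEquiv,
    PartialEquiv.trans_refl, OpenPartialHomeomorph.coe_toPartialEquiv,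
    OpenPartialHomeomorph.coe_toPartialEquiv_symm]
  rw [e1]
  exact s.e.right_inv hy'

/-- The tangent space of a slice is the kernel of the differential of its defining coordinates. One
inclusion holds because those coordinates vanish on `Z`. For the other, the vector is lifted by the
inverse of the induced chart, which is the inverse of the ambient chart restricted to the slice. -/
theorem mem_range_mfderiv_val (s : SliceChart H H₁ H₂ Z) (z : Z) (hz : (z : B) ∈ s.e.source)
    (v : TangentSpace 𝓘(ℝ, H) (z : B)) :
    letI := chartedSpace h
    (∃ w : TangentSpace 𝓘(ℝ, H₁) z,
      mfderiv 𝓘(ℝ, H₁) 𝓘(ℝ, H) (Subtype.val : Z → B) z w = v) ↔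
      (s.L (mfderiv 𝓘(ℝ, H) 𝓘(ℝ, H) s.e (z : B) v)).2 = 0 := by
  let _ := chartedSpace h
  have := isManifold h
  have hval : MDifferentiableAt 𝓘(ℝ, H₁) 𝓘(ℝ, H) (Subtype.val : Z → B) z :=
    ((isSmoothEmbedding h).contMDiff z).mdifferentiableAt (by simp)
  have he : HasMFDerivAt 𝓘(ℝ, H) 𝓘(ℝ, H) s.e (z : B) (mfderiv 𝓘(ℝ, H) 𝓘(ℝ, H) s.e (z : B)) :=
    ((contMDiffAt_of_mem_maximalAtlas s.mem hz).mdifferentiableAt (by simp)).hasMFDerivAt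
  let q : H →L[ℝ] H₂ := (ContinuousLinearMap.snd ℝ H₁ H₂).comp (s.L : H →L[ℝ] H₁ × H₂)
  have hq : ∀ x, HasMFDerivAt 𝓘(ℝ, H) 𝓘(ℝ, H₂) q x q := fun x => q.hasMFDerivAt
  constructor
  · rintro ⟨w, rfl⟩
    have h1 := (hq _).comp z (he.comp z hval.hasMFDerivAt)
    have h2 : HasMFDerivAt 𝓘(ℝ, H₁) 𝓘(ℝ, H₂) (q ∘ (s.e ∘ (Subtype.val : Z → B))) z
        (0 : TangentSpace 𝓘(ℝ, H₁) z →L[ℝ] H₂) := by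
      refine (hasMFDerivAt_const (0 : H₂) z).congr_of_eventuallyEq ?_
      filter_upwards [(s.e.open_source.preimage continuous_subtype_val).mem_nhds hz] with z' hz'
      exact (s.slice _ hz').1 z'.2
    exact DFunLike.congr_fun (hasMFDerivAt_unique h1 h2) w
  · intro hv
    let ι : H₁ →L[ℝ] H := (s.L.symm : H₁ × H₂ →L[ℝ] H).comp (ContinuousLinearMap.inl ℝ H₁ H₂)
    let c := s.restr z
    have hzc : z ∈ c.source := hz
    have hcz : c z ∈ c.target := c.map_source hzc
    have hsymm : HasMFDerivAt 𝓘(ℝ, H₁) 𝓘(ℝ, H₁) c.symm (c z)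
        (mfderiv 𝓘(ℝ, H₁) 𝓘(ℝ, H₁) c.symm (c z)) :=
      ((contMDiffAt_symm_of_mem_maximalAtlas (restr_mem_maximalAtlas h s z) hcz).mdifferentiableAt
        (by simp)).hasMFDerivAt
    let w₁ : H₁ := (s.L (mfderiv 𝓘(ℝ, H) 𝓘(ℝ, H) s.e (z : B) v)).1
    refine ⟨(mfderiv 𝓘(ℝ, H₁) 𝓘(ℝ, H₁) c.symm (c z) w₁ : H₁), ?_⟩
    have hι : ι w₁ = mfderiv 𝓘(ℝ, H) 𝓘(ℝ, H) s.e (z : B) v := by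
      change s.L.symm (w₁, 0) = _
      exact (s.L.symm_apply_eq (x := (w₁, 0))).2 (Prod.ext rfl hv.symm)
    have hιz : ι (c z) = s.e z := s.L_symm_fst z.2 hz
    have hesymm : HasMFDerivAt 𝓘(ℝ, H) 𝓘(ℝ, H) s.e.symm (ι (c z))
        (mfderiv 𝓘(ℝ, H) 𝓘(ℝ, H) s.e.symm (ι (c z))) :=
      ((contMDiffAt_symm_of_mem_maximalAtlas s.mem (by
        rw [hιz]; exact s.e.map_source hz)).mdifferentiableAt (by simp)).hasMFDerivAt
    have hval' : MDifferentiableAt 𝓘(ℝ, H₁) 𝓘(ℝ, H) (Subtype.val : Z → B) (c.symm (c z)) := by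
      rw [c.left_inv hzc]; exact hval
    have k1 := hval'.hasMFDerivAt.comp (c z) hsymm
    have k2 := (hesymm.comp (c z) ι.hasMFDerivAt).congr_of_eventuallyEq
      (f₁ := (Subtype.val : Z → B) ∘ c.symm) (by
        filter_upwards [c.open_target.mem_nhds hcz] with y hy
        exact s.restr_symm_val z hy)
    have k3 := DFunLike.congr_fun (hasMFDerivAt_unique k1 k2) w₁
    have hmd : s.e.MDifferentiable 𝓘(ℝ, H) 𝓘(ℝ, H) :=
      ⟨(contMDiffOn_of_mem_maximalAtlas s.mem).mdifferentiableOn (by simp),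
        (contMDiffOn_symm_of_mem_maximalAtlas s.mem).mdifferentiableOn (by simp)⟩
    have k4 := DFunLike.congr_fun (hmd.symm_comp_deriv hz) v
    have k5 : mfderiv 𝓘(ℝ, H₁) 𝓘(ℝ, H) (Subtype.val : Z → B) (c.symm (c z)) =
      mfderiv 𝓘(ℝ, H₁) 𝓘(ℝ, H) (Subtype.val : Z → B) z := by rw [c.left_inv hzc]
    have k6 : mfderiv 𝓘(ℝ, H) 𝓘(ℝ, H) s.e.symm (ι (c z)) =
      mfderiv 𝓘(ℝ, H) 𝓘(ℝ, H) s.e.symm (s.e z) := by rw [hιz]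
    have k7 : (mfderiv 𝓘(ℝ, H₁) 𝓘(ℝ, H) (Subtype.val : Z → B) (c.symm (c z)))
        (mfderiv 𝓘(ℝ, H₁) 𝓘(ℝ, H₁) c.symm (c z) w₁) =
      (mfderiv 𝓘(ℝ, H) 𝓘(ℝ, H) s.e.symm (ι (c z))) (ι w₁) := k3
    rw [← k5]
    refine k7.trans ?_
    rw [hι, k6]
    exact k4

end SliceChart

end Slice

/-! ### Closed two-forms from local pullbacks of constant forms -/

section ConstantForms

variable {H : Type*} [NormedAddCommGroup H] [NormedSpace ℝ H]
  {K : Type*} [NormedAddCommGroup K] [NormedSpace ℝ K]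
  {W : Type*} [NormedAddCommGroup W] [NormedSpace ℝ W]

set_option synthInstance.maxHeartbeats 400000 in
theorem contDiffOn_bilinearComp (β : K →L[ℝ] K →L[ℝ] W) {A : H → H →L[ℝ] K}
    {U : Set H} (hA : ContDiffOn ℝ ∞ A U) :
    ContDiffOn ℝ ∞ (fun y => β.bilinearComp (A y) (A y)) U := by
  have h1 : ContDiffOn ℝ ∞ (fun y => β.comp (A y)) U := contDiffOn_const.clm_comp hA
  have h2 : ContDiffOn ℝ ∞ (fun y => (ContinuousLinearMap.compL ℝ H K W).flip (A y)) U :=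
    contDiffOn_const.clm_apply hA
  exact h2.clm_comp h1

-- The pulled back form is written as the alternation of the bilinear map `(x, y) ↦ η(A x, A y)`.
-- Alternation is a fixed bounded linear operator, so smoothness in `A` is reduced to composition of
-- linear maps.
set_option synthInstance.maxHeartbeats 400000 in
set_option maxHeartbeats 1000000 in
theorem contDiffOn_compContinuousLinearMap_two (η : K [⋀^Fin 2]→L[ℝ] W) {A : H → H →L[ℝ] K}
    {U : Set H} (hA : ContDiffOn ℝ ∞ A U) :
    ContDiffOn ℝ ∞ (fun y => η.compContinuousLinearMap (A y)) U := by
  let o' : (H →L[ℝ] W) →L[ℝ] H [⋀^Fin 1]→L[ℝ] W :=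
    ((ContinuousAlternatingMap.ofSubsingletonLIE (𝕜 := ℝ) (E := H) (F := W) (0 : Fin 1)).toContinuousLinearEquiv :
      (H →L[ℝ] W) →L[ℝ] _)
  let oi : (K [⋀^Fin 1]→L[ℝ] W) →L[ℝ] (K →L[ℝ] W) :=
    ((ContinuousAlternatingMap.ofSubsingletonLIE (𝕜 := ℝ) (E := K) (F := W) (0 : Fin 1)).symm.toContinuousLinearEquiv :
      _ →L[ℝ] (K →L[ℝ] W))
  let β : K →L[ℝ] K →L[ℝ] W := oi.comp η.curryLeft
  have h3 : ContDiffOn ℝ ∞ (fun y => β.bilinearComp (A y) (A y)) U :=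
    contDiffOn_bilinearComp β hA
  have h1 : ContDiffOn ℝ ∞ (fun y => o'.comp (β.bilinearComp (A y) (A y))) U :=
    contDiffOn_const.clm_comp h3
  -- Alternating a bilinear map that is already alternating doubles it; the factor `1/2`
  -- compensates.
  have h2 := ((2⁻¹ : ℝ) • ContinuousAlternatingMap.alternatizeUncurryFinCLM ℝ H W
    (n := 1)).contDiff.comp_contDiffOn h1
  refine h2.congr fun y _ => ?_
  ext v
  have hs : η ![A y (v 1), A y (v 0)] = - η ![A y (v 0), A y (v 1)] := by
    have := η.toAlternatingMap.map_swap ![A y (v 0), A y (v 1)] (i := 0) (j := 1) (by decide)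
    convert this using 1
    · change η _ = η _
      congr 1
      ext i
      fin_cases i <;> rfl
    · rfl
  have e0 : (⇑(A y) ∘ v) = ![A y (v 0), A y (v 1)] := by
    ext i
    fin_cases i <;> simp
  simp [ContinuousAlternatingMap.alternatizeUncurryFin_apply, Fin.sum_univ_two, o', β, oi]
  have e1 : (Matrix.vecCons (A y (v 0)) fun x : Fin 1 => A y (Fin.tail v 0)) =
      ![A y (v 0), A y (v 1)] := by
    ext i
    fin_cases i <;> rfl
  have e2 : (Matrix.vecCons (A y (v 1)) fun x : Fin 1 => A y (Fin.removeNth 1 v 0)) =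
      ![A y (v 1), A y (v 0)] := by
    ext i
    fin_cases i <;> rfl
  rw [e0, e1, e2, hs, smul_neg, neg_neg, ← add_smul]
  norm_num


/-- The exterior derivative commutes with pullback, and a form with constant coefficients is closed.
-/
theorem extDeriv_compContinuousLinearMap_fderiv (η : K [⋀^Fin 2]→L[ℝ] W) {f : H → K} {y : H}
    (hf : ContDiffAt ℝ ∞ f y) :
    extDeriv (fun y => η.compContinuousLinearMap (fderiv ℝ f y)) y = 0 := by
  have h : extDeriv (fun y => ((fun _ : K => η) (f y)).compContinuousLinearMap (fderiv ℝ f y)) y =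
      (extDeriv (fun _ : K => η) (f y)).compContinuousLinearMap (fderiv ℝ f y) :=
    extDeriv_pullback (differentiableAt_const η) hf (by
      simp only [minSmoothness_of_isRCLikeNormedField]; exact ENat.LEInfty.out)
  refine h.trans ?_
  have : extDeriv (fun _ : K => η) (f y) = 0 := by
    refine ContinuousAlternatingMap.ext fun v => ?_
    simp [extDeriv, ContinuousAlternatingMap.alternatizeUncurryFin_apply]
  rw [this]
  ext v
  simp

/-- A two-form that is locally the pullback of one constant alternating form is smooth and
closed; it is weak symplectic if it is nondegenerate. -/
theorem isWeakPolySymplectic_of_pullback {r : ℕ} {B : Type*} [TopologicalSpace B]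
    [ChartedSpace H B] [IsManifold 𝓘(ℝ, H) ∞ B] (η : K [⋀^Fin 2]→L[ℝ] (Fin r → ℝ))
    (α : ∀ b : B, TangentSpace 𝓘(ℝ, H) b → TangentSpace 𝓘(ℝ, H) b → (Fin r → ℝ))
    (hα : ∀ b₀ : B, ∃ U : Set B, IsOpen U ∧ b₀ ∈ U ∧ ∃ f : B → K,
      ContMDiffOn 𝓘(ℝ, H) 𝓘(ℝ, K) ∞ f U ∧ ∀ b ∈ U, ∀ v w,
        α b v w = η ![mfderiv 𝓘(ℝ, H) 𝓘(ℝ, K) f b v, mfderiv 𝓘(ℝ, H) 𝓘(ℝ, K) f b w])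
    (hnd : ∀ b v, (∀ w, α b v w = 0) → v = 0) : IsWeakPolySymplectic α := by
  choose U hUo hbU f hf hαf using hα
  -- At each point the form is built from the local map chosen for that very point. The identity
  -- with `α` makes the choice irrelevant, so that on all of `U b₀` the form is the pullback by the
  -- single map `f b₀`; this is `hΩ'`.
  let Ω : ∀ b : B, TangentSpace 𝓘(ℝ, H) b [⋀^Fin 2]→L[ℝ] (Fin r → ℝ) := fun b =>
    η.compContinuousLinearMap (show H →L[ℝ] K from mfderiv 𝓘(ℝ, H) 𝓘(ℝ, K) (f b) b)
  have hΩ : ∀ b v w, Ω b ![v, w] = α b v w := by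
    intro b v w
    rw [hαf b b (hbU b)]
    change η _ = _
    congr 1
    ext i
    fin_cases i <;> rfl
  have hΩ' : ∀ b₀, ∀ b ∈ U b₀, Ω b =
      η.compContinuousLinearMap (show H →L[ℝ] K from mfderiv 𝓘(ℝ, H) 𝓘(ℝ, K) (f b₀) b) := by
    intro b₀ b hb
    refine ContinuousAlternatingMap.ext fun v => ?_
    have e : v = ![v 0, v 1] := by
      ext i
      fin_cases i <;> rfl
    rw [e, hΩ, hαf b₀ b hb]
    change _ = η _
    congr 1
    ext i
    fin_cases i <;> rfl
  refine ⟨Ω, hΩ, fun e he => ?_, hnd⟩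
  have key : ∀ y₀ ∈ e.target, ∃ V : Set H, IsOpen V ∧ y₀ ∈ V ∧ V ⊆ e.target ∧ ∃ g : H → K,
      ContDiffOn ℝ ∞ g V ∧ ∀ y ∈ V,
        twoFormInChart Ω e y = η.compContinuousLinearMap (fderiv ℝ g y) := by
    intro y₀ hy₀
    refine ⟨e.target ∩ e.symm ⁻¹' U (e.symm y₀), e.isOpen_inter_preimage_symm (hUo _),
      ⟨hy₀, hbU _⟩, inter_subset_left, f (e.symm y₀) ∘ e.symm, ?_, ?_⟩
    · rw [← contMDiffOn_iff_contDiffOn]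
      exact (hf _).comp ((contMDiffOn_symm_of_mem_maximalAtlas he).mono inter_subset_left)
        fun y hy => hy.2
    · intro y hy
      have h1 : MDifferentiableAt 𝓘(ℝ, H) 𝓘(ℝ, K) (f (e.symm y₀)) (e.symm y) :=
        ((hf _).contMDiffAt ((hUo _).mem_nhds hy.2)).mdifferentiableAt (by simp)
      have h2 : MDifferentiableAt 𝓘(ℝ, H) 𝓘(ℝ, H) e.symm y :=
        (contMDiffAt_symm_of_mem_maximalAtlas he hy.1).mdifferentiableAt (by simp)
      have h3 := mfderiv_comp y h1 h2
      rw [mfderiv_eq_fderiv] at h3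
      rw [h3, twoFormInChart, hΩ' _ _ hy.2]
      rfl
  constructor
  · intro y₀ hy₀
    obtain ⟨V, hVo, hyV, -, g, hg, hΩg⟩ := key y₀ hy₀
    have h1 : ContDiffOn ℝ ∞ (twoFormInChart Ω e) V :=
      (contDiffOn_compContinuousLinearMap_two η (hg.fderiv_of_isOpen hVo (by simp))).congr hΩg
    exact (h1.contDiffAt (hVo.mem_nhds hyV)).contDiffWithinAt
  · intro y₀ hy₀
    obtain ⟨V, hVo, hyV, -, g, hg, hΩg⟩ := key y₀ hy₀
    have h1 : twoFormInChart Ω e =ᶠ[𝓝 y₀] fun y => η.compContinuousLinearMap (fderiv ℝ g y) := by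
      filter_upwards [hVo.mem_nhds hyV] with y hy using hΩg y hy
    rw [h1.extDeriv_eq]
    exact extDeriv_compContinuousLinearMap_fderiv η (hg.contDiffAt (hVo.mem_nhds hyV))

end ConstantForms

/-! ### The inverse function theorem for smooth maps -/

/-- The inverse function theorem, with a smooth local inverse. -/
theorem exists_smooth_openPartialHomeomorph {X Y : Type*} [NormedAddCommGroup X] [NormedSpace ℝ X]
    [CompleteSpace X] [NormedAddCommGroup Y] [NormedSpace ℝ Y] [CompleteSpace Y]
    {f : X → Y} {N : Set X} (hN : IsOpen N)
    (hf : ContDiffOn ℝ ∞ f N) {a : X} (ha : a ∈ N) (A : X ≃L[ℝ] Y)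
    (hA : HasFDerivAt f (A : X →L[ℝ] Y) a) :
    ∃ h : OpenPartialHomeomorph X Y, a ∈ h.source ∧ h.source ⊆ N ∧ (∀ x, h x = f x) ∧
      ContDiffOn ℝ ∞ h.symm h.target := by
  have hfa : ContDiffAt ℝ ∞ f a := hf.contDiffAt (hN.mem_nhds ha)
  let h₀ := hfa.toOpenPartialHomeomorph f hA (by simp)
  -- The inverse function theorem gives smoothness of the inverse only at the image of `a`.
  -- Shrinking the source to the open set where the derivative is invertible gives it on the whole
  -- target.
  have hopen : IsOpen (N ∩ fderiv ℝ f ⁻¹' range ((↑) : (X ≃L[ℝ] Y) → X →L[ℝ] Y)) :=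
    (hf.continuousOn_fderiv_of_isOpen hN (by simp)).isOpen_inter_preimage hN
      (ContinuousLinearEquiv.isOpen)
  let h := h₀.restrOpen _ hopen
  refine ⟨h, ⟨hfa.mem_toOpenPartialHomeomorph_source hA (by simp), ha, A, hA.fderiv.symm⟩,
    fun x hx => hx.2.1, fun x => rfl, ?_⟩
  intro y hy
  obtain ⟨hx1, hx2, B, hB⟩ := h.map_target hy
  have hfx : ContDiffAt ℝ ∞ f (h.symm y) := hf.contDiffAt (hN.mem_nhds hx2)
  refine (h.contDiffAt_symm hy (f₀' := B) ?_ hfx).contDiffWithinAt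
  rw [hB]
  exact (hfx.differentiableAt (by simp)).hasFDerivAt

section Tube

variable {E : Type u} [NormedAddCommGroup E] [NormedSpace ℝ E]
  {M : Type v} [TopologicalSpace M] [ChartedSpace E M] [IsManifold 𝓘(ℝ, E) ∞ M]

/-! ### Time-dependent charts -/

namespace TubeChart

/-- The inverse of the chart at the time `t`. -/
def inv (τ : TubeChart E M) (t : ℝ) (y : E) : M := (τ.toHomeo.symm (t, y)).2

theorem apply_eq (τ : TubeChart E M) {t : ℝ} {x : M} (h : (t, x) ∈ τ.toHomeo.source) :
    τ.toHomeo (t, x) = (t, τ.slice t x) := Prod.ext (τ.fst_eq _ h) rfl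

theorem mem_target (τ : TubeChart E M) {t : ℝ} {x : M} (h : (t, x) ∈ τ.toHomeo.source) :
    (t, τ.slice t x) ∈ τ.toHomeo.target := by
  rw [← τ.apply_eq h]; exact τ.toHomeo.map_source h

theorem symm_eq (τ : TubeChart E M) {t : ℝ} {y : E} (h : (t, y) ∈ τ.toHomeo.target) :
    τ.toHomeo.symm (t, y) = (t, τ.inv t y) := by
  refine Prod.ext ?_ rfl
  rw [← τ.fst_eq _ (τ.toHomeo.map_target h), τ.toHomeo.right_inv h]

theorem mem_source (τ : TubeChart E M) {t : ℝ} {y : E} (h : (t, y) ∈ τ.toHomeo.target) :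
    (t, τ.inv t y) ∈ τ.toHomeo.source := by
  rw [← τ.symm_eq h]; exact τ.toHomeo.map_target h

theorem inv_slice (τ : TubeChart E M) {t : ℝ} {x : M} (h : (t, x) ∈ τ.toHomeo.source) :
    τ.inv t (τ.slice t x) = x := by
  rw [inv, ← τ.apply_eq h, τ.toHomeo.left_inv h]

theorem slice_inv (τ : TubeChart E M) {t : ℝ} {y : E} (h : (t, y) ∈ τ.toHomeo.target) :
    τ.slice t (τ.inv t y) = y := by
  rw [slice, ← τ.symm_eq h, τ.toHomeo.right_inv h]

variable (E) in
/-- A preferred chart of `M` as a time-dependent chart. -/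
def const (x₀ : M) : TubeChart E M where
  toHomeo := (OpenPartialHomeomorph.refl ℝ).prod (chartAt E x₀)
  fst_eq _ _ := rfl
  smooth := by
    refine ContMDiffOn.prodMk_space contMDiffOn_fst ?_
    exact (contMDiffOn_chart : ContMDiffOn 𝓘(ℝ, E) 𝓘(ℝ, E) ∞ (chartAt E x₀) _).comp contMDiffOn_snd fun _ hq => hq.2
  smooth_symm := by
    refine ContMDiffOn.prodMk contDiff_fst.contMDiff.contMDiffOn ?_
    exact (contMDiffOn_chart_symm : ContMDiffOn 𝓘(ℝ, E) 𝓘(ℝ, E) ∞ (chartAt E x₀).symm _).comp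
      contDiff_snd.contMDiff.contMDiffOn fun q hq => hq.2

theorem mem_const_source {x₀ : M} {q : ℝ × M} :
    q ∈ (const E x₀).toHomeo.source ↔ q.2 ∈ (chartAt E x₀).source := by
  simp [const]

/-- The coordinate change between two time-dependent charts. -/
def trans (τ τ' : TubeChart E M) (p : ℝ × E) : E := τ'.slice p.1 (τ.inv p.1 p.2)

/-- The domain of the coordinate change between two time-dependent charts. -/
def transDom (τ τ' : TubeChart E M) : Set (ℝ × E) :=
  τ.toHomeo.target ∩ τ.toHomeo.symm ⁻¹' τ'.toHomeo.source

theorem isOpen_transDom (τ τ' : TubeChart E M) : IsOpen (τ.transDom τ') :=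
  τ.toHomeo.isOpen_inter_preimage_symm τ'.toHomeo.open_source

theorem mem_transDom {τ τ' : TubeChart E M} {t : ℝ} {y : E} : (t, y) ∈ τ.transDom τ' ↔
    (t, y) ∈ τ.toHomeo.target ∧ (t, τ.inv t y) ∈ τ'.toHomeo.source := by
  constructor
  · rintro ⟨h1, h2⟩
    exact ⟨h1, by rw [← τ.symm_eq h1]; exact h2⟩
  · rintro ⟨h1, h2⟩
    exact ⟨h1, by rw [mem_preimage, τ.symm_eq h1]; exact h2⟩

theorem slice_mem_transDom {τ τ' : TubeChart E M} {t : ℝ} {x : M}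
    (h : (t, x) ∈ τ.toHomeo.source) (h' : (t, x) ∈ τ'.toHomeo.source) :
    (t, τ.slice t x) ∈ τ.transDom τ' :=
  mem_transDom.2 ⟨τ.mem_target h, by rwa [τ.inv_slice h]⟩

theorem trans_slice {τ τ' : TubeChart E M} {t : ℝ} {x : M} (h : (t, x) ∈ τ.toHomeo.source) :
    τ.trans τ' (t, τ.slice t x) = τ'.slice t x := by
  rw [trans, τ.inv_slice h]

theorem trans_mem_transDom {τ τ' : TubeChart E M} {t : ℝ} {y : E} (h : (t, y) ∈ τ.transDom τ') :
    (t, τ.trans τ' (t, y)) ∈ τ'.transDom τ := by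
  obtain ⟨h1, h2⟩ := mem_transDom.1 h
  exact slice_mem_transDom h2 (τ.mem_source h1)

theorem trans_trans {τ τ' : TubeChart E M} {t : ℝ} {y : E} (h : (t, y) ∈ τ.transDom τ') :
    τ'.trans τ (t, τ.trans τ' (t, y)) = y := by
  obtain ⟨h1, h2⟩ := mem_transDom.1 h
  rw [trans, trans, τ'.inv_slice h2, τ.slice_inv h1]

theorem contDiffOn_trans (τ τ' : TubeChart E M) :
    ContDiffOn ℝ ∞ (τ.trans τ') (τ.transDom τ') := by
  have h1 : ContDiffOn ℝ ∞ (fun p => (τ'.toHomeo (τ.toHomeo.symm p)).2) (τ.transDom τ') := by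
    refine contDiff_snd.comp_contDiffOn ?_
    rw [← contMDiffOn_iff_contDiffOn]
    exact τ'.smooth.comp (τ.smooth_symm.mono inter_subset_left) fun p hp => hp.2
  refine h1.congr fun p hp => ?_
  rw [τ.symm_eq (t := p.1) (y := p.2) hp.1]
  rfl

/-- The spatial derivative of the coordinate change. -/
def dtrans (τ τ' : TubeChart E M) (p : ℝ × E) : E →L[ℝ] E :=
  (fderiv ℝ (τ.trans τ') p).comp (.inr ℝ ℝ E)

theorem contDiffOn_dtrans (τ τ' : TubeChart E M) :
    ContDiffOn ℝ ∞ (τ.dtrans τ') (τ.transDom τ') :=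
  ((τ.contDiffOn_trans τ').fderiv_of_isOpen (τ.isOpen_transDom τ') (by simp)).clm_comp
    contDiffOn_const

theorem hasFDerivAt_trans {τ τ' : TubeChart E M} {t : ℝ} {y : E} (h : (t, y) ∈ τ.transDom τ') :
    HasFDerivAt (fun y => τ.trans τ' (t, y)) (τ.dtrans τ' (t, y)) y :=
  (((τ.contDiffOn_trans τ').contDiffAt ((τ.isOpen_transDom τ').mem_nhds h)).differentiableAt
    (by simp)).hasFDerivAt.comp y (hasFDerivAt_prodMk_right t y)

theorem dtrans_comp {τ τ' : TubeChart E M} {t : ℝ} {y : E} (h : (t, y) ∈ τ.transDom τ') :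
    (τ'.dtrans τ (t, τ.trans τ' (t, y))).comp (τ.dtrans τ' (t, y)) = .id ℝ E := by
  have h1 := (hasFDerivAt_trans (trans_mem_transDom h)).comp y (hasFDerivAt_trans h)
  refine HasFDerivAt.unique (h1.congr_of_eventuallyEq ?_) (hasFDerivAt_id y)
  have : {y | (t, y) ∈ τ.transDom τ'} ∈ 𝓝 y :=
    ((τ.isOpen_transDom τ').preimage (by fun_prop : Continuous fun y : E => (t, y))).mem_nhds h
  filter_upwards [this] with y hy
  exact (trans_trans hy).symm

/-- The spatial derivative of the coordinate change as an equivalence. -/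
def dtransEquiv {τ τ' : TubeChart E M} {t : ℝ} {y : E} (h : (t, y) ∈ τ.transDom τ') : E ≃L[ℝ] E :=
  ContinuousLinearEquiv.equivOfInverse (τ.dtrans τ' (t, y)) (τ'.dtrans τ (t, τ.trans τ' (t, y)))
    (fun v => DFunLike.congr_fun (dtrans_comp h) v) (fun v => by
      have := dtrans_comp (trans_mem_transDom h)
      rw [trans_trans h] at this
      exact DFunLike.congr_fun this v)

end TubeChart

/-! ### Existence of time-dependent charts along a path -/

/-- Near `q`, the map `(t, x) ↦ (t, F (t, x))` is a time-dependent chart. -/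
def IsTubeCoordAt (F : ℝ × M → E) (q : ℝ × M) : Prop :=
  ∃ τ : TubeChart E M, q ∈ τ.toHomeo.source ∧ ∀ q' ∈ τ.toHomeo.source, (τ.toHomeo q').2 = F q'

/-- The derivative of `(t, y) ↦ (t, F(t, y))` is block triangular with the identity as its time
block. It is invertible as soon as the spatial block is, and the inverse function theorem applies.
-/
theorem isTubeCoordAt_of_chart [CompleteSpace E] {F : ℝ × M → E} {x₀ : M} {q : ℝ × M}
    (hx : q.2 ∈ (chartAt E x₀).source) {N : Set (ℝ × E)} (hN : IsOpen N)
    (hq : (q.1, chartAt E x₀ q.2) ∈ N)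
    (hF : ContDiffOn ℝ ∞ (fun p : ℝ × E => F (p.1, (chartAt E x₀).symm p.2)) N) (A : E ≃L[ℝ] E)
    (hA : HasFDerivAt (fun y => F (q.1, (chartAt E x₀).symm y)) (A : E →L[ℝ] E)
      (chartAt E x₀ q.2)) : IsTubeCoordAt F q := by
  set c := TubeChart.const E x₀
  have hqc : q ∈ c.toHomeo.source := TubeChart.mem_const_source.2 hx
  let f : ℝ × E → ℝ × E := fun p => (p.1, F (p.1, (chartAt E x₀).symm p.2))
  have hf : ContDiffOn ℝ ∞ f N := contDiffOn_fst.prodMk hF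
  have hd := ((hF.contDiffAt (hN.mem_nhds hq)).differentiableAt (by simp)).hasFDerivAt
  set D := fderiv ℝ (fun p : ℝ × E => F (p.1, (chartAt E x₀).symm p.2)) (q.1, chartAt E x₀ q.2)
  have hDA : D.comp (.inr ℝ ℝ E) = A :=
    (hd.comp (chartAt E x₀ q.2) (hasFDerivAt_prodMk_right q.1 _)).unique hA
  let B : (ℝ × E) ≃L[ℝ] (ℝ × E) :=
    (ContinuousLinearEquiv.refl ℝ ℝ).skewProd A (D.comp (.inl ℝ ℝ E))
  have hB : HasFDerivAt f (B : ℝ × E →L[ℝ] ℝ × E) (q.1, chartAt E x₀ q.2) := by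
    refine (hasFDerivAt_fst.prodMk hd).congr_fderiv ?_
    ext p
    · simp [B]
    · simp [B]
    · simp [B]
    · simpa [B, Prod.mk_zero_zero] using DFunLike.congr_fun hDA p
  obtain ⟨h, hqh, hhN, hhf, hsymm⟩ := exists_smooth_openPartialHomeomorph hN hf hq B hB
  have hcq : c.toHomeo q = (q.1, chartAt E x₀ q.2) := rfl
  refine ⟨⟨c.toHomeo.trans h, ?_, ?_, ?_⟩, ?_, ?_⟩
  · intro q' hq'
    simp only [OpenPartialHomeomorph.trans_apply, hhf]
    rfl
  · have h1 : ContDiffOn ℝ ∞ h h.source := (hf.mono hhN).congr fun x _ => hhf x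
    refine (contMDiffOn_iff_contDiffOn.2 h1).comp (c.smooth.mono ?_) ?_
    · intro q' hq'; exact hq'.1
    · intro q' hq'; exact hq'.2
  · refine c.smooth_symm.comp ((contMDiffOn_iff_contDiffOn.2 hsymm).mono ?_) ?_
    · intro q' hq'; exact hq'.1
    · intro q' hq'; exact hq'.2
  · exact ⟨hqc, hqh⟩
  · intro q' hq'
    have hq1 : q'.2 ∈ (chartAt E x₀).source := TubeChart.mem_const_source.1 hq'.1
    simp only [OpenPartialHomeomorph.trans_apply, hhf]
    change F (q'.1, (chartAt E x₀).symm (chartAt E x₀ q'.2)) = _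
    rw [(chartAt E x₀).left_inv hq1]

/-- The converse of the preceding criterion, on a whole neighbourhood. In a fixed chart of `M` the
function is a coordinate change between two time-dependent charts, whose spatial derivative is
inverted by that of the reverse change. -/
theorem IsTubeCoordAt.exists_chart {F : ℝ × M → E} {q : ℝ × M} (h : IsTubeCoordAt F q) {x₀ : M}
    (hx : q.2 ∈ (chartAt E x₀).source) : ∃ N : Set (ℝ × E), IsOpen N ∧
      (q.1, chartAt E x₀ q.2) ∈ N ∧
      ContDiffOn ℝ ∞ (fun p : ℝ × E => F (p.1, (chartAt E x₀).symm p.2)) N ∧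
      ∀ p ∈ N, ∃ A : E ≃L[ℝ] E,
        HasFDerivAt (fun y => F (p.1, (chartAt E x₀).symm y)) (A : E →L[ℝ] E) p.2 := by
  obtain ⟨τ, hq, hF⟩ := h
  set c := TubeChart.const E x₀
  have hqc : q ∈ c.toHomeo.source := TubeChart.mem_const_source.2 hx
  have e : ∀ p ∈ c.transDom τ, F (p.1, (chartAt E x₀).symm p.2) = c.trans τ p := fun p hp =>
    (hF _ (TubeChart.mem_transDom.1 hp).2).symm
  refine ⟨c.transDom τ, c.isOpen_transDom τ, TubeChart.slice_mem_transDom hqc hq,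
    (c.contDiffOn_trans τ).congr e, fun p hp => ⟨TubeChart.dtransEquiv hp, ?_⟩⟩
  refine (TubeChart.hasFDerivAt_trans hp).congr_of_eventuallyEq ?_
  have : {y | (p.1, y) ∈ c.transDom τ} ∈ 𝓝 p.2 :=
    ((c.isOpen_transDom τ).preimage (by fun_prop : Continuous fun y : E => (p.1, y))).mem_nhds hp
  filter_upwards [this] with y hy using e _ hy

/-- A local diffeomorphism that is injective on a compact set is injective near it. Here the compact
set is the graph of the path, where injectivity costs nothing because the time component separates
the points. Local charts given by one function `F` thus combine to one chart. -/
theorem exists_tubeChart_of_isTubeCoordAt [T2Space M] {F : ℝ × M → E} {X : I → M}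
    (hX : Continuous X) (hF : ∀ t : I, IsTubeCoordAt F ((t : ℝ), X t)) :
    ∃ τ : TubeChart E M, ∀ t : I, ((t : ℝ), X t) ∈ τ.toHomeo.source := by
  classical
  let Θ : ℝ × M → ℝ × E := fun q => (q.1, F q)
  have hΘ : ∀ {τ : TubeChart E M} {q}, (∀ q' ∈ τ.toHomeo.source, (τ.toHomeo q').2 = F q') →
      q ∈ τ.toHomeo.source → τ.toHomeo q = Θ q :=
    fun h hq => Prod.ext (TubeChart.fst_eq _ _ hq) (h _ hq)
  let K : Set (ℝ × M) := range fun t : I => ((t : ℝ), X t)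
  have hK : IsCompact K := isCompact_range (by fun_prop)
  have hcont : ∀ q, IsTubeCoordAt F q → ContinuousAt Θ q := by
    rintro q ⟨τ, hq, h⟩
    refine (τ.toHomeo.continuousAt hq).congr ?_
    filter_upwards [τ.toHomeo.open_source.mem_nhds hq] with q' hq' using hΘ h hq'
  -- Compactness of the graph upgrades injectivity on it, together with local injectivity, to
  -- injectivity on an open neighbourhood.
  obtain ⟨V, hVo, hKV, hinj⟩ := InjOn.exists_isOpen_superset (f := Θ) (s := K)
    (by
      rintro _ ⟨t, rfl⟩ _ ⟨t', rfl⟩ h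
      have : t = t' := Subtype.ext (congrArg Prod.fst h)
      rw [this]) hK
    (by rintro _ ⟨t, rfl⟩; exact hcont _ (hF t))
    (by
      rintro _ ⟨t, rfl⟩
      obtain ⟨τ, hq, h⟩ := hF t
      refine ⟨τ.toHomeo.source, τ.toHomeo.open_source.mem_nhds hq, fun a ha b hb hab => ?_⟩
      rw [← hΘ h ha, ← hΘ h hb] at hab
      exact τ.toHomeo.injOn ha hb hab)
  let W : Set (ℝ × M) := V ∩ {q | IsTubeCoordAt F q}
  have hWo : IsOpen W := by
    refine hVo.inter (isOpen_iff_mem_nhds.2 ?_)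
    rintro q ⟨τ, hq, h⟩
    exact Filter.mem_of_superset (τ.toHomeo.open_source.mem_nhds hq) fun q' hq' => ⟨τ, hq', h⟩
  have hKW : ∀ t : I, ((t : ℝ), X t) ∈ W := fun t => ⟨hKV ⟨t, rfl⟩, hF t⟩
  have hinjW : InjOn Θ W := hinj.mono inter_subset_left
  have hopen : ∀ O ⊆ W, IsOpen O → IsOpen (Θ '' O) := by
    intro O hOW hO
    rw [isOpen_iff_mem_nhds]
    rintro _ ⟨q, hq, rfl⟩
    obtain ⟨τ, hqτ, h⟩ := (hOW hq).2
    have h1 : IsOpen (τ.toHomeo '' (τ.toHomeo.source ∩ O)) :=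
      τ.toHomeo.isOpen_image_source_inter hO
    refine Filter.mem_of_superset (h1.mem_nhds ⟨q, ⟨hqτ, hq⟩, hΘ h hqτ⟩) ?_
    rintro _ ⟨q', ⟨hq1, hq2⟩, rfl⟩
    exact ⟨q', hq2, (hΘ h hq1).symm⟩
  have : Nonempty (ℝ × M) := ⟨(0, X 0)⟩
  let pe : PartialEquiv (ℝ × M) (ℝ × E) := hinjW.toPartialEquiv Θ W
  let e : OpenPartialHomeomorph (ℝ × M) (ℝ × E) :=
    OpenPartialHomeomorph.ofContinuousOpenRestrict pe
      (fun q hq => (hcont q hq.2).continuousWithinAt)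
      (by
        intro O hO
        have h1 : IsOpen ((Subtype.val : W → ℝ × M) '' O) := hWo.isOpenMap_subtype_val O hO
        have h2 := hopen _ (by rintro _ ⟨q, -, rfl⟩; exact q.2) h1
        have h3 : pe.source.domRestrict pe '' O = Θ '' ((Subtype.val : W → ℝ × M) '' O) :=
          (image_image Θ (Subtype.val : W → ℝ × M) O).symm
        exact h3 ▸ h2) hWo
  have he : ∀ q, e q = Θ q := fun q => rfl
  refine ⟨⟨e, fun q _ => rfl, ?_, ?_⟩, hKW⟩
  · intro q hq
    obtain ⟨τ, hqτ, h⟩ := (show q ∈ W from hq).2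
    have h1 := (τ.smooth.contMDiffAt (τ.toHomeo.open_source.mem_nhds hqτ))
    refine (h1.congr_of_eventuallyEq ?_).contMDiffWithinAt
    filter_upwards [τ.toHomeo.open_source.mem_nhds hqτ] with q' hq' using (hΘ h hq').symm
  · intro p hp
    have hq : e.symm p ∈ W := e.map_target hp
    obtain ⟨τ, hqτ, h⟩ := hq.2
    have hp' : τ.toHomeo (e.symm p) = p := by rw [hΘ h hqτ, ← he, e.right_inv hp]
    have hpτ : p ∈ τ.toHomeo.target := by rw [← hp']; exact τ.toHomeo.map_source hqτ
    have h1 := (τ.smooth_symm.contMDiffAt (τ.toHomeo.open_target.mem_nhds hpτ))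
    refine (h1.congr_of_eventuallyEq ?_).contMDiffWithinAt
    have hmem : e.target ∩ e.symm ⁻¹' τ.toHomeo.source ∈ 𝓝 p :=
      (e.isOpen_inter_preimage_symm τ.toHomeo.open_source).mem_nhds ⟨hp, hqτ⟩
    filter_upwards [hmem] with p' hp'
    have : τ.toHomeo (e.symm p') = p' := by rw [hΘ h hp'.2, ← he, e.right_inv hp'.1]
    rw [← this, τ.toHomeo.left_inv hp'.2, this]

theorem IsTubeCoordAt.congr {F F' : ℝ × M → E} {q : ℝ × M} (h : IsTubeCoordAt F q) {O : Set (ℝ × M)}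
    (hO : IsOpen O) (hq : q ∈ O) (hFF' : ∀ q' ∈ O, F' q' = F q') : IsTubeCoordAt F' q := by
  obtain ⟨τ, hqτ, hF⟩ := h
  refine ⟨⟨τ.toHomeo.restrOpen O hO, fun q' hq' => τ.fst_eq _ hq'.1,
    τ.smooth.mono fun q' hq' => hq'.1, τ.smooth_symm.mono fun p hp => hp.1⟩, ⟨hqτ, hq⟩,
    fun q' hq' => ?_⟩
  rw [hFF' q' hq'.2, ← hF q' hq'.1]
  rfl

/-- Coordinates that are valid up to time `b` are blended, just before `b`, into `L ∘ φ`, where `φ`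
is an ordinary chart and `L` is the spatial derivative of the old coordinates at `X(b)`. Only the
derivatives of the two functions have to be close. Their values may differ, since injectivity near
the graph is automatic. -/
theorem exists_isTubeCoordAt_extend [CompleteSpace E] {X : I → M} (hX : Continuous X) (t₀ : I) :
    ∃ U ∈ 𝓝 t₀, ∀ b ∈ U, ∀ b' ∈ U,
      (∃ F : ℝ × M → E, ∀ t ≤ b, IsTubeCoordAt F ((t : ℝ), X t)) →
      ∃ F : ℝ × M → E, ∀ t ≤ b', IsTubeCoordAt F ((t : ℝ), X t) := by
  set φ := chartAt E (X t₀) with hφ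
  obtain ⟨ε, hε, hεX⟩ := Metric.mem_nhds_iff.1
    ((φ.open_source.preimage hX).mem_nhds (mem_chart_source E (X t₀)))
  refine ⟨_, Metric.ball_mem_nhds t₀ hε, fun b hb b' hb' => ?_⟩
  rintro ⟨F, hF⟩
  rcases le_total b' b with hle | hle
  · exact ⟨F, fun t ht => hF t (ht.trans hle)⟩
  have hXb : X b ∈ φ.source := hεX hb
  obtain ⟨N, hNo, hbN, hFN, hAN⟩ := (hF b le_rfl).exists_chart hXb
  obtain ⟨L, hL⟩ := hAN _ hbN
  let a : ℝ × E → E →L[ℝ] E := fun p =>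
    (fderiv ℝ (fun p : ℝ × E => F (p.1, φ.symm p.2)) p).comp (.inr ℝ ℝ E)
  have ha : ∀ p ∈ N, HasFDerivAt (fun y => F (p.1, φ.symm y)) (a p) p.2 := fun p hp =>
    HasFDerivAt.comp (g := fun p : ℝ × E => F (p.1, φ.symm p.2)) (f := fun y => (p.1, y)) p.2
      ((hFN.contDiffAt (hNo.mem_nhds hp)).differentiableAt (by simp)).hasFDerivAt
      (hasFDerivAt_prodMk_right p.1 p.2)
  have hac : ContinuousOn a N :=
    (hFN.continuousOn_fderiv_of_isOpen hNo (by simp)).clm_comp continuousOn_const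
  have hab : a ((b : ℝ), φ (X b)) = L := (ha _ hbN).unique hL
  -- Invertible operators form an open set. A ball about `L` inside it is convex, so blended
  -- derivatives remain invertible.
  obtain ⟨ρ, hρ, hρL⟩ := Metric.isOpen_iff.1 (ContinuousLinearEquiv.isOpen (𝕜 := ℝ) (E := E) (F := E))
    (L : E →L[ℝ] E) ⟨L, rfl⟩
  have hev : ∀ᶠ t : I in 𝓝 b, X t ∈ φ.source ∧ ((t : ℝ), φ (X t)) ∈ N ∧
      a ((t : ℝ), φ (X t)) ∈ Metric.ball (L : E →L[ℝ] E) ρ := by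
    have h1 : ContinuousAt (fun t : I => ((t : ℝ), φ (X t))) b :=
      (continuous_subtype_val.continuousAt).prodMk
        ((φ.continuousAt hXb).comp hX.continuousAt)
    have h2 : ContinuousAt (fun t : I => a ((t : ℝ), φ (X t))) b :=
      ContinuousAt.comp (g := a) (hac.continuousAt (hNo.mem_nhds hbN)) h1
    filter_upwards [hX.continuousAt (φ.open_source.mem_nhds hXb), h1 (hNo.mem_nhds hbN),
      h2 ((Metric.isOpen_ball (x := (L : E →L[ℝ] E)) (ε := ρ)).mem_nhds
        (show a _ ∈ _ by rw [hab]; exact Metric.mem_ball_self hρ))] with t e1 e2 e3 using ⟨e1, e2, e3⟩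
  obtain ⟨δ, hδ, hδ'⟩ := Metric.eventually_nhds_iff.1 hev
  have hδb : ∀ t : I, (b : ℝ) - δ / 2 ≤ t → t ≤ b → X t ∈ φ.source ∧ ((t : ℝ), φ (X t)) ∈ N ∧
      a ((t : ℝ), φ (X t)) ∈ Metric.ball (L : E →L[ℝ] E) ρ := fun t h1 h2 => hδ' (by
    have h2' : (t : ℝ) ≤ b := h2
    rw [Subtype.dist_eq, Real.dist_eq, abs_lt]
    constructor <;> linarith)
  -- The affine argument is at most `0` for `t ≤ b - δ/2` and at least `1` for `t ≥ b - δ/4`. The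
  -- blending thus takes place inside the `δ`-neighbourhood of `b` where the derivative is
  -- controlled, and is finished before `b`.
  let χ : ℝ → ℝ := fun t => Real.smoothTransition (4 * (t - b) / δ + 2)
  have hχ : ContDiff ℝ ∞ χ := Real.smoothTransition.contDiff.comp (by fun_prop)
  have hχ0 : ∀ t : ℝ, t ≤ b - δ / 2 → χ t = 0 := fun t ht =>
    Real.smoothTransition.zero_of_nonpos (by
      have : 4 * (t - b) / δ ≤ -2 := by rw [div_le_iff₀ hδ]; linarith
      linarith)
  have hχ1 : ∀ t : ℝ, (b : ℝ) - δ / 4 ≤ t → χ t = 1 := fun t ht =>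
    Real.smoothTransition.one_of_one_le (by
      have : -1 ≤ 4 * (t - b) / δ := by rw [le_div_iff₀ hδ]; linarith
      linarith)
  refine ⟨fun q => (1 - χ q.1) • F q + χ q.1 • L (φ q.2), fun t ht => ?_⟩
  rcases lt_or_ge (t : ℝ) (b - δ / 2) with h1 | h1
  · refine (hF t ?_).congr (O := {q | q.1 < b - δ / 2})
      (isOpen_lt continuous_fst continuous_const) h1 fun q hq => ?_
    · have : (t : ℝ) ≤ b := by linarith
      exact this
    · simp [hχ0 q.1 (le_of_lt hq)]
  rcases le_or_gt t b with h2 | h2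
  · obtain ⟨e1, e2, e3⟩ := hδb t h1 h2
    -- The cutoff depends on time only, so the spatial derivative of the blend is the convex
    -- combination of the two spatial derivatives.
    have hmem : (1 - χ t) • a ((t : ℝ), φ (X t)) + χ t • (L : E →L[ℝ] E) ∈
        Metric.ball (L : E →L[ℝ] E) ρ :=
      convex_ball _ _ e3 (Metric.mem_ball_self hρ)
        (sub_nonneg.2 (Real.smoothTransition.le_one _)) (Real.smoothTransition.nonneg _) (by ring)
    obtain ⟨A, hA⟩ := hρL hmem
    have hsymm : ∀ y ∈ φ.target, φ (φ.symm y) = y := fun y hy => φ.right_inv hy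
    refine isTubeCoordAt_of_chart (x₀ := X t₀) e1 (N := N ∩ univ ×ˢ φ.target)
      (hNo.inter (isOpen_univ.prod φ.open_target)) ⟨e2, mem_univ _, φ.map_source e1⟩ ?_ A ?_
    · have h3 : ContDiffOn ℝ ∞ (fun p : ℝ × E => (1 - χ p.1) • F (p.1, φ.symm p.2) +
          χ p.1 • L p.2) (N ∩ univ ×ˢ φ.target) := by
        have h4 : ContDiff ℝ ∞ fun p : ℝ × E => χ p.1 := hχ.comp contDiff_fst
        exact ((contDiff_const.sub h4).contDiffOn.smul (hFN.mono inter_subset_left)).add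
          (h4.smul (L.contDiff.comp contDiff_snd)).contDiffOn
      refine h3.congr fun p hp => ?_
      simp only [← hφ, hsymm p.2 hp.2.2]
    · rw [hA]
      have h3 := ((ha _ e2).const_smul (1 - χ t)).add
        ((L.hasFDerivAt (x := φ (X t))).const_smul (χ t))
      refine h3.congr_of_eventuallyEq ?_
      filter_upwards [φ.open_target.mem_nhds (φ.map_source e1)] with y hy
      simp only [← hφ, hsymm y hy]
      rfl
  · have h2' : (b : ℝ) < t := h2
    have e1 : X t ∈ φ.source := hεX (by
      rw [Metric.mem_ball, Subtype.dist_eq, Real.dist_eq, abs_lt] at hb hb' ⊢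
      have : (t : ℝ) ≤ b' := ht
      constructor <;> linarith)
    have hlt : (b : ℝ) - δ / 4 < t := by linarith
    refine isTubeCoordAt_of_chart (x₀ := X t₀) e1 (N := {p | (b : ℝ) - δ / 4 < p.1} ∩ univ ×ˢ φ.target)
      ((isOpen_lt continuous_const continuous_fst).inter (isOpen_univ.prod φ.open_target))
      ⟨hlt, mem_univ _, φ.map_source e1⟩ ?_ L ?_
    · refine (L.contDiff.comp contDiff_snd).contDiffOn.congr fun p hp => ?_
      simp only [hχ1 p.1 (le_of_lt hp.1), ← hφ, φ.right_inv hp.2.2]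
      simp
    · refine L.hasFDerivAt.congr_of_eventuallyEq ?_
      filter_upwards [φ.open_target.mem_nhds (φ.map_source e1)] with y hy
      simp only [hχ1 t hlt.le, ← hφ, φ.right_inv hy]
      simp

/-- A property of times in the unit interval that is locally constant holds everywhere as soon as
it holds at `0`. -/
theorem unitInterval_induction {R : I → Prop} (h0 : R 0)
    (h : ∀ t₀, ∃ U ∈ 𝓝 t₀, ∀ b ∈ U, ∀ b' ∈ U, R b → R b') (t : I) : R t := by
  have hclopen : IsClopen {t | R t} := by
    constructor
    · rw [← isOpen_compl_iff, isOpen_iff_mem_nhds]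
      intro t ht
      obtain ⟨U, hU, hR⟩ := h t
      filter_upwards [hU] with t' ht' hRt' using ht (hR t' ht' t (mem_of_mem_nhds hU) hRt')
    · rw [isOpen_iff_mem_nhds]
      intro t ht
      obtain ⟨U, hU, hR⟩ := h t
      filter_upwards [hU] with t' ht' using hR t (mem_of_mem_nhds hU) t' ht' ht
  have := mem_univ t
  rwa [← hclopen.eq_univ ⟨0, h0⟩] at this

/-- Every path stays in the domain of a time-dependent chart. -/
theorem exists_tubeChart [CompleteSpace E] [T2Space M] {X : I → M} (hX : Continuous X) :
    ∃ τ : TubeChart E M, ∀ t : I, ((t : ℝ), X t) ∈ τ.toHomeo.source := by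
  obtain ⟨F, hF⟩ := unitInterval_induction
    (R := fun b => ∃ F : ℝ × M → E, ∀ t ≤ b, IsTubeCoordAt F ((t : ℝ), X t))
    ⟨fun q => chartAt E (X 0) q.2, fun t ht => by
      obtain rfl : t = 0 := le_antisymm ht unitInterval.nonneg'
      exact ⟨TubeChart.const E (X 0), TubeChart.mem_const_source.2 (mem_chart_source E _),
        fun q _ => rfl⟩⟩ (exists_isTubeCoordAt_extend hX) 1
  exact exists_tubeChart_of_isTubeCoordAt hX fun t => hF t unitInterval.le_one'

end Tube

section Covectors

variable {E : Type u} [NormedAddCommGroup E] [NormedSpace ℝ E]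
  {M : Type v} [TopologicalSpace M] [ChartedSpace E M] [IsManifold 𝓘(ℝ, E) ∞ M]

namespace TubeChart

/-! ### Differentials of time-dependent charts -/

theorem contMDiffAt_slice (τ : TubeChart E M) {t : ℝ} {x : M} (h : (t, x) ∈ τ.toHomeo.source) :
    ContMDiffAt 𝓘(ℝ, E) 𝓘(ℝ, E) ∞ (τ.slice t) x := by
  have h1 := τ.smooth.contMDiffAt (τ.toHomeo.open_source.mem_nhds h)
  have h2 : ContMDiffAt 𝓘(ℝ, E) (𝓘(ℝ, ℝ).prod 𝓘(ℝ, E)) ∞ (fun x : M => (t, x)) x :=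
    contMDiffAt_const.prodMk contMDiffAt_id
  exact contDiff_snd.contMDiff.contMDiffAt.comp x (h1.comp x h2)

theorem contMDiffAt_inv (τ : TubeChart E M) {t : ℝ} {y : E} (h : (t, y) ∈ τ.toHomeo.target) :
    ContMDiffAt 𝓘(ℝ, E) 𝓘(ℝ, E) ∞ (τ.inv t) y := by
  have h1 := τ.smooth_symm.contMDiffAt (τ.toHomeo.open_target.mem_nhds h)
  have h2 : ContMDiffAt 𝓘(ℝ, E) 𝓘(ℝ, ℝ × E) ∞ (fun y : E => (t, y)) y :=
    (contDiff_prodMk_right t).contMDiff.contMDiffAt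
  exact contMDiffAt_snd.comp y (h1.comp y h2)

/-- The differential of the chart at the time `t`. -/
def dslice (τ : TubeChart E M) (t : ℝ) (x : M) : E →L[ℝ] E := mfderiv 𝓘(ℝ, E) 𝓘(ℝ, E) (τ.slice t) x

/-- The differential of the inverse chart at the time `t`. -/
def dinv (τ : TubeChart E M) (t : ℝ) (y : E) : E →L[ℝ] E := mfderiv 𝓘(ℝ, E) 𝓘(ℝ, E) (τ.inv t) y

theorem dslice_comp_dinv {τ τ' : TubeChart E M} {t : ℝ} {y : E} (h : (t, y) ∈ τ.transDom τ') :
    (τ'.dslice t (τ.inv t y)).comp (τ.dinv t y) = τ.dtrans τ' (t, y) := by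
  obtain ⟨h1, h2⟩ := mem_transDom.1 h
  have e := mfderiv_comp y ((τ'.contMDiffAt_slice h2).mdifferentiableAt (by simp))
    ((τ.contMDiffAt_inv h1).mdifferentiableAt (by simp))
  rw [mfderiv_eq_fderiv] at e
  exact e.symm.trans (hasFDerivAt_trans h).fderiv

theorem dslice_comp_dinv_self (τ : TubeChart E M) {t : ℝ} {x : M} (h : (t, x) ∈ τ.toHomeo.source) :
    (τ.dslice t x).comp (τ.dinv t (τ.slice t x)) = .id ℝ E := by
  have h1 := τ.mem_target h
  have h2 := slice_mem_transDom h h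
  have e := dslice_comp_dinv h2
  rw [τ.inv_slice h] at e
  rw [e]
  refine (hasFDerivAt_trans h2).unique ((hasFDerivAt_id _).congr_of_eventuallyEq ?_)
  have : {y | (t, y) ∈ τ.toHomeo.target} ∈ 𝓝 (τ.slice t x) :=
    (τ.toHomeo.open_target.preimage (by fun_prop : Continuous fun y : E => (t, y))).mem_nhds h1
  filter_upwards [this] with y hy using τ.slice_inv hy

theorem dinv_comp_dslice_self (τ : TubeChart E M) {t : ℝ} {x : M} (h : (t, x) ∈ τ.toHomeo.source) :
    (τ.dinv t (τ.slice t x)).comp (τ.dslice t x) = .id ℝ E := by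
  have h1 := τ.mem_target h
  have e := mfderiv_comp x ((τ.contMDiffAt_inv h1).mdifferentiableAt (by simp))
    ((τ.contMDiffAt_slice h).mdifferentiableAt (by simp))
  refine Eq.trans e.symm ?_
  have : (τ.inv t ∘ τ.slice t) =ᶠ[𝓝 x] id := by
    have : {x | (t, x) ∈ τ.toHomeo.source} ∈ 𝓝 x :=
      (τ.toHomeo.open_source.preimage (by fun_prop : Continuous fun x : M => (t, x))).mem_nhds h
    filter_upwards [this] with x hx using τ.inv_slice hx
  rw [this.mfderiv_eq, mfderiv_id]
  rfl

theorem dslice_eq {τ τ' : TubeChart E M} {t : ℝ} {x : M}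
    (h : (t, x) ∈ τ.toHomeo.source) (h' : (t, x) ∈ τ'.toHomeo.source) :
    τ'.dslice t x = (τ.dtrans τ' (t, τ.slice t x)).comp (τ.dslice t x) := by
  have e := dslice_comp_dinv (slice_mem_transDom h h')
  rw [τ.inv_slice h] at e
  rw [← e, ContinuousLinearMap.comp_assoc, τ.dinv_comp_dslice_self h,
    ContinuousLinearMap.comp_id]

/-! ### Coordinates of covectors -/

/-- The coordinates of an `ℝ^r`-valued covector in the chart at the time `t`. -/
def covCoord (τ : TubeChart E M) {r : ℕ} (t : ℝ) (p : CoVelSpace E M r) : E →L[ℝ] (Fin r → ℝ) :=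
  (show E →L[ℝ] (Fin r → ℝ) from p.2).comp (τ.dinv t (τ.slice t p.proj))

/-- The `ℝ^r`-valued covector with the given coordinates. -/
def covOf (τ : TubeChart E M) {r : ℕ} (t : ℝ) (y : E) (ζ : E →L[ℝ] (Fin r → ℝ)) : CoVelSpace E M r :=
  ⟨τ.inv t y, (ζ.comp (τ.dslice t (τ.inv t y)) : E →L[ℝ] (Fin r → ℝ))⟩

variable {r : ℕ}

theorem covCoord_covOf (τ : TubeChart E M) {t : ℝ} {y : E} (h : (t, y) ∈ τ.toHomeo.target)
    (ζ : E →L[ℝ] (Fin r → ℝ)) : τ.covCoord t (τ.covOf t y ζ) = ζ := by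
  change (ζ.comp (τ.dslice t (τ.inv t y))).comp (τ.dinv t (τ.slice t (τ.inv t y))) = ζ
  rw [ContinuousLinearMap.comp_assoc, τ.dslice_comp_dinv_self (τ.mem_source h),
    ContinuousLinearMap.comp_id]

theorem covCoord_comp_dslice (τ : TubeChart E M) {t : ℝ} {p : CoVelSpace E M r}
    (h : (t, p.proj) ∈ τ.toHomeo.source) :
    (τ.covCoord t p).comp (τ.dslice t p.proj) = (show E →L[ℝ] (Fin r → ℝ) from p.2) := by
  rw [covCoord, ContinuousLinearMap.comp_assoc, τ.dinv_comp_dslice_self h,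
    ContinuousLinearMap.comp_id]

theorem covOf_covCoord (τ : TubeChart E M) {t : ℝ} {p : CoVelSpace E M r}
    (h : (t, p.proj) ∈ τ.toHomeo.source) : τ.covOf t (τ.slice t p.proj) (τ.covCoord t p) = p := by
  rcases p with ⟨x, φ⟩
  have h1 := τ.covCoord_comp_dslice h
  have h2 : τ.inv t (τ.slice t x) = x := τ.inv_slice h
  refine (TotalSpace.ext_iff).2 ⟨h2, ?_⟩
  refine HEq.trans ?_ (heq_of_eq h1)
  change HEq ((τ.covCoord t ⟨x, φ⟩).comp (τ.dslice t (τ.inv t (τ.slice t x)))) _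
  rw [h2]
  exact HEq.rfl

theorem covCoord_trans {τ τ' : TubeChart E M} {t : ℝ} {p : CoVelSpace E M r}
    (h : (t, p.proj) ∈ τ.toHomeo.source) (h' : (t, p.proj) ∈ τ'.toHomeo.source) :
    (τ'.covCoord t p).comp (τ.dtrans τ' (t, τ.slice t p.proj)) = τ.covCoord t p := by
  have h1 := τ'.covCoord_comp_dslice h'
  rw [dslice_eq h h'] at h1
  change _ = ContinuousLinearMap.comp (show E →L[ℝ] (Fin r → ℝ) from p.2) _
  rw [← h1, ContinuousLinearMap.comp_assoc, ContinuousLinearMap.comp_assoc,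
    τ.dslice_comp_dinv_self h, ContinuousLinearMap.comp_id]

/-- This identifies the trivialization of the bundle of covelocities with the covector coordinates
of a constant-in-time chart, so that smoothness in the bundle can be tested in such charts. -/
theorem inCoordinates_eq_covCoord (x₀ : M) (t : ℝ) (p : CoVelSpace E M r)
    (hp : p.proj ∈ (chartAt E x₀).source) :
    ContinuousLinearMap.inCoordinates E (TangentSpace 𝓘(ℝ, E)) (Fin r → ℝ)
      (Trivial M (Fin r → ℝ)) x₀ p.proj x₀ p.proj p.2 = (const E x₀).covCoord t p := by
  have h1 : (trivializationAt E (TangentSpace 𝓘(ℝ, E)) x₀).symmL ℝ p.proj =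
      mfderivWithin 𝓘(ℝ, E) 𝓘(ℝ, E) (extChartAt 𝓘(ℝ, E) x₀).symm (range 𝓘(ℝ, E))
        (extChartAt 𝓘(ℝ, E) x₀ p.proj) := TangentBundle.symmL_trivializationAt hp
  rw [ContinuousLinearMap.inCoordinates, h1]
  simp only [modelWithCornersSelf_coe, range_id, mfderivWithin_univ]
  simp
  rfl

/-! ### Smoothness in coordinates -/

section Smooth

variable {E' : Type*} [NormedAddCommGroup E'] [NormedSpace ℝ E'] {H' : Type*} [TopologicalSpace H']
  {J : ModelWithCorners ℝ E' H'} {N : Type*} [TopologicalSpace N] [ChartedSpace H' N]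
  {n : ℕ∞ω} {θ : N → ℝ} {z : N}

theorem eventually_mem_source {τ : TubeChart E M} (hθ : ContinuousAt θ z) {X : N → M}
    (hX : ContinuousAt X z) (h : (θ z, X z) ∈ τ.toHomeo.source) :
    ∀ᶠ z' in 𝓝 z, (θ z', X z') ∈ τ.toHomeo.source :=
  (hθ.prodMk hX).eventually (τ.toHomeo.open_source.mem_nhds h)

theorem contMDiffAt_iff_slice {τ : TubeChart E M} (hn : n ≤ ∞) (hθ : ContMDiffAt J 𝓘(ℝ, ℝ) n θ z)
    {X : N → M} (hX : ContinuousAt X z) (h : (θ z, X z) ∈ τ.toHomeo.source) :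
    ContMDiffAt J 𝓘(ℝ, E) n X z ↔
      ContMDiffAt J 𝓘(ℝ, E) n (fun z' => τ.slice (θ z') (X z')) z := by
  constructor
  · intro hX'
    have h1 := (τ.smooth.contMDiffAt (τ.toHomeo.open_source.mem_nhds h)).of_le hn
    exact contDiff_snd.contMDiff.contMDiffAt.comp z
      (h1.comp z (f := fun z' => (θ z', X z')) (hθ.prodMk hX'))
  · intro hu
    have h1 := (τ.smooth_symm.contMDiffAt
      (τ.toHomeo.open_target.mem_nhds (τ.mem_target h))).of_le hn
    have h2 := contMDiffAt_snd.comp z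
      (h1.comp z (f := fun z' => (θ z', τ.slice (θ z') (X z'))) (hθ.prodMk_space hu))
    refine h2.congr_of_eventuallyEq ?_
    filter_upwards [eventually_mem_source hθ.continuousAt hX h] with z' hz'
    exact (τ.inv_slice hz').symm

theorem contMDiffAt_covCoord_change {τ τ' : TubeChart E M} (hn : n ≤ ∞)
    (hθ : ContMDiffAt J 𝓘(ℝ, ℝ) n θ z) {p : N → CoVelSpace E M r}
    (hX : ContMDiffAt J 𝓘(ℝ, E) n (fun z => (p z).proj) z)
    (h : (θ z, (p z).proj) ∈ τ.toHomeo.source) (h' : (θ z, (p z).proj) ∈ τ'.toHomeo.source)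
    (hp : ContMDiffAt J 𝓘(ℝ, E →L[ℝ] (Fin r → ℝ)) n (fun z' => τ'.covCoord (θ z') (p z')) z) :
    ContMDiffAt J 𝓘(ℝ, E →L[ℝ] (Fin r → ℝ)) n (fun z' => τ.covCoord (θ z') (p z')) z := by
  have hu := (contMDiffAt_iff_slice hn hθ hX.continuousAt h).1 hX
  have h1 : ContDiffAt ℝ n (τ.dtrans τ') (θ z, τ.slice (θ z) (p z).proj) :=
    ((τ.contDiffOn_dtrans τ').contDiffAt
      ((τ.isOpen_transDom τ').mem_nhds (slice_mem_transDom h h'))).of_le hn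
  have h2 := h1.comp_contMDiffAt (f := fun z' => (θ z', τ.slice (θ z') (p z').proj))
    (hθ.prodMk_space hu)
  refine (hp.clm_comp h2).congr_of_eventuallyEq ?_
  filter_upwards [eventually_mem_source hθ.continuousAt hX.continuousAt h,
    eventually_mem_source hθ.continuousAt hX.continuousAt h'] with z' hz hz'
  exact (covCoord_trans hz hz').symm

/-- Smoothness into the bundle can be tested in any time-dependent chart, with the time allowed to
vary as a function `θ` of the point. The three uses are paths (`θ` the inclusion of the interval),
evaluation at a fixed time (`θ` constant) and forms on `ℝ × E` (`θ` the first coordinate). -/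
theorem contMDiffAt_iff_covCoord {τ : TubeChart E M} (hn : n ≤ ∞)
    (hθ : ContMDiffAt J 𝓘(ℝ, ℝ) n θ z) {p : N → CoVelSpace E M r}
    (hX : ContinuousAt (fun z => (p z).proj) z) (h : (θ z, (p z).proj) ∈ τ.toHomeo.source) :
    ContMDiffAt J (coVelModel E r) n p z ↔
      ContMDiffAt J 𝓘(ℝ, E) n (fun z' => τ.slice (θ z') (p z').proj) z ∧
      ContMDiffAt J 𝓘(ℝ, E →L[ℝ] (Fin r → ℝ)) n (fun z' => τ.covCoord (θ z') (p z')) z := by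
  have h' : (θ z, (p z).proj) ∈ (const E (p z).proj).toHomeo.source :=
    mem_const_source.2 (mem_chart_source E (p z).proj)
  have e : (fun z' => ContinuousLinearMap.inCoordinates E (TangentSpace 𝓘(ℝ, E)) (Fin r → ℝ)
      (Trivial M (Fin r → ℝ)) (p z).proj (p z').proj (p z).proj (p z').proj (p z').2) =ᶠ[𝓝 z]
      fun z' => (const E (p z).proj).covCoord (θ z') (p z') := by
    filter_upwards [eventually_mem_source hθ.continuousAt hX h'] with z' hz'
    exact inCoordinates_eq_covCoord _ _ _ (mem_const_source.1 hz')
  rw [contMDiffAt_hom_bundle, ← contMDiffAt_iff_slice hn hθ hX h]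
  refine and_congr_right fun hX' => ?_
  rw [e.contMDiffAt_iff]
  exact ⟨contMDiffAt_covCoord_change hn hθ hX' h h', contMDiffAt_covCoord_change hn hθ hX' h' h⟩

end Smooth

end TubeChart

end Covectors

/-! ### Curves of class `C^k` as smooth maps on the interval with boundary -/

namespace CkCurve

variable {k : ℕ} {F : Type*} [NormedAddCommGroup F] [NormedSpace ℝ F]

theorem exists_iff_contMDiff {f : I → F} : (∃ c : CkCurve k F, ∀ t, c.eval t = f t) ↔
    ContMDiff (𝓡∂ 1) 𝓘(ℝ, F) k f :=
  exists_iff_contDiffOn.trans (contMDiffOn_iff_contDiffOn.symm.trans contMDiffOn_comp_projIcc_iff)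

theorem contMDiff (c : CkCurve k F) : ContMDiff (𝓡∂ 1) 𝓘(ℝ, F) k c.eval :=
  exists_iff_contMDiff.1 ⟨c, fun _ => rfl⟩

open Classical in
/-- The element of `C^k([0,1], F)` that is given by a function, if it is of class `C^k`. -/
def ofFun (k : ℕ) (f : I → F) : CkCurve k F :=
  if h : ∃ c : CkCurve k F, ∀ t, c.eval t = f t then h.choose else 0

theorem ofFun_eval {f : I → F} (hf : ContMDiff (𝓡∂ 1) 𝓘(ℝ, F) k f) (t : I) :
    (ofFun k f).eval t = f t := by
  have h := exists_iff_contMDiff.2 hf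
  rw [ofFun, dif_pos h]
  exact h.choose_spec t

end CkCurve

/-! ### Coordinates of the path space and their changes -/

section PathSpace

variable {E : Type u} [NormedAddCommGroup E] [NormedSpace ℝ E]
  {M : Type v} [TopologicalSpace M] [ChartedSpace E M] [IsManifold 𝓘(ℝ, E) ∞ M] {r k : ℕ}

theorem CoPath.path_injective : Function.Injective (CoPath.path : CoPath E M r k → _) := by
  rintro ⟨p, _, _⟩ ⟨p', _, _⟩ h
  cases h
  rfl

theorem CoPath.continuous_base (γ : CoPath E M r k) : Continuous fun t => (γ.path t).proj :=
  γ.contMDiff_base.continuous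

theorem natCast_le_infty (n : ℕ) : (n : ℕ∞ω) ≤ ∞ := mod_cast le_top

namespace TubeChart

variable (r k) in
/-- The paths that stay in the domain of a time-dependent chart. -/
def coSource (τ : TubeChart E M) : Set (CoPath E M r k) :=
  {γ | ∀ t : I, ((t : ℝ), (γ.path t).proj) ∈ τ.toHomeo.source}

variable (r k) in
/-- The coordinate expressions of the paths in the domain of a time-dependent chart. -/
def coTarget (τ : TubeChart E M) : Set (CoPathModel E r k) :=
  {p | ∀ t : I, ((t : ℝ), p.1.eval t) ∈ τ.toHomeo.target}

/-- The coordinate expression of a path. -/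
def coCoord (τ : TubeChart E M) (γ : CoPath E M r k) : CoPathModel E r k :=
  (CkCurve.ofFun (k + 1) fun t => τ.slice t (γ.path t).proj,
    CkCurve.ofFun k fun t => τ.covCoord t (γ.path t))

theorem coCoord_eval (τ : TubeChart E M) {γ : CoPath E M r k} (hγ : γ ∈ τ.coSource r k) (t : I) :
    (τ.coCoord γ).1.eval t = τ.slice t (γ.path t).proj ∧
      (τ.coCoord γ).2.eval t = τ.covCoord t (γ.path t) := by
  constructor
  · refine CkCurve.ofFun_eval (fun t => ?_) t
    exact (contMDiffAt_iff_slice (natCast_le_infty _) contMDiff_subtypeVal_Icc.contMDiffAt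
      γ.continuous_base.continuousAt (hγ t)).1 (γ.contMDiff_base t)
  · refine CkCurve.ofFun_eval (fun t => ?_) t
    exact ((contMDiffAt_iff_covCoord (natCast_le_infty _) contMDiff_subtypeVal_Icc.contMDiffAt
      γ.continuous_base.continuousAt (hγ t)).1 (γ.contMDiff_path t)).2

/-- The path with the given coordinate expression. -/
def coOf (τ : TubeChart E M) (p : CoPathModel E r k) (hp : p ∈ τ.coTarget r k) :
    CoPath E M r k :=
  have hbase : ∀ n : ℕ, n ≤ k + 1 →
      ContMDiff (𝓡∂ 1) 𝓘(ℝ, E) (n : ℕ∞ω) fun t : I => τ.inv t (p.1.eval t) := fun n hn t => by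
    have h1 := ((τ.smooth_symm.contMDiffAt (τ.toHomeo.open_target.mem_nhds (hp t))).of_le
      (natCast_le_infty n))
    exact contMDiffAt_snd.comp t (h1.comp t (f := fun t : I => ((t : ℝ), p.1.eval t))
      (contMDiff_subtypeVal_Icc.contMDiffAt.prodMk_space
        ((p.1.contMDiff t).of_le (mod_cast hn))))
  { path := fun t => τ.covOf t (p.1.eval t) (p.2.eval t)
    contMDiff_base := hbase (k + 1) le_rfl
    contMDiff_path := fun t => by
      refine (contMDiffAt_iff_covCoord (τ := τ) (natCast_le_infty k)
        contMDiff_subtypeVal_Icc.contMDiffAt (hbase k k.le_succ).continuous.continuousAt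
        (τ.mem_source (hp t))).2 ⟨?_, ?_⟩
      · refine ((p.1.contMDiff t).of_le (mod_cast k.le_succ)).congr_of_eventuallyEq
          (Filter.Eventually.of_forall fun t => τ.slice_inv (hp t))
      · exact (p.2.contMDiff t).congr_of_eventuallyEq
          (Filter.Eventually.of_forall fun t => τ.covCoord_covOf (hp t) _) }

/-- Some path; its choice is irrelevant. -/
def somePath (τ : TubeChart E M) : CoPath E M r k where
  path _ := ⟨(τ.toHomeo.symm 0).2, 0⟩
  contMDiff_base := contMDiff_const
  contMDiff_path := contMDiff_const

open Classical in
variable (r k) in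
/-- The chart of the path space that is induced by a time-dependent chart. -/
def coEquiv (τ : TubeChart E M) : PartialEquiv (CoPath E M r k) (CoPathModel E r k) where
  toFun := τ.coCoord
  invFun p := if hp : p ∈ τ.coTarget r k then τ.coOf p hp else τ.somePath
  source := τ.coSource r k
  target := τ.coTarget r k
  map_source' γ hγ t := by
    rw [(τ.coCoord_eval hγ t).1]
    exact τ.mem_target (hγ t)
  map_target' p hp t := by
    simp only [dif_pos hp]
    exact τ.mem_source (hp t)
  left_inv' γ hγ := by
    have h : τ.coCoord γ ∈ τ.coTarget r k := fun t => by
      rw [(τ.coCoord_eval hγ t).1]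
      exact τ.mem_target (hγ t)
    simp only [dif_pos h]
    refine CoPath.path_injective (funext fun t => ?_)
    change τ.covOf t _ _ = _
    rw [(τ.coCoord_eval hγ t).1, (τ.coCoord_eval hγ t).2]
    exact τ.covOf_covCoord (hγ t)
  right_inv' p hp := by
    simp only [dif_pos hp]
    have h : τ.coOf p hp ∈ τ.coSource r k := fun t => τ.mem_source (hp t)
    refine Prod.ext (CkCurve.ext fun t => ?_) (CkCurve.ext fun t => ?_)
    · rw [(τ.coCoord_eval h t).1]
      exact τ.slice_inv (hp t)
    · rw [(τ.coCoord_eval h t).2]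
      exact τ.covCoord_covOf (hp t) _

theorem coEquiv_symm_path (τ : TubeChart E M) {p : CoPathModel E r k} (hp : p ∈ τ.coTarget r k)
    (t : I) : ((τ.coEquiv r k).symm p).path t = τ.covOf t (p.1.eval t) (p.2.eval t) := by
  exact congrArg (fun γ : CoPath E M r k => γ.path t) (dif_pos hp)

/-- The coordinate change for covectors. -/
def coTrans (τ τ' : TubeChart E M) (r : ℕ) (q : ℝ × (E × (E →L[ℝ] (Fin r → ℝ)))) :
    E × (E →L[ℝ] (Fin r → ℝ)) :=
  (τ.trans τ' (q.1, q.2.1), q.2.2.comp (τ'.dtrans τ (q.1, τ.trans τ' (q.1, q.2.1))))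

theorem coTrans_eq {τ τ' : TubeChart E M} {t : ℝ} {y : E} (h : (t, y) ∈ τ.transDom τ')
    (ζ : E →L[ℝ] (Fin r → ℝ)) :
    coTrans τ τ' r (t, (y, ζ)) =
      (τ'.slice t (τ.covOf t y ζ).proj, τ'.covCoord t (τ.covOf t y ζ)) := by
  obtain ⟨h1, h2⟩ := mem_transDom.1 h
  refine Prod.ext rfl ?_
  have := covCoord_trans (p := τ.covOf t y ζ) h2 (τ.mem_source h1)
  rw [τ.covCoord_covOf h1] at this
  exact this

variable (r) in
/-- The domain of the coordinate change for covectors. -/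
def coTransDom (τ τ' : TubeChart E M) : Set (ℝ × (E × (E →L[ℝ] (Fin r → ℝ)))) :=
  {q | (q.1, q.2.1) ∈ τ.transDom τ'}

theorem isOpen_coTransDom (τ τ' : TubeChart E M) : IsOpen (coTransDom r τ τ') :=
  (τ.isOpen_transDom τ').preimage (by fun_prop)

theorem contDiffOn_coTrans (τ τ' : TubeChart E M) :
    ContDiffOn ℝ ∞ (coTrans τ τ' r) (coTransDom r τ τ') := by
  have h0 : ContDiff ℝ ∞ fun q : ℝ × (E × (E →L[ℝ] (Fin r → ℝ))) => (q.1, q.2.1) := by fun_prop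
  have h1 : ContDiffOn ℝ ∞ (fun q : ℝ × (E × (E →L[ℝ] (Fin r → ℝ))) =>
      τ.trans τ' (q.1, q.2.1)) (coTransDom r τ τ') :=
    (τ.contDiffOn_trans τ').comp h0.contDiffOn fun q hq => hq
  have h2 : ContDiffOn ℝ ∞ (fun q : ℝ × (E × (E →L[ℝ] (Fin r → ℝ))) =>
      τ'.dtrans τ (q.1, τ.trans τ' (q.1, q.2.1))) (coTransDom r τ τ') :=
    (τ'.contDiffOn_dtrans τ).comp (contDiffOn_fst.prodMk h1) fun q hq => trans_mem_transDom hq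
  exact h1.prodMk ((contDiff_snd.comp contDiff_snd).contDiffOn.clm_comp h2)

theorem coEquiv_trans_source (τ τ' : TubeChart E M) :
    ((τ.coEquiv r k).symm.trans (τ'.coEquiv r k)).source =
      Prod.fst ⁻¹' CkCurve.graphIn (k + 1) (τ.transDom τ') := by
  ext p
  rw [PartialEquiv.trans_source]
  constructor
  · rintro ⟨h1, h2⟩ t
    have h3 := h2 t
    rw [τ.coEquiv_symm_path h1] at h3
    exact mem_transDom.2 ⟨h1 t, h3⟩
  · intro h
    have h1 : p ∈ τ.coTarget r k := fun t => (mem_transDom.1 (h t)).1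
    refine ⟨h1, fun t => ?_⟩
    rw [τ.coEquiv_symm_path h1]
    exact (mem_transDom.1 (h t)).2

theorem pairL_mem_graphIn {τ τ' : TubeChart E M} {p : CoPathModel E r k}
    (hp : p ∈ Prod.fst ⁻¹' CkCurve.graphIn (k + 1) (τ.transDom τ')) :
    CkCurve.pairL (CkCurve.incl p.1, p.2) ∈ CkCurve.graphIn k (coTransDom r τ τ') := fun t => by
  rw [CkCurve.pairL_eval]
  exact hp t

/-- Both components are superposition operators. The covector component involves the derivative of
the coordinate change of `M`, but only through the values of `u`; as the symbol is smooth, no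
regularity is lost and `u` may be read as a curve of class `C^k`. -/
theorem coEquiv_trans_apply {τ τ' : TubeChart E M} {p : CoPathModel E r k}
    (hp : p ∈ ((τ.coEquiv r k).symm.trans (τ'.coEquiv r k)).source) :
    (τ.coEquiv r k).symm.trans (τ'.coEquiv r k) p =
      (CkCurve.nemytskii (k + 1) (τ.trans τ') p.1,
        CkCurve.nemytskii k (fun q => (coTrans τ τ' r q).2)
          (CkCurve.pairL (CkCurve.incl p.1, p.2))) := by
  have hp' := hp
  rw [coEquiv_trans_source] at hp'
  have h1 : p ∈ τ.coTarget r k := hp.1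
  have h2 : (τ.coEquiv r k).symm p ∈ τ'.coSource r k := hp.2
  refine Prod.ext (CkCurve.ext fun t => ?_) (CkCurve.ext fun t => ?_)
  · refine (τ'.coCoord_eval h2 t).1.trans ?_
    rw [CkCurve.nemytskii_eval ((τ.contDiffOn_trans τ').of_le (natCast_le_infty _)) hp',
      τ.coEquiv_symm_path h1]
    rfl
  · refine (τ'.coCoord_eval h2 t).2.trans ?_
    change _ = (CkCurve.nemytskii k (Prod.snd ∘ coTrans τ τ' r)
      (CkCurve.pairL (CkCurve.incl p.1, p.2))).eval t
    rw [CkCurve.nemytskii_eval (O := coTransDom r τ τ')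
      ((contDiff_snd.comp_contDiffOn (contDiffOn_coTrans τ τ')).of_le (natCast_le_infty _))
      (pairL_mem_graphIn hp'), τ.coEquiv_symm_path h1, CkCurve.pairL_eval, CkCurve.incl_eval,
      Function.comp_apply, coTrans_eq (hp' t)]

theorem contDiffOn_coEquiv_trans [CompleteSpace E] (τ τ' : TubeChart E M) :
    ContDiffOn ℝ ∞ ((τ.coEquiv r k).symm.trans (τ'.coEquiv r k))
      ((τ.coEquiv r k).symm.trans (τ'.coEquiv r k)).source := by
  have h1 : ContDiffOn ℝ ∞ (fun p : CoPathModel E r k =>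
      (CkCurve.nemytskii (k + 1) (τ.trans τ') p.1,
        CkCurve.nemytskii k (fun q => (coTrans τ τ' r q).2)
          (CkCurve.pairL (CkCurve.incl p.1, p.2))))
      (Prod.fst ⁻¹' CkCurve.graphIn (k + 1) (τ.transDom τ')) := by
    refine ContDiffOn.prodMk ?_ ?_
    · exact (CkCurve.contDiffOn_nemytskii (τ.isOpen_transDom τ') (τ.contDiffOn_trans τ')).comp
        contDiffOn_fst fun p hp => hp
    · refine (CkCurve.contDiffOn_nemytskii (isOpen_coTransDom τ τ')
        (contDiff_snd.comp_contDiffOn (contDiffOn_coTrans τ τ'))).comp (f := fun p : CoPathModel E r k =>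
          CkCurve.pairL (CkCurve.incl p.1, p.2)) ?_ fun p hp => pairL_mem_graphIn hp
      exact (CkCurve.pairL.contDiff.comp
        ((CkCurve.incl.contDiff.comp contDiff_fst).prodMk contDiff_snd)).contDiffOn
  rw [← coEquiv_trans_source] at h1
  exact h1.congr fun p hp => coEquiv_trans_apply hp

end TubeChart

/-! ### The manifold structure of the path space -/

variable (E M r k) in
/-- The charts of the path space that are induced by the time-dependent charts. -/
def coPathCore [CompleteSpace E] [T2Space M] :
    ChartedSpaceCore (CoPathModel E r k) (CoPath E M r k) where
  atlas := range (TubeChart.coEquiv r k)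
  chartAt γ := (exists_tubeChart γ.continuous_base).choose.coEquiv r k
  mem_chart_source γ := (exists_tubeChart γ.continuous_base).choose_spec
  chart_mem_atlas γ := ⟨_, rfl⟩
  open_source := by
    rintro _ _ ⟨τ, rfl⟩ ⟨τ', rfl⟩
    rw [TubeChart.coEquiv_trans_source]
    exact (CkCurve.isOpen_graphIn (τ.isOpen_transDom τ')).preimage continuous_fst
  continuousOn_toFun := by
    rintro _ _ ⟨τ, rfl⟩ ⟨τ', rfl⟩
    exact (TubeChart.contDiffOn_coEquiv_trans τ τ').continuousOn

variable [CompleteSpace E] [T2Space M]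

instance CoPath.instTopologicalSpace : TopologicalSpace (CoPath E M r k) :=
  (coPathCore E M r k).toTopologicalSpace

instance CoPath.instChartedSpace : ChartedSpace (CoPathModel E r k) (CoPath E M r k) :=
  (coPathCore E M r k).toChartedSpace

variable (r k) in
/-- The chart of the path space that is induced by a time-dependent chart. -/
def TubeChart.coChart (τ : TubeChart E M) :
    OpenPartialHomeomorph (CoPath E M r k) (CoPathModel E r k) :=
  (coPathCore E M r k).openPartialHomeomorph (τ.coEquiv r k) ⟨τ, rfl⟩

theorem TubeChart.coChart_apply (τ : TubeChart E M) (γ : CoPath E M r k) :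
    τ.coChart r k γ = τ.coCoord γ := rfl

instance CoPath.instIsManifold :
    IsManifold 𝓘(ℝ, CoPathModel E r k) ∞ (CoPath E M r k) := by
  refine isManifold_of_contDiffOn _ ∞ _ ?_
  intro e e' he he'
  obtain ⟨_, ⟨τ, rfl⟩, he⟩ : ∃ c, ∃ h : c ∈ (coPathCore E M r k).atlas,
      e = (coPathCore E M r k).openPartialHomeomorph c h := by simpa using mem_iUnion₂.1 he
  obtain ⟨_, ⟨τ', rfl⟩, he'⟩ : ∃ c, ∃ h : c ∈ (coPathCore E M r k).atlas,
      e' = (coPathCore E M r k).openPartialHomeomorph c h := by simpa using mem_iUnion₂.1 he'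
  subst he he'
  simp only [modelWithCornersSelf_coe, modelWithCornersSelf_coe_symm, Function.id_comp,
    Function.comp_id, range_id, inter_univ, preimage_id]
  exact TubeChart.contDiffOn_coEquiv_trans τ τ'

theorem TubeChart.coChart_mem_maximalAtlas (τ : TubeChart E M) :
    τ.coChart r k ∈ IsManifold.maximalAtlas 𝓘(ℝ, CoPathModel E r k) ∞ (CoPath E M r k) :=
  IsManifold.subset_maximalAtlas (mem_iUnion₂.2 ⟨τ.coEquiv r k, ⟨τ, rfl⟩, rfl⟩)

variable (E M r k) in
theorem isPathManifold_coPath : IsPathManifold E M r k := by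
  refine ⟨inferInstance, fun γ => exists_tubeChart γ.continuous_base, fun τ =>
    ⟨τ.coChart r k, τ.coChart_mem_maximalAtlas, rfl, rfl, fun γ hγ t => ?_⟩⟩
  rw [τ.coChart_apply, (τ.coCoord_eval hγ t).1, (τ.coCoord_eval hγ t).2]
  exact ⟨rfl, τ.covCoord_comp_dslice (hγ t)⟩

/-! ### The two-form of the path space in coordinates -/

theorem TubeChart.coCoord_eventually (τ : TubeChart E M) {γ : CoPath E M r k}
    (hγ : γ ∈ τ.coSource r k) (t : I) : ∀ᶠ δ in 𝓝 γ,
      ((t : ℝ), (δ.path t).proj) ∈ τ.toHomeo.source ∧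
      (τ.coChart r k δ).1.eval t = τ.slice t (δ.path t).proj ∧
      (τ.coChart r k δ).2.eval t = τ.covCoord t (δ.path t) := by
  filter_upwards [(τ.coChart r k).open_source.mem_nhds hγ] with δ hδ
  exact ⟨hδ t, τ.coCoord_eval hδ t⟩

theorem TubeChart.contMDiffAt_coChart (τ : TubeChart E M) {γ : CoPath E M r k}
    (hγ : γ ∈ τ.coSource r k) :
    ContMDiffAt 𝓘(ℝ, CoPathModel E r k) 𝓘(ℝ, CoPathModel E r k) ∞ (τ.coChart r k) γ :=
  contMDiffAt_of_mem_maximalAtlas τ.coChart_mem_maximalAtlas hγ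

/-- Evaluation at a time on the model space of the path space. -/
def coEvalL (t : I) : CoPathModel E r k →L[ℝ] E × (E →L[ℝ] (Fin r → ℝ)) :=
  (CkCurve.evalL t).prodMap (CkCurve.evalL t)

theorem CoPath.continuousAt_proj (γ : CoPath E M r k) (t : I) :
    ContinuousAt (fun δ : CoPath E M r k => (δ.path t).proj) γ := by
  obtain ⟨τ, hτ⟩ := exists_tubeChart (E := E) γ.continuous_base
  have h1 : ContinuousAt (fun δ => (coEvalL t (τ.coChart r k δ)).1) γ :=
    (continuous_fst.comp (coEvalL (E := E) (r := r) (k := k) t).continuous).continuousAt.comp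
      ((τ.coChart r k).continuousAt hτ)
  have h0 : ((t : ℝ), (coEvalL t (τ.coChart r k γ)).1) ∈ τ.toHomeo.target := by
    change ((t : ℝ), (τ.coChart r k γ).1.eval t) ∈ _
    rw [τ.coChart_apply, (τ.coCoord_eval hτ t).1]
    exact τ.mem_target (hτ t)
  have h2 := ContinuousAt.comp (f := fun δ => (coEvalL t (τ.coChart r k δ)).1)
    (τ.contMDiffAt_inv h0).continuousAt h1
  refine h2.congr ?_
  filter_upwards [τ.coCoord_eventually hτ t] with δ hδ
  change τ.inv t ((τ.coChart r k δ).1.eval t) = _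
  rw [hδ.2.1, τ.inv_slice hδ.1]

theorem CoPath.contMDiffAt_eval (γ : CoPath E M r k) (t : I) :
    ContMDiffAt 𝓘(ℝ, CoPathModel E r k) (coVelModel E r) ∞
      (fun δ : CoPath E M r k => δ.path t) γ := by
  obtain ⟨τ, hτ⟩ := exists_tubeChart (E := E) γ.continuous_base
  have hc := (coEvalL (E := E) (r := r) (k := k) t).contDiff.contMDiff.contMDiffAt.comp γ
    (τ.contMDiffAt_coChart hτ)
  refine (TubeChart.contMDiffAt_iff_covCoord (τ := τ) (θ := fun _ => (t : ℝ)) le_rfl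
    contMDiffAt_const (γ.continuousAt_proj t) (hτ t)).2 ⟨?_, ?_⟩
  · refine (contDiff_fst.contMDiff.contMDiffAt.comp γ hc).congr_of_eventuallyEq ?_
    filter_upwards [τ.coCoord_eventually hτ t] with δ hδ using hδ.2.1.symm
  · refine (contDiff_snd.contMDiff.contMDiffAt.comp γ hc).congr_of_eventuallyEq ?_
    filter_upwards [τ.coCoord_eventually hτ t] with δ hδ using hδ.2.2.symm

/-- The components of a tangent vector at a point of the bundle refer to the preferred bundle chart
there. This chart is given by the constant chart of `M` at the base point, so the differential can
be computed from its coordinates. -/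
theorem CoPath.mfderiv_eval (γ : CoPath E M r k) (t : I) :
    (mfderiv 𝓘(ℝ, CoPathModel E r k) (coVelModel E r) (fun δ : CoPath E M r k => δ.path t) γ :
      CoPathModel E r k →L[ℝ] E × (E →L[ℝ] (Fin r → ℝ))) =
    mfderiv 𝓘(ℝ, CoPathModel E r k) 𝓘(ℝ, E × (E →L[ℝ] (Fin r → ℝ)))
      (fun δ : CoPath E M r k =>
        ((TubeChart.const E (γ.path t).proj).slice t (δ.path t).proj,
          (TubeChart.const E (γ.path t).proj).covCoord t (δ.path t))) γ := by
  set c := TubeChart.const E (γ.path t).proj with hc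
  have hmem : ((t : ℝ), (γ.path t).proj) ∈ c.toHomeo.source :=
    TubeChart.mem_const_source.2 (mem_chart_source E _)
  have h1 := γ.contMDiffAt_eval t
  have h2 := (TubeChart.contMDiffAt_iff_covCoord (τ := c) (θ := fun _ => (t : ℝ)) le_rfl
    contMDiffAt_const (γ.continuousAt_proj t) hmem).1 h1
  rw [(h1.mdifferentiableAt (by simp)).mfderiv,
    ((h2.1.prodMk_space h2.2).mdifferentiableAt (by simp)).mfderiv]
  have h3 : ∀ᶠ δ in 𝓝 γ, extChartAt (coVelModel E r) (γ.path t) (δ.path t) =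
      (c.slice t (δ.path t).proj, c.covCoord t (δ.path t)) := by
    filter_upwards [(γ.continuousAt_proj t).eventually
      ((chartAt E (γ.path t).proj).open_source.mem_nhds (mem_chart_source E _))] with δ hδ
    rw [hc, ← TubeChart.inCoordinates_eq_covCoord _ _ _ hδ]
    exact hom_chart _ _
  have h4 : ∀ᶠ y in 𝓝 (extChartAt 𝓘(ℝ, CoPathModel E r k) γ γ),
      extChartAt (coVelModel E r) (γ.path t)
        (((extChartAt 𝓘(ℝ, CoPathModel E r k) γ).symm y).path t) =
      (c.slice t (((extChartAt 𝓘(ℝ, CoPathModel E r k) γ).symm y).path t).proj,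
        c.covCoord t (((extChartAt 𝓘(ℝ, CoPathModel E r k) γ).symm y).path t)) := by
    have : ContinuousAt (extChartAt 𝓘(ℝ, CoPathModel E r k) γ).symm
        (extChartAt 𝓘(ℝ, CoPathModel E r k) γ γ) := continuousAt_extChartAt_symm γ
    rw [ContinuousAt, extChartAt_to_inv] at this
    exact this.eventually h3
  refine Filter.EventuallyEq.fderivWithin_eq (h4.filter_mono nhdsWithin_le_nhds) h4.self_of_nhds

/-- Cotangent lifts are symplectic. With `g` the change of base coordinates and `K` the derivative
of its inverse, the lift is `(y, ζ) ↦ (g(y), ζ ∘ K(g(y)))`. The terms containing the derivative of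
`K` cancel because second derivatives are symmetric, and in the remaining ones `K` undoes the
derivative of `g`. -/
theorem symplectic_coTrans {τ τ' : TubeChart E M} {t : ℝ} {y : E} (h : (t, y) ∈ τ.transDom τ')
    (ζ : E →L[ℝ] (Fin r → ℝ)) (v w : E × (E →L[ℝ] (Fin r → ℝ))) :
    (fderiv ℝ (fun q => TubeChart.coTrans τ τ' r (t, q)) (y, ζ) w).2
        (fderiv ℝ (fun q => TubeChart.coTrans τ τ' r (t, q)) (y, ζ) v).1 -
      (fderiv ℝ (fun q => TubeChart.coTrans τ τ' r (t, q)) (y, ζ) v).2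
        (fderiv ℝ (fun q => TubeChart.coTrans τ τ' r (t, q)) (y, ζ) w).1 = w.2 v.1 - v.2 w.1 := by
  set G := τ.dtrans τ' (t, y)
  set z := τ.trans τ' (t, y)
  have hz : (t, z) ∈ τ'.transDom τ := TubeChart.trans_mem_transDom h
  have hK : HasFDerivAt (fun z => τ'.dtrans τ (t, z))
      (fderiv ℝ (fun z => τ'.dtrans τ (t, z)) z) z := by
    refine DifferentiableAt.hasFDerivAt ?_
    have h1 := (((τ'.contDiffOn_dtrans τ).contDiffAt
      ((τ'.isOpen_transDom τ).mem_nhds hz)).differentiableAt (by simp))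
    exact h1.comp z (hasFDerivAt_prodMk_right t z).differentiableAt
  set K' := fderiv ℝ (fun z => τ'.dtrans τ (t, z)) z
  have hsymm : ∀ a b, K' a b = K' b a := by
    intro a b
    refine second_derivative_symmetric_of_eventually (f := fun z => τ'.trans τ (t, z)) ?_ hK a b
    have : {z | (t, z) ∈ τ'.transDom τ} ∈ 𝓝 z :=
      ((τ'.isOpen_transDom τ).preimage (by fun_prop : Continuous fun z : E => (t, z))).mem_nhds hz
    filter_upwards [this] with z hz using TubeChart.hasFDerivAt_trans hz
  have hG : HasFDerivAt (fun q : E × (E →L[ℝ] (Fin r → ℝ)) => τ.trans τ' (t, q.1))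
      (G.comp (.fst ℝ _ _)) (y, ζ) :=
    HasFDerivAt.comp (g := fun y => τ.trans τ' (t, y)) (y, ζ) (TubeChart.hasFDerivAt_trans h)
      hasFDerivAt_fst
  have hKG : HasFDerivAt (fun q : E × (E →L[ℝ] (Fin r → ℝ)) =>
      τ'.dtrans τ (t, τ.trans τ' (t, q.1))) (K'.comp (G.comp (.fst ℝ _ _))) (y, ζ) :=
    HasFDerivAt.comp (g := fun z => τ'.dtrans τ (t, z)) (y, ζ) hK hG
  have hd := (hG.prodMk ((hasFDerivAt_snd (p := (y, ζ))).clm_comp hKG)).fderiv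
  have hd' : fderiv ℝ (fun q => TubeChart.coTrans τ τ' r (t, q)) (y, ζ) = _ := hd
  have hinv : ∀ a, τ'.dtrans τ (t, z) (G a) = a := fun a =>
    DFunLike.congr_fun (TubeChart.dtrans_comp h) a
  rw [hd']
  simp [hinv, hsymm (G v.1) (G w.1), z]

/-- The canonical form at time `t` is defined in the preferred chart at `X(t)`, which varies with
`t`. By invariance under cotangent lifts it may be computed in the one time-dependent chart, where
its coefficients no longer depend on the path. -/
theorem TubeChart.pathForm_eq (τ : TubeChart E M) {γ : CoPath E M r k} (hγ : γ ∈ τ.coSource r k)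
    (v w : TangentSpace 𝓘(ℝ, CoPathModel E r k) γ) :
    pathForm γ v w = ∫ t : I,
      ((mfderiv 𝓘(ℝ, CoPathModel E r k) 𝓘(ℝ, CoPathModel E r k) (τ.coChart r k) γ w).2.eval t
        ((mfderiv 𝓘(ℝ, CoPathModel E r k) 𝓘(ℝ, CoPathModel E r k) (τ.coChart r k) γ v).1.eval t) -
      (mfderiv 𝓘(ℝ, CoPathModel E r k) 𝓘(ℝ, CoPathModel E r k) (τ.coChart r k) γ v).2.eval t
        ((mfderiv 𝓘(ℝ, CoPathModel E r k) 𝓘(ℝ, CoPathModel E r k) (τ.coChart r k) γ w).1.eval t)) := by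
  refine integral_congr_ae (Filter.Eventually.of_forall fun t => ?_)
  simp only []
  set D := mfderiv 𝓘(ℝ, CoPathModel E r k) 𝓘(ℝ, CoPathModel E r k) (τ.coChart r k) γ
  set c := TubeChart.const E (γ.path t).proj with hc
  have hmem : ((t : ℝ), (γ.path t).proj) ∈ c.toHomeo.source :=
    TubeChart.mem_const_source.2 (mem_chart_source E _)
  have hdom : ((t : ℝ), (τ.coChart r k γ).1.eval t) ∈ τ.transDom c := by
    rw [τ.coChart_apply, (τ.coCoord_eval hγ t).1]
    exact slice_mem_transDom (hγ t) hmem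
  let g : E × (E →L[ℝ] (Fin r → ℝ)) → E × (E →L[ℝ] (Fin r → ℝ)) := fun q => coTrans τ c r (t, q)
  let A := fderiv ℝ g (coEvalL t (τ.coChart r k γ))
  have hg : HasFDerivAt g A (coEvalL t (τ.coChart r k γ)) := by
    refine DifferentiableAt.hasFDerivAt ?_
    have h1 := (((contDiffOn_coTrans (r := r) τ c).contDiffAt
      ((isOpen_coTransDom τ c).mem_nhds
        (x := ((t : ℝ), coEvalL t (τ.coChart r k γ))) hdom)).differentiableAt (by simp))
    exact h1.comp _ (hasFDerivAt_prodMk_right (t : ℝ) _).differentiableAt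
  have hD : HasMFDerivAt 𝓘(ℝ, CoPathModel E r k) 𝓘(ℝ, CoPathModel E r k) (τ.coChart r k) γ D :=
    ((τ.contMDiffAt_coChart hγ).mdifferentiableAt (by simp)).hasMFDerivAt
  have h1 := (hg.hasMFDerivAt).comp γ ((coEvalL (E := E) (r := r) (k := k) t).hasMFDerivAt.comp γ hD)
  have h2 := h1.congr_of_eventuallyEq (f₁ := fun δ : CoPath E M r k =>
      (c.slice t (δ.path t).proj, c.covCoord t (δ.path t))) (by
    filter_upwards [τ.coCoord_eventually hγ t,
      (γ.continuousAt_proj t).eventually ((c.toHomeo.open_source.preimage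
        (by fun_prop : Continuous fun x : M => ((t : ℝ), x))).mem_nhds hmem)] with δ hδ hδ'
    change _ = coTrans τ c r (t, ((τ.coChart r k δ).1.eval t, (τ.coChart r k δ).2.eval t))
    rw [hδ.2.1, hδ.2.2, coTrans_eq (slice_mem_transDom hδ.1 hδ'), τ.covOf_covCoord hδ.1])
  have h3 := (γ.mfderiv_eval t).trans h2.mfderiv
  have h4 : ∀ v, (mfderiv 𝓘(ℝ, CoPathModel E r k) (coVelModel E r)
      (fun δ : CoPath E M r k => δ.path t) γ v : E × (E →L[ℝ] (Fin r → ℝ))) =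
      A (coEvalL t (D v)) := fun v => DFunLike.congr_fun h3 v
  have h5 := symplectic_coTrans hdom ((τ.coChart r k γ).2.eval t) (coEvalL t (D v))
    (coEvalL t (D w))
  change (mfderiv 𝓘(ℝ, CoPathModel E r k) (coVelModel E r)
      (fun δ : CoPath E M r k => δ.path t) γ w : E × (E →L[ℝ] (Fin r → ℝ))).2
      (mfderiv 𝓘(ℝ, CoPathModel E r k) (coVelModel E r)
      (fun δ : CoPath E M r k => δ.path t) γ v : E × (E →L[ℝ] (Fin r → ℝ))).1 -
      (mfderiv 𝓘(ℝ, CoPathModel E r k) (coVelModel E r)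
      (fun δ : CoPath E M r k => δ.path t) γ v : E × (E →L[ℝ] (Fin r → ℝ))).2
      (mfderiv 𝓘(ℝ, CoPathModel E r k) (coVelModel E r)
      (fun δ : CoPath E M r k => δ.path t) γ w : E × (E →L[ℝ] (Fin r → ℝ))).1 = _
  rw [h4, h4]
  exact h5

end PathSpace

/-! ### The bracket of one-forms in coordinates -/

section Bracket

variable {E : Type*} [NormedAddCommGroup E] [NormedSpace ℝ E]
  {W : Type*} [NormedAddCommGroup W] [NormedSpace ℝ W]

/-- The coordinate expression `ℒ_V γ - i_U dη` of the bracket of two one-forms `η` and `γ` with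
anchors `V` and `U`. -/
def coordBracket (V U : E → E) (η γ : E → E →L[ℝ] W) (z : E) : E →L[ℝ] W :=
  fderiv ℝ γ z (V z) + (γ z).comp (fderiv ℝ V z) -
    (fderiv ℝ η z (U z) - (fderiv ℝ η z).flip (U z))

theorem coordBracket_apply (V U : E → E) (η γ : E → E →L[ℝ] W) (z h : E) :
    coordBracket V U η γ z h = fderiv ℝ γ z (V z) h + γ z (fderiv ℝ V z h) -
      (fderiv ℝ η z (U z) h - fderiv ℝ η z h (U z)) := rfl

/-- The anchor `U` of the second form enters undifferentiated, so for it equality at the point is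
enough, whereas the other data must agree as germs. -/
theorem coordBracket_congr {V V' U U' : E → E} {η η' γ γ' : E → E →L[ℝ] W} {z : E}
    (hV : V' =ᶠ[𝓝 z] V) (hU : U' z = U z) (hη : η' =ᶠ[𝓝 z] η) (hγ : γ' =ᶠ[𝓝 z] γ) :
    coordBracket V' U' η' γ' z = coordBracket V U η γ z := by
  simp only [coordBracket, hV.fderiv_eq, hη.fderiv_eq, hγ.fderiv_eq, hV.self_of_nhds,
    hγ.self_of_nhds, hU]

set_option synthInstance.maxHeartbeats 400000 in
theorem ContDiffOn.coordBracket {V U : E → E} {η γ : E → E →L[ℝ] W} {N : Set E} (hN : IsOpen N)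
    (hV : ContDiffOn ℝ ∞ V N) (hU : ContDiffOn ℝ ∞ U N) (hη : ContDiffOn ℝ ∞ η N)
    (hγ : ContDiffOn ℝ ∞ γ N) : ContDiffOn ℝ ∞ (coordBracket V U η γ) N := by
  have h1 := hγ.fderiv_of_isOpen (m := ∞) hN (by simp)
  have h2 := hV.fderiv_of_isOpen (m := ∞) hN (by simp)
  have h3 := hη.fderiv_of_isOpen (m := ∞) hN (by simp)
  have h5 : ContDiffOn ℝ ∞ (fun z => ContinuousLinearMap.apply ℝ W (U z)) N :=
    contDiffOn_const.clm_apply hU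
  have h4 : ContDiffOn ℝ ∞ (fun z => (ContinuousLinearMap.apply ℝ W (U z)).comp (fderiv ℝ η z)) N :=
    h5.clm_comp h3
  exact ((h1.clm_apply hV).add (hγ.clm_comp h2)).sub ((h3.clm_apply hU).sub h4)

/-- The derivative of a pulled back one-form. -/
theorem fderiv_pullback_apply {g : E → E} {γ γ' : E → E →L[ℝ] W} {z : E}
    (hg : ContDiffAt ℝ ∞ g z) (hγ : γ =ᶠ[𝓝 z] fun z => (γ' (g z)).comp (fderiv ℝ g z))
    (hγ' : DifferentiableAt ℝ γ' (g z)) (v h : E) :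
    fderiv ℝ γ z v h = fderiv ℝ γ' (g z) (fderiv ℝ g z v) (fderiv ℝ g z h) +
      γ' (g z) (fderiv ℝ (fderiv ℝ g) z v h) := by
  have h1 : DifferentiableAt ℝ g z := hg.differentiableAt (by simp)
  have h2 : DifferentiableAt ℝ (fderiv ℝ g) z :=
    (hg.fderiv_right (m := ∞) (by simp)).differentiableAt (by simp)
  have h3 := (hγ'.hasFDerivAt.comp z h1.hasFDerivAt).clm_comp h2.hasFDerivAt
  rw [(h3.congr_of_eventuallyEq hγ).fderiv]
  simp [add_comm]

theorem second_derivative_comm {g : E → E} {z : E} (hg : ContDiffAt ℝ ∞ g z) (v h : E) :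
    fderiv ℝ (fderiv ℝ g) z v h = fderiv ℝ (fderiv ℝ g) z h v :=
  (hg.isSymmSndFDerivAt (by simp only [minSmoothness_of_isRCLikeNormedField];
                            exact ENat.LEInfty.out)).eq v h

/-- The derivatives of two vector fields that are related by a map. -/
theorem fderiv_related {g : E → E} {V V' : E → E} {z : E} (hg : ContDiffAt ℝ ∞ g z)
    (hV : (fun z => fderiv ℝ g z (V z)) =ᶠ[𝓝 z] fun z => V' (g z))
    (hVd : DifferentiableAt ℝ V z) (hVd' : DifferentiableAt ℝ V' (g z)) (h : E) :
    fderiv ℝ (fderiv ℝ g) z h (V z) + fderiv ℝ g z (fderiv ℝ V z h) =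
      fderiv ℝ V' (g z) (fderiv ℝ g z h) := by
  have h1 : DifferentiableAt ℝ g z := hg.differentiableAt (by simp)
  have h2 : DifferentiableAt ℝ (fderiv ℝ g) z :=
    (hg.fderiv_right (m := ∞) (by simp)).differentiableAt (by simp)
  have h3 := h2.hasFDerivAt.clm_apply hVd.hasFDerivAt
  have h4 := (hVd'.hasFDerivAt.comp z h1.hasFDerivAt).congr_of_eventuallyEq hV
  have := DFunLike.congr_fun (h3.unique h4) h
  simpa [add_comm] using this

/-- The bracket is natural. -/
theorem coordBracket_pullback {g : E → E} {V V' U U' : E → E} {η η' γ γ' : E → E →L[ℝ] W} {z : E}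
    (hg : ContDiffAt ℝ ∞ g z)
    (hV : (fun z => fderiv ℝ g z (V z)) =ᶠ[𝓝 z] fun z => V' (g z))
    (hU : fderiv ℝ g z (U z) = U' (g z))
    (hη : η =ᶠ[𝓝 z] fun z => (η' (g z)).comp (fderiv ℝ g z))
    (hγ : γ =ᶠ[𝓝 z] fun z => (γ' (g z)).comp (fderiv ℝ g z))
    (hVd : DifferentiableAt ℝ V z) (hVd' : DifferentiableAt ℝ V' (g z))
    (hη' : DifferentiableAt ℝ η' (g z)) (hγ' : DifferentiableAt ℝ γ' (g z)) :
    coordBracket V U η γ z = (coordBracket V' U' η' γ' (g z)).comp (fderiv ℝ g z) := by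
  ext h
  have e1 := fderiv_related hg hV hVd hVd' h
  have e2 := congrArg (γ' (g z)) e1
  rw [map_add] at e2
  have e3 : fderiv ℝ g z (V z) = V' (g z) := hV.self_of_nhds
  rw [ContinuousLinearMap.comp_apply, coordBracket_apply, coordBracket_apply,
    fderiv_pullback_apply hg hγ hγ', fderiv_pullback_apply hg hη hη',
    fderiv_pullback_apply hg hη hη', hγ.self_of_nhds, ContinuousLinearMap.comp_apply, hU, e3,
    ← e2, second_derivative_comm hg h (V z), second_derivative_comm hg h (U z)]
  abel

/-- The Leibniz rule. -/
theorem coordBracket_smul {V U : E → E} {η γ : E → E →L[ℝ] W} {f : E → ℝ} {z : E}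
    (hf : DifferentiableAt ℝ f z) (hγ : DifferentiableAt ℝ γ z) :
    coordBracket V (fun z => f z • U z) η (fun z => f z • γ z) z =
      f z • coordBracket V U η γ z + fderiv ℝ f z (V z) • γ z := by
  ext h
  have e : fderiv ℝ (fun z => f z • γ z) z = _ := (hf.hasFDerivAt.smul hγ.hasFDerivAt).fderiv
  simp only [coordBracket_apply, e, map_smul, add_apply,
    smul_apply, ContinuousLinearMap.smulRight_apply]
  module

theorem coordBracket_add {V U U' : E → E} {η γ γ' : E → E →L[ℝ] W} {z : E}
    (hγ : DifferentiableAt ℝ γ z) (hγ' : DifferentiableAt ℝ γ' z) :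
    coordBracket V (fun z => U z + U' z) η (fun z => γ z + γ' z) z =
      coordBracket V U η γ z + coordBracket V U' η γ' z := by
  ext h
  have e : fderiv ℝ (fun z => γ z + γ' z) z = _ := (hγ.hasFDerivAt.add hγ'.hasFDerivAt).fderiv
  simp only [coordBracket_apply, e, map_add, add_apply]
  abel

/-- The bracket is antisymmetric on forms that satisfy the contraction identity. -/
theorem coordBracket_antisymm {V U : E → E} {η γ : E → E →L[ℝ] W} {z : E}
    (hV : DifferentiableAt ℝ V z) (hU : DifferentiableAt ℝ U z) (hη : DifferentiableAt ℝ η z)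
    (hγ : DifferentiableAt ℝ γ z) (h : (fun z => γ z (V z) + η z (U z)) =ᶠ[𝓝 z] fun _ => 0) :
    coordBracket U V γ η z = -coordBracket V U η γ z := by
  ext x
  -- The sum of the two brackets is the differential of `γ(V) + η(U)`, which vanishes near `z`.
  have h1 := (hγ.hasFDerivAt.clm_apply hV.hasFDerivAt).add
    (hη.hasFDerivAt.clm_apply hU.hasFDerivAt)
  have h2 := h1.unique ((hasFDerivAt_const (0 : W) z).congr_of_eventuallyEq h)
  have h3 := DFunLike.congr_fun h2 x
  simp only [add_apply, ContinuousLinearMap.comp_apply,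
    ContinuousLinearMap.flip_apply, zero_apply] at h3
  rw [neg_apply, coordBracket_apply, coordBracket_apply, eq_neg_iff_add_eq_zero,
    ← h3]
  abel

end Bracket

section Fields

variable {E : Type u} [NormedAddCommGroup E] [NormedSpace ℝ E]
  {M : Type v} [TopologicalSpace M] [ChartedSpace E M] [IsManifold 𝓘(ℝ, E) ∞ M] {r : ℕ}

/-! ### Forms and vector fields in time-dependent charts -/

namespace TubeChart

/-- A form in a time-dependent chart. -/
def formIn (τ : TubeChart E M) (α : ∀ x : M, CoVel E M r x) (p : ℝ × E) : E →L[ℝ] (Fin r → ℝ) :=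
  τ.covCoord p.1 ⟨τ.inv p.1 p.2, α (τ.inv p.1 p.2)⟩

/-- A vector field in a time-dependent chart. -/
def fieldIn (τ : TubeChart E M) (V : ∀ x : M, TangentSpace 𝓘(ℝ, E) x) (p : ℝ × E) : E :=
  τ.dslice p.1 (τ.inv p.1 p.2) (V (τ.inv p.1 p.2))

/-- The base point is kept as a free variable because fibres over `x` and over `τ.inv t y` are
different spaces until the two points are identified. -/
theorem formIn_of_inv_eq (τ : TubeChart E M) {t : ℝ} {y : E} {x : M} (h : τ.inv t y = x)
    (α : ∀ x : M, CoVel E M r x) : τ.formIn α (t, y) = τ.covCoord t ⟨x, α x⟩ := by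
  subst h; rfl

theorem fieldIn_of_inv_eq (τ : TubeChart E M) {t : ℝ} {y : E} {x : M} (h : τ.inv t y = x)
    (V : ∀ x : M, TangentSpace 𝓘(ℝ, E) x) : τ.fieldIn V (t, y) = τ.dslice t x (V x) := by
  subst h; rfl

theorem isOpen_inv_preimage (τ : TubeChart E M) {U : Set M} (hU : IsOpen U) :
    IsOpen {p | p ∈ τ.toHomeo.target ∧ τ.inv p.1 p.2 ∈ U} :=
  τ.toHomeo.isOpen_inter_preimage_symm (hU.preimage continuous_snd)

theorem contMDiffAt_inv_prod (τ : TubeChart E M) {p : ℝ × E} (hp : p ∈ τ.toHomeo.target) :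
    ContMDiffAt 𝓘(ℝ, ℝ × E) 𝓘(ℝ, E) ∞ (fun p : ℝ × E => τ.inv p.1 p.2) p :=
  contMDiffAt_snd.comp p (τ.smooth_symm.contMDiffAt (τ.toHomeo.open_target.mem_nhds hp))

theorem contDiffOn_formIn (τ : TubeChart E M) {α : ∀ x : M, CoVel E M r x} {U : Set M}
    (hU : IsOpen U) (hα : SmoothFormOn α U) :
    ContDiffOn ℝ ∞ (τ.formIn α) {p | p ∈ τ.toHomeo.target ∧ τ.inv p.1 p.2 ∈ U} := by
  rintro p ⟨hp, hpU⟩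
  have h1 := (hα.contMDiffAt (hU.mem_nhds hpU)).comp p (τ.contMDiffAt_inv_prod hp)
  have h2 := (contMDiffAt_iff_covCoord (τ := τ) (θ := fun p : ℝ × E => p.1) le_rfl
    contDiff_fst.contMDiff.contMDiffAt (τ.contMDiffAt_inv_prod hp).continuousAt
    (τ.mem_source hp)).1 h1
  exact (contMDiffAt_iff_contDiffAt.1 h2.2).contDiffWithinAt

theorem smoothFormOn_of_formIn (τ : TubeChart E M) {t : ℝ} {α : ∀ x : M, CoVel E M r x} {x : M}
    (hx : (t, x) ∈ τ.toHomeo.source)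
    (h : ContDiffAt ℝ ∞ (fun z => τ.formIn α (t, z)) (τ.slice t x)) :
    ContMDiffAt 𝓘(ℝ, E) (coVelModel E r) ∞
      (fun x => (TotalSpace.mk' (E →L[ℝ] (Fin r → ℝ)) x (α x) : CoVelSpace E M r)) x := by
  refine (contMDiffAt_iff_covCoord (τ := τ) (θ := fun _ => t) le_rfl contMDiffAt_const
    continuousAt_id hx).2 ⟨τ.contMDiffAt_slice hx, ?_⟩
  refine (h.comp_contMDiffAt (τ.contMDiffAt_slice hx)).congr_of_eventuallyEq ?_
  have : {x | (t, x) ∈ τ.toHomeo.source} ∈ 𝓝 x :=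
    (τ.toHomeo.open_source.preimage (by fun_prop : Continuous fun x : M => (t, x))).mem_nhds hx
  filter_upwards [this] with x' hx'
  change _ = τ.covCoord t ⟨τ.inv t (τ.slice t x'), α (τ.inv t (τ.slice t x'))⟩
  rw [τ.inv_slice hx']

theorem formIn_trans {τ τ' : TubeChart E M} {t : ℝ} {y : E} (h : (t, y) ∈ τ.transDom τ')
    (α : ∀ x : M, CoVel E M r x) :
    τ.formIn α (t, y) = (τ'.formIn α (t, τ.trans τ' (t, y))).comp (τ.dtrans τ' (t, y)) := by
  obtain ⟨h1, h2⟩ := mem_transDom.1 h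
  have h3 := covCoord_trans (p := ⟨τ.inv t y, α (τ.inv t y)⟩) (τ.mem_source h1) h2
  simp only [τ.slice_inv h1] at h3
  rw [formIn, ← h3, τ'.formIn_of_inv_eq (x := τ.inv t y) (by rw [trans, τ'.inv_slice h2])]

theorem fieldIn_trans {τ τ' : TubeChart E M} {t : ℝ} {y : E} (h : (t, y) ∈ τ.transDom τ')
    (V : ∀ x : M, TangentSpace 𝓘(ℝ, E) x) :
    τ'.fieldIn V (t, τ.trans τ' (t, y)) = τ.dtrans τ' (t, y) (τ.fieldIn V (t, y)) := by
  obtain ⟨h1, h2⟩ := mem_transDom.1 h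
  have h3 := dslice_eq (τ.mem_source h1) h2
  rw [τ.slice_inv h1] at h3
  rw [τ'.fieldIn_of_inv_eq (x := τ.inv t y) (by rw [trans, τ'.inv_slice h2]), h3]
  rfl

theorem contDiffOn_fieldIn_const (x₀ : M) {V : ∀ x : M, TangentSpace 𝓘(ℝ, E) x} {U : Set M}
    (hU : IsOpen U) (hV : SmoothFieldOn V U) :
    ContDiffOn ℝ ∞ ((const E x₀).fieldIn V)
      {p | p ∈ (const E x₀).toHomeo.target ∧ (const E x₀).inv p.1 p.2 ∈ U} := by
  rintro p ⟨hp, hpU⟩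
  have h1 := (hV.contMDiffAt (hU.mem_nhds hpU)).comp p ((const E x₀).contMDiffAt_inv_prod hp)
  have hs : (const E x₀).inv p.1 p.2 ∈ (chartAt E x₀).source :=
    mem_const_source.1 ((const E x₀).mem_source hp)
  have h2 := ((trivializationAt E (TangentSpace 𝓘(ℝ, E)) x₀).contMDiffAt_iff (by
    simpa using hs)).1 h1
  refine ((contMDiffAt_iff_contDiffAt.1 h2.2).congr_of_eventuallyEq ?_).contDiffWithinAt
  filter_upwards [(const E x₀).toHomeo.open_target.mem_nhds hp] with q hq
  have hq' : (const E x₀).inv q.1 q.2 ∈ (chartAt E x₀).source :=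
    mem_const_source.1 ((const E x₀).mem_source hq)
  have h3 : (trivializationAt E (TangentSpace 𝓘(ℝ, E)) x₀).continuousLinearMapAt ℝ
      ((const E x₀).inv q.1 q.2) =
      mfderiv 𝓘(ℝ, E) 𝓘(ℝ, E) (extChartAt 𝓘(ℝ, E) x₀) ((const E x₀).inv q.1 q.2) :=
    TangentBundle.continuousLinearMapAt_trivializationAt hq'
  have h4 := DFunLike.congr_fun h3 (V ((const E x₀).inv q.1 q.2))
  refine h4.symm.trans ?_
  rw [Trivialization.continuousLinearMapAt_apply, Trivialization.coe_linearMapAt_of_mem]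
  · rfl
  · simpa using hq'

/-- The expression of the field in the chart `τ` arises from its expression in an ordinary chart at
the point by applying the derivative of the coordinate change, which is smooth in time and space. -/
theorem contDiffOn_fieldIn (τ : TubeChart E M) {V : ∀ x : M, TangentSpace 𝓘(ℝ, E) x} {U : Set M}
    (hU : IsOpen U) (hV : SmoothFieldOn V U) :
    ContDiffOn ℝ ∞ (τ.fieldIn V) {p | p ∈ τ.toHomeo.target ∧ τ.inv p.1 p.2 ∈ U} := by
  rintro ⟨t, y⟩ ⟨hp, hpU⟩
  set c := const E (τ.inv t y)
  have hdom : (t, y) ∈ τ.transDom c :=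
    mem_transDom.2 ⟨hp, mem_const_source.2 (mem_chart_source E _)⟩
  have hdom' := trans_mem_transDom hdom
  have hg := (τ.contDiffOn_trans c).contDiffAt ((τ.isOpen_transDom c).mem_nhds hdom)
  have hd : ContDiffAt ℝ ∞ (c.dtrans τ) (t, τ.trans c (t, y)) :=
    (c.contDiffOn_dtrans τ).contDiffAt ((c.isOpen_transDom τ).mem_nhds hdom')
  have hpair : ContDiffAt ℝ ∞ (fun p : ℝ × E => (p.1, τ.trans c p)) (t, y) :=
    contDiffAt_fst.prodMk hg
  have hf : ContDiffAt ℝ ∞ (c.fieldIn V) (t, τ.trans c (t, y)) := by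
    refine (contDiffOn_fieldIn_const _ hU hV).contDiffAt ((isOpen_inv_preimage _ hU).mem_nhds ?_)
    refine ⟨(mem_transDom.1 hdom').1, ?_⟩
    change c.inv t (τ.trans c (t, y)) ∈ U
    rw [trans, c.inv_slice (mem_transDom.1 hdom).2]
    exact hpU
  have h1 := (hd.comp (t, y) hpair).clm_apply (hf.comp (t, y) hpair)
  refine (h1.congr_of_eventuallyEq ?_).contDiffWithinAt
  filter_upwards [(τ.isOpen_transDom c).mem_nhds hdom] with q hq
  have h2 := fieldIn_trans (t := q.1) (y := τ.trans c q) (trans_mem_transDom hq) V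
  rw [trans_trans (t := q.1) (y := q.2) hq] at h2
  exact h2

end TubeChart

theorem formInChart_eq (x₀ : M) (α : ∀ x : M, CoVel E M r x) {z : E}
    (hz : z ∈ (chartAt E x₀).target) :
    formInChart x₀ α z = (TubeChart.const E x₀).formIn α (0, z) := by
  have h : (TubeChart.const E x₀).slice 0 ((chartAt E x₀).symm z) = z := (chartAt E x₀).right_inv hz
  change _ = ContinuousLinearMap.comp _ ((TubeChart.const E x₀).dinv 0
    ((TubeChart.const E x₀).slice 0 ((chartAt E x₀).symm z)))
  rw [h]
  rfl

/-! ### The subbundle and the anchor in time-dependent charts -/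

section Coord

variable (S : ∀ x : M, Submodule ℝ (CoVel E M r x)) (P : ∀ x : M, S x →ₗ[ℝ] TangentSpace 𝓘(ℝ, E) x)

/-- The pullback of covectors by a time-dependent chart. -/
def TubeChart.pullCov (τ : TubeChart E M) (p : ℝ × E) :
    (E →L[ℝ] (Fin r → ℝ)) →ₗ[ℝ] CoVel E M r (τ.inv p.1 p.2) where
  toFun ζ := (τ.covOf p.1 p.2 ζ).2
  map_add' _ _ := ContinuousLinearMap.add_comp _ _ _
  map_smul' _ _ := ContinuousLinearMap.smul_comp _ _ _

/-- The subbundle in a time-dependent chart. -/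
def sCoord (τ : TubeChart E M) (p : ℝ × E) : Submodule ℝ (E →L[ℝ] (Fin r → ℝ)) :=
  (S (τ.inv p.1 p.2)).comap (τ.pullCov p)

variable {S} in
/-- The anchor in a time-dependent chart. -/
def aCoord (τ : TubeChart E M) (p : ℝ × E) : sCoord S τ p →ₗ[ℝ] E :=
  (τ.dslice p.1 (τ.inv p.1 p.2)).toLinearMap ∘ₗ P (τ.inv p.1 p.2) ∘ₗ
    (τ.pullCov p).restrict fun _ h => h

variable {S P}

theorem mem_sCoord_of_inv_eq {τ : TubeChart E M} {t : ℝ} {y : E} {x : M} (h : τ.inv t y = x)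
    {ζ : E →L[ℝ] (Fin r → ℝ)} : ζ ∈ sCoord S τ (t, y) ↔
      (show CoVel E M r x from (ζ.comp (τ.dslice t x) : E →L[ℝ] (Fin r → ℝ))) ∈ S x := by
  subst h; rfl

theorem aCoord_of_inv_eq {τ : TubeChart E M} {t : ℝ} {y : E} {x : M} (h : τ.inv t y = x)
    {ζ : E →L[ℝ] (Fin r → ℝ)} (hζ : ζ ∈ sCoord S τ (t, y)) :
    aCoord P τ (t, y) ⟨ζ, hζ⟩ = τ.dslice t x (P x ⟨show CoVel E M r x from
      (ζ.comp (τ.dslice t x) : E →L[ℝ] (Fin r → ℝ)), (mem_sCoord_of_inv_eq h).1 hζ⟩) := by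
  subst h; rfl

theorem covOf_formIn {τ : TubeChart E M} {p : ℝ × E} (hp : p ∈ τ.toHomeo.target)
    (α : ∀ x : M, CoVel E M r x) :
    (τ.covOf p.1 p.2 (τ.formIn α p)).2 = α (τ.inv p.1 p.2) :=
  τ.covCoord_comp_dslice (p := ⟨τ.inv p.1 p.2, α (τ.inv p.1 p.2)⟩) (τ.mem_source hp)

theorem formIn_mem_sCoord {τ : TubeChart E M} {p : ℝ × E} (hp : p ∈ τ.toHomeo.target)
    {α : ∀ x : M, CoVel E M r x} (hα : α (τ.inv p.1 p.2) ∈ S (τ.inv p.1 p.2)) :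
    τ.formIn α p ∈ sCoord S τ p := by
  change (τ.covOf p.1 p.2 (τ.formIn α p)).2 ∈ S _
  rw [covOf_formIn hp]
  exact hα

theorem aCoord_formIn {τ : TubeChart E M} {p : ℝ × E} (hp : p ∈ τ.toHomeo.target)
    (η : ∀ x : M, S x) (h : τ.formIn (fun x => (η x).1) p ∈ sCoord S τ p) :
    aCoord P τ p ⟨τ.formIn (fun x => (η x).1) p, h⟩ = τ.fieldIn (fun x => P x (η x)) p := by
  refine congrArg (fun ζ => τ.dslice p.1 (τ.inv p.1 p.2) (P (τ.inv p.1 p.2) ζ)) (Subtype.ext ?_)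
  exact covOf_formIn hp _

theorem formIn_eq_of_covOf {τ : TubeChart E M} {p : ℝ × E} (hp : p ∈ τ.toHomeo.target)
    {α : ∀ x : M, CoVel E M r x} {ζ : E →L[ℝ] (Fin r → ℝ)}
    (h : α (τ.inv p.1 p.2) = (τ.covOf p.1 p.2 ζ).2) : τ.formIn α p = ζ := by
  rw [TubeChart.formIn, h]
  exact τ.covCoord_covOf hp ζ

/-- Local sections of the subbundle extend to global ones. -/
theorem exists_section_extension [FiniteDimensional ℝ E] [T2Space M] (x₀ : M)
    {κ : E → E →L[ℝ] (Fin r → ℝ)} {N : Set E} (hN : IsOpen N) (hz : chartAt E x₀ x₀ ∈ N)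
    (hκ : ContDiffOn ℝ ∞ κ N) (hS : ∀ z ∈ N, κ z ∈ sCoord S (TubeChart.const E x₀) (0, z)) :
    ∃ η : ∀ x : M, S x, IsSmoothSection S η ∧
      ∀ᶠ z in 𝓝 (chartAt E x₀ x₀), formInChart x₀ (fun x => (η x).1) z = κ z := by
  classical
  set φ := chartAt E x₀
  set c := TubeChart.const E x₀ with hc
  let O : Set M := φ.source ∩ φ ⁻¹' N
  have hO : IsOpen O := φ.isOpen_inter_preimage hN
  have hxO : x₀ ∈ O := ⟨mem_chart_source E x₀, hz⟩
  -- A bump function at `x₀` with support in `O` cuts the local section off. As it equals `1` near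
  -- `x₀`, the germ there is unchanged.
  obtain ⟨f, -, hf⟩ := (show (𝓝 x₀).HasBasis (fun _ : SmoothBumpFunction 𝓘(ℝ, E) x₀ => True)
    fun f => tsupport f from SmoothBumpFunction.nhds_basis_tsupport x₀).mem_iff.1
    (hO.mem_nhds hxO)
  have hmem : ∀ x (hx : x ∈ O), (show CoVel E M r x from
      ((κ (φ x)).comp (c.dslice 0 x) : E →L[ℝ] (Fin r → ℝ))) ∈ S x := fun x hx =>
    (mem_sCoord_of_inv_eq (τ := c) (t := 0) (y := φ x) (φ.left_inv hx.1)).1 (hS _ hx.2)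
  let η : ∀ x : M, S x := fun x => if hx : x ∈ O then f x • ⟨_, hmem x hx⟩ else 0
  have hη : ∀ z ∈ φ.target ∩ N, c.formIn (fun x => (η x).1) (0, z) = f (φ.symm z) • κ z := by
    rintro z ⟨hz1, hz2⟩
    have hx : φ.symm z ∈ O := ⟨φ.map_target hz1, by rw [mem_preimage, φ.right_inv hz1]; exact hz2⟩
    have htar : ((0 : ℝ), z) ∈ c.toHomeo.target := ⟨mem_univ _, hz1⟩
    refine formIn_eq_of_covOf htar ?_
    change (η (φ.symm z)).1 = _
    simp only [η, dif_pos hx]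
    change f (φ.symm z) • ((κ (φ (φ.symm z))).comp (c.dslice 0 (φ.symm z))) =
      (f (φ.symm z) • κ z).comp (c.dslice 0 (φ.symm z))
    rw [φ.right_inv hz1]
    rfl
  have hfs : ContMDiff 𝓘(ℝ, E) 𝓘(ℝ) ∞ f := f.contMDiff
  refine ⟨η, fun x _ => ContMDiffAt.contMDiffWithinAt ?_, ?_⟩
  · by_cases hx : x ∈ O
    · have hxt : φ x ∈ φ.target := φ.map_source hx.1
      refine c.smoothFormOn_of_formIn (t := 0) (TubeChart.mem_const_source.2 hx.1) ?_
      have h1 : ContDiffAt ℝ ∞ (fun z => f (φ.symm z) • κ z) (φ x) := by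
        have h0 : ContDiffAt ℝ ∞ (fun z => f (φ.symm z)) (φ x) := by
          rw [← contMDiffAt_iff_contDiffAt]
          exact hfs.contMDiffAt.comp _ (contMDiffAt_symm_of_mem_maximalAtlas
            (IsManifold.chart_mem_maximalAtlas x₀) hxt)
        exact h0.smul (hκ.contDiffAt (hN.mem_nhds hx.2))
      refine h1.congr_of_eventuallyEq ?_
      filter_upwards [(φ.open_target.inter hN).mem_nhds ⟨hxt, hx.2⟩] with z hz using hη z hz
    -- Outside `O`, hence off the closed support of the bump function, the extension vanishes in a
    -- neighbourhood, so smoothness needs no information on `κ`.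
    · have hx' : x ∉ tsupport f := fun h => hx (hf h)
      have hev : ∀ᶠ x' in 𝓝 x, (η x').1 = 0 := by
        filter_upwards [(isClosed_tsupport f).isOpen_compl.mem_nhds hx'] with x' hx'
        have : f x' = 0 := image_eq_zero_of_notMem_tsupport hx'
        by_cases h : x' ∈ O
        · simp only [η, dif_pos h, this, zero_smul]
          rfl
        · simp only [η, dif_neg h]
          rfl
      have hxs : ((0 : ℝ), x) ∈ (TubeChart.const E x).toHomeo.source :=
        TubeChart.mem_const_source.2 (mem_chart_source E x)
      refine (TubeChart.const E x).smoothFormOn_of_formIn (t := 0) hxs ?_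
      refine (contDiffAt_const (c := (0 : E →L[ℝ] (Fin r → ℝ)))).congr_of_eventuallyEq ?_
      have h3 := ((TubeChart.const E x).contMDiffAt_inv
        ((TubeChart.const E x).mem_target hxs)).continuousAt
      rw [ContinuousAt, TubeChart.inv_slice _ hxs] at h3
      filter_upwards [h3.eventually hev] with z hz
      change ContinuousLinearMap.comp (show E →L[ℝ] (Fin r → ℝ) from
        (η ((TubeChart.const E x).inv 0 z)).1) _ = 0
      rw [hz]
      exact ContinuousLinearMap.zero_comp _
  · have h1 : ContinuousAt φ.symm (φ x₀) := φ.continuousAt_symm (φ.map_source hxO.1)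
    rw [ContinuousAt, φ.left_inv hxO.1] at h1
    filter_upwards [h1.eventually f.eventuallyEq_one,
      (φ.open_target.inter hN).mem_nhds ⟨φ.map_source hxO.1, hz⟩] with z hz1 hz2
    rw [formInChart_eq x₀ _ hz2.1, hη z hz2, hz1, Pi.one_apply, one_smul]

end Coord

end Fields

section Graph

variable {E : Type u} [NormedAddCommGroup E] [NormedSpace ℝ E]
  {M : Type v} [TopologicalSpace M] [ChartedSpace E M] [IsManifold 𝓘(ℝ, E) ∞ M] {r : ℕ}
  {S : ∀ x : M, Submodule ℝ (CoVel E M r x)} (P : ∀ x : M, S x →ₗ[ℝ] TangentSpace 𝓘(ℝ, E) x)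

/-! ### The graph of the anchor in time-dependent charts -/

/-- The graph of the anchor in a time-dependent chart. -/
def anchorGraph (τ : TubeChart E M) (p : ℝ × E) : Submodule ℝ ((E →L[ℝ] (Fin r → ℝ)) × E) :=
  LinearMap.range ((sCoord S τ p).subtype.prod (aCoord P τ p))

variable {P} {τ τ' : TubeChart E M}

theorem mem_anchorGraph {p : ℝ × E} {q : (E →L[ℝ] (Fin r → ℝ)) × E} :
    q ∈ anchorGraph P τ p ↔ ∃ h : q.1 ∈ sCoord S τ p, aCoord P τ p ⟨q.1, h⟩ = q.2 := by
  constructor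
  · rintro ⟨ζ, rfl⟩
    exact ⟨ζ.2, rfl⟩
  · rintro ⟨h, h'⟩
    exact ⟨⟨q.1, h⟩, Prod.ext rfl h'⟩

theorem mem_sCoord_iff {p : ℝ × E} {ζ : E →L[ℝ] (Fin r → ℝ)} :
    ζ ∈ sCoord S τ p ↔ ∃ v, (ζ, v) ∈ anchorGraph P τ p :=
  ⟨fun h => ⟨aCoord P τ p ⟨ζ, h⟩, mem_anchorGraph.2 ⟨h, rfl⟩⟩, fun ⟨_, h⟩ => (mem_anchorGraph.1 h).choose⟩

theorem mem_anchorGraph_of_inv_eq {t : ℝ} {y : E} {x : M} (h : τ.inv t y = x)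
    {ζ : E →L[ℝ] (Fin r → ℝ)} {v : E} : (ζ, v) ∈ anchorGraph P τ (t, y) ↔
      ∃ η : S x, (show E →L[ℝ] (Fin r → ℝ) from η.1) = ζ.comp (τ.dslice t x) ∧
        τ.dslice t x (P x η) = v := by
  rw [mem_anchorGraph]
  constructor
  · rintro ⟨h1, h2⟩
    refine ⟨⟨_, (mem_sCoord_of_inv_eq h).1 h1⟩, rfl, ?_⟩
    exact (aCoord_of_inv_eq h h1).symm.trans h2
  · rintro ⟨⟨η, hη⟩, h1, h2⟩
    change η = _ at h1
    subst h1
    refine ⟨(mem_sCoord_of_inv_eq h).2 hη, ?_⟩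
    exact (aCoord_of_inv_eq h ((mem_sCoord_of_inv_eq h).2 hη)).trans h2

theorem mem_anchorGraph_slice {t : ℝ} {x : M} (h : (t, x) ∈ τ.toHomeo.source) (η : S x) :
    (τ.covCoord t ⟨x, η.1⟩, τ.dslice t x (P x η)) ∈ anchorGraph P τ (t, τ.slice t x) :=
  (mem_anchorGraph_of_inv_eq (τ.inv_slice h)).2
    ⟨η, (τ.covCoord_comp_dslice (p := ⟨x, η.1⟩) h).symm, rfl⟩

theorem anchorGraph_unique {p : ℝ × E} {ζ : E →L[ℝ] (Fin r → ℝ)} {v w : E}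
    (hv : (ζ, v) ∈ anchorGraph P τ p) (hw : (ζ, w) ∈ anchorGraph P τ p) : v = w := by
  obtain ⟨h1, h3⟩ := mem_anchorGraph.1 hv
  obtain ⟨h2, h4⟩ := mem_anchorGraph.1 hw
  exact h3.symm.trans h4

theorem anchorGraph_contraction (hP : ∀ (x : M) (η : S x), η.1 (P x η) = 0) {p : ℝ × E}
    {ζ : E →L[ℝ] (Fin r → ℝ)} {v : E} (h : (ζ, v) ∈ anchorGraph P τ p) : ζ v = 0 := by
  obtain ⟨η, h1, h2⟩ := (mem_anchorGraph_of_inv_eq (t := p.1) (y := p.2) rfl).1 h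
  rw [← h2]
  exact (DFunLike.congr_fun h1 (P _ η)).symm.trans (hP _ η)

/-- The contraction identity is quadratic in the covector; this is its polarization, obtained by
expanding it on a sum. -/
theorem anchorGraph_polarized (hP : ∀ (x : M) (η : S x), η.1 (P x η) = 0) {p : ℝ × E}
    {ζ ζ' : E →L[ℝ] (Fin r → ℝ)} {v v' : E} (h : (ζ, v) ∈ anchorGraph P τ p)
    (h' : (ζ', v') ∈ anchorGraph P τ p) : ζ' v + ζ v' = 0 := by
  have h1 := anchorGraph_contraction hP (Submodule.add_mem _ h h')
  have h2 := anchorGraph_contraction hP h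
  have h3 := anchorGraph_contraction hP h'
  simp only [add_apply, map_add, h2, h3, zero_add, add_zero] at h1
  rwa [add_comm] at h1 ⊢

theorem anchorGraph_annihilator (hP : ∀ (x : M) (v : TangentSpace 𝓘(ℝ, E) x),
    (∀ η : S x, η.1 v = 0) → v = 0) {p : ℝ × E} (hp : p ∈ τ.toHomeo.target) {w : E}
    (h : ∀ ζ v, (ζ, v) ∈ anchorGraph P τ p → ζ w = 0) : w = 0 := by
  obtain ⟨t, y⟩ := p
  have hs := τ.mem_source hp
  have e1 : (τ.dslice t (τ.inv t y)).comp (τ.dinv t y) = .id ℝ E := by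
    have := τ.dslice_comp_dinv_self hs
    rwa [τ.slice_inv hp] at this
  have h0 : τ.dinv t y w = 0 := by
    refine hP (τ.inv t y) (τ.dinv t y w) fun η => ?_
    have h1 := h _ _ ((mem_anchorGraph_of_inv_eq (P := P) (τ := τ) (t := t) (y := y) rfl
      (ζ := τ.covCoord t ⟨_, η.1⟩)).2 ⟨η, (τ.covCoord_comp_dslice (p := ⟨_, η.1⟩) hs).symm, rfl⟩)
    rw [TubeChart.covCoord] at h1
    simp only [τ.slice_inv hp] at h1
    exact h1
  have := DFunLike.congr_fun e1 w
  rw [ContinuousLinearMap.comp_apply, h0, map_zero] at this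
  exact this.symm

/-- The graph of the anchor in two time-dependent charts. -/
theorem mem_anchorGraph_trans {t : ℝ} {y : E} (h : (t, y) ∈ τ.transDom τ')
    {ζ : E →L[ℝ] (Fin r → ℝ)} {v : E} :
    (ζ, τ.dtrans τ' (t, y) v) ∈ anchorGraph P τ' (t, τ.trans τ' (t, y)) ↔
      (ζ.comp (τ.dtrans τ' (t, y)), v) ∈ anchorGraph P τ (t, y) := by
  obtain ⟨h1, h2⟩ := TubeChart.mem_transDom.1 h
  have e := TubeChart.dslice_eq (τ.mem_source h1) h2
  rw [τ.slice_inv h1] at e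
  rw [mem_anchorGraph_of_inv_eq (x := τ.inv t y) (by rw [TubeChart.trans, τ'.inv_slice h2]),
    mem_anchorGraph_of_inv_eq (x := τ.inv t y) rfl, e]
  simp only [← ContinuousLinearMap.comp_assoc]
  refine exists_congr fun η => and_congr_right fun _ => ?_
  exact (TubeChart.dtransEquiv h).injective.eq_iff (a := τ.dslice t (τ.inv t y) (P _ η)) (b := v)

theorem formIn_mem_anchorGraph {p : ℝ × E} (hp : p ∈ τ.toHomeo.target) (η : ∀ x : M, S x) :
    (τ.formIn (fun x => (η x).1) p, τ.fieldIn (fun x => P x (η x)) p) ∈ anchorGraph P τ p :=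
  mem_anchorGraph.2 ⟨formIn_mem_sCoord hp (η _).2, aCoord_formIn hp η _⟩

end Graph

/-! ### The Lie algebroid of a poly-Poisson structure -/

section Algebroid

variable {E : Type u} [NormedAddCommGroup E] [NormedSpace ℝ E] [FiniteDimensional ℝ E]
  {M : Type v} [TopologicalSpace M] [T2Space M] [ChartedSpace E M] [IsManifold 𝓘(ℝ, E) ∞ M] {r : ℕ}
  {S : ∀ x : M, Submodule ℝ (CoVel E M r x)} (P : ∀ x : M, S x →ₗ[ℝ] TangentSpace 𝓘(ℝ, E) x)

/-- A section of the subbundle near `x₀` together with its anchor, in the preferred chart. -/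
def IsLocalSection (x₀ : M) (η : E → E →L[ℝ] (Fin r → ℝ)) (V : E → E) : Prop :=
  ∀ᶠ z in 𝓝 (chartAt E x₀ x₀),
    ContDiffAt ℝ ∞ η z ∧ (η z, V z) ∈ anchorGraph P (TubeChart.const E x₀) (0, z)

variable {P} {x₀ : M} {s : ℕ}

theorem const_mem_target {z : E} (hz : z ∈ (chartAt E x₀).target) :
    ((0 : ℝ), z) ∈ (TubeChart.const E x₀).toHomeo.target := ⟨mem_univ _, hz⟩

theorem contDiffOn_formIn_const {η : ∀ x : M, S x} (hη : IsSmoothSection S η) :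
    ContDiffOn ℝ ∞ (fun z => (TubeChart.const E x₀).formIn (fun x => (η x).1) (0, z))
      (chartAt E x₀).target :=
  ((TubeChart.const E x₀).contDiffOn_formIn isOpen_univ hη).comp (by fun_prop)
    fun z hz => ⟨const_mem_target hz, mem_univ _⟩

theorem contDiffOn_fieldIn_anchor (hSP : IsPolyPoisson S P s) {η : ∀ x : M, S x}
    (hη : IsSmoothSection S η) :
    ContDiffOn ℝ ∞ (fun z => (TubeChart.const E x₀).fieldIn (fun x => P x (η x)) (0, z))
      (chartAt E x₀).target :=
  ((TubeChart.const E x₀).contDiffOn_fieldIn isOpen_univ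
    (hSP.smooth_anchor univ η isOpen_univ hη)).comp (by fun_prop)
    fun z hz => ⟨const_mem_target hz, mem_univ _⟩

theorem isLocalSection_of_isSmoothSection {η : ∀ x : M, S x} (hη : IsSmoothSection S η) (x₀ : M) :
    IsLocalSection P x₀ (fun z => (TubeChart.const E x₀).formIn (fun x => (η x).1) (0, z))
      (fun z => (TubeChart.const E x₀).fieldIn (fun x => P x (η x)) (0, z)) := by
  filter_upwards [chart_target_mem_nhds E x₀] with z hz
  exact ⟨(contDiffOn_formIn_const hη).contDiffAt ((chartAt E x₀).open_target.mem_nhds hz),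
    formIn_mem_anchorGraph (const_mem_target hz) η⟩

/-- The axioms on the bracket concern global sections only. Extending germs to global sections with
a bump function makes them available for local sections. -/
theorem IsLocalSection.exists_section {η : E → E →L[ℝ] (Fin r → ℝ)} {V : E → E}
    (h : IsLocalSection P x₀ η V) : ∃ η' : ∀ x : M, S x, IsSmoothSection S η' ∧
      (fun z => (TubeChart.const E x₀).formIn (fun x => (η' x).1) (0, z))
        =ᶠ[𝓝 (chartAt E x₀ x₀)] η ∧
      (fun z => (TubeChart.const E x₀).fieldIn (fun x => P x (η' x)) (0, z))
        =ᶠ[𝓝 (chartAt E x₀ x₀)] V := by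
  have ht := chart_target_mem_nhds E x₀
  obtain ⟨N, hN, hNo, hz⟩ := eventually_nhds_iff.1 h
  obtain ⟨η', hη', e⟩ := exists_section_extension (S := S) x₀ hNo hz
    (fun z hz => (hN z hz).1.contDiffWithinAt) fun z hz => mem_sCoord_iff.2 ⟨_, (hN z hz).2⟩
  have e1 : (fun z => (TubeChart.const E x₀).formIn (fun x => (η' x).1) (0, z))
      =ᶠ[𝓝 (chartAt E x₀ x₀)] η := by
    filter_upwards [e, ht] with z hz hz'
    rw [← hz, formInChart_eq x₀ _ hz']
  refine ⟨η', hη', e1, ?_⟩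
  filter_upwards [e1, h, isLocalSection_of_isSmoothSection hη' x₀] with z h3 h4 h5
  rw [h3] at h5
  exact anchorGraph_unique h5.2 h4.2

/-- The field `V` is only required to be the pointwise anchor of `η`. Its smoothness comes from that
of the anchor of a global extension. -/
theorem IsLocalSection.eventually_contDiffAt (hSP : IsPolyPoisson S P s)
    {η : E → E →L[ℝ] (Fin r → ℝ)} {V : E → E} (h : IsLocalSection P x₀ η V) :
    ∀ᶠ z in 𝓝 (chartAt E x₀ x₀), ContDiffAt ℝ ∞ V z := by
  obtain ⟨η', hη', -, e⟩ := h.exists_section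
  filter_upwards [chart_target_mem_nhds E x₀, e.eventually_nhds] with z hz hz'
  exact ((contDiffOn_fieldIn_anchor hSP hη').contDiffAt
    ((chartAt E x₀).open_target.mem_nhds hz)).congr_of_eventuallyEq (Filter.EventuallyEq.symm hz')

/-- The bracket in the preferred charts. -/
theorem formIn_ppBracket (hSP : IsPolyPoisson S P s) {η γ : ∀ x : M, S x}
    (hη : IsSmoothSection S η) (hγ : IsSmoothSection S γ) {z : E}
    (hz : z ∈ (chartAt E x₀).target) :
    (TubeChart.const E x₀).formIn (ppBracket P η γ) (0, z) = coordBracket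
      (fun z => (TubeChart.const E x₀).fieldIn (fun x => P x (η x)) (0, z))
      (fun z => (TubeChart.const E x₀).fieldIn (fun x => P x (γ x)) (0, z))
      (fun z => (TubeChart.const E x₀).formIn (fun x => (η x).1) (0, z))
      (fun z => (TubeChart.const E x₀).formIn (fun x => (γ x).1) (0, z)) z := by
  set c := TubeChart.const E x₀
  set x := (chartAt E x₀).symm z
  -- The bracket at the point `x` is defined in the preferred chart at `x`, not in the one at `x₀`.
  -- It is identified there first, in `e1`, and then carried over by naturality under the coordinate
  -- change.
  set c' := TubeChart.const E x
  have hx0 : x ∈ (chartAt E x₀).source := (chartAt E x₀).map_target hz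
  have hdom : ((0 : ℝ), z) ∈ c.transDom c' := TubeChart.mem_transDom.2
    ⟨const_mem_target hz, TubeChart.mem_const_source.2 (mem_chart_source E x)⟩
  have hg : c.trans c' (0, z) = chartAt E x x := rfl
  have ht := chart_target_mem_nhds E x
  have hxt : chartAt E x x ∈ (chartAt E x).target := mem_of_mem_nhds ht
  have e1 : c'.formIn (ppBracket P η γ) (0, chartAt E x x) = coordBracket
      (fun z => c'.fieldIn (fun x => P x (η x)) (0, z))
      (fun z => c'.fieldIn (fun x => P x (γ x)) (0, z))
      (fun z => c'.formIn (fun x => (η x).1) (0, z))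
      (fun z => c'.formIn (fun x => (γ x).1) (0, z)) (chartAt E x x) := by
    refine (c'.formIn_of_inv_eq (x := x)
      ((chartAt E x).left_inv (mem_chart_source E x)) _).trans ?_
    have hf : ∀ α : ∀ x : M, CoVel E M r x, (fun z => c'.formIn α (0, z)) =ᶠ[𝓝 (chartAt E x x)]
        formInChart x α := fun α => by
      filter_upwards [ht] with z hz using (formInChart_eq x α hz).symm
    rw [coordBracket_congr (Filter.EventuallyEq.refl _ _) rfl (hf _) (hf _)]
    have hs : ((0 : ℝ), x) ∈ c'.toHomeo.source :=
      TubeChart.mem_const_source.2 (mem_chart_source E x)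
    have h1 := c'.dslice_comp_dinv_self hs
    have h2 : ppBracket P η γ x = (coordBracket (fun z => c'.fieldIn (fun x => P x (η x)) (0, z))
      (fun z => c'.fieldIn (fun x => P x (γ x)) (0, z))
      (formInChart x fun x => (η x).1) (formInChart x fun x => (γ x).1) (chartAt E x x)).comp
        (c'.dslice 0 x) := (ContinuousLinearMap.sub_comp _ _ _).symm
    rw [TubeChart.covCoord, h2]
    change ContinuousLinearMap.comp (ContinuousLinearMap.comp _ _) _ = _
    rw [ContinuousLinearMap.comp_assoc]
    exact (congrArg _ h1).trans (ContinuousLinearMap.comp_id _)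
  have hd : c.dtrans c' (0, z) = fderiv ℝ (fun z => c.trans c' (0, z)) z :=
    (TubeChart.hasFDerivAt_trans hdom).fderiv.symm
  have hev : ∀ᶠ z' in 𝓝 z, ((0 : ℝ), z') ∈ c.transDom c' :=
    ((c.isOpen_transDom c').preimage (by fun_prop : Continuous fun y : E => ((0 : ℝ), y))).mem_nhds
      hdom
  rw [TubeChart.formIn_trans hdom, hg, e1, hd]
  refine (coordBracket_pullback (g := fun z => c.trans c' (0, z)) ?_ ?_ ?_ ?_ ?_ ?_ ?_ ?_ ?_).symm
  · exact ((c.contDiffOn_trans c').contDiffAt ((c.isOpen_transDom c').mem_nhds hdom)).comp z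
      (by fun_prop)
  · filter_upwards [hev] with z' hz'
    rw [← (TubeChart.hasFDerivAt_trans hz').fderiv.symm, TubeChart.fieldIn_trans hz']
  · rw [← hd, TubeChart.fieldIn_trans hdom]
  · filter_upwards [hev] with z' hz'
    rw [← (TubeChart.hasFDerivAt_trans hz').fderiv.symm, TubeChart.formIn_trans hz']
  · filter_upwards [hev] with z' hz'
    rw [← (TubeChart.hasFDerivAt_trans hz').fderiv.symm, TubeChart.formIn_trans hz']
  · exact ((contDiffOn_fieldIn_anchor hSP hη).contDiffAt
      ((chartAt E x₀).open_target.mem_nhds hz)).differentiableAt (by simp)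
  · exact ((contDiffOn_fieldIn_anchor hSP hη).contDiffAt ht).differentiableAt (by simp)
  · exact ((contDiffOn_formIn_const hη).contDiffAt ht).differentiableAt (by simp)
  · exact ((contDiffOn_formIn_const hγ).contDiffAt ht).differentiableAt (by simp)

/-- The bracket of two smooth sections. -/
def ppBracketSection (hSP : IsPolyPoisson S P s) {η γ : ∀ x : M, S x}
    (hη : IsSmoothSection S η) (hγ : IsSmoothSection S γ) (x : M) : S x :=
  ⟨ppBracket P η γ x, hSP.closed η γ hη hγ x⟩

theorem isSmoothSection_ppBracketSection (hSP : IsPolyPoisson S P s) {η γ : ∀ x : M, S x}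
    (hη : IsSmoothSection S η) (hγ : IsSmoothSection S γ) :
    IsSmoothSection S (ppBracketSection hSP hη hγ) := by
  intro x _
  refine ((TubeChart.const E x).smoothFormOn_of_formIn (t := 0)
    (TubeChart.mem_const_source.2 (mem_chart_source E x)) ?_).contMDiffWithinAt
  have ht := chart_target_mem_nhds E x
  refine ((ContDiffOn.coordBracket (chartAt E x).open_target (contDiffOn_fieldIn_anchor hSP hη)
    (contDiffOn_fieldIn_anchor hSP hγ) (contDiffOn_formIn_const hη)
    (contDiffOn_formIn_const hγ)).contDiffAt ht).congr_of_eventuallyEq ?_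
  filter_upwards [ht] with z hz using formIn_ppBracket hSP hη hγ hz

/-- The bracket of global extensions is a section of the subbundle by the closure axiom, and its
germ depends only on the germs of the two sections. -/
theorem IsLocalSection.exists_bracket (hSP : IsPolyPoisson S P s)
    {η γ : E → E →L[ℝ] (Fin r → ℝ)} {V U : E → E} (h : IsLocalSection P x₀ η V)
    (h' : IsLocalSection P x₀ γ U) : ∃ B, IsLocalSection P x₀ (coordBracket V U η γ) B := by
  obtain ⟨η', hη, e1, e2⟩ := h.exists_section
  obtain ⟨γ', hγ, e3, e4⟩ := h'.exists_section
  have h1 := isLocalSection_of_isSmoothSection (P := P)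
    (isSmoothSection_ppBracketSection hSP hη hγ) x₀
  have e : (fun z => (TubeChart.const E x₀).formIn
      (fun x => (ppBracketSection hSP hη hγ x).1) (0, z)) =ᶠ[𝓝 (chartAt E x₀ x₀)]
      coordBracket V U η γ := by
    filter_upwards [chart_target_mem_nhds E x₀, e1.eventually_nhds, e2.eventually_nhds,
      e3.eventually_nhds, e4.eventually_nhds] with z hz h1 h2 h3 h4
    exact (formIn_ppBracket hSP hη hγ hz).trans (coordBracket_congr h2 h4.self_of_nhds h1 h3)
  refine ⟨fun z => (TubeChart.const E x₀).fieldIn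
    (fun x => P x (ppBracketSection hSP hη hγ x)) (0, z), ?_⟩
  filter_upwards [h1, e.eventually_nhds] with z hz hz'
  refine ⟨hz.1.congr_of_eventuallyEq (Filter.EventuallyEq.symm hz'), ?_⟩
  rw [← Filter.Eventually.self_of_nhds hz']
  exact hz.2

/-- The Jacobi identity for local sections. -/
theorem IsLocalSection.jacobi (hSP : IsPolyPoisson S P s)
    {η₁ η₂ η₃ : E → E →L[ℝ] (Fin r → ℝ)} {V₁ V₂ V₃ V₁₂ V₂₃ V₃₁ : E → E}
    (h₁ : IsLocalSection P x₀ η₁ V₁) (h₂ : IsLocalSection P x₀ η₂ V₂)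
    (h₃ : IsLocalSection P x₀ η₃ V₃)
    (h₁₂ : IsLocalSection P x₀ (coordBracket V₁ V₂ η₁ η₂) V₁₂)
    (h₂₃ : IsLocalSection P x₀ (coordBracket V₂ V₃ η₂ η₃) V₂₃)
    (h₃₁ : IsLocalSection P x₀ (coordBracket V₃ V₁ η₃ η₁) V₃₁) :
    coordBracket V₁₂ V₃ (coordBracket V₁ V₂ η₁ η₂) η₃ (chartAt E x₀ x₀) +
    coordBracket V₂₃ V₁ (coordBracket V₂ V₃ η₂ η₃) η₁ (chartAt E x₀ x₀) +
    coordBracket V₃₁ V₂ (coordBracket V₃ V₁ η₃ η₁) η₂ (chartAt E x₀ x₀) = 0 := by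
  -- A double bracket of global extensions is expressed through local data. The anchor of the inner
  -- bracket must be differentiated in the outer one, and it agrees with the given `B` as a germ
  -- because the anchor of a covector is unique.
  have key : ∀ {η γ κ : E → E →L[ℝ] (Fin r → ℝ)} {V U T B : E → E} {η' γ' κ' : ∀ x : M, S x}
      (hη : IsSmoothSection S η') (hγ : IsSmoothSection S γ') (hκ : IsSmoothSection S κ'),
      (fun z => (TubeChart.const E x₀).formIn (fun x => (η' x).1) (0, z))
        =ᶠ[𝓝 (chartAt E x₀ x₀)] η →
      (fun z => (TubeChart.const E x₀).fieldIn (fun x => P x (η' x)) (0, z))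
        =ᶠ[𝓝 (chartAt E x₀ x₀)] V →
      (fun z => (TubeChart.const E x₀).formIn (fun x => (γ' x).1) (0, z))
        =ᶠ[𝓝 (chartAt E x₀ x₀)] γ →
      (fun z => (TubeChart.const E x₀).fieldIn (fun x => P x (γ' x)) (0, z))
        =ᶠ[𝓝 (chartAt E x₀ x₀)] U →
      (fun z => (TubeChart.const E x₀).formIn (fun x => (κ' x).1) (0, z))
        =ᶠ[𝓝 (chartAt E x₀ x₀)] κ →
      (fun z => (TubeChart.const E x₀).fieldIn (fun x => P x (κ' x)) (0, z))
        =ᶠ[𝓝 (chartAt E x₀ x₀)] T →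
      IsLocalSection P x₀ (coordBracket V U η γ) B →
      (TubeChart.const E x₀).formIn (ppBracket P (ppBracketSection hSP hη hγ) κ')
        (0, chartAt E x₀ x₀) = coordBracket B T (coordBracket V U η γ) κ (chartAt E x₀ x₀) := by
    intro η γ κ V U T B η' γ' κ' hη hγ hκ e1 e2 e3 e4 e5 e6 hB
    have ht := chart_target_mem_nhds E x₀
    have hβ := isSmoothSection_ppBracketSection hSP hη hγ
    rw [formIn_ppBracket hSP hβ hκ (mem_of_mem_nhds ht)]
    have e : (fun z => (TubeChart.const E x₀).formIn
        (fun x => (ppBracketSection hSP hη hγ x).1) (0, z)) =ᶠ[𝓝 (chartAt E x₀ x₀)]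
        coordBracket V U η γ := by
      filter_upwards [ht, e1.eventually_nhds, e2.eventually_nhds,
        e3.eventually_nhds, e4.eventually_nhds] with z hz h1 h2 h3 h4
      exact (formIn_ppBracket hSP hη hγ hz).trans (coordBracket_congr h2 h4.self_of_nhds h1 h3)
    refine coordBracket_congr ?_ e6.self_of_nhds e e5
    filter_upwards [e, hB, isLocalSection_of_isSmoothSection (P := P) hβ x₀] with z h1 h2 h3
    rw [h1] at h3
    exact anchorGraph_unique h3.2 h2.2
  obtain ⟨η₁', k₁, a₁, b₁⟩ := h₁.exists_section
  obtain ⟨η₂', k₂, a₂, b₂⟩ := h₂.exists_section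
  obtain ⟨η₃', k₃, a₃, b₃⟩ := h₃.exists_section
  rw [← key k₁ k₂ k₃ a₁ b₁ a₂ b₂ a₃ b₃ h₁₂, ← key k₂ k₃ k₁ a₂ b₂ a₃ b₃ a₁ b₁ h₂₃,
    ← key k₃ k₁ k₂ a₃ b₃ a₁ b₁ a₂ b₂ h₃₁]
  have h := hSP.jacobi η₁' η₂' η₃' k₁ k₂ k₃ x₀
  have hi : ∀ α, (TubeChart.const E x₀).formIn α (0, chartAt E x₀ x₀) =
      (show E →L[ℝ] (Fin r → ℝ) from α x₀).comp ((TubeChart.const E x₀).dinv 0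
        ((TubeChart.const E x₀).slice 0 x₀)) := fun α =>
    (TubeChart.const E x₀).formIn_of_inv_eq (x := x₀)
      ((chartAt E x₀).left_inv (mem_chart_source E x₀)) α
  rw [hi, hi, hi, ← ContinuousLinearMap.add_comp, ← ContinuousLinearMap.add_comp]
  exact (congrArg (fun a : E →L[ℝ] (Fin r → ℝ) => a.comp ((TubeChart.const E x₀).dinv 0
        ((TubeChart.const E x₀).slice 0 x₀))) h).trans (ContinuousLinearMap.zero_comp _)

end Algebroid

section Algebroid

variable {E : Type u} [NormedAddCommGroup E] [NormedSpace ℝ E] [FiniteDimensional ℝ E]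
  {M : Type v} [TopologicalSpace M] [T2Space M] [ChartedSpace E M] [IsManifold 𝓘(ℝ, E) ∞ M] {r : ℕ}
  {S : ∀ x : M, Submodule ℝ (CoVel E M r x)} {P : ∀ x : M, S x →ₗ[ℝ] TangentSpace 𝓘(ℝ, E) x}
  {x₀ : M} {s : ℕ}

/-! ### The anchor is a homomorphism -/

namespace IsLocalSection

variable {η γ : E → E →L[ℝ] (Fin r → ℝ)} {V U : E → E}

theorem add (h : IsLocalSection P x₀ η V) (h' : IsLocalSection P x₀ γ U) :
    IsLocalSection P x₀ (fun z => η z + γ z) (fun z => V z + U z) := by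
  filter_upwards [h, h'] with z hz hz'
  exact ⟨hz.1.add hz'.1, Submodule.add_mem _ hz.2 hz'.2⟩

theorem smul (h : IsLocalSection P x₀ η V) {f : E → ℝ}
    (hf : ∀ᶠ z in 𝓝 (chartAt E x₀ x₀), ContDiffAt ℝ ∞ f z) :
    IsLocalSection P x₀ (fun z => f z • η z) (fun z => f z • V z) := by
  filter_upwards [h, hf] with z hz hz'
  exact ⟨hz'.smul hz.1, Submodule.smul_mem _ (f z) hz.2⟩

theorem congr (h : IsLocalSection P x₀ η V) (e : γ =ᶠ[𝓝 (chartAt E x₀ x₀)] η) :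
    IsLocalSection P x₀ γ V := by
  filter_upwards [h, e.eventually_nhds] with z hz hz'
  exact ⟨hz.1.congr_of_eventuallyEq hz', by rw [hz'.self_of_nhds]; exact hz.2⟩

theorem antisymm (hSP : IsPolyPoisson S P s) (h : IsLocalSection P x₀ η V)
    (h' : IsLocalSection P x₀ γ U) :
    coordBracket U V γ η =ᶠ[𝓝 (chartAt E x₀ x₀)] fun z => -coordBracket V U η γ z := by
  filter_upwards [h.eventually_nhds, h'.eventually_nhds, h.eventually_contDiffAt hSP,
    h'.eventually_contDiffAt hSP] with z h1 h2 h3 h4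
  refine coordBracket_antisymm (h3.differentiableAt (by simp)) (h4.differentiableAt (by simp))
    (h1.self_of_nhds.1.differentiableAt (by simp)) (h2.self_of_nhds.1.differentiableAt (by simp)) ?_
  filter_upwards [h1, h2] with z' h5 h6 using anchorGraph_polarized hSP.contraction h5.2 h6.2

/-- A section with prescribed value. -/
theorem exists_of_mem (hSP : IsPolyPoisson S P s) {ζ : E →L[ℝ] (Fin r → ℝ)}
    (h : ζ ∈ sCoord S (TubeChart.const E x₀) (0, chartAt E x₀ x₀)) :
    ∃ κ T, IsLocalSection P x₀ κ T ∧ κ (chartAt E x₀ x₀) = ζ := by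
  set c := TubeChart.const E x₀
  obtain ⟨U, hU, e, he, hS⟩ := hSP.subbundle x₀
  obtain ⟨U', hU', hUo, hx⟩ := mem_nhds_iff.1 hU
  have hi : (chartAt E x₀).symm (chartAt E x₀ x₀) = x₀ :=
    (chartAt E x₀).left_inv (mem_chart_source E x₀)
  have h1 := (mem_sCoord_of_inv_eq (τ := c) (t := 0) (y := chartAt E x₀ x₀) hi).1 h
  rw [← (hS x₀ (mem_of_mem_nhds hU)).2, Submodule.mem_span_range_iff_exists_fun] at h1
  obtain ⟨a, ha⟩ := h1
  have hs : ((0 : ℝ), x₀) ∈ c.toHomeo.source := TubeChart.mem_const_source.2 (mem_chart_source E x₀)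
  have hev : ∀ᶠ z in 𝓝 (chartAt E x₀ x₀), ((0 : ℝ), z) ∈
      {p | p ∈ c.toHomeo.target ∧ c.inv p.1 p.2 ∈ U'} :=
    ((TubeChart.isOpen_inv_preimage c hUo).preimage
      (by fun_prop : Continuous fun y : E => ((0 : ℝ), y))).mem_nhds
        ⟨c.mem_target hs, by rw [show c.inv 0 (chartAt E x₀ x₀) = x₀ from hi]; exact hx⟩
  have hev2 : ∀ᶠ z in 𝓝 (chartAt E x₀ x₀), ContDiffAt ℝ ∞ (fun z => ∑ i, a i • c.formIn (e i) (0, z)) z ∧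
      ∃ v, ((∑ i, a i • c.formIn (e i) (0, z)), v) ∈ anchorGraph P c (0, z) := by
    filter_upwards [hev] with z hz
    refine ⟨ContDiffAt.sum fun i _ => ?_, ?_⟩
    · have h2 := c.contDiffOn_formIn hUo ((he i).mono hU')
      have h3 : ContDiffAt ℝ ∞ (fun z => c.formIn (e i) (0, z)) z :=
        (h2.contDiffAt ((TubeChart.isOpen_inv_preimage c hUo).mem_nhds hz)).comp z (by fun_prop)
      have h4 : ContDiffAt ℝ ∞ (fun _ : E => a i) z := contDiffAt_const
      exact h4.smul h3
    · refine mem_sCoord_iff.1 (Submodule.sum_mem _ fun i _ => Submodule.smul_mem _ _ ?_)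
      refine formIn_mem_sCoord hz.1 ?_
      rw [← (hS _ (hU' hz.2)).2]
      exact Submodule.subset_span ⟨i, rfl⟩
  have hev3 : ∀ᶠ z in 𝓝 (chartAt E x₀ x₀), ∃ v,
      ContDiffAt ℝ ∞ (fun z => ∑ i, a i • c.formIn (e i) (0, z)) z ∧
      ((∑ i, a i • c.formIn (e i) (0, z)), v) ∈ anchorGraph P c (0, z) := by
    filter_upwards [hev2] with z hz
    exact ⟨hz.2.choose, hz.1, hz.2.choose_spec⟩
  obtain ⟨T, hT⟩ := hev3.choice
  refine ⟨_, T, hT, ?_⟩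
  have h4 : ∀ i, c.formIn (e i) (0, chartAt E x₀ x₀) =
      (show E →L[ℝ] (Fin r → ℝ) from e i x₀).comp (c.dinv 0 (c.slice 0 x₀)) := fun i =>
    c.formIn_of_inv_eq (x := x₀) hi _
  have h5 : (∑ i, a i • c.formIn (e i) (0, chartAt E x₀ x₀)) =
      (∑ i, a i • (show E →L[ℝ] (Fin r → ℝ) from e i x₀)).comp (c.dinv 0 (c.slice 0 x₀)) := by
    simp only [h4]
    exact (map_sum ((ContinuousLinearMap.compL ℝ E E (Fin r → ℝ)).flip
      (c.dinv 0 (c.slice 0 x₀))) (fun i => a i • (show E →L[ℝ] (Fin r → ℝ) from e i x₀))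
      Finset.univ).symm
  refine h5.trans ((congrArg (fun b : E →L[ℝ] (Fin r → ℝ) =>
    b.comp (c.dinv 0 (c.slice 0 x₀))) ha).trans ?_)
  change (ζ.comp (c.dslice 0 x₀)).comp (c.dinv 0 (c.slice 0 x₀)) = ζ
  rw [ContinuousLinearMap.comp_assoc, c.dslice_comp_dinv_self hs, ContinuousLinearMap.comp_id]

end IsLocalSection

theorem coordBracket_smul_add_smul {V C T : E → E} {η μ κ : E → E →L[ℝ] (Fin r → ℝ)} {f h : E → ℝ}
    {z : E} (hf : DifferentiableAt ℝ f z) (hh : DifferentiableAt ℝ h z)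
    (hμ : DifferentiableAt ℝ μ z) (hκ : DifferentiableAt ℝ κ z) (hz : f z = 0) :
    coordBracket V (fun z => f z • C z + h z • T z) η (fun z => f z • μ z + h z • κ z) z =
      fderiv ℝ f z (V z) • μ z + (h z • coordBracket V T η κ z + fderiv ℝ h z (V z) • κ z) := by
  rw [coordBracket_add (show DifferentiableAt ℝ (fun z => f z • μ z) z from hf.smul hμ)
      (show DifferentiableAt ℝ (fun z => h z • κ z) z from hh.smul hκ), coordBracket_smul hf hμ, coordBracket_smul hh hκ,
    hz, zero_smul, zero_add]

theorem coordBracket_neg {V U : E → E} {η γ : E → E →L[ℝ] (Fin r → ℝ)} {z : E} :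
    coordBracket V (fun z => -U z) η (fun z => -γ z) z = -coordBracket V U η γ z := by
  have h : fderiv ℝ (fun z => -γ z) z = -fderiv ℝ γ z := fderiv_neg
  refine ContinuousLinearMap.ext fun x => ?_
  simp only [coordBracket_apply, h, neg_apply, map_neg]
  abel

/-- The Jacobi identity is evaluated on `η`, `γ` and `f κ`, where `f` is the affine function `z ↦
l(z - z₀)` vanishing at the point. By the Leibniz rule the double brackets of `η`, `γ`, `κ` carry
the factor `f(z₀) = 0`. The terms with one derivative of `f` on a single bracket cancel in pairs,
and what survives is `l` applied to the anchor of the bracket minus the commutator, times `κ`. -/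
theorem IsLocalSection.anchor_smul_eq_zero (hSP : IsPolyPoisson S P s)
    {η γ κ : E → E →L[ℝ] (Fin r → ℝ)} {V U T B : E → E} (h : IsLocalSection P x₀ η V)
    (h' : IsLocalSection P x₀ γ U) (hB : IsLocalSection P x₀ (coordBracket V U η γ) B)
    (hκ : IsLocalSection P x₀ κ T) (l : E →L[ℝ] ℝ) :
    l (B (chartAt E x₀ x₀) - (fderiv ℝ U (chartAt E x₀ x₀) (V (chartAt E x₀ x₀)) -
      fderiv ℝ V (chartAt E x₀ x₀) (U (chartAt E x₀ x₀)))) • κ (chartAt E x₀ x₀) = 0 := by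
  set z₀ := chartAt E x₀ x₀ with hz₀
  let f : E → ℝ := fun z => l (z - z₀)
  have hfz : f z₀ = 0 := by simp [f]
  have hf : ContDiff ℝ ∞ f := l.contDiff.comp (contDiff_id.sub contDiff_const)
  have hfd : ∀ z, fderiv ℝ f z = l := fun z =>
    (l.hasFDerivAt.comp z ((hasFDerivAt_id z).sub_const z₀)).fderiv
  have hV := h.eventually_contDiffAt hSP
  have hU := h'.eventually_contDiffAt hSP
  have hκ' : IsLocalSection P x₀ (fun z => f z • κ z) (fun z => f z • T z) :=
    hκ.smul (.of_forall fun z => hf.contDiffAt)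
  obtain ⟨C₁, hC₁⟩ := h'.exists_bracket hSP hκ
  obtain ⟨C₂, hC₂⟩ := h.exists_bracket hSP hκ
  have hlU : ∀ᶠ z in 𝓝 z₀, ContDiffAt ℝ ∞ (fun z => l (U z)) z := by
    filter_upwards [hU] with z hz using l.contDiff.contDiffAt.comp z hz
  have hlV : ∀ᶠ z in 𝓝 z₀, ContDiffAt ℝ ∞ (fun z => l (V z)) z := by
    filter_upwards [hV] with z hz using l.contDiff.contDiffAt.comp z hz
  have e₁ : coordBracket U (fun z => f z • T z) γ (fun z => f z • κ z) =ᶠ[𝓝 z₀]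
      fun z => f z • coordBracket U T γ κ z + l (U z) • κ z := by
    filter_upwards [hκ] with z hz
    rw [coordBracket_smul (hf.differentiable (by simp) z) (hz.1.differentiableAt (by simp)), hfd]
  have e₂ : coordBracket V (fun z => f z • T z) η (fun z => f z • κ z) =ᶠ[𝓝 z₀]
      fun z => f z • coordBracket V T η κ z + l (V z) • κ z := by
    filter_upwards [hκ] with z hz
    rw [coordBracket_smul (hf.differentiable (by simp) z) (hz.1.differentiableAt (by simp)), hfd]
  have s₁ : IsLocalSection P x₀ (fun z => f z • coordBracket U T γ κ z + l (U z) • κ z)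
      (fun z => f z • C₁ z + l (U z) • T z) :=
    (hC₁.smul (.of_forall fun z => hf.contDiffAt)).add (hκ.smul hlU)
  have s₂ : IsLocalSection P x₀ (fun z => f z • coordBracket V T η κ z + l (V z) • κ z)
      (fun z => f z • C₂ z + l (V z) • T z) :=
    (hC₂.smul (.of_forall fun z => hf.contDiffAt)).add (hκ.smul hlV)
  have e₃ : coordBracket (fun z => f z • T z) V (fun z => f z • κ z) η =ᶠ[𝓝 z₀]
      fun z => -(f z • coordBracket V T η κ z + l (V z) • κ z) := by
    filter_upwards [h.antisymm hSP hκ', e₂] with z h1 h2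
    rw [h1, h2]
  have s₃ : IsLocalSection P x₀ (fun z => -(f z • coordBracket V T η κ z + l (V z) • κ z))
      (fun z => -(f z • C₂ z + l (V z) • T z)) := by
    have h1 := s₂.smul (f := fun _ => -1) (.of_forall fun z => contDiffAt_const)
    have h2 : ∀ a : E →L[ℝ] (Fin r → ℝ), (-1 : ℝ) • a = -a := fun a => neg_one_smul ℝ a
    simpa only [h2, neg_one_smul] using h1
  -- Only the Leibniz rule in the second argument is available, so brackets with `f κ` or its
  -- derived sections on the left are first reversed by antisymmetry. The three terms of the
  -- identity are then `t₁`, `t₂` and `t₃`.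
  have J := IsLocalSection.jacobi hSP h h' hκ' hB (s₁.congr e₁) (s₃.congr e₃)
  have hκd := hκ.self_of_nhds.1.differentiableAt (n := ∞) (by simp)
  have t₁ : coordBracket B (fun z => f z • T z) (coordBracket V U η γ) (fun z => f z • κ z) z₀ =
      l (B z₀) • κ z₀ := by
    rw [coordBracket_smul (hf.differentiable (by simp) z₀) hκd, hfz, hfd, zero_smul, zero_add]
  have dU : fderiv ℝ (fun z => l (U z)) z₀ (V z₀) = l (fderiv ℝ U z₀ (V z₀)) := by
    have h1 : HasFDerivAt (fun z => l (U z)) (l.comp (fderiv ℝ U z₀)) z₀ :=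
      l.hasFDerivAt.comp z₀ (hU.self_of_nhds.differentiableAt (by simp)).hasFDerivAt
    rw [h1.fderiv]
    rfl
  have dV : fderiv ℝ (fun z => l (V z)) z₀ (U z₀) = l (fderiv ℝ V z₀ (U z₀)) := by
    have h1 : HasFDerivAt (fun z => l (V z)) (l.comp (fderiv ℝ V z₀)) z₀ :=
      l.hasFDerivAt.comp z₀ (hV.self_of_nhds.differentiableAt (by simp)).hasFDerivAt
    rw [h1.fderiv]
    rfl
  have t₂ : coordBracket (fun z => f z • C₁ z + l (U z) • T z) V
      (coordBracket U (fun z => f z • T z) γ (fun z => f z • κ z)) η z₀ =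
      -(l (V z₀) • coordBracket U T γ κ z₀ + (l (U z₀) • coordBracket V T η κ z₀ +
        l (fderiv ℝ U z₀ (V z₀)) • κ z₀)) := by
    rw [coordBracket_congr .rfl rfl e₁ .rfl]
    refine (h.antisymm hSP s₁).self_of_nhds.trans (congrArg Neg.neg ?_)
    rw [← hz₀, coordBracket_smul_add_smul (hf.differentiable (by simp) z₀)
        (hlU.self_of_nhds.differentiableAt (by simp))
        (hC₁.self_of_nhds.1.differentiableAt (by simp)) hκd hfz, hfd, dU]
  have t₃ : coordBracket (fun z => -(f z • C₂ z + l (V z) • T z)) U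
      (coordBracket (fun z => f z • T z) V (fun z => f z • κ z) η) γ z₀ =
      l (U z₀) • coordBracket V T η κ z₀ + (l (V z₀) • coordBracket U T γ κ z₀ +
        l (fderiv ℝ V z₀ (U z₀)) • κ z₀) := by
    rw [coordBracket_congr .rfl rfl e₃ .rfl]
    refine (h'.antisymm hSP s₃).self_of_nhds.trans ?_
    beta_reduce
    rw [← hz₀, coordBracket_neg, neg_neg, coordBracket_smul_add_smul (hf.differentiable (by simp) z₀)
        (hlV.self_of_nhds.differentiableAt (by simp))
        (hC₂.self_of_nhds.1.differentiableAt (by simp)) hκd hfz, hfd, dV]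
  rw [← hz₀, t₁, t₂, t₃] at J
  rw [← J, map_sub, map_sub]
  module

/-- The anchor maps the bracket to the commutator of vector fields. -/
theorem IsLocalSection.anchor_bracket (hSP : IsPolyPoisson S P s)
    {η γ : E → E →L[ℝ] (Fin r → ℝ)} {V U : E → E} (h : IsLocalSection P x₀ η V)
    (h' : IsLocalSection P x₀ γ U) :
    (coordBracket V U η γ (chartAt E x₀ x₀),
      fderiv ℝ U (chartAt E x₀ x₀) (V (chartAt E x₀ x₀)) -
        fderiv ℝ V (chartAt E x₀ x₀) (U (chartAt E x₀ x₀))) ∈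
      anchorGraph P (TubeChart.const E x₀) (0, chartAt E x₀ x₀) := by
  obtain ⟨B, hB⟩ := h.exists_bracket hSP h'
  have hB0 := hB.self_of_nhds.2
  suffices hw : B (chartAt E x₀ x₀) - (fderiv ℝ U (chartAt E x₀ x₀) (V (chartAt E x₀ x₀)) -
      fderiv ℝ V (chartAt E x₀ x₀) (U (chartAt E x₀ x₀))) = 0 by
    rwa [← sub_eq_zero.1 hw]
  by_contra hw
  obtain ⟨l, hl⟩ := SeparatingDual.exists_eq_one (R := ℝ) hw
  -- If the defect were nonzero, a functional `l` with value `1` on it would force every section of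
  -- `S` to vanish at the point. Every vector, the defect included, would then be annihilated by
  -- `S`, contradicting `S° = 0`.
  refine hw (anchorGraph_annihilator (P := P) hSP.annihilator (const_mem_target (mem_chart_target E x₀))
    fun ζ v hζ => ?_)
  obtain ⟨κ, T, hκ, rfl⟩ := IsLocalSection.exists_of_mem (P := P) hSP (mem_sCoord_iff.2 ⟨v, hζ⟩)
  have := h.anchor_smul_eq_zero hSP h' hB hκ l
  rw [hl, one_smul] at this
  rw [this]
  rfl

end Algebroid

/-! ### Anchored frames along a path -/

section Frames

variable {Y : Type*} [NormedAddCommGroup Y] [NormedSpace ℝ Y]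
  {Q : Type*} [NormedAddCommGroup Q] [NormedSpace ℝ Q] [FiniteDimensional ℝ Q]
  {R : Type*} [NormedAddCommGroup R] [NormedSpace ℝ R] [FiniteDimensional ℝ R]
  {W : Type*} [NormedAddCommGroup W] [NormedSpace ℝ W] [FiniteDimensional ℝ W]
  {F : Type*} [NormedAddCommGroup F] [NormedSpace ℝ F]

/-- On the open set `N`, the first components of `Φ` are a smooth frame of the domain of the
relation `G`, with anchor `V`, and the second components of `Φ` are a frame of a complement. -/
structure IsAnchoredFrame (G : Y → Submodule ℝ (W × F)) (Φ : Y → Q × R →L[ℝ] W) (V : Y → Q →L[ℝ] F)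
    (N : Set Y) : Prop where
  isOpen : IsOpen N
  smooth : ContDiffOn ℝ ∞ Φ N
  smooth_anchor : ContDiffOn ℝ ∞ V N
  exists_equiv : ∀ p ∈ N, ∃ A : (Q × R) ≃L[ℝ] W, (A : Q × R →L[ℝ] W) = Φ p
  mem : ∀ p ∈ N, ∀ a, (Φ p (a, 0), V p a) ∈ G p

/-- The image of `Q × 0` lies in `S` and has the same dimension, hence is all of `S`. -/
theorem equiv_mem_iff_snd_eq_zero {S : Submodule ℝ W} (hS : Module.finrank ℝ S = Module.finrank ℝ Q)
    (A : (Q × R) ≃L[ℝ] W) (hA : ∀ a, A (a, 0) ∈ S) (q : Q × R) : A q ∈ S ↔ q.2 = 0 := by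
  have hinj : Function.Injective (A.toLinearMap ∘ₗ LinearMap.inl ℝ Q R) :=
    A.injective.comp LinearMap.inl_injective
  have h : LinearMap.range (A.toLinearMap ∘ₗ LinearMap.inl ℝ Q R) = S := by
    refine Submodule.eq_of_le_of_finrank_eq ?_ ?_
    · rintro _ ⟨a, rfl⟩
      exact hA a
    · rw [LinearMap.finrank_range_of_inj hinj, hS]
  constructor
  · intro hq
    rw [← h] at hq
    obtain ⟨a, ha⟩ := hq
    have := A.injective ha
    rw [← this]
    rfl
  · obtain ⟨a, b⟩ := q
    rintro rfl
    exact hA a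

/-- A frame valid up to time `b` is blended with a local frame that has first been normalized to
agree with it at `b`. Covectors and anchors are combined with the same weights. Since `G p` is a
linear subspace, the blended pairs still belong to it, and near `b` the blend is still invertible.
-/
theorem IsAnchoredFrame.glue {E : Type*} [NormedAddCommGroup E] [NormedSpace ℝ E]
    {G : ℝ × E → Submodule ℝ (W × F)} {S : ℝ × E → Submodule ℝ W}
    (hGS : ∀ p ζ v, (ζ, v) ∈ G p → ζ ∈ S p) {u : I → E} (hu : Continuous u)
    (hdim : ∀ t : I, Module.finrank ℝ (S ((t : ℝ), u t)) = Module.finrank ℝ Q) (t₀ : I)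
    {f : ℝ × E → Q × R →L[ℝ] W} {v : ℝ × E → Q →L[ℝ] F} {N₀ : Set (ℝ × E)}
    (hf : IsAnchoredFrame G f v N₀) (h₀ : ((t₀ : ℝ), u t₀) ∈ N₀) :
    ∃ U ∈ 𝓝 t₀, ∀ b ∈ U, ∀ b' ∈ U,
      (∃ (Φ : ℝ × E → Q × R →L[ℝ] W) (V : ℝ × E → Q →L[ℝ] F) (N : Set (ℝ × E)),
        IsAnchoredFrame G Φ V N ∧ ∀ t ≤ b, ((t : ℝ), u t) ∈ N) →
      ∃ (Φ : ℝ × E → Q × R →L[ℝ] W) (V : ℝ × E → Q →L[ℝ] F) (N : Set (ℝ × E)),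
        IsAnchoredFrame G Φ V N ∧ ∀ t ≤ b', ((t : ℝ), u t) ∈ N := by
  have hp : Continuous fun t : I => ((t : ℝ), u t) := by fun_prop
  obtain ⟨ε, hε, hεu⟩ := Metric.mem_nhds_iff.1 ((hf.isOpen.preimage hp).mem_nhds h₀)
  refine ⟨_, Metric.ball_mem_nhds t₀ hε, fun b hb b' hb' => ?_⟩
  rintro ⟨Φ, V, N, hΦ, hN⟩
  rcases le_total b' b with hle | hle
  · exact ⟨Φ, V, N, hΦ, fun t ht => hN t (ht.trans hle)⟩
  have hbN := hN b le_rfl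
  have hbN₀ : ((b : ℝ), u b) ∈ N₀ := hεu hb
  obtain ⟨A, hA⟩ := hΦ.exists_equiv _ hbN
  obtain ⟨B, hB⟩ := hf.exists_equiv _ hbN₀
  -- The constant change of frame that makes the local frame equal to the given one at time `b`. It
  -- maps `Q × 0` to itself, because both frames send this subspace onto the same fibre, and `C'` is
  -- the induced map of `Q`.
  let C : (Q × R) ≃L[ℝ] (Q × R) := A.trans B.symm
  let C' : Q →L[ℝ] Q := (ContinuousLinearMap.fst ℝ Q R).comp
    ((C : Q × R →L[ℝ] Q × R).comp (ContinuousLinearMap.inl ℝ Q R))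
  have hBC : ∀ q, B (C q) = A q := fun q => B.apply_symm_apply _
  have hC : ∀ a, C (a, 0) = (C' a, 0) := by
    intro a
    refine Prod.ext rfl ?_
    refine (equiv_mem_iff_snd_eq_zero (hdim b) B (fun a => ?_) (C (a, 0))).1 ?_
    · have := hf.mem _ hbN₀ a
      rw [← hB] at this
      exact hGS _ _ _ this
    · have := hΦ.mem _ hbN a
      rw [← hA] at this
      rw [hBC]
      exact hGS _ _ _ this
  have hopenW : IsOpen (range ((↑) : ((Q × R) ≃L[ℝ] W) → Q × R →L[ℝ] W)) :=
    ContinuousLinearEquiv.isOpen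
  obtain ⟨ρ, hρ, hρA⟩ := Metric.isOpen_iff.1 hopenW (A : Q × R →L[ℝ] W) ⟨A, rfl⟩
  let f' : ℝ × E → Q × R →L[ℝ] W := fun p => (f p).comp (C : Q × R →L[ℝ] Q × R)
  have hf's : ContDiffOn ℝ ∞ f' N₀ := hf.smooth.clm_comp contDiffOn_const
  have hv's : ContDiffOn ℝ ∞ (fun p => (v p).comp C') N₀ := hf.smooth_anchor.clm_comp contDiffOn_const
  have hf'b : f' ((b : ℝ), u b) = A := by
    refine ContinuousLinearMap.ext fun q => ?_
    change f _ (C q) = A q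
    rw [← hBC, ← hB]
    rfl
  have hf'mem : ∀ p ∈ N₀, ∀ a, (f' p (a, 0), (v p).comp C' a) ∈ G p := by
    intro p hp a
    have h1 : f' p (a, 0) = f p (C' a, 0) := congrArg (f p) (hC a)
    rw [h1]
    exact hf.mem p hp (C' a)
  let O : Set (ℝ × E) := N ∩ N₀ ∩ {p | Φ p ∈ Metric.ball (A : Q × R →L[ℝ] W) ρ ∧
    f' p ∈ Metric.ball (A : Q × R →L[ℝ] W) ρ}
  have hO : IsOpen O := by
    have h1 : ContinuousOn (fun p => (Φ p, f' p)) (N ∩ N₀) :=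
      (hΦ.smooth.continuousOn.mono inter_subset_left).prodMk
        (hf's.continuousOn.mono inter_subset_right)
    exact h1.isOpen_inter_preimage (hΦ.isOpen.inter hf.isOpen)
      (Metric.isOpen_ball.prod Metric.isOpen_ball)
  have hbO : ((b : ℝ), u b) ∈ O := by
    refine ⟨⟨hbN, hbN₀⟩, ?_, ?_⟩
    · rw [← hA]; exact Metric.mem_ball_self hρ
    · rw [hf'b]; exact Metric.mem_ball_self hρ
  obtain ⟨δ, hδ, hδ'⟩ := Metric.mem_nhds_iff.1 ((hO.preimage hp).mem_nhds hbO)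
  have hδb : ∀ t : I, (b : ℝ) - δ / 2 ≤ t → t ≤ b → ((t : ℝ), u t) ∈ O := fun t h1 h2 => hδ' (by
    have h2' : (t : ℝ) ≤ b := h2
    rw [Metric.mem_ball, Subtype.dist_eq, Real.dist_eq, abs_lt]
    constructor <;> linarith)
  let χ : ℝ → ℝ := fun t => Real.smoothTransition (4 * (t - b) / δ + 2)
  have hχ : ContDiff ℝ ∞ fun p : ℝ × E => χ p.1 :=
    Real.smoothTransition.contDiff.comp (by fun_prop)
  have hχ0 : ∀ t : ℝ, t < b - δ / 2 → χ t = 0 := fun t ht =>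
    Real.smoothTransition.zero_of_nonpos (by
      have : 4 * (t - b) / δ ≤ -2 := by rw [div_le_iff₀ hδ]; linarith
      linarith)
  have hχ1 : ∀ t : ℝ, (b : ℝ) - δ / 4 < t → χ t = 1 := fun t ht =>
    Real.smoothTransition.one_of_one_le (by
      have : -1 ≤ 4 * (t - b) / δ := by rw [le_div_iff₀ hδ]; linarith
      linarith)
  -- On `N₁` this is the old frame, on `N₃` the normalized local frame, and on `O` a convex
  -- combination of operators from one ball of invertible ones.
  let Φ' : ℝ × E → Q × R →L[ℝ] W := fun p => (1 - χ p.1) • Φ p + χ p.1 • f' p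
  let V' : ℝ × E → Q →L[ℝ] F := fun p => (1 - χ p.1) • V p + χ p.1 • (v p).comp C'
  let N₁ : Set (ℝ × E) := N ∩ {p | p.1 < b - δ / 2}
  let N₃ : Set (ℝ × E) := N₀ ∩ {p | (b : ℝ) - δ / 4 < p.1}
  have hN₁ : IsOpen N₁ := hΦ.isOpen.inter (isOpen_lt continuous_fst continuous_const)
  have hN₃ : IsOpen N₃ := hf.isOpen.inter (isOpen_lt continuous_const continuous_fst)
  have e₁ : ∀ p ∈ N₁, Φ' p = Φ p ∧ V' p = V p := by
    rintro p ⟨-, hp⟩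
    simp [Φ', V', hχ0 p.1 hp]
  have e₃ : ∀ p ∈ N₃, Φ' p = f' p ∧ V' p = (v p).comp C' := by
    rintro p ⟨-, hp⟩
    simp [Φ', V', hχ1 p.1 hp]
  have hk : IsAnchoredFrame G Φ' V' (N₁ ∪ O ∪ N₃) := by
    refine ⟨(hN₁.union hO).union hN₃, ?_, ?_, ?_, ?_⟩
    · rintro p ((hp | hp) | hp)
      · exact (((hΦ.smooth.mono inter_subset_left).congr fun p hp => (e₁ p hp).1).contDiffAt
          (hN₁.mem_nhds hp)).contDiffWithinAt
      · exact ((((contDiff_const.sub hχ).contDiffOn.smul (hΦ.smooth.mono fun p hp => hp.1.1)).add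
          (hχ.contDiffOn.smul (hf's.mono fun p hp => hp.1.2))).contDiffAt
            (hO.mem_nhds hp)).contDiffWithinAt
      · exact (((hf's.mono inter_subset_left).congr fun p hp => (e₃ p hp).1).contDiffAt
          (hN₃.mem_nhds hp)).contDiffWithinAt
    · rintro p ((hp | hp) | hp)
      · exact (((hΦ.smooth_anchor.mono inter_subset_left).congr fun p hp => (e₁ p hp).2).contDiffAt
          (hN₁.mem_nhds hp)).contDiffWithinAt
      · exact ((((contDiff_const.sub hχ).contDiffOn.smul
          (hΦ.smooth_anchor.mono fun p hp => hp.1.1)).add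
          (hχ.contDiffOn.smul (hv's.mono fun p hp => hp.1.2))).contDiffAt
            (hO.mem_nhds hp)).contDiffWithinAt
      · exact (((hv's.mono inter_subset_left).congr fun p hp => (e₃ p hp).2).contDiffAt
          (hN₃.mem_nhds hp)).contDiffWithinAt
    · rintro p ((hp | hp) | hp)
      · rw [(e₁ p hp).1]
        exact hΦ.exists_equiv p hp.1
      · exact hρA (convex_ball _ _ hp.2.1 hp.2.2 (sub_nonneg.2 (Real.smoothTransition.le_one _))
          (Real.smoothTransition.nonneg _) (by ring))
      · obtain ⟨B', hB'⟩ := hf.exists_equiv p hp.1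
        rw [(e₃ p hp).1]
        refine ⟨C.trans B', ?_⟩
        change _ = (f p).comp _
        rw [← hB']
        rfl
    · rintro p ((hp | hp) | hp) a
      · rw [(e₁ p hp).1, (e₁ p hp).2]
        exact hΦ.mem p hp.1 a
      · exact Submodule.add_mem _ (Submodule.smul_mem _ (1 - χ p.1) (hΦ.mem p hp.1.1 a))
          (Submodule.smul_mem _ (χ p.1) (hf'mem p hp.1.2 a))
      · rw [(e₃ p hp).1, (e₃ p hp).2]
        exact hf'mem p hp.1 a
  refine ⟨Φ', V', _, hk, fun t ht => ?_⟩
  rcases lt_or_ge (t : ℝ) (b - δ / 2) with h1 | h1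
  · have h2 : (t : ℝ) ≤ b := by linarith
    exact Or.inl (Or.inl ⟨hN t h2, h1⟩)
  rcases le_or_gt t b with h2 | h2
  · exact Or.inl (Or.inr (hδb t h1 h2))
  · have h2' : (b : ℝ) < t := h2
    refine Or.inr ⟨hεu ?_, ?_⟩
    · rw [Metric.mem_ball, Subtype.dist_eq, Real.dist_eq, abs_lt] at hb hb' ⊢
      have : (t : ℝ) ≤ b' := ht
      constructor <;> linarith
    · change (b : ℝ) - δ / 4 < t
      linarith

theorem exists_isAnchoredFrame {E : Type*} [NormedAddCommGroup E] [NormedSpace ℝ E]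
    {G : ℝ × E → Submodule ℝ (W × F)} {S : ℝ × E → Submodule ℝ W}
    (hGS : ∀ p ζ v, (ζ, v) ∈ G p → ζ ∈ S p) {u : I → E} (hu : Continuous u)
    (hdim : ∀ t : I, Module.finrank ℝ (S ((t : ℝ), u t)) = Module.finrank ℝ Q)
    (hloc : ∀ t : I, ∃ (Φ : ℝ × E → Q × R →L[ℝ] W) (V : ℝ × E → Q →L[ℝ] F) (N : Set (ℝ × E)),
      IsAnchoredFrame G Φ V N ∧ ((t : ℝ), u t) ∈ N) :
    ∃ (Φ : ℝ × E → Q × R →L[ℝ] W) (V : ℝ × E → Q →L[ℝ] F) (N : Set (ℝ × E)),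
      IsAnchoredFrame G Φ V N ∧ ∀ t : I, ((t : ℝ), u t) ∈ N := by
  obtain ⟨Φ, V, N, h, hN⟩ := unitInterval_induction
    (R := fun b => ∃ (Φ : ℝ × E → Q × R →L[ℝ] W) (V : ℝ × E → Q →L[ℝ] F) (N : Set (ℝ × E)),
      IsAnchoredFrame G Φ V N ∧ ∀ t ≤ b, ((t : ℝ), u t) ∈ N)
    (by
      obtain ⟨Φ, V, N, h, hN⟩ := hloc 0
      refine ⟨Φ, V, N, h, fun t ht => ?_⟩
      obtain rfl : t = 0 := le_antisymm ht unitInterval.nonneg'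
      exact hN)
    (fun t₀ => by
      obtain ⟨f, v, N₀, hf, h₀⟩ := hloc t₀
      exact IsAnchoredFrame.glue hGS hu hdim t₀ hf h₀) 1
  exact ⟨Φ, V, N, h, fun t => hN t unitInterval.le_one'⟩

end Frames

/-! ### Anchored frames of a poly-Poisson structure -/

section Local

variable {E : Type u} [NormedAddCommGroup E] [NormedSpace ℝ E] [FiniteDimensional ℝ E]
  {M : Type v} [TopologicalSpace M] [ChartedSpace E M] [IsManifold 𝓘(ℝ, E) ∞ M] {r : ℕ}
  {S : ∀ x : M, Submodule ℝ (CoVel E M r x)} {P : ∀ x : M, S x →ₗ[ℝ] TangentSpace 𝓘(ℝ, E) x}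
  {s : ℕ} {τ : TubeChart E M}

theorem pullCov_injective {p : ℝ × E} (hp : p ∈ τ.toHomeo.target) :
    Function.Injective (τ.pullCov (r := r) p) := by
  intro ζ ζ' h
  have h1 := τ.covCoord_covOf (t := p.1) (y := p.2) hp ζ
  have h2 := τ.covCoord_covOf (t := p.1) (y := p.2) hp ζ'
  rw [← h1, ← h2]
  change τ.covCoord p.1 ⟨_, τ.pullCov p ζ⟩ = τ.covCoord p.1 ⟨_, τ.pullCov p ζ'⟩
  rw [h]

theorem exists_frame_sCoord (hS : IsSubbundle S s) {p₀ : ℝ × E} (hp₀ : p₀ ∈ τ.toHomeo.target) :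
    ∃ (e : Fin s → ∀ x : M, S x) (U : Set M) (N : Set (ℝ × E)), IsOpen U ∧ IsOpen N ∧ p₀ ∈ N ∧
      N = {p | p ∈ τ.toHomeo.target ∧ τ.inv p.1 p.2 ∈ U} ∧
      (∀ i, SmoothFormOn (fun x => (e i x).1) U) ∧ ∀ p ∈ N,
        LinearIndependent ℝ (fun i => τ.formIn (fun x => (e i x).1) p) ∧
        Submodule.span ℝ (range fun i => τ.formIn (fun x => (e i x).1) p) = sCoord S τ p := by
  classical
  obtain ⟨U', hU', e, he, heS⟩ := hS (τ.inv p₀.1 p₀.2)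
  obtain ⟨U, hUU', hU, hpU⟩ := mem_nhds_iff.1 hU'
  have hmem : ∀ x ∈ U, ∀ i, e i x ∈ S x := fun x hx i => by
    rw [← (heS x (hUU' hx)).2]
    exact Submodule.subset_span ⟨i, rfl⟩
  -- The value `0` is used only where the frame leaves `S`, which does not happen on `U`.
  let e' : Fin s → ∀ x : M, S x := fun i x => if h : e i x ∈ S x then ⟨e i x, h⟩ else 0
  have he' : ∀ x ∈ U, ∀ i, (e' i x).1 = e i x := fun x hx i => by
    simp only [e', dif_pos (hmem x hx i)]
  refine ⟨e', U, _, hU, τ.isOpen_inv_preimage hU, ⟨hp₀, hpU⟩, rfl, fun i => ?_, ?_⟩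
  · refine ((he i).mono hUU').congr fun x hx => ?_
    exact congrArg (TotalSpace.mk' _ x) (he' x hx i)
  · rintro p ⟨hp, hpU⟩
    have h1 : ∀ i, τ.pullCov p (τ.formIn (fun x => (e' i x).1) p) = e i (τ.inv p.1 p.2) := fun i =>
      (covOf_formIn hp _).trans (he' _ hpU i)
    obtain ⟨h2, h3⟩ := heS _ (hUU' hpU)
    have hli : LinearIndependent ℝ (fun i => τ.formIn (fun x => (e' i x).1) p) := by
      refine LinearIndependent.of_comp (τ.pullCov p) ?_
      convert h2 using 1
      exact funext h1
    refine ⟨hli, le_antisymm ?_ ?_⟩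
    · rw [Submodule.span_le]
      rintro _ ⟨i, rfl⟩
      exact formIn_mem_sCoord hp (e' i _).2
    · intro ζ hζ
      have h4 : τ.pullCov p ζ ∈ S (τ.inv p.1 p.2) := hζ
      rw [← h3, Submodule.mem_span_range_iff_exists_fun] at h4
      obtain ⟨a, ha⟩ := h4
      rw [Submodule.mem_span_range_iff_exists_fun]
      refine ⟨a, pullCov_injective hp ?_⟩
      rw [map_sum, ← ha]
      refine Finset.sum_congr rfl fun i _ => ?_
      rw [map_smul, h1]

theorem finrank_sCoord (hS : IsSubbundle S s) {p : ℝ × E} (hp : p ∈ τ.toHomeo.target) :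
    Module.finrank ℝ (sCoord S τ p) = s := by
  obtain ⟨e, U, N, -, -, hpN, -, -, h⟩ := exists_frame_sCoord hS hp
  obtain ⟨h1, h2⟩ := h p hpN
  rw [← h2, finrank_span_eq_card h1, Fintype.card_fin]

/-- The corank of the subbundle. -/
def corank (E : Type u) [NormedAddCommGroup E] [NormedSpace ℝ E] (r s : ℕ) : ℕ :=
  Module.finrank ℝ (E →L[ℝ] (Fin r → ℝ)) - s

/-- A complement of the fibre at the single point `p₀` is kept constant. Together with a smooth
frame of the subbundle it gives an invertible operator at `p₀`, hence also near `p₀`. -/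
theorem exists_local_anchoredFrame (hSP : IsPolyPoisson S P s) {p₀ : ℝ × E}
    (hp₀ : p₀ ∈ τ.toHomeo.target) :
    ∃ (Φ : ℝ × E → (Fin s → ℝ) × (Fin (corank E r s) → ℝ) →L[ℝ] E →L[ℝ] (Fin r → ℝ))
      (V : ℝ × E → (Fin s → ℝ) →L[ℝ] E) (N : Set (ℝ × E)),
      IsAnchoredFrame (anchorGraph P τ) Φ V N ∧ p₀ ∈ N ∧ N ⊆ τ.toHomeo.target := by
  obtain ⟨e, U, N, hU, hN, hpN, hNU, he, h⟩ := exists_frame_sCoord hSP.subbundle hp₀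
  obtain ⟨C, hC⟩ := Submodule.exists_isCompl (sCoord S τ p₀)
  -- The subtraction of natural numbers in `corank` is a genuine one, since `s` plus the dimension
  -- of the complement is the full dimension.
  have hdC : Module.finrank ℝ C = corank E r s := by
    have h1 := Submodule.finrank_add_eq_of_isCompl hC
    rw [finrank_sCoord hSP.subbundle hp₀] at h1
    rw [corank]
    omega
  have : Module.Free ℝ C := Module.Free.of_divisionRing ℝ C
  have : Module.Finite ℝ C := FiniteDimensional.finiteDimensional_submodule C
  obtain ⟨κ⟩ : Nonempty ((Fin (corank E r s) → ℝ) ≃ₗ[ℝ] C) :=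
    FiniteDimensional.nonempty_linearEquiv_of_finrank_eq (by simp [hdC])
  let κ' : (Fin (corank E r s) → ℝ) →L[ℝ] E →L[ℝ] (Fin r → ℝ) :=
    LinearMap.toContinuousLinearMap (C.subtype ∘ₗ κ.toLinearMap)
  let pr : Fin s → ((Fin s → ℝ) →L[ℝ] ℝ) := fun i => ContinuousLinearMap.proj i
  let Φ : ℝ × E → (Fin s → ℝ) × (Fin (corank E r s) → ℝ) →L[ℝ] E →L[ℝ] (Fin r → ℝ) := fun p =>
    (∑ i, (pr i).smulRight (τ.formIn (fun x => (e i x).1) p)).comp (.fst ℝ _ _) +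
      κ'.comp (.snd ℝ _ _)
  let V : ℝ × E → (Fin s → ℝ) →L[ℝ] E := fun p =>
    ∑ i, (pr i).smulRight (τ.fieldIn (fun x => P x (e i x)) p)
  have hΦa : ∀ p a b, Φ p (a, b) = ∑ i, a i • τ.formIn (fun x => (e i x).1) p + κ' b := by
    intro p a b
    simp only [Φ, pr, add_apply, ContinuousLinearMap.comp_apply, sum_apply,
      ContinuousLinearMap.smulRight_apply, ContinuousLinearMap.coe_fst',
      ContinuousLinearMap.coe_snd', ContinuousLinearMap.proj_apply]
  have hVa : ∀ p a, V p a = ∑ i, a i • τ.fieldIn (fun x => P x (e i x)) p := by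
    intro p a
    simp only [V, pr, sum_apply, ContinuousLinearMap.smulRight_apply,
      ContinuousLinearMap.proj_apply]
  have hΦs : ContDiffOn ℝ ∞ Φ N := by
    refine (ContDiffOn.clm_comp (ContDiffOn.sum fun i _ => ?_) contDiffOn_const).add
      contDiffOn_const
    refine contDiffOn_const.smulRight ?_
    rw [hNU]
    exact τ.contDiffOn_formIn hU (he i)
  have hVs : ContDiffOn ℝ ∞ V N := by
    refine ContDiffOn.sum fun i _ => contDiffOn_const.smulRight ?_
    rw [hNU]
    exact τ.contDiffOn_fieldIn hU (hSP.smooth_anchor U (e i) hU (he i))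
  have hinj : Function.Injective (Φ p₀) := by
    rw [injective_iff_map_eq_zero]
    rintro ⟨a, b⟩ hab
    rw [hΦa] at hab
    have h1 : ∑ i, a i • τ.formIn (fun x => (e i x).1) p₀ ∈ sCoord S τ p₀ := by
      rw [← (h p₀ hpN).2]
      exact Submodule.sum_mem _ fun i _ => Submodule.smul_mem _ _ (Submodule.subset_span ⟨i, rfl⟩)
    have h2 : κ' b ∈ C := (κ b).2
    have h3 : κ' b = 0 := by
      have h4 : κ' b ∈ sCoord S τ p₀ := by
        rw [eq_neg_of_add_eq_zero_right hab]
        exact Submodule.neg_mem _ h1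
      have := hC.disjoint.le_bot ⟨h4, h2⟩
      exact (Submodule.mem_bot ℝ).1 this
    have h5 : b = 0 := κ.injective (Subtype.ext (h3.trans (by simp)))
    rw [h3, add_zero] at hab
    have h6 := Fintype.linearIndependent_iff.1 (h p₀ hpN).1 a hab
    exact Prod.ext (funext h6) h5
  have hfr : Module.finrank ℝ ((Fin s → ℝ) × (Fin (corank E r s) → ℝ)) =
      Module.finrank ℝ (E →L[ℝ] (Fin r → ℝ)) := by
    have h1 := Submodule.finrank_add_eq_of_isCompl hC
    rw [finrank_sCoord hSP.subbundle hp₀, hdC] at h1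
    simp [Module.finrank_prod, h1]
  let A : ((Fin s → ℝ) × (Fin (corank E r s) → ℝ)) ≃L[ℝ] (E →L[ℝ] (Fin r → ℝ)) :=
    (LinearEquiv.ofInjectiveOfFinrankEq (Φ p₀).toLinearMap hinj hfr).toContinuousLinearEquiv
  have hA : (A : _ →L[ℝ] (E →L[ℝ] (Fin r → ℝ))) = Φ p₀ := ContinuousLinearMap.ext fun q => rfl
  let N' := N ∩ Φ ⁻¹' range ((↑) : (((Fin s → ℝ) × (Fin (corank E r s) → ℝ)) ≃L[ℝ]
    (E →L[ℝ] (Fin r → ℝ))) → _ →L[ℝ] (E →L[ℝ] (Fin r → ℝ)))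
  have hN' : IsOpen N' := hΦs.continuousOn.isOpen_inter_preimage hN ContinuousLinearEquiv.isOpen
  refine ⟨Φ, V, N', ⟨hN', hΦs.mono inter_subset_left, hVs.mono inter_subset_left,
    fun p hp => hp.2, fun p hp a => ?_⟩, ⟨hpN, A, hA⟩, fun p hp => ?_⟩
  · have hp1 : p ∈ τ.toHomeo.target := by have := hp.1; rw [hNU] at this; exact this.1
    rw [hΦa, hVa, map_zero, add_zero]
    have h1 := Submodule.sum_mem (anchorGraph P τ p) (t := Finset.univ)
      (f := fun i => a i • (τ.formIn (fun x => (e i x).1) p, τ.fieldIn (fun x => P x (e i x)) p))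
      fun i _ => Submodule.smul_mem _ _ (formIn_mem_anchorGraph hp1 (e i))
    convert h1 using 1
    simp only [Prod.smul_mk, Prod.ext_iff, Prod.fst_sum, Prod.snd_sum, and_self]
  · have := hp.1; rw [hNU] at this; exact this.1

/-- Every path in the domain of a time-dependent chart has an anchored frame. -/
theorem exists_anchoredFrame (hSP : IsPolyPoisson S P s) {u : I → E} (hu : Continuous u)
    (h : ∀ t : I, ((t : ℝ), u t) ∈ τ.toHomeo.target) :
    ∃ (Φ : ℝ × E → (Fin s → ℝ) × (Fin (corank E r s) → ℝ) →L[ℝ] E →L[ℝ] (Fin r → ℝ))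
      (V : ℝ × E → (Fin s → ℝ) →L[ℝ] E) (N : Set (ℝ × E)),
      IsAnchoredFrame (anchorGraph P τ) Φ V N ∧ N ⊆ τ.toHomeo.target ∧
        ∀ t : I, ((t : ℝ), u t) ∈ N := by
  obtain ⟨Φ, V, N, hΦ, hN⟩ := exists_isAnchoredFrame (Q := Fin s → ℝ)
    (R := Fin (corank E r s) → ℝ) (S := sCoord S τ)
    (fun p ζ v hv => mem_sCoord_iff.2 ⟨v, hv⟩) hu
    (fun t => by rw [finrank_sCoord hSP.subbundle (h t)]; simp) fun t => by
      obtain ⟨Φ, V, N, h1, h2, -⟩ := exists_local_anchoredFrame hSP (h t)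
      exact ⟨Φ, V, N, h1, h2⟩
  exact ⟨Φ, V, N ∩ τ.toHomeo.target, ⟨hΦ.isOpen.inter τ.toHomeo.open_target,
    hΦ.smooth.mono inter_subset_left, hΦ.smooth_anchor.mono inter_subset_left,
    fun p hp => hΦ.exists_equiv p hp.1, fun p hp => hΦ.mem p hp.1⟩, inter_subset_right,
    fun t => ⟨hN t, h t⟩⟩

theorem IsAnchoredFrame.apply_mem_sCoord_iff (hS : IsSubbundle S s)
    {Φ : ℝ × E → (Fin s → ℝ) × (Fin (corank E r s) → ℝ) →L[ℝ] E →L[ℝ] (Fin r → ℝ)}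
    {V : ℝ × E → (Fin s → ℝ) →L[ℝ] E} {N : Set (ℝ × E)}
    (h : IsAnchoredFrame (anchorGraph P τ) Φ V N) {p : ℝ × E} (hp : p ∈ N)
    (hpt : p ∈ τ.toHomeo.target) (q : (Fin s → ℝ) × (Fin (corank E r s) → ℝ)) :
    Φ p q ∈ sCoord S τ p ↔ q.2 = 0 := by
  obtain ⟨A, hA⟩ := h.exists_equiv p hp
  have := equiv_mem_iff_snd_eq_zero (S := sCoord S τ p)
    (by rw [finrank_sCoord hS hpt]; simp) A (fun a => by
      have := h.mem p hp a
      rw [← hA] at this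
      exact mem_sCoord_iff.2 ⟨_, this⟩) q
  rw [← hA]
  exact this

end Local

/-! ### The structure equations in time-dependent charts -/

section Structure

/-- Difference quotients lie in the subspace, and a finite-dimensional subspace is closed. Applied
to the graph of the anchor at a fixed point of `M`, this yields the infinitesimal invariance of the
anchor relation. -/
theorem Submodule.hasDerivAt_mem {F : Type*} [NormedAddCommGroup F] [NormedSpace ℝ F]
    [FiniteDimensional ℝ F] (G : Submodule ℝ F) {m : ℝ → F} {m' : F} {t : ℝ}
    (h : HasDerivAt m m' t) (hm : ∀ᶠ s in 𝓝 t, m s ∈ G) : m' ∈ G := by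
  refine G.closed_of_finiteDimensional.mem_of_tendsto (hasDerivAt_iff_tendsto_slope.1 h) ?_
  filter_upwards [hm.filter_mono nhdsWithin_le_nhds] with s hs
  rw [slope_def_module]
  exact G.smul_mem _ (G.sub_mem hs hm.self_of_nhds)

/-- The differential of a time-dependent map evolves by the differential of its velocity. -/
theorem hasDerivAt_fderiv_inr {E : Type*} [NormedAddCommGroup E] [NormedSpace ℝ E] {h T : ℝ × E → E}
    {t : ℝ} {z : E} (hh : ContDiffAt ℝ ∞ h (t, z))
    (hT : DifferentiableAt ℝ (fun y => T (t, y)) (h (t, z)))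
    (e : (fun z => T (t, h (t, z))) =ᶠ[𝓝 z] fun z => fderiv ℝ h (t, z) ((1 : ℝ), (0 : E))) :
    HasDerivAt (fun s => (fderiv ℝ h (s, z)).comp (.inr ℝ ℝ E))
      ((fderiv ℝ (fun y => T (t, y)) (h (t, z))).comp ((fderiv ℝ h (t, z)).comp (.inr ℝ ℝ E))) t := by
  have h2 : HasFDerivAt (fderiv ℝ h) (fderiv ℝ (fderiv ℝ h) (t, z)) (t, z) :=
    ((hh.fderiv_right (m := ∞) (by simp)).differentiableAt (by simp)).hasFDerivAt
  have h3 : HasDerivAt (fun s : ℝ => (s, z)) (1, 0) t :=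
    (hasDerivAt_id t).prodMk (hasDerivAt_const t z)
  have h1 := h2.comp_hasDerivAt t h3
  have h4 : HasDerivAt (fun s => (fderiv ℝ h (s, z)).comp (.inr ℝ ℝ E))
      ((fderiv ℝ (fderiv ℝ h) (t, z) (1, 0)).comp (.inr ℝ ℝ E)) t :=
    (((ContinuousLinearMap.compL ℝ E (ℝ × E) E).flip (.inr ℝ ℝ E)).hasFDerivAt).comp_hasDerivAt t h1
  refine h4.congr_deriv (ContinuousLinearMap.ext fun w => ?_)
  have h5 : HasFDerivAt (fun z => T (t, h (t, z))) ((fderiv ℝ (fun y => T (t, y)) (h (t, z))).comp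
      ((fderiv ℝ h (t, z)).comp (.inr ℝ ℝ E))) z :=
    HasFDerivAt.comp (g := fun y => T (t, y)) z hT.hasFDerivAt
      ((hh.differentiableAt (by simp)).hasFDerivAt.comp z (hasFDerivAt_prodMk_right t z))
  have h6 := h2.comp z (hasFDerivAt_prodMk_right t z)
  have h7 : HasFDerivAt (fun z => fderiv ℝ h (t, z) ((1 : ℝ), (0 : E)))
      ((ContinuousLinearMap.apply ℝ E ((1 : ℝ), (0 : E))).comp
        ((fderiv ℝ (fderiv ℝ h) (t, z)).comp (.inr ℝ ℝ E))) z :=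
    (ContinuousLinearMap.apply ℝ E ((1 : ℝ), (0 : E))).hasFDerivAt.comp z h6
  have h9 := DFunLike.congr_fun (h5.unique (h7.congr_of_eventuallyEq e)) w
  have h10 := (hh.isSymmSndFDerivAt (by
    simp only [minSmoothness_of_isRCLikeNormedField]
    exact ENat.LEInfty.out)).eq ((1 : ℝ), (0 : E)) ((0 : ℝ), w)
  exact h10.trans h9.symm

variable {E : Type u} [NormedAddCommGroup E] [NormedSpace ℝ E]
  {M : Type v} [TopologicalSpace M] [ChartedSpace E M] [IsManifold 𝓘(ℝ, E) ∞ M] {r : ℕ}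

namespace TubeChart

variable (τ : TubeChart E M)

/-- The velocity of the points of `M` in a time-dependent chart. -/
def velocity (p : ℝ × E) : E := deriv (fun s => τ.slice s (τ.inv p.1 p.2)) p.1

variable {τ}

theorem hasFDerivAt_trans_full {τ' : TubeChart E M} {p : ℝ × E} (h : p ∈ τ.transDom τ') :
    HasFDerivAt (τ.trans τ') (fderiv ℝ (τ.trans τ') p) p :=
  (((τ.contDiffOn_trans τ').contDiffAt ((τ.isOpen_transDom τ').mem_nhds h)).differentiableAt
    (by simp)).hasFDerivAt

theorem hasDerivAt_trans {τ' : TubeChart E M} {t : ℝ} {z : E} (h : (t, z) ∈ τ.transDom τ') :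
    HasDerivAt (fun s => τ.trans τ' (s, z)) (fderiv ℝ (τ.trans τ') (t, z) (1, 0)) t := by
  have h1 : HasDerivAt (fun s : ℝ => (s, z)) (1, 0) t :=
    (hasDerivAt_id t).prodMk (hasDerivAt_const t z)
  exact HasFDerivAt.comp_hasDerivAt (l := τ.trans τ') t (hasFDerivAt_trans_full h) h1

theorem velocity_trans {x : M} {t : ℝ} {z : E} (h : (t, z) ∈ (const E x).transDom τ) :
    τ.velocity (t, (const E x).trans τ (t, z)) =
      fderiv ℝ ((const E x).trans τ) (t, z) (1, 0) := by
  have h1 : τ.inv t ((const E x).trans τ (t, z)) = (const E x).inv t z :=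
    τ.inv_slice (mem_transDom.1 h).2
  rw [velocity]
  simp only [h1]
  exact (hasDerivAt_trans h).deriv

theorem mem_transDom_const {t : ℝ} {y : E} (h : (t, y) ∈ τ.toHomeo.target) :
    (t, y) ∈ τ.transDom (const E (τ.inv t y)) :=
  mem_transDom.2 ⟨h, mem_const_source.2 (mem_chart_source E _)⟩

theorem contDiffOn_velocity : ContDiffOn ℝ ∞ τ.velocity τ.toHomeo.target := by
  rintro ⟨t, y⟩ hp
  set c := const E (τ.inv t y)
  have hdom : (t, y) ∈ τ.transDom c := mem_transDom_const hp
  have hg := (τ.contDiffOn_trans c).contDiffAt ((τ.isOpen_transDom c).mem_nhds hdom)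
  have h1 : ContDiffAt ℝ ∞ (fderiv ℝ (c.trans τ)) (t, τ.trans c (t, y)) :=
    ((c.contDiffOn_trans τ).contDiffAt ((c.isOpen_transDom τ).mem_nhds
      (trans_mem_transDom hdom))).fderiv_right (by simp)
  have hpair : ContDiffAt ℝ ∞ (fun p : ℝ × E => (p.1, τ.trans c p)) (t, y) :=
    contDiffAt_fst.prodMk hg
  have h2 : ContDiffAt ℝ ∞ (fun p : ℝ × E =>
      fderiv ℝ (c.trans τ) (p.1, τ.trans c p) ((1 : ℝ), (0 : E))) (t, y) :=
    (h1.comp (t, y) hpair).clm_apply contDiffAt_const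
  refine (h2.congr_of_eventuallyEq ?_).contDiffWithinAt
  filter_upwards [(τ.isOpen_transDom c).mem_nhds hdom] with q hq
  have h3 := velocity_trans (trans_mem_transDom (t := q.1) (y := q.2) hq)
  rw [trans_trans (t := q.1) (y := q.2) hq] at h3
  exact h3

end TubeChart

variable {S : ∀ x : M, Submodule ℝ (CoVel E M r x)} {P : ∀ x : M, S x →ₗ[ℝ] TangentSpace 𝓘(ℝ, E) x}
  {s : ℕ} {τ : TubeChart E M}

/-- The anchor relation is preserved by the Lie derivative along the velocity. -/
theorem lieDeriv_velocity_mem [FiniteDimensional ℝ E] {ξ : ℝ × E → E →L[ℝ] (Fin r → ℝ)}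
    {ν : ℝ × E → E} {t : ℝ} {y : E} (hp : (t, y) ∈ τ.toHomeo.target)
    (hξ : DifferentiableAt ℝ ξ (t, y)) (hν : DifferentiableAt ℝ ν (t, y))
    (hmem : ∀ᶠ p in 𝓝 (t, y), (ξ p, ν p) ∈ anchorGraph P τ p) :
    (fderiv ℝ ξ (t, y) (1, τ.velocity (t, y)) +
        (ξ (t, y)).comp (fderiv ℝ (fun y => τ.velocity (t, y)) y),
      fderiv ℝ ν (t, y) (1, τ.velocity (t, y)) -
        fderiv ℝ (fun y => τ.velocity (t, y)) y (ν (t, y))) ∈ anchorGraph P τ (t, y) := by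
  set c := TubeChart.const E (τ.inv t y)
  have hdom : (t, y) ∈ τ.transDom c := TubeChart.mem_transDom_const hp
  -- The point of `M` is held fixed, with coordinate `z` in a chart that does not depend on time.
  -- The curve `s ↦ c.trans τ (s, z)` records how its coordinate in `τ` moves, with derivative the
  -- velocity of `τ`.
  set z := τ.trans c (t, y) with hz
  have hdom' : (t, z) ∈ c.transDom τ := TubeChart.trans_mem_transDom hdom
  have hzy : c.trans τ (t, z) = y := TubeChart.trans_trans hdom
  have hv : fderiv ℝ (c.trans τ) (t, z) (1, 0) = τ.velocity (t, y) := by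
    rw [← TubeChart.velocity_trans hdom', hzy]
  have hev : ∀ᶠ s in 𝓝 t, (s, z) ∈ c.transDom τ :=
    ((c.isOpen_transDom τ).preimage (by fun_prop : Continuous fun s : ℝ => (s, z))).mem_nhds hdom'
  have hh := (c.contDiffOn_trans τ).contDiffAt ((c.isOpen_transDom τ).mem_nhds hdom')
  have hy : HasDerivAt (fun s => c.trans τ (s, z)) (τ.velocity (t, y)) t := by
    rw [← hv]; exact TubeChart.hasDerivAt_trans hdom'
  have hpair : HasDerivAt (fun s => (s, c.trans τ (s, z))) (1, τ.velocity (t, y)) t :=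
    (hasDerivAt_id t).prodMk hy
  have hpc : Filter.Tendsto (fun s => (s, c.trans τ (s, z))) (𝓝 t) (𝓝 (t, y)) := by
    have := hpair.continuousAt
    rwa [ContinuousAt, hzy] at this
  have hξ' : HasDerivAt (fun s => ξ (s, c.trans τ (s, z)))
      (fderiv ℝ ξ (t, y) (1, τ.velocity (t, y))) t := by
    refine HasFDerivAt.comp_hasDerivAt t ?_ hpair
    rw [hzy]; exact hξ.hasFDerivAt
  have hν' : HasDerivAt (fun s => ν (s, c.trans τ (s, z)))
      (fderiv ℝ ν (t, y) (1, τ.velocity (t, y))) t := by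
    refine HasFDerivAt.comp_hasDerivAt t ?_ hpair
    rw [hzy]; exact hν.hasFDerivAt
  set DT := fderiv ℝ (fun y => τ.velocity (t, y)) y
  have hK : HasDerivAt (fun s => c.dtrans τ (s, z)) (DT.comp (c.dtrans τ (t, z))) t := by
    have h1 := hasDerivAt_fderiv_inr (T := τ.velocity) hh (by
      rw [hzy]
      exact ((TubeChart.contDiffOn_velocity.contDiffAt
        (τ.toHomeo.open_target.mem_nhds hp)).differentiableAt (by simp)).comp y
          (hasFDerivAt_prodMk_right t y).differentiableAt) (by
      filter_upwards [((c.isOpen_transDom τ).preimage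
        (by fun_prop : Continuous fun z : E => (t, z))).mem_nhds hdom'] with z hz
      exact TubeChart.velocity_trans hz)
    rw [hzy] at h1
    exact h1
  obtain ⟨n', hn'⟩ : ∃ n', HasDerivAt (fun s => τ.dtrans c (s, c.trans τ (s, z))
      (ν (s, c.trans τ (s, z)))) n' t := by
    have h1 : DifferentiableAt ℝ (τ.dtrans c) (t, y) :=
      ((τ.contDiffOn_dtrans c).contDiffAt
        ((τ.isOpen_transDom c).mem_nhds hdom)).differentiableAt (by simp)
    have h2 : HasDerivAt (fun s => τ.dtrans c (s, c.trans τ (s, z)))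
        (fderiv ℝ (τ.dtrans c) (t, y) (1, τ.velocity (t, y))) t := by
      rw [← hzy] at h1
      have h3 := h1.hasFDerivAt.comp_hasDerivAt t hpair
      rw [hzy] at h3
      exact h3
    exact ⟨_, h2.clm_apply hν'⟩
  -- Read in the time-independent chart, the pairs `(ξ, ν)` along this curve all lie in one and the
  -- same linear subspace, so their derivative lies in it too.
  have hm : ∀ᶠ s in 𝓝 t, ((ξ (s, c.trans τ (s, z))).comp (c.dtrans τ (s, z)),
      τ.dtrans c (s, c.trans τ (s, z)) (ν (s, c.trans τ (s, z)))) ∈ anchorGraph P c (t, z) := by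
    filter_upwards [hev, hpc.eventually hmem] with s hs hs'
    refine (mem_anchorGraph_trans (t := s) hs).1 ?_
    have h1 := DFunLike.congr_fun (TubeChart.dtrans_comp (TubeChart.trans_mem_transDom hs))
      (ν (s, c.trans τ (s, z)))
    rw [TubeChart.trans_trans hs, ContinuousLinearMap.comp_apply] at h1
    rw [h1]
    exact hs'
  have key := Submodule.hasDerivAt_mem _ ((hξ'.clm_comp hK).prodMk hn') hm
  -- The derivative `n'` of the transformed vector need not be computed by itself. Its image in the
  -- chart `τ` results from differentiating the identity that transforms the vector back.
  have hKn : c.dtrans τ (t, z) n' = fderiv ℝ ν (t, y) (1, τ.velocity (t, y)) - DT (ν (t, y)) := by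
    have h1 := (hK.clm_apply hn').congr_of_eventuallyEq
      (f₁ := fun s => ν (s, c.trans τ (s, z))) (by
        filter_upwards [hev] with s hs
        have h1 := DFunLike.congr_fun (TubeChart.dtrans_comp (TubeChart.trans_mem_transDom hs))
          (ν (s, c.trans τ (s, z)))
        rw [TubeChart.trans_trans hs, ContinuousLinearMap.comp_apply] at h1
        exact h1.symm)
    have h2 := h1.unique hν'
    have h3 := DFunLike.congr_fun (TubeChart.dtrans_comp hdom') (ν (t, y))
    rw [hzy] at h2
    have h4 : c.dtrans τ (t, z) (τ.dtrans c (t, y) (ν (t, y))) = ν (t, y) := by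
      have h1 := DFunLike.congr_fun (TubeChart.dtrans_comp hdom) (ν (t, y))
      exact h1
    rw [ContinuousLinearMap.comp_apply, h4] at h2
    rw [← h2, add_sub_cancel_left]
  rw [hzy, ← ContinuousLinearMap.comp_assoc, ← ContinuousLinearMap.add_comp] at key
  have key2 := (mem_anchorGraph_trans hdom').2 key
  rwa [hKn, hzy] at key2

/-- The anchor maps the bracket to the commutator, at a fixed time. -/
theorem anchor_bracket_slice [FiniteDimensional ℝ E] [T2Space M] (hSP : IsPolyPoisson S P s)
    {ξ ξ' : E → E →L[ℝ] (Fin r → ℝ)} {ν ν' : E → E} {t : ℝ} {y : E}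
    (hp : (t, y) ∈ τ.toHomeo.target)
    (hξ : ∀ᶠ y in 𝓝 y, ContDiffAt ℝ ∞ ξ y ∧ (ξ y, ν y) ∈ anchorGraph P τ (t, y))
    (hξ' : ∀ᶠ y in 𝓝 y, ContDiffAt ℝ ∞ ξ' y ∧ (ξ' y, ν' y) ∈ anchorGraph P τ (t, y))
    (hν : DifferentiableAt ℝ ν y) (hν' : DifferentiableAt ℝ ν' y) :
    (coordBracket ν ν' ξ ξ' y, fderiv ℝ ν' y (ν y) - fderiv ℝ ν y (ν' y)) ∈
      anchorGraph P τ (t, y) := by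
  set c := TubeChart.const E (τ.inv t y)
  have hdom : (t, y) ∈ τ.transDom c := TubeChart.mem_transDom_const hp
  set z := τ.trans c (t, y) with hz
  have hdom' : (t, z) ∈ c.transDom τ := TubeChart.trans_mem_transDom hdom
  have hzy : c.trans τ (t, z) = y := TubeChart.trans_trans hdom
  have hevz : ∀ᶠ z in 𝓝 z, (t, z) ∈ c.transDom τ :=
    ((c.isOpen_transDom τ).preimage (by fun_prop : Continuous fun z : E => (t, z))).mem_nhds hdom'
  have hevy : ∀ᶠ y in 𝓝 y, (t, y) ∈ τ.transDom c :=
    ((τ.isOpen_transDom c).preimage (by fun_prop : Continuous fun z : E => (t, z))).mem_nhds hdom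
  let g : E → E := fun y => τ.trans c (t, y)
  have hg : ContDiffAt ℝ ∞ g y := ((τ.contDiffOn_trans c).contDiffAt
    ((τ.isOpen_transDom c).mem_nhds hdom)).comp y (by fun_prop)
  have hgd : ∀ᶠ y in 𝓝 y, fderiv ℝ g y = τ.dtrans c (t, y) := by
    filter_upwards [hevy] with y hy using (TubeChart.hasFDerivAt_trans hy).fderiv
  -- At a fixed time the sections are transported to the preferred chart at the point, where the
  -- homomorphism property is known; naturality of the bracket and relatedness of the fields bring
  -- the result back.
  let push : (E → E →L[ℝ] (Fin r → ℝ)) → E → E →L[ℝ] (Fin r → ℝ) := fun ξ z =>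
    (ξ (c.trans τ (t, z))).comp (c.dtrans τ (t, z))
  let pushV : (E → E) → E → E := fun ν z =>
    τ.dtrans c (t, c.trans τ (t, z)) (ν (c.trans τ (t, z)))
  have hc : ∀ z, (t, z) ∈ c.transDom τ → ContDiffAt ℝ ∞ (fun z => c.trans τ (t, z)) z :=
    fun z hz => ((c.contDiffOn_trans τ).contDiffAt ((c.isOpen_transDom τ).mem_nhds hz)).comp z
      (by fun_prop)
  have htend : Filter.Tendsto (fun z => c.trans τ (t, z)) (𝓝 z) (𝓝 y) := by
    have := (hc z hdom').continuousAt
    rwa [ContinuousAt, hzy] at this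
  have hloc : ∀ {ξ ν}, (∀ᶠ y in 𝓝 y, ContDiffAt ℝ ∞ ξ y ∧ (ξ y, ν y) ∈ anchorGraph P τ (t, y)) →
      IsLocalSection P (τ.inv t y) (push ξ) (pushV ν) := by
    intro ξ ν h
    filter_upwards [show ∀ᶠ z in 𝓝 (chartAt E (τ.inv t y) (τ.inv t y)), _ from hevz,
      show ∀ᶠ z in 𝓝 (chartAt E (τ.inv t y) (τ.inv t y)), _ from htend.eventually h] with z hz hz'
    refine ⟨?_, ?_⟩
    · exact (hz'.1.comp z (hc z hz)).clm_comp (((c.contDiffOn_dtrans τ).contDiffAt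
        ((c.isOpen_transDom τ).mem_nhds hz)).comp z (by fun_prop))
    · refine (mem_anchorGraph_trans (t := t) hz).1 ?_
      have h1 := DFunLike.congr_fun (TubeChart.dtrans_comp (TubeChart.trans_mem_transDom hz))
        (ν (c.trans τ (t, z)))
      rw [TubeChart.trans_trans hz, ContinuousLinearMap.comp_apply] at h1
      change (_, c.dtrans τ (t, z) (τ.dtrans c (t, c.trans τ (t, z)) _)) ∈ _
      rw [h1]
      exact hz'.2
  have hpush : ∀ ξ : E → E →L[ℝ] (Fin r → ℝ),
      ξ =ᶠ[𝓝 y] fun y => (push ξ (g y)).comp (fderiv ℝ g y) := by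
    intro ξ
    filter_upwards [hevy, hgd] with y hy hy'
    change _ = ((ξ (c.trans τ (t, g y))).comp (c.dtrans τ (t, g y))).comp _
    rw [hy', ContinuousLinearMap.comp_assoc, TubeChart.dtrans_comp hy, TubeChart.trans_trans hy,
      ContinuousLinearMap.comp_id]
  have hpushV : ∀ ν : E → E, (fun y => fderiv ℝ g y (ν y)) =ᶠ[𝓝 y] fun y => pushV ν (g y) := by
    intro ν
    filter_upwards [hevy, hgd] with y hy hy'
    change _ = τ.dtrans c (t, c.trans τ (t, g y)) (ν (c.trans τ (t, g y)))
    rw [hy', TubeChart.trans_trans hy]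
  have l := hloc hξ
  have l' := hloc hξ'
  have key := l.anchor_bracket hSP l'
  have d : DifferentiableAt ℝ (push ξ) (g y) := l.self_of_nhds.1.differentiableAt (by simp)
  have d' : DifferentiableAt ℝ (push ξ') (g y) := l'.self_of_nhds.1.differentiableAt (by simp)
  have dν : DifferentiableAt ℝ (pushV ν) (g y) :=
    (l.eventually_contDiffAt hSP).self_of_nhds.differentiableAt (by simp)
  have dν' : DifferentiableAt ℝ (pushV ν') (g y) :=
    (l'.eventually_contDiffAt hSP).self_of_nhds.differentiableAt (by simp)
  have e := coordBracket_pullback hg (hpushV ν) (hpushV ν').self_of_nhds (hpush ξ) (hpush ξ')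
    hν dν d d'
  have e1 := fderiv_related hg (hpushV ν) hν dν (ν' y)
  have e2 := fderiv_related hg (hpushV ν') hν' dν' (ν y)
  rw [e, hgd.self_of_nhds]
  refine (mem_anchorGraph_trans hdom).1 ?_
  refine (congrArg (fun w => (coordBracket (pushV ν) (pushV ν') (push ξ) (push ξ') (g y), w) ∈
    anchorGraph P c (t, g y)) ?_).mpr key
  rw [← hgd.self_of_nhds, map_sub]
  have e3 : fderiv ℝ g y (ν y) = pushV ν (g y) := (hpushV ν).self_of_nhds
  have e4 : fderiv ℝ g y (ν' y) = pushV ν' (g y) := (hpushV ν').self_of_nhds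
  change _ = fderiv ℝ (pushV ν') (g y) (pushV ν (g y)) - fderiv ℝ (pushV ν) (g y) (pushV ν' (g y))
  rw [← e3, ← e4, ← e1, ← e2, second_derivative_comm hg (ν y) (ν' y)]
  abel

/-- The structure equations of a poly-Poisson structure. -/
theorem IsAnchoredFrame.structure_equation [FiniteDimensional ℝ E] [T2Space M]
    (hSP : IsPolyPoisson S P s) {Q R : Type*} [NormedAddCommGroup Q] [NormedSpace ℝ Q]
    [NormedAddCommGroup R] [NormedSpace ℝ R] {Φ : ℝ × E → Q × R →L[ℝ] E →L[ℝ] (Fin r → ℝ)}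
    {V : ℝ × E → Q →L[ℝ] E} {N : Set (ℝ × E)} (h : IsAnchoredFrame (anchorGraph P τ) Φ V N)
    (hN : N ⊆ τ.toHomeo.target) {t : ℝ} {y : E} (hp : (t, y) ∈ N) (a q : Q) :
    (fderiv ℝ (fun p => Φ p (q, 0)) (t, y) (1, τ.velocity (t, y) - V (t, y) a) +
        (Φ (t, y) (q, 0)).comp (fderiv ℝ (fun y => τ.velocity (t, y) - V (t, y) a) y) +
        (fderiv ℝ (fun y => Φ (t, y) (a, 0)) y (V (t, y) q) -
          (fderiv ℝ (fun y => Φ (t, y) (a, 0)) y).flip (V (t, y) q)),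
      fderiv ℝ (fun p => V p q) (t, y) (1, τ.velocity (t, y) - V (t, y) a) -
        fderiv ℝ (fun y => τ.velocity (t, y) - V (t, y) a) y (V (t, y) q)) ∈
      anchorGraph P τ (t, y) := by
  have hpN := h.isOpen.mem_nhds hp
  have hpt := hN hp
  have hΦ : ∀ q, ∀ p ∈ N, ContDiffAt ℝ ∞ (fun p => Φ p (q, 0)) p := fun q p hp =>
    (h.smooth.contDiffAt (h.isOpen.mem_nhds hp)).clm_apply contDiffAt_const
  have hV : ∀ q, ∀ p ∈ N, ContDiffAt ℝ ∞ (fun p => V p q) p := fun q p hp =>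
    (h.smooth_anchor.contDiffAt (h.isOpen.mem_nhds hp)).clm_apply contDiffAt_const
  have hev : ∀ᶠ y in 𝓝 y, (t, y) ∈ N :=
    (h.isOpen.preimage (by fun_prop : Continuous fun y : E => (t, y))).mem_nhds hp
  have h1 := lieDeriv_velocity_mem (P := P) (ξ := fun p => Φ p (q, 0)) (ν := fun p => V p q) hpt
    ((hΦ q _ hp).differentiableAt (by simp)) ((hV q _ hp).differentiableAt (by simp))
    (by filter_upwards [hpN] with p hp using h.mem p hp q)
  have hsec : ∀ q, ∀ᶠ y in 𝓝 y, ContDiffAt ℝ ∞ (fun y => Φ (t, y) (q, 0)) y ∧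
      (Φ (t, y) (q, 0), V (t, y) q) ∈ anchorGraph P τ (t, y) := fun q => by
    filter_upwards [hev] with y hy
    exact ⟨(hΦ q _ hy).comp y (by fun_prop), h.mem _ hy q⟩
  have hVy : ∀ q, HasFDerivAt (fun y => V (t, y) q)
      ((fderiv ℝ (fun p => V p q) (t, y)).comp (.inr ℝ ℝ E)) y := fun q =>
    ((hV q _ hp).differentiableAt (by simp)).hasFDerivAt.comp y (hasFDerivAt_prodMk_right t y)
  have hΦy : ∀ q, HasFDerivAt (fun y => Φ (t, y) (q, 0))
      ((fderiv ℝ (fun p => Φ p (q, 0)) (t, y)).comp (.inr ℝ ℝ E)) y := fun q =>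
    ((hΦ q _ hp).differentiableAt (by simp)).hasFDerivAt.comp y (hasFDerivAt_prodMk_right t y)
  have h2 := anchor_bracket_slice hSP hpt (hsec a) (hsec q) (hVy a).differentiableAt
    (hVy q).differentiableAt
  have hT : DifferentiableAt ℝ (fun y => τ.velocity (t, y)) y :=
    ((TubeChart.contDiffOn_velocity.contDiffAt
      (τ.toHomeo.open_target.mem_nhds hpt)).differentiableAt (by simp)).comp y
        (hasFDerivAt_prodMk_right t y).differentiableAt
  have h3 : fderiv ℝ (fun y => τ.velocity (t, y) - V (t, y) a) y =
      fderiv ℝ (fun y => τ.velocity (t, y)) y - fderiv ℝ (fun y => V (t, y) a) y :=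
    fderiv_sub hT (hVy a).differentiableAt
  have h4 : ∀ v w : E, ((1 : ℝ), v - w) = (1, v) - (0, w) := fun v w => by simp
  -- The derivative along `T - V a` is the difference of the Lie derivative along the velocity `T`
  -- and of the bracket with the section of constant coefficients `a`. Both pairs belong to the
  -- graph, hence so does their difference.
  have h5 := Submodule.sub_mem _ h1 h2
  refine (congrArg (· ∈ anchorGraph P τ (t, y)) ?_).mpr h5
  refine Prod.ext ?_ ?_
  · rw [h3, h4, map_sub, Prod.fst_sub, coordBracket, (hΦy q).fderiv, ContinuousLinearMap.comp_sub]
    simp only [ContinuousLinearMap.comp_apply, ContinuousLinearMap.inr_apply]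
    abel
  · rw [h3, h4, map_sub (fderiv ℝ (fun p => V p q) (t, y)), Prod.snd_sub, (hVy q).fderiv, sub_apply]
    simp only [ContinuousLinearMap.comp_apply, ContinuousLinearMap.inr_apply]
    abel

end Structure

/-! ### The linearized problem -/

section UnitDeriv

variable {F : Type*} [NormedAddCommGroup F] [NormedSpace ℝ F]
  {G : Type*} [NormedAddCommGroup G] [NormedSpace ℝ G]

theorem HasUnitDeriv.clm_apply {c : I → F →L[ℝ] G} {x : I → F} {c' : F →L[ℝ] G} {x' : F} {t : I}
    (hc : HasUnitDeriv c c' t) (hx : HasUnitDeriv x x' t) :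
    HasUnitDeriv (fun t => c t (x t)) (c' (x t) + c t x') t := by
  have := HasDerivWithinAt.clm_apply hc hx
  rwa [projIcc_val] at this

theorem HasUnitDeriv.unique {x : I → F} {d d' : F} {t : I} (h : HasUnitDeriv x d t)
    (h' : HasUnitDeriv x d' t) : d = d' := (CkCurve.uniqueDiff_unit t).eq_deriv _ h h'

theorem CkCurve.hasUnitDeriv {k : ℕ} (f : CkCurve (k + 1) F) (t : I) :
    HasUnitDeriv f.eval ((derivL f).eval t) t := f.hasDerivWithinAt t

theorem integrable_of_continuous_unitInterval {f : I → F} (hf : Continuous f) :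
    Integrable f := hf.integrable_of_hasCompactSupport (HasCompactSupport.of_compactSpace f)

end UnitDeriv

/-- The structure equations along a path: `ε` is a frame of the subbundle, `V` its anchor, `A` the
linearized flow and `B` the curvature term. -/
structure IsStructureCurve {k : ℕ} {E Q W : Type*} [NormedAddCommGroup E] [NormedSpace ℝ E]
    [NormedAddCommGroup Q] [NormedSpace ℝ Q] [NormedAddCommGroup W] [NormedSpace ℝ W]
    (ε : CkCurve (k + 1) (Q →L[ℝ] E →L[ℝ] W)) (V : CkCurve (k + 1) (Q →L[ℝ] E))
    (A : CkCurve k (E →L[ℝ] E)) (B : CkCurve k (E →L[ℝ] E →L[ℝ] W))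
    (Ξ : CkCurve k (Q →L[ℝ] Q)) : Prop where
  frame_eq : ∀ t q x, (CkCurve.derivL ε).eval t q x + ε.eval t q (A.eval t x) +
    B.eval t (V.eval t q) x = ε.eval t (Ξ.eval t q) x
  anchor_eq : ∀ t q, (CkCurve.derivL V).eval t q - A.eval t (V.eval t q) = V.eval t (Ξ.eval t q)
  skew : ∀ t x y, B.eval t x y = -B.eval t y x
  contraction : ∀ t q q', ε.eval t q (V.eval t q') + ε.eval t q' (V.eval t q) = 0
  annihilator : ∀ t x, (∀ q, ε.eval t q x = 0) → x = 0
  injective : ∀ t q, ε.eval t q = 0 → q = 0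

section Linear

variable {k : ℕ} {E Q W : Type*} [NormedAddCommGroup E] [NormedSpace ℝ E] [FiniteDimensional ℝ E]
  [NormedAddCommGroup Q] [NormedSpace ℝ Q] [FiniteDimensional ℝ Q]
  [NormedAddCommGroup W] [NormedSpace ℝ W] [FiniteDimensional ℝ W]

/-- The linearized two-form. -/
def linForm (ε : CkCurve (k + 1) (Q →L[ℝ] E →L[ℝ] W)) (B : CkCurve k (E →L[ℝ] E →L[ℝ] W))
    (v w : CkCurve (k + 1) E × CkCurve k Q) : W :=
  ∫ t : I, (ε.eval t (w.2.eval t) (v.1.eval t) - ε.eval t (v.2.eval t) (w.1.eval t) +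
    B.eval t (w.1.eval t) (v.1.eval t))

local instance : CompleteSpace E := FiniteDimensional.complete ℝ E
local instance : CompleteSpace Q := FiniteDimensional.complete ℝ Q
local instance : CompleteSpace W := FiniteDimensional.complete ℝ W

/-- The linearized equation. -/
def linSolutions (V : CkCurve (k + 1) (Q →L[ℝ] E)) (A : CkCurve k (E →L[ℝ] E)) :
    Submodule ℝ (CkCurve (k + 1) E × CkCurve k Q) :=
  LinearMap.ker ((CkCurve.derivL - (CkCurve.applyL A).comp CkCurve.incl).comp (.fst ℝ _ _) +
    (CkCurve.applyL (CkCurve.incl V)).comp (.snd ℝ _ _) :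
      CkCurve (k + 1) E × CkCurve k Q →L[ℝ] CkCurve k E).toLinearMap

variable {ε : CkCurve (k + 1) (Q →L[ℝ] E →L[ℝ] W)} {V : CkCurve (k + 1) (Q →L[ℝ] E)}
  {A : CkCurve k (E →L[ℝ] E)} {B : CkCurve k (E →L[ℝ] E →L[ℝ] W)} {Ξ : CkCurve k (Q →L[ℝ] Q)}

theorem mem_linSolutions {v : CkCurve (k + 1) E × CkCurve k Q} : v ∈ linSolutions V A ↔
    ∀ t, (CkCurve.derivL v.1).eval t = A.eval t (v.1.eval t) - V.eval t (v.2.eval t) := by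
  rw [linSolutions, LinearMap.mem_ker, CkCurve.ext_iff]
  refine forall_congr' fun t => ?_
  simp [sub_add_eq_add_sub, sub_eq_zero, eq_sub_iff_add_eq]

/-- The gauge directions. -/
def gaugeDir (V : CkCurve (k + 1) (Q →L[ℝ] E)) (Ξ : CkCurve k (Q →L[ℝ] Q)) :
    CkCurve (k + 1) Q →L[ℝ] CkCurve (k + 1) E × CkCurve k Q :=
  (CkCurve.applyL V).prod (-(CkCurve.derivL + (CkCurve.applyL Ξ).comp CkCurve.incl))

theorem gaugeDir_fst_eval (b : CkCurve (k + 1) Q) (t : I) :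
    (gaugeDir V Ξ b).1.eval t = V.eval t (b.eval t) := by simp [gaugeDir]

theorem gaugeDir_snd_eval (b : CkCurve (k + 1) Q) (t : I) :
    (gaugeDir V Ξ b).2.eval t = -((CkCurve.derivL b).eval t + Ξ.eval t (b.eval t)) := by
  simp [gaugeDir]

set_option synthInstance.maxHeartbeats 400000 in
theorem continuous_flip_apply {T : Type*} [TopologicalSpace T] {f : T → Q →L[ℝ] E →L[ℝ] W}
    {x : T → E} (hf : Continuous f) (hx : Continuous x) :
    Continuous fun t => (f t).flip (x t) :=
  (((ContinuousLinearMap.flipₗᵢ ℝ Q E W).continuous.comp hf)).clm_apply hx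

/-- Testing against `(0, b)` gives `ε(q)(y) = 0` for all `q`, hence `y = 0` by the annihilator
condition. The curvature term is then gone, and testing against `(y', 0)` gives `ε(β) = 0`, hence `β
= 0`. -/
theorem linForm_nondegenerate (hann : ∀ t x, (∀ q, ε.eval t q x = 0) → x = 0)
    (hinj : ∀ t q, ε.eval t q = 0 → q = 0) {v : CkCurve (k + 1) E × CkCurve k Q}
    (hv : ∀ w, linForm ε B v w = 0) : v = 0 := by
  have h1 : v.1 = 0 := by
    ext t
    refine hann t _ fun q => ?_
    have h2 := eq_zero_of_integral_apply_eq_zero (k := k)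
      (Λ := fun t => (ε.eval t).flip (v.1.eval t)) (continuous_flip_apply ε.continuous_eval
        v.1.continuous_eval) (fun b => by
        have := hv (0, b)
        simpa [linForm] using this) t
    exact DFunLike.congr_fun h2 q
  refine Prod.ext h1 (CkCurve.ext fun t => hinj t _ ?_)
  refine eq_zero_of_integral_apply_eq_zero (k := k + 1)
    (Λ := fun t => ε.eval t (v.2.eval t)) (ε.continuous_eval.clm_apply v.2.continuous_eval)
      (fun y => ?_) t
  have := hv (y, 0)
  simp only [linForm, h1, CkCurve.eval_zero, map_zero, add_zero, zero_sub,
    integral_neg, neg_eq_zero] at this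
  exact this

set_option synthInstance.maxHeartbeats 400000 in
theorem continuous_linForm_integrand (v w : CkCurve (k + 1) E × CkCurve k Q) : Continuous
    fun t : I => ε.eval t (w.2.eval t) (v.1.eval t) - ε.eval t (v.2.eval t) (w.1.eval t) +
      B.eval t (w.1.eval t) (v.1.eval t) := by
  have c1 := ε.continuous_eval
  have c2 := B.continuous_eval
  have c3 := v.1.continuous_eval
  have c4 := v.2.continuous_eval
  have c5 := w.1.continuous_eval
  have c6 := w.2.continuous_eval
  exact ((((c1.clm_apply c6).clm_apply c3).sub ((c1.clm_apply c4).clm_apply c5)).add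
    ((c2.clm_apply c5).clm_apply c3))

/-- The gauge directions with vanishing end points. -/
def gaugeZero (V : CkCurve (k + 1) (Q →L[ℝ] E)) (Ξ : CkCurve k (Q →L[ℝ] Q)) :
    Submodule ℝ (CkCurve (k + 1) E × CkCurve k Q) :=
  (LinearMap.ker ((CkCurve.evalL 0).prod (CkCurve.evalL 1) :
    CkCurve (k + 1) Q →L[ℝ] Q × Q).toLinearMap).map (gaugeDir V Ξ).toLinearMap

theorem mem_gaugeZero {v : CkCurve (k + 1) E × CkCurve k Q} : v ∈ gaugeZero V Ξ ↔
    ∃ b : CkCurve (k + 1) Q, b.eval 0 = 0 ∧ b.eval 1 = 0 ∧ gaugeDir V Ξ b = v := by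
  simp [gaugeZero, Submodule.mem_map, and_assoc]

/-- The gauge parameter that starts at zero and generates the second component `b`. -/
def gaugeOf (Ξ : CkCurve k (Q →L[ℝ] Q)) : CkCurve k Q →L[ℝ] CkCurve (k + 1) Q :=
  ((CkCurve.linearIVP (-Ξ)).symm : Q × CkCurve k Q →L[ℝ] CkCurve (k + 1) Q).comp
    ((0 : CkCurve k Q →L[ℝ] Q).prod (-.id ℝ _))

theorem linearIVP_gaugeOf (b : CkCurve k Q) :
    CkCurve.linearIVP (-Ξ) (gaugeOf Ξ b) = (0, -b) := by
  simp [gaugeOf, -CkCurve.linearIVP_apply]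

theorem gaugeOf_eval_zero (b : CkCurve k Q) : (gaugeOf Ξ b).eval 0 = 0 :=
  congrArg Prod.fst (linearIVP_gaugeOf b)

theorem gaugeDir_gaugeOf_snd (b : CkCurve k Q) : (gaugeDir V Ξ (gaugeOf Ξ b)).2 = b := by
  ext t
  have := congrArg (fun p => p.2.eval t) (linearIVP_gaugeOf (Ξ := Ξ) b)
  simp only [CkCurve.linearIVP_apply, CkCurve.eval_sub, CkCurve.applyL_eval, CkCurve.eval_neg,
    neg_apply, CkCurve.incl_eval, sub_neg_eq_add] at this
  rw [gaugeDir_snd_eval, this, neg_neg]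

theorem gaugeOf_gaugeDir_snd {c : CkCurve (k + 1) Q} (hc : c.eval 0 = 0) :
    gaugeOf Ξ (gaugeDir V Ξ c).2 = c := by
  refine (CkCurve.linearIVP (-Ξ)).injective ?_
  rw [linearIVP_gaugeOf]
  refine Prod.ext hc.symm (CkCurve.ext fun t => ?_)
  simp [gaugeDir_snd_eval]

theorem linForm_add_left (v v' w : CkCurve (k + 1) E × CkCurve k Q) :
    linForm ε B (v + v') w = linForm ε B v w + linForm ε B v' w := by
  rw [linForm, linForm, linForm, ← integral_add]
  · congr 1
    ext1 t
    simp only [Prod.fst_add, Prod.snd_add, CkCurve.eval_add, map_add, add_apply]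
    abel
  all_goals
    refine integrable_of_continuous_unitInterval ?_
    exact continuous_linForm_integrand _ _

/-- An element of the linearized equation with prescribed initial value and second component. -/
theorem exists_mem_linSolutions (V : CkCurve (k + 1) (Q →L[ℝ] E)) (A : CkCurve k (E →L[ℝ] E))
    (y₀ : E) (β : CkCurve k Q) :
    ∃ y : CkCurve (k + 1) E, y.eval 0 = y₀ ∧ (y, β) ∈ linSolutions V A := by
  obtain ⟨y, hy⟩ := (CkCurve.linearIVP A).surjective
    (y₀, -CkCurve.applyL (CkCurve.incl V) β)
  refine ⟨y, congrArg Prod.fst hy, mem_linSolutions.2 fun t => ?_⟩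
  have := congrArg (fun p => p.2.eval t) hy
  simp only [CkCurve.linearIVP_apply, CkCurve.eval_sub, CkCurve.applyL_eval, CkCurve.eval_neg,
    CkCurve.incl_eval] at this
  change (CkCurve.derivL y).eval t = A.eval t (y.eval t) - V.eval t (β.eval t)
  rw [sub_eq_iff_eq_add] at this
  rw [this]
  abel

theorem eq_of_mem_linSolutions {y y' : CkCurve (k + 1) E} {β : CkCurve k Q}
    (hy : (y, β) ∈ linSolutions V A) (hy' : (y', β) ∈ linSolutions V A)
    (h0 : y.eval 0 = y'.eval 0) : y = y' := by
  refine (CkCurve.linearIVP A).injective (Prod.ext h0 (CkCurve.ext fun t => ?_))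
  rw [mem_linSolutions] at hy hy'
  simp [hy t, hy' t]

namespace IsStructureCurve

/-- By the anchor equation `V' = A V + V Ξ`, the derivative of `V b` is `A (V b) + V (b' + Ξ b)`,
which is the linearized equation with `β = -(b' + Ξ b)`. -/
theorem gaugeDir_mem (h : IsStructureCurve ε V A B Ξ) (b : CkCurve (k + 1) Q) : gaugeDir V Ξ b ∈ linSolutions V A := by
  rw [mem_linSolutions]
  intro t
  have h1 : HasUnitDeriv (gaugeDir V Ξ b).1.eval
      ((CkCurve.derivL V).eval t (b.eval t) + V.eval t ((CkCurve.derivL b).eval t)) t := by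
    have := (V.hasUnitDeriv t).clm_apply (b.hasUnitDeriv t)
    simpa only [← gaugeDir_fst_eval (Ξ := Ξ)] using this
  rw [CkCurve.derivL_eval_eq _ t h1, gaugeDir_fst_eval, gaugeDir_snd_eval, map_neg, map_add,
    ← h.anchor_eq]
  abel

/-- The integrand is the derivative of `ε(b)(y)`, where `(y, β)` is the solution `w`. The terms in
`b'` match directly, those in `Ξ b` by the frame equation and the skewness of `B`, and the one in
`β` by the polarized contraction identity. -/
theorem linForm_gaugeDir (h : IsStructureCurve ε V A B Ξ) (b : CkCurve (k + 1) Q) {w : CkCurve (k + 1) E × CkCurve k Q}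
    (hw : w ∈ linSolutions V A) : linForm ε B (gaugeDir V Ξ b) w =
      ε.eval 1 (b.eval 1) (w.1.eval 1) - ε.eval 0 (b.eval 0) (w.1.eval 0) := by
  rw [mem_linSolutions] at hw
  have hd : ∀ t, HasUnitDeriv (fun t => ε.eval t (b.eval t) (w.1.eval t))
      (ε.eval t (w.2.eval t) ((gaugeDir V Ξ b).1.eval t) - ε.eval t ((gaugeDir V Ξ b).2.eval t)
        (w.1.eval t) + B.eval t (w.1.eval t) ((gaugeDir V Ξ b).1.eval t)) t := by
    intro t
    have h1 := ((ε.hasUnitDeriv t).clm_apply (b.hasUnitDeriv t)).clm_apply (w.1.hasUnitDeriv t)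
    refine h1.congr_deriv ?_
    have e1 := h.frame_eq t (b.eval t) (w.1.eval t)
    have e2 := h.skew t (V.eval t (b.eval t)) (w.1.eval t)
    have e3 := h.contraction t (b.eval t) (w.2.eval t)
    rw [gaugeDir_fst_eval, gaugeDir_snd_eval, hw t, add_apply, map_sub, map_neg, map_add, neg_apply,
      add_apply, ← e1, e2, ← sub_eq_zero, ← neg_eq_zero, ← e3]
    abel
  exact integral_eq_sub_of_hasUnitDeriv hd (continuous_linForm_integrand _ _)

/-- The adjoint of the linearized equation. -/
theorem exists_adjoint (A : CkCurve k (E →L[ℝ] E)) (B : CkCurve k (E →L[ℝ] E →L[ℝ] W))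
    (z : CkCurve (k + 1) E) (μ₁ : E →L[ℝ] W) : ∃ μ : C(I, E →L[ℝ] W), μ 1 = μ₁ ∧
      ∀ t, HasUnitDeriv μ (-(μ t).comp (A.eval t) - (B.eval t).flip (z.eval t)) t := by
  obtain ⟨μ, h1, hμ⟩ := exists_linear_solution_terminal (F := E →L[ℝ] W)
    ⟨fun t => -(ContinuousLinearMap.compL ℝ E E W).flip (A.eval t),
      ((ContinuousLinearMap.compL ℝ E E W).flip.continuous.comp A.continuous_eval).neg⟩
    ⟨fun t => -(B.eval t).flip (z.eval t),
      (continuous_flip_apply B.continuous_eval z.continuous_eval).neg⟩ μ₁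
  exact ⟨μ, h1, fun t => by simpa [sub_eq_add_neg] using hμ t⟩

/-- After a gauge direction is subtracted, only a vector component `z` is left. Orthogonality to all
solutions is then converted by an adjoint variable `μ` into pointwise conditions on freely chosen
data `y(0)` and `β`. These conditions and the structure equations force `z` and `μ` to vanish, and
the terminal value of `μ` says that the gauge parameter vanishes at `1`. -/
theorem orthogonal_mem_gaugeZero (h : IsStructureCurve ε V A B Ξ)
    {v : CkCurve (k + 1) E × CkCurve k Q}
    (hv : ∀ w ∈ linSolutions V A, linForm ε B v w = 0) : v ∈ gaugeZero V Ξ := by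
  -- The gauge parameter starting at `0` that reproduces the second component of `v`; the difference
  -- from `v` therefore has the form `(z, 0)`.
  set c := gaugeOf Ξ v.2 with hc
  set z : CkCurve (k + 1) E := v.1 - (gaugeDir V Ξ c).1 with hz
  have hvz : v = gaugeDir V Ξ c + (z, 0) := by
    refine Prod.ext ?_ ?_
    · simp [hz]
    · simp [hc, gaugeDir_gaugeOf_snd]
  have hc0 : c.eval 0 = 0 := gaugeOf_eval_zero _
  -- The terminal value is chosen to cancel the boundary term at `1` of the gauge part, and the
  -- source term cancels the curvature term in `z`.
  obtain ⟨μ, hμ1, hμ⟩ := exists_adjoint A B z (ε.eval 1 (c.eval 1))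
  -- Differentiating `μ(y)` along a solution eliminates the values of `y` for positive times. What
  -- remains involves only `β` and `y(0)`, which can be prescribed independently.
  have key : ∀ y β, (y, β) ∈ linSolutions V A →
      (∫ t : I, (ε.eval t (β.eval t) (z.eval t) - μ t (V.eval t (β.eval t)))) +
        μ 0 (y.eval 0) = 0 := by
    intro y β hy
    have e1 := hv _ hy
    rw [hvz, linForm_add_left, h.linForm_gaugeDir _ hy, hc0] at e1
    rw [mem_linSolutions] at hy
    have hd : ∀ t, HasUnitDeriv (fun t => μ t (y.eval t))
        (-B.eval t (y.eval t) (z.eval t) - μ t (V.eval t (β.eval t))) t := by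
      intro t
      refine ((hμ t).clm_apply (y.hasUnitDeriv t)).congr_deriv ?_
      rw [hy t]
      simp only [sub_apply, neg_apply, ContinuousLinearMap.comp_apply, ContinuousLinearMap.flip_apply,
        map_sub]
      abel
    have cB : Continuous fun t : I => B.eval t (y.eval t) (z.eval t) :=
      (B.continuous_eval.clm_apply y.continuous_eval).clm_apply z.continuous_eval
    have cμ : Continuous fun t : I => μ t (V.eval t (β.eval t)) :=
      μ.continuous.clm_apply (V.continuous_eval.clm_apply β.continuous_eval)
    have cε : Continuous fun t : I => ε.eval t (β.eval t) (z.eval t) :=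
      (ε.continuous_eval.clm_apply β.continuous_eval).clm_apply z.continuous_eval
    have e2 := integral_eq_sub_of_hasUnitDeriv hd (cB.neg.sub cμ)
    have iB' : Integrable fun t : I => -B.eval t (y.eval t) (z.eval t) :=
      integrable_of_continuous_unitInterval cB.neg
    have iB := integrable_of_continuous_unitInterval cB
    have iμ := integrable_of_continuous_unitInterval cμ
    have iε := integrable_of_continuous_unitInterval cε
    have e3 : linForm ε B (z, (0 : CkCurve k Q)) (y, β) =
        (∫ t : I, ε.eval t (β.eval t) (z.eval t)) + ∫ t : I, B.eval t (y.eval t) (z.eval t) := by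
      rw [← integral_add iε iB]
      simp [linForm]
    rw [e3] at e1
    rw [integral_sub iB' iμ, integral_neg, hμ1] at e2
    rw [integral_sub iε iμ]
    have e2' : -(∫ t : I, μ t (V.eval t (β.eval t))) = ε.eval 1 (c.eval 1) (y.eval 1) -
        μ 0 (y.eval 0) + ∫ t : I, B.eval t (y.eval t) (z.eval t) := by
      rw [← e2]; abel
    rw [sub_eq_add_neg, e2', ← e1]
    simp only [map_zero, zero_apply, sub_zero]
    abel
  -- The choice `β = 0` with arbitrary `y(0)` isolates the boundary term; `y(0) = 0` with arbitrary
  -- `β` then gives the pointwise identity `hpt`.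
  have hμ0 : μ 0 = 0 := by
    ext1 y₀
    obtain ⟨y, hy0, hy⟩ := exists_mem_linSolutions V A y₀ 0
    simpa [hy0] using key y 0 hy
  have hpt : ∀ t q, ε.eval t q (z.eval t) = μ t (V.eval t q) := by
    intro t q
    have := eq_zero_of_integral_apply_eq_zero (k := k)
      (Λ := fun t => (ε.eval t).flip (z.eval t) - (μ t).comp (V.eval t))
      ((continuous_flip_apply ε.continuous_eval z.continuous_eval).sub
        (μ.continuous.clm_comp V.continuous_eval)) (fun β => by
          obtain ⟨y, hy0, hy⟩ := exists_mem_linSolutions V A 0 β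
          simpa [hy0] using key y β hy) t
    exact sub_eq_zero.1 (DFunLike.congr_fun this q)
  -- Both sides of `ε(q)(z) = μ(V q)` are differentiated. By the two structure equations and the
  -- equation for `μ` everything cancels except `ε(q)(z' - A z)`, and the annihilator condition
  -- applies.
  have hz' : ∀ t, (CkCurve.derivL z).eval t = A.eval t (z.eval t) := by
    intro t
    rw [← sub_eq_zero]
    refine h.annihilator t _ fun q => ?_
    have dq : HasUnitDeriv (fun _ => q) 0 t := hasDerivWithinAt_const _ _ q
    have d1 := ((ε.hasUnitDeriv t).clm_apply dq).clm_apply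
      (z.hasUnitDeriv t)
    have d2 := (hμ t).clm_apply ((V.hasUnitDeriv t).clm_apply dq)
    have d3 := d1.unique (by simpa only [hpt] using d2)
    have e1 := h.frame_eq t q (z.eval t)
    have e2 := congrArg (μ t) (h.anchor_eq t q)
    rw [← hpt, ← e1] at e2
    simp only [map_zero, add_zero, sub_apply, neg_apply, map_sub,
      ContinuousLinearMap.comp_apply, ContinuousLinearMap.flip_apply] at d3 e2 ⊢
    rw [sub_eq_iff_eq_add] at e2
    rw [e2] at d3
    rw [← sub_eq_zero] at d3
    rw [← d3]
    abel
  have hz0 : z = 0 := by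
    refine (CkCurve.linearIVP A).injective (Prod.ext ?_ (CkCurve.ext fun t => ?_))
    · refine h.annihilator 0 _ fun q => ?_
      have := hpt 0 q
      rwa [hμ0] at this
    · simp [hz' t]
  -- With `z = 0` the adjoint equation is homogeneous with zero initial value, so `μ` vanishes up to
  -- `t = 1`, where it equals `ε(c(1))`.
  have hμz : ∀ t, μ t = 0 := by
    obtain ⟨K, hK⟩ : ∃ K : ℝ, ∀ t, ‖A.eval t‖ ≤ K := ⟨‖A‖, A.norm_eval_le⟩
    refine eq_zero_of_hasUnitDeriv hμ hμ0 (K := K) fun t => ?_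
    rw [hz0, CkCurve.eval_zero, map_zero, sub_zero, norm_neg, mul_comm]
    exact (ContinuousLinearMap.opNorm_comp_le _ _).trans (by gcongr; exact hK t)
  refine mem_gaugeZero.2 ⟨c, hc0, h.injective 1 _ ?_, ?_⟩
  · rw [← hμ1, hμz]
  · rw [hvz, hz0]
    simp

/-- The orthogonal is the space of gauge directions with vanishing end points. A solution is such a
gauge direction precisely when two finite-dimensional obstructions vanish, and these obstructions
take all values. -/
theorem isCoisotropicOfCodim_linSolutions (h : IsStructureCurve ε V A B Ξ) :
    IsCoisotropicOfCodim (linForm ε B) (linSolutions V A)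
      (Module.finrank ℝ E + Module.finrank ℝ Q) := by
  refine ⟨gaugeZero V Ξ, fun v => ⟨fun hv w hw => ?_, h.orthogonal_mem_gaugeZero⟩, fun v hv => ?_, ?_⟩
  · obtain ⟨b, h0, h1, rfl⟩ := mem_gaugeZero.1 hv
    rw [h.linForm_gaugeDir b hw, h0, h1]
    simp
  · obtain ⟨b, -, -, rfl⟩ := mem_gaugeZero.1 hv
    exact h.gaugeDir_mem b
  -- The obstructions are the initial value `y(0)` and the end value of the gauge parameter that
  -- starts at `0` and has second component `β`. If both vanish, the gauge direction and the
  -- solution share initial value and `β`, so they coincide.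
  · let ψ : linSolutions V A →ₗ[ℝ] E × Q :=
      (((CkCurve.evalL 0).comp (.fst ℝ _ _)).prod
        ((CkCurve.evalL 1).comp ((gaugeOf Ξ).comp (.snd ℝ _ _))) :
          CkCurve (k + 1) E × CkCurve k Q →L[ℝ] E × Q).toLinearMap.comp (linSolutions V A).subtype
    have hψ : ∀ w, ψ w = (w.1.1.eval 0, (gaugeOf Ξ w.1.2).eval 1) := fun w => rfl
    have hker : LinearMap.ker ψ = (gaugeZero V Ξ).submoduleOf (linSolutions V A) := by
      ext w
      rw [LinearMap.mem_ker, hψ, Submodule.submoduleOf, Submodule.mem_comap, mem_gaugeZero,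
        Prod.mk_eq_zero]
      constructor
      · rintro ⟨h0, h1⟩
        refine ⟨gaugeOf Ξ w.1.2, gaugeOf_eval_zero _, h1, ?_⟩
        refine Prod.ext ?_ (gaugeDir_gaugeOf_snd _)
        have hg := h.gaugeDir_mem (gaugeOf Ξ w.1.2)
        refine eq_of_mem_linSolutions (β := w.1.2) (V := V) (A := A) ?_ w.2 ?_
        · have e : gaugeDir V Ξ (gaugeOf Ξ w.1.2) = ((gaugeDir V Ξ (gaugeOf Ξ w.1.2)).1, w.1.2) :=
            Prod.ext rfl (gaugeDir_gaugeOf_snd _)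
          rwa [e] at hg
        · rw [gaugeDir_fst_eval, gaugeOf_eval_zero, map_zero]
          exact h0.symm
      · rintro ⟨b, h0, h1, hb⟩
        change _ = w.1 at hb
        rw [← hb, gaugeDir_fst_eval, h0, map_zero, gaugeOf_gaugeDir_snd h0, h1]
        exact ⟨rfl, rfl⟩
    have hsurj : Function.Surjective ψ := by
      rintro ⟨y₀, q⟩
      -- The line `t ↦ t q` joins `0` to the prescribed end value.
      obtain ⟨c, hc0, hc1⟩ : ∃ c : CkCurve (k + 1) Q, c.eval 0 = 0 ∧ c.eval 1 = q :=
        ⟨CkCurve.ofSmooth (fun t => t • q) (by fun_prop), by simp, by simp⟩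
      obtain ⟨y, hy0, hy⟩ := exists_mem_linSolutions V A y₀ (gaugeDir V Ξ c).2
      refine ⟨⟨_, hy⟩, ?_⟩
      rw [hψ, gaugeOf_gaugeDir_snd hc0, hc1, hy0]
    have e := (Submodule.quotEquivOfEq _ _ hker).symm.trans (ψ.quotKerEquivOfSurjective hsurj)
    exact ⟨Module.Finite.equiv e.symm, by rw [e.finrank_eq, Module.finrank_prod]⟩

end IsStructureCurve

end Linear

/-! ### Slice charts from local diffeomorphisms of the model space -/

section SliceDiffeo

variable {H : Type*} [NormedAddCommGroup H] [NormedSpace ℝ H]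
  {B : Type*} [TopologicalSpace B] [ChartedSpace H B]

theorem trans_mem_maximalAtlas {c : OpenPartialHomeomorph B H}
    (hc : c ∈ IsManifold.maximalAtlas 𝓘(ℝ, H) ∞ B) {Θ : OpenPartialHomeomorph H H}
    (hΘ : ContDiffOn ℝ ∞ Θ Θ.source) (hΘ' : ContDiffOn ℝ ∞ Θ.symm Θ.target) :
    c ≫ₕ Θ ∈ IsManifold.maximalAtlas 𝓘(ℝ, H) ∞ B := by
  have hg : Θ ∈ contDiffGroupoid ∞ 𝓘(ℝ, H) := by
    rw [contDiffGroupoid, mem_groupoid_of_pregroupoid]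
    simp only [contDiffPregroupoid, modelWithCornersSelf_coe, modelWithCornersSelf_coe_symm,
      Function.id_comp, Function.comp_id, range_id, inter_univ, preimage_id]
    exact ⟨hΘ, hΘ'⟩
  intro e he
  obtain ⟨h1, h2⟩ := hc e he
  constructor
  · rw [OpenPartialHomeomorph.trans_symm_eq_symm_trans_symm, OpenPartialHomeomorph.trans_assoc]
    exact StructureGroupoid.trans _ (StructureGroupoid.symm _ hg) h1
  · rw [← OpenPartialHomeomorph.trans_assoc]
    exact StructureGroupoid.trans _ h2 hg

namespace SliceChart

variable {H₁ H₂ : Type*} [NormedAddCommGroup H₁] [NormedSpace ℝ H₁]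
  [NormedAddCommGroup H₂] [NormedSpace ℝ H₂] {Z : Set B}

/-- The slice chart that is obtained from a chart by a local diffeomorphism of the model space. -/
def ofDiffeo {c : OpenPartialHomeomorph B H} (hc : c ∈ IsManifold.maximalAtlas 𝓘(ℝ, H) ∞ B)
    (Θ : OpenPartialHomeomorph H (H₁ × H₂)) (hΘ : ContDiffOn ℝ ∞ Θ Θ.source)
    (hΘ' : ContDiffOn ℝ ∞ Θ.symm Θ.target) (L : H ≃L[ℝ] H₁ × H₂)
    (hZ : ∀ b ∈ c.source, c b ∈ Θ.source → (b ∈ Z ↔ (Θ (c b)).2 = 0)) :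
    SliceChart H H₁ H₂ Z where
  e := c ≫ₕ Θ.transHomeomorph L.symm.toHomeomorph
  mem := by
    refine trans_mem_maximalAtlas hc ?_ ?_
    · exact L.symm.contDiff.comp_contDiffOn hΘ
    · exact hΘ'.comp L.contDiff.contDiffOn fun x hx => hx
  L := L
  slice b hb := by
    have hb' : b ∈ c.source ∧ c b ∈ Θ.source := by simpa using hb
    rw [hZ b hb'.1 hb'.2]
    simp

section

variable {c : OpenPartialHomeomorph B H} {hc : c ∈ IsManifold.maximalAtlas 𝓘(ℝ, H) ∞ B}
    {Θ : OpenPartialHomeomorph H (H₁ × H₂)} {hΘ : ContDiffOn ℝ ∞ Θ Θ.source}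
    {hΘ' : ContDiffOn ℝ ∞ Θ.symm Θ.target} {L : H ≃L[ℝ] H₁ × H₂}
    {hZ : ∀ b ∈ c.source, c b ∈ Θ.source → (b ∈ Z ↔ (Θ (c b)).2 = 0)}

theorem mem_ofDiffeo_source {b : B} : b ∈ (ofDiffeo hc Θ hΘ hΘ' L hZ).e.source ↔
    b ∈ c.source ∧ c b ∈ Θ.source := by simp [ofDiffeo]

theorem L_ofDiffeo (b : B) :
    (ofDiffeo hc Θ hΘ hΘ' L hZ).L ((ofDiffeo hc Θ hΘ hΘ' L hZ).e b) = Θ (c b) := by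
  simp [ofDiffeo]

theorem restr_ofDiffeo (z₀ z : Z) :
    (ofDiffeo hc Θ hΘ hΘ' L hZ).restr z₀ z = (Θ (c z)).1 := by
  rw [restr_apply, L_ofDiffeo]

variable (h : ∀ z : Z, ∃ s : SliceChart H H₁ H₂ Z, (z : B) ∈ s.e.source)

theorem mem_range_mfderiv_val_ofDiffeo (z : Z) (hz : (z : B) ∈ c.source) (hz' : c z ∈ Θ.source)
    (hc : c ∈ IsManifold.maximalAtlas 𝓘(ℝ, H) ∞ B) (hΘ : ContDiffOn ℝ ∞ Θ Θ.source)
    (hΘ' : ContDiffOn ℝ ∞ Θ.symm Θ.target) (L : H ≃L[ℝ] H₁ × H₂)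
    (hZ : ∀ b ∈ c.source, c b ∈ Θ.source → (b ∈ Z ↔ (Θ (c b)).2 = 0))
    (v : TangentSpace 𝓘(ℝ, H) (z : B)) :
    letI := chartedSpace h
    (∃ w : TangentSpace 𝓘(ℝ, H₁) z,
      mfderiv 𝓘(ℝ, H₁) 𝓘(ℝ, H) (Subtype.val : Z → B) z w = v) ↔
      (fderiv ℝ Θ (c z) (mfderiv 𝓘(ℝ, H) 𝓘(ℝ, H) c (z : B) v)).2 = 0 := by
  let _ := chartedSpace h
  set s := ofDiffeo hc Θ hΘ hΘ' L hZ with hs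
  have hzs : (z : B) ∈ s.e.source := mem_ofDiffeo_source.2 ⟨hz, hz'⟩
  rw [s.mem_range_mfderiv_val h z hzs]
  have h1 : HasMFDerivAt 𝓘(ℝ, H) 𝓘(ℝ, H) c (z : B) (mfderiv 𝓘(ℝ, H) 𝓘(ℝ, H) c (z : B)) :=
    ((contMDiffAt_of_mem_maximalAtlas hc hz).mdifferentiableAt (by simp)).hasMFDerivAt
  have h2 : HasFDerivAt Θ (fderiv ℝ Θ (c z)) (c z) :=
    ((hΘ.contDiffAt (Θ.open_source.mem_nhds hz')).differentiableAt (by simp)).hasFDerivAt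
  have h3 := (L.symm.hasFDerivAt (x := Θ (c z))).hasMFDerivAt.comp (z : B)
    (h2.hasMFDerivAt.comp (z : B) h1)
  have h4 : mfderiv 𝓘(ℝ, H) 𝓘(ℝ, H) s.e (z : B) v =
      L.symm (fderiv ℝ Θ (c z) (mfderiv 𝓘(ℝ, H) 𝓘(ℝ, H) c (z : B) v)) :=
    DFunLike.congr_fun h3.mfderiv v
  rw [h4]
  change (L (L.symm _)).2 = 0 ↔ _
  rw [L.apply_symm_apply]

/-- The inclusion in the coordinates of a slice chart. -/
theorem mfderiv_comp_val_ofDiffeo (z : Z) (hz : (z : B) ∈ c.source) (hz' : c z ∈ Θ.source)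
    (s : SliceChart H H₁ H₂ Z) (hs : s = ofDiffeo hc Θ hΘ hΘ' L hZ)
    (v : letI := chartedSpace h; TangentSpace 𝓘(ℝ, H₁) z) :
    letI := chartedSpace h
    mfderiv 𝓘(ℝ, H) 𝓘(ℝ, H) c (z : B) (mfderiv 𝓘(ℝ, H₁) 𝓘(ℝ, H) (Subtype.val : Z → B) z v) =
      fderiv ℝ (fun y : H₁ => Θ.symm (y, 0)) ((Θ (c z)).1)
        (mfderiv 𝓘(ℝ, H₁) 𝓘(ℝ, H₁) (s.restr z) z v) := by
  let _ := chartedSpace h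
  have := isManifold h
  have hzs : (z : B) ∈ s.e.source := by rw [hs]; exact mem_ofDiffeo_source.2 ⟨hz, hz'⟩
  have hval : MDifferentiableAt 𝓘(ℝ, H₁) 𝓘(ℝ, H) (Subtype.val : Z → B) z :=
    ((isSmoothEmbedding h).contMDiff z).mdifferentiableAt (by simp)
  have h1 : HasMFDerivAt 𝓘(ℝ, H) 𝓘(ℝ, H) c (z : B) (mfderiv 𝓘(ℝ, H) 𝓘(ℝ, H) c (z : B)) :=
    ((contMDiffAt_of_mem_maximalAtlas hc hz).mdifferentiableAt (by simp)).hasMFDerivAt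
  have h2 : HasMFDerivAt 𝓘(ℝ, H₁) 𝓘(ℝ, H₁) (s.restr z) z
      (mfderiv 𝓘(ℝ, H₁) 𝓘(ℝ, H₁) (s.restr z) z) :=
    ((contMDiffAt_of_mem_maximalAtlas (restr_mem_maximalAtlas h s z)
      (show z ∈ (s.restr z).source from hzs)).mdifferentiableAt (by simp)).hasMFDerivAt
  have hr : ∀ w : Z, s.restr z w = (Θ (c w)).1 := fun w => by rw [hs, restr_ofDiffeo]
  have hslice : ∀ w : Z, (w : B) ∈ c.source → c w ∈ Θ.source →
      Θ.symm ((Θ (c w)).1, 0) = c w := fun w hw hw' => by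
    rw [← (hZ w hw hw').1 w.2, Prod.mk.eta, Θ.left_inv hw']
  have hmem : ((Θ (c z)).1, (0 : H₂)) ∈ Θ.target := by
    rw [← (hZ z hz hz').1 z.2, Prod.mk.eta]
    exact Θ.map_source hz'
  have h3 : HasFDerivAt (fun y : H₁ => Θ.symm (y, 0))
      (fderiv ℝ (fun y : H₁ => Θ.symm (y, 0)) (s.restr z z)) (s.restr z z) := by
    rw [hr]
    refine DifferentiableAt.hasFDerivAt ?_
    exact DifferentiableAt.comp (g := Θ.symm) (f := fun y : H₁ => (y, (0 : H₂))) _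
      ((hΘ'.contDiffAt (Θ.open_target.mem_nhds hmem)).differentiableAt (by simp)) (by fun_prop)
  have h4 := (h3.hasMFDerivAt.comp z h2).congr_of_eventuallyEq (f₁ := c ∘ (Subtype.val : Z → B)) (by
    filter_upwards [(s.e.open_source.preimage continuous_subtype_val).mem_nhds hzs] with w hw
    have hw' : (w : B) ∈ c.source ∧ c w ∈ Θ.source := by
      rw [← mem_ofDiffeo_source (hc := hc) (hΘ := hΘ) (hΘ' := hΘ') (L := L) (hZ := hZ), ← hs]
      exact hw
    change c w = Θ.symm (s.restr z w, 0)
    rw [hr, hslice w hw'.1 hw'.2])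
  have h5 := DFunLike.congr_fun (hasMFDerivAt_unique (h1.comp z hval.hasMFDerivAt) h4) v
  rw [← hr]
  exact h5

end

/-- The differential of the chart that is induced by a slice chart. -/
theorem exists_mfderiv_restr (h : ∀ z : Z, ∃ s : SliceChart H H₁ H₂ Z, (z : B) ∈ s.e.source)
    (s : SliceChart H H₁ H₂ Z) (z : Z) (hz : (z : B) ∈ s.e.source) :
    letI := chartedSpace h
    ∃ κ : TangentSpace 𝓘(ℝ, H₁) z ≃ₗ[ℝ] H₁,
      ∀ v, κ v = mfderiv 𝓘(ℝ, H₁) 𝓘(ℝ, H₁) (s.restr z) z v := by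
  let _ := chartedSpace h
  have := isManifold h
  have hm := restr_mem_maximalAtlas h s z
  have hmd : (s.restr z).MDifferentiable 𝓘(ℝ, H₁) 𝓘(ℝ, H₁) :=
      ⟨(contMDiffOn_of_mem_maximalAtlas hm).mdifferentiableOn (by simp),
        (contMDiffOn_symm_of_mem_maximalAtlas hm).mdifferentiableOn (by simp)⟩
  exact ⟨LinearEquiv.ofBijective _ (hmd.mfderiv_bijective (show z ∈ (s.restr z).source from hz)),
    fun v => rfl⟩

end SliceChart

end SliceDiffeo

theorem IsCoisotropicOfCodim.of_linearEquiv {V V' W : Type*} [AddCommGroup V] [Module ℝ V]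
    [AddCommGroup V'] [Module ℝ V'] [AddCommGroup W] {α : V → V → W} {β : V' → V' → W}
    {L : Submodule ℝ V} {L' : Submodule ℝ V'} {d : ℕ} (h : IsCoisotropicOfCodim β L' d)
    (κ : V ≃ₗ[ℝ] V') (hα : ∀ v w, α v w = β (κ v) (κ w)) (hL : ∀ v, v ∈ L ↔ κ v ∈ L') :
    IsCoisotropicOfCodim α L d := by
  obtain ⟨K, hK, hKL, hfin, hd⟩ := h
  refine ⟨K.comap κ.toLinearMap, fun v => ?_, fun v hv => (hL v).2 (hKL hv), ?_⟩
  · rw [Submodule.mem_comap]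
    refine (hK _).trans ⟨fun hv w hw => ?_, fun hv w hw => ?_⟩
    · rw [hα]
      exact hv _ ((hL w).1 hw)
    · have := hv (κ.symm w) ((hL _).2 (by simpa using hw))
      rw [hα] at this
      simpa using this
  · let κL : L ≃ₗ[ℝ] L' := κ.ofSubmodules L L' (by
      ext w
      rw [Submodule.mem_map]
      constructor
      · rintro ⟨v, hv, rfl⟩
        exact (hL v).1 hv
      · intro hw
        exact ⟨κ.symm w, (hL _).2 (by simpa using hw), by simp⟩)
    have e := Submodule.Quotient.equiv ((K.comap κ.toLinearMap).submoduleOf L) (K.submoduleOf L') κL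
      (by
        ext w
        rw [Submodule.mem_map]
        constructor
        · rintro ⟨v, hv, rfl⟩
          exact hv
        · intro hw
          refine ⟨κL.symm w, ?_, by simp⟩
          change κ (κL.symm w : V) ∈ K
          have : κ (κL.symm w : V) = w := congrArg Subtype.val (κL.apply_symm_apply w)
          rw [this]
          exact hw)
    exact ⟨Module.Finite.equiv e.symm, by rw [e.finrank_eq, hd]⟩

/-! ### Frames along curves -/

section FrameCurves

variable {k : ℕ} {E : Type*} [NormedAddCommGroup E] [NormedSpace ℝ E] [CompleteSpace E]
  {X : Type*} [NormedAddCommGroup X] [NormedSpace ℝ X] [CompleteSpace X]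
  {Y : Type*} [NormedAddCommGroup Y] [NormedSpace ℝ Y] [CompleteSpace Y]


/-- The part of `ℝ × E × X` that lies over `N`. -/
def actDom (X : Type*) (N : Set (ℝ × E)) : Set (ℝ × (E × X)) := {z | (z.1, z.2.1) ∈ N}

theorem isOpen_actDom {N : Set (ℝ × E)} (hN : IsOpen N) : IsOpen (actDom X N) :=
  hN.preimage (by fun_prop : Continuous fun z : ℝ × (E × X) => (z.1, z.2.1))

/-- The pointwise action of a family of linear maps. -/
def act (Ψ : ℝ × E → X →L[ℝ] Y) (z : ℝ × (E × X)) : Y := Ψ (z.1, z.2.1) z.2.2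

theorem contDiffOn_base {Z : Type*} [NormedAddCommGroup Z] [NormedSpace ℝ Z] {N : Set (ℝ × E)}
    {g : ℝ × E → Z} (hg : ContDiffOn ℝ ∞ g N) :
    ContDiffOn ℝ ∞ (fun z : ℝ × (E × X) => g (z.1, z.2.1)) (actDom X N) :=
  hg.comp (f := fun z : ℝ × (E × X) => (z.1, z.2.1)) (by fun_prop) fun _ hz => hz

theorem contDiffOn_act {N : Set (ℝ × E)} {Ψ : ℝ × E → X →L[ℝ] Y} (hΨ : ContDiffOn ℝ ∞ Ψ N) :
    ContDiffOn ℝ ∞ (act Ψ) (actDom X N) :=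
  (contDiffOn_base hΨ).clm_apply (by fun_prop)

theorem hasFDerivAt_act {Ψ : ℝ × E → X →L[ℝ] Y} {z : ℝ × (E × X)}
    (hΨ : DifferentiableAt ℝ Ψ (z.1, z.2.1)) (v : E × X) :
    fderiv ℝ (act Ψ) z (0, v) = fderiv ℝ Ψ (z.1, z.2.1) (0, v.1) z.2.2 + Ψ (z.1, z.2.1) v.2 := by
  let q : ℝ × (E × X) →L[ℝ] ℝ × E :=
    (ContinuousLinearMap.fst ℝ _ _).prod ((ContinuousLinearMap.fst ℝ _ _).comp (.snd ℝ _ _))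
  have h1 : HasFDerivAt (fun z : ℝ × (E × X) => Ψ (z.1, z.2.1))
      ((fderiv ℝ Ψ (z.1, z.2.1)).comp q) z :=
    HasFDerivAt.comp (g := Ψ) (f := q) z hΨ.hasFDerivAt q.hasFDerivAt
  let q' : ℝ × (E × X) →L[ℝ] X := (ContinuousLinearMap.snd ℝ _ _).comp (.snd ℝ _ _)
  have h2 := h1.clm_apply (q'.hasFDerivAt (x := z))
  have h3 : fderiv ℝ (act Ψ) z = _ := h2.fderiv
  rw [h3]
  simp [q, q', add_comm]

/-- The derivative of a family of linear maps in the directions of `E`. -/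
def spaceDeriv (Ψ : ℝ × E → X →L[ℝ] Y) (z : ℝ × (E × X)) : E →L[ℝ] Y :=
  ((fderiv ℝ Ψ (z.1, z.2.1)).comp (.inr ℝ ℝ E)).flip z.2.2

theorem spaceDeriv_apply (Ψ : ℝ × E → X →L[ℝ] Y) (z : ℝ × (E × X)) (x : E) :
    spaceDeriv Ψ z x = fderiv ℝ Ψ (z.1, z.2.1) (0, x) z.2.2 := rfl

theorem spaceDeriv_eq_fderiv {Ψ : ℝ × E → X →L[ℝ] Y} {t : ℝ} {y : E}
    (hΨ : DifferentiableAt ℝ Ψ (t, y)) (a : X) :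
    spaceDeriv Ψ (t, (y, a)) = fderiv ℝ (fun y => Ψ (t, y) a) y := by
  have h1 : HasFDerivAt (fun y => Ψ (t, y)) ((fderiv ℝ Ψ (t, y)).comp (.inr ℝ ℝ E)) y :=
    HasFDerivAt.comp (g := Ψ) (f := fun y => (t, y)) y hΨ.hasFDerivAt
      (hasFDerivAt_prodMk_right t y)
  have h2 := h1.clm_apply (hasFDerivAt_const a y)
  rw [h2.fderiv]
  ext x
  simp [spaceDeriv]

theorem contDiff_flip {E X Y : Type*} [NormedAddCommGroup E] [NormedSpace ℝ E]
    [NormedAddCommGroup X] [NormedSpace ℝ X] [NormedAddCommGroup Y] [NormedSpace ℝ Y] :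
    ContDiff ℝ ∞ fun L : E →L[ℝ] X →L[ℝ] Y => L.flip :=
  (IsLinearMap.with_bound ⟨fun _ _ => rfl, fun _ _ => rfl⟩ 1 fun L => by
    rw [one_mul]; exact (ContinuousLinearMap.opNorm_flip L).le).contDiff

set_option synthInstance.maxHeartbeats 400000 in
theorem contDiffOn_spaceDeriv {N : Set (ℝ × E)} (hN : IsOpen N) {Ψ : ℝ × E → X →L[ℝ] Y}
    (hΨ : ContDiffOn ℝ ∞ Ψ N) : ContDiffOn ℝ ∞ (spaceDeriv Ψ) (actDom X N) := by
  have h1 : ContDiffOn ℝ ∞ (fderiv ℝ Ψ) N := hΨ.fderiv_of_isOpen hN (by simp)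
  have hT : ContDiff ℝ ∞ fun L : ℝ × E →L[ℝ] X →L[ℝ] Y => L.comp (.inr ℝ ℝ E) :=
    (ContinuousLinearMap.isBoundedLinearMap_comp_right (.inr ℝ ℝ E)).contDiff
  have h2 : ContDiffOn ℝ ∞ (fun p => (fderiv ℝ Ψ p).comp (.inr ℝ ℝ E)) N := hT.comp_contDiffOn h1
  have h3 : ContDiffOn ℝ ∞ (fun p => ((fderiv ℝ Ψ p).comp (.inr ℝ ℝ E)).flip) N :=
    contDiff_flip.comp_contDiffOn h2
  exact (contDiffOn_base h3).clm_apply (by fun_prop)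

/-- The product of the two components as a curve. -/
def pairCurve : CkCurve (k + 1) E × CkCurve k X →L[ℝ] CkCurve k (E × X) :=
  CkCurve.pairL.comp (CkCurve.incl.prodMap (.id ℝ _))

@[simp] theorem pairCurve_eval (p : CkCurve (k + 1) E × CkCurve k X) (t : I) :
    (pairCurve p).eval t = (p.1.eval t, p.2.eval t) := by simp [pairCurve]

/-- The pointwise action along a curve. -/
def actCurve (Ψ : ℝ × E → X →L[ℝ] Y) (p : CkCurve (k + 1) E × CkCurve k X) : CkCurve k Y :=
  CkCurve.nemytskii k (act Ψ) (pairCurve p)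

theorem pairCurve_mem_actDom {N : Set (ℝ × E)} {p : CkCurve (k + 1) E × CkCurve k X}
    (hp : p.1 ∈ CkCurve.graphIn (k + 1) N) :
    pairCurve p ∈ CkCurve.graphIn k (actDom X N) := fun t => by
  simpa [actDom] using hp t

theorem nemytskii_pair_eval {Z : Type*} [NormedAddCommGroup Z] [NormedSpace ℝ Z] {N : Set (ℝ × E)}
    {g : ℝ × (E × X) → Z} (hg : ContDiffOn ℝ ∞ g (actDom X N)) {p : CkCurve (k + 1) E × CkCurve k X}
    (hp : p.1 ∈ CkCurve.graphIn (k + 1) N) (t : I) :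
    (CkCurve.nemytskii k g (pairCurve p)).eval t =
      g (t, (p.1.eval t, p.2.eval t)) := by
  rw [CkCurve.nemytskii_eval (hg.of_le (mod_cast le_top)) (pairCurve_mem_actDom hp)]
  simp

theorem actCurve_eval {N : Set (ℝ × E)} {Ψ : ℝ × E → X →L[ℝ] Y} (hΨ : ContDiffOn ℝ ∞ Ψ N)
    {p : CkCurve (k + 1) E × CkCurve k X} (hp : p.1 ∈ CkCurve.graphIn (k + 1) N) (t : I) :
    (actCurve Ψ p).eval t = Ψ (t, p.1.eval t) (p.2.eval t) :=
  nemytskii_pair_eval (contDiffOn_act hΨ) hp t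

theorem contDiffOn_actCurve {N : Set (ℝ × E)} (hN : IsOpen N) {Ψ : ℝ × E → X →L[ℝ] Y}
    (hΨ : ContDiffOn ℝ ∞ Ψ N) : ContDiffOn ℝ ∞ (actCurve (k := k) Ψ)
      (Prod.fst ⁻¹' CkCurve.graphIn (k + 1) N) :=
  by
  have hO : IsOpen (actDom X N) := isOpen_actDom hN
  have hg : ContDiffOn ℝ ∞ (act Ψ) (actDom X N) := contDiffOn_act hΨ
  have h1 : ContDiffOn ℝ ∞ (CkCurve.nemytskii k (act Ψ)) (CkCurve.graphIn k (actDom X N)) :=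
    CkCurve.contDiffOn_nemytskii hO hg
  have h2 : ContDiffOn ℝ ∞ (pairCurve (k := k) (E := E) (X := X))
    (Prod.fst ⁻¹' CkCurve.graphIn (k + 1) N) := pairCurve.contDiff.contDiffOn
  have h3 : MapsTo (pairCurve (k := k) (E := E) (X := X))
    (Prod.fst ⁻¹' CkCurve.graphIn (k + 1) N) (CkCurve.graphIn k (actDom X N)) :=
    fun _ hp => pairCurve_mem_actDom hp
  exact h1.comp h2 h3

theorem isOpen_fst_graphIn {N : Set (ℝ × E)} (hN : IsOpen N) :
    IsOpen (Prod.fst ⁻¹' CkCurve.graphIn (k + 1) N : Set (CkCurve (k + 1) E × CkCurve k X)) :=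
  (CkCurve.isOpen_graphIn hN).preimage continuous_fst

theorem fderiv_actCurve_eval {N : Set (ℝ × E)} (hN : IsOpen N) {Ψ : ℝ × E → X →L[ℝ] Y}
    (hΨ : ContDiffOn ℝ ∞ Ψ N) {p : CkCurve (k + 1) E × CkCurve k X}
    (hp : p.1 ∈ CkCurve.graphIn (k + 1) N) (v : CkCurve (k + 1) E × CkCurve k X) (t : I) :
    (fderiv ℝ (actCurve Ψ) p v).eval t =
      spaceDeriv Ψ (t, (p.1.eval t, p.2.eval t)) (v.1.eval t) +
        Ψ (t, p.1.eval t) (v.2.eval t) := by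
  have hO : IsOpen (actDom X N) := isOpen_actDom hN
  have hg : ContDiffOn ℝ ∞ (act Ψ) (actDom X N) := contDiffOn_act hΨ
  have hm : pairCurve p ∈ CkCurve.graphIn k (actDom X N) := pairCurve_mem_actDom hp
  have h0 : ContDiffOn ℝ ∞ (CkCurve.nemytskii k (act Ψ)) (CkCurve.graphIn k (actDom X N)) :=
    CkCurve.contDiffOn_nemytskii hO hg
  have h1 : DifferentiableAt ℝ (CkCurve.nemytskii k (act Ψ)) (pairCurve p) :=
    (h0.contDiffAt ((CkCurve.isOpen_graphIn hO).mem_nhds hm)).differentiableAt (by simp)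
  have h2 : fderiv ℝ (actCurve Ψ) p = (fderiv ℝ (CkCurve.nemytskii k (act Ψ)) (pairCurve p)).comp
      pairCurve :=
    (HasFDerivAt.comp (g := CkCurve.nemytskii k (act Ψ)) (f := pairCurve) p h1.hasFDerivAt
      pairCurve.hasFDerivAt).fderiv
  rw [h2]
  have h3 := CkCurve.fderiv_nemytskii_eval hO hg hm (pairCurve v) t
  refine h3.trans ?_
  rw [hasFDerivAt_act ((hΨ.contDiffAt (hN.mem_nhds (by simpa using hp t))).differentiableAt (by simp))]
  simp [spaceDeriv_apply]

end FrameCurves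

/-! ### Straightening the covector component of the path coordinates by a frame -/

section FrameHomeo

variable {k : ℕ} {E : Type*} [NormedAddCommGroup E] [NormedSpace ℝ E] [CompleteSpace E]
  {Q : Type*} [NormedAddCommGroup Q] [NormedSpace ℝ Q] [CompleteSpace Q]
  {R : Type*} [NormedAddCommGroup R] [NormedSpace ℝ R] [CompleteSpace R]
  {W : Type*} [NormedAddCommGroup W] [NormedSpace ℝ W] [CompleteSpace W]
  {F : Type*} [NormedAddCommGroup F] [NormedSpace ℝ F]


/-- The frame of the subbundle. -/
def subFrame (Φ : ℝ × E → Q × R →L[ℝ] W) (p : ℝ × E) : Q →L[ℝ] W := (Φ p).comp (.inl ℝ Q R)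

theorem subFrame_apply (Φ : ℝ × E → Q × R →L[ℝ] W) (p : ℝ × E) (q : Q) :
    subFrame Φ p q = Φ p (q, 0) := rfl

/-- Curves with values in a product, split into their components. -/
def splitCurves : (CkCurve (k + 1) E × CkCurve k (Q × R)) ≃L[ℝ]
    (CkCurve (k + 1) E × CkCurve k Q) × CkCurve k R :=
  ContinuousLinearEquiv.equivOfInverse
    (((ContinuousLinearMap.fst ℝ _ _).prod ((CkCurve.map (.fst ℝ Q R)).comp (.snd ℝ _ _))).prod
      ((CkCurve.map (.snd ℝ Q R)).comp (.snd ℝ _ _)))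
    (((ContinuousLinearMap.fst ℝ _ _).comp (.fst ℝ _ _)).prod
      (CkCurve.pairL.comp (((ContinuousLinearMap.snd ℝ _ _).comp (.fst ℝ _ _)).prod (.snd ℝ _ _))))
    (fun p => Prod.ext rfl (CkCurve.ext fun t => by simp))
    (fun p => Prod.ext (Prod.ext rfl (CkCurve.ext fun t => by simp)) (CkCurve.ext fun t => by simp))

theorem splitCurves_symm_fst (y : (CkCurve (k + 1) E × CkCurve k Q) × CkCurve k R) :
    (splitCurves.symm y).1 = y.1.1 := rfl

theorem splitCurves_symm_snd_eval (y : (CkCurve (k + 1) E × CkCurve k Q) × CkCurve k R) (t : I) :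
    (splitCurves.symm y).2.eval t = (y.1.2.eval t, y.2.eval t) :=
  CkCurve.pairL_eval (y.1.2, y.2) t

namespace IsAnchoredFrame

variable {G : ℝ × E → Submodule ℝ (W × F)} {Φ : ℝ × E → Q × R →L[ℝ] W} {V : ℝ × E → Q →L[ℝ] F}
  {N : Set (ℝ × E)} (h : IsAnchoredFrame G Φ V N)

theorem contDiffOn_inverse (h : IsAnchoredFrame G Φ V N) :
    ContDiffOn ℝ ∞ (fun p => (Φ p).inverse) N := fun p hp => by
  obtain ⟨A, hA⟩ := h.exists_equiv p hp
  have h1 := contDiffAt_map_inverse (𝕜 := ℝ) (n := ∞) A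
  rw [hA] at h1
  exact h1.comp_contDiffWithinAt p (h.smooth p hp)

theorem inverse_apply (h : IsAnchoredFrame G Φ V N) {p : ℝ × E} (hp : p ∈ N) (q : Q × R) :
    (Φ p).inverse (Φ p q) = q := by
  obtain ⟨A, hA⟩ := h.exists_equiv p hp
  rw [← hA, ContinuousLinearMap.inverse_equiv]
  exact A.symm_apply_apply q

theorem apply_inverse (h : IsAnchoredFrame G Φ V N) {p : ℝ × E} (hp : p ∈ N) (w : W) :
    Φ p ((Φ p).inverse w) = w := by
  obtain ⟨A, hA⟩ := h.exists_equiv p hp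
  rw [← hA, ContinuousLinearMap.inverse_equiv]
  exact A.apply_symm_apply w

theorem contDiffOn_subFrame (h : IsAnchoredFrame G Φ V N) : ContDiffOn ℝ ∞ (subFrame Φ) N :=
  (((ContinuousLinearMap.compL ℝ Q (Q × R) W).flip (.inl ℝ Q R)).contDiff).comp_contDiffOn h.smooth

/-- A frame straightens the covector component of the coordinates of the path space. -/
def homeo (h : IsAnchoredFrame G Φ V N) : OpenPartialHomeomorph (CkCurve (k + 1) E × CkCurve k W)
    (CkCurve (k + 1) E × CkCurve k (Q × R)) where
  toFun p := (p.1, actCurve (fun p => (Φ p).inverse) p)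
  invFun p := (p.1, actCurve Φ p)
  source := Prod.fst ⁻¹' CkCurve.graphIn (k + 1) N
  target := Prod.fst ⁻¹' CkCurve.graphIn (k + 1) N
  map_source' _ hp := hp
  map_target' _ hp := hp
  left_inv' p hp := Prod.ext rfl (CkCurve.ext fun t => by
    have hp : p.1 ∈ CkCurve.graphIn (k + 1) N := hp
    rw [actCurve_eval h.smooth (by exact hp), actCurve_eval h.contDiffOn_inverse hp]
    exact h.apply_inverse (hp t) _)
  right_inv' p hp := Prod.ext rfl (CkCurve.ext fun t => by
    have hp : p.1 ∈ CkCurve.graphIn (k + 1) N := hp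
    rw [actCurve_eval h.contDiffOn_inverse (by exact hp), actCurve_eval h.smooth hp]
    exact h.inverse_apply (hp t) _)
  open_source := isOpen_fst_graphIn h.isOpen
  open_target := isOpen_fst_graphIn h.isOpen
  continuousOn_toFun := continuousOn_fst.prodMk
    (contDiffOn_actCurve h.isOpen h.contDiffOn_inverse).continuousOn
  continuousOn_invFun := continuousOn_fst.prodMk (contDiffOn_actCurve h.isOpen h.smooth).continuousOn

variable (k) in
/-- A frame, as a local diffeomorphism of the model space of the path space. -/
def straighten (h : IsAnchoredFrame G Φ V N) : OpenPartialHomeomorph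
    (CkCurve (k + 1) E × CkCurve k W) ((CkCurve (k + 1) E × CkCurve k Q) × CkCurve k R) :=
  (h.homeo (k := k)).transHomeomorph splitCurves.toHomeomorph

theorem contDiffOn_straighten (h : IsAnchoredFrame G Φ V N) :
    ContDiffOn ℝ ∞ (h.straighten k) (h.straighten k).source :=
  splitCurves.contDiff.comp_contDiffOn
    (contDiffOn_fst.prodMk (contDiffOn_actCurve h.isOpen h.contDiffOn_inverse))

theorem contDiffOn_straighten_symm (h : IsAnchoredFrame G Φ V N) :
    ContDiffOn ℝ ∞ (h.straighten k).symm (h.straighten k).target :=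
  ContDiffOn.comp (g := (h.homeo (k := k)).symm) (t := Prod.fst ⁻¹' CkCurve.graphIn (k + 1) N)
    (contDiffOn_fst.prodMk (contDiffOn_actCurve h.isOpen h.smooth))
    splitCurves.symm.contDiff.contDiffOn fun _ hx => hx

theorem straighten_eval (h : IsAnchoredFrame G Φ V N) {p : CkCurve (k + 1) E × CkCurve k W}
    (hp : p.1 ∈ CkCurve.graphIn (k + 1) N) (t : I) : Φ (t, p.1.eval t)
      ((h.straighten k p).1.2.eval t, (h.straighten k p).2.eval t) = p.2.eval t := by
  have e : ((h.straighten k p).1.2.eval t, (h.straighten k p).2.eval t) =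
      (actCurve (fun p => (Φ p).inverse) p).eval t := by
    rw [← splitCurves_symm_snd_eval]
    change (splitCurves.symm (splitCurves _)).2.eval t = _
    rw [ContinuousLinearEquiv.symm_apply_apply]
    rfl
  rw [e, actCurve_eval h.contDiffOn_inverse hp]
  exact h.apply_inverse (hp t) _

theorem straighten_symm_eq (h : IsAnchoredFrame G Φ V N) {y : CkCurve (k + 1) E × CkCurve k Q}
    (hy : y.1 ∈ CkCurve.graphIn (k + 1) N) :
    (h.straighten k).symm (y, 0) = (y.1, actCurve (subFrame Φ) y) := by
  refine Prod.ext rfl (CkCurve.ext fun t => ?_)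
  change (actCurve Φ (splitCurves.symm (y, 0))).eval t = (actCurve (subFrame Φ) y).eval t
  rw [actCurve_eval h.smooth (p := splitCurves.symm (y, 0)) hy,
    actCurve_eval h.contDiffOn_subFrame hy, splitCurves_symm_snd_eval, splitCurves_symm_fst]
  rfl

theorem fderiv_straighten_symm (h : IsAnchoredFrame G Φ V N) {y : CkCurve (k + 1) E × CkCurve k Q}
    (hy : y.1 ∈ CkCurve.graphIn (k + 1) N) (v : CkCurve (k + 1) E × CkCurve k Q) :
    fderiv ℝ (fun y : CkCurve (k + 1) E × CkCurve k Q => (h.straighten k).symm (y, 0)) y v =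
      (v.1, fderiv ℝ (actCurve (subFrame Φ)) y v) := by
  have h1 : (fun y : CkCurve (k + 1) E × CkCurve k Q => (h.straighten k).symm (y, 0)) =ᶠ[𝓝 y]
      fun y => (y.1, actCurve (subFrame Φ) y) := by
    filter_upwards [(isOpen_fst_graphIn h.isOpen).mem_nhds hy] with z hz
    exact h.straighten_symm_eq hz
  have h2 : DifferentiableAt ℝ (actCurve (k := k) (subFrame Φ)) y :=
    ((contDiffOn_actCurve h.isOpen h.contDiffOn_subFrame).contDiffAt
      ((isOpen_fst_graphIn h.isOpen).mem_nhds hy)).differentiableAt (by simp)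
  rw [h1.fderiv_eq, (hasFDerivAt_fst.prodMk h2.hasFDerivAt).fderiv]
  rfl

/-- The model space of the path space splits. -/
theorem nonempty_splitting (h : IsAnchoredFrame G Φ V N) {p : ℝ × E} (hp : p ∈ N) :
    Nonempty ((CkCurve (k + 1) E × CkCurve k W) ≃L[ℝ]
      (CkCurve (k + 1) E × CkCurve k Q) × CkCurve k R) := by
  obtain ⟨A, -⟩ := h.exists_equiv p hp
  let e : CkCurve k W ≃L[ℝ] CkCurve k (Q × R) := ContinuousLinearEquiv.equivOfInverse
    (CkCurve.map (A.symm : W →L[ℝ] Q × R)) (CkCurve.map (A : Q × R →L[ℝ] W))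
    (fun f => CkCurve.ext fun t => by simp) (fun f => CkCurve.ext fun t => by simp)
  exact ⟨((ContinuousLinearEquiv.refl ℝ _).prodCongr e).trans splitCurves⟩

end IsAnchoredFrame

end FrameHomeo

/-! ### The manifold of `S`-paths -/

section AltForm

variable {H : Type*} [NormedAddCommGroup H] [NormedSpace ℝ H]
  {W : Type*} [NormedAddCommGroup W] [NormedSpace ℝ W]

/-- The antisymmetrization of a bilinear map. -/
def altOfBilinear (β : H →L[ℝ] H →L[ℝ] W) : H [⋀^Fin 2]→L[ℝ] W where
  toFun v := β (v 0) (v 1) - β (v 1) (v 0)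
  map_update_add' m i x y := by
    fin_cases i <;> simp [Function.update] <;> abel
  map_update_smul' m i c x := by
    fin_cases i <;> simp [Function.update, smul_sub]
  cont := by fun_prop
  map_eq_zero_of_eq' v i j h hij := by
    have h01 : v 0 = v 1 := by
      fin_cases i <;> fin_cases j <;> simp_all
    simp [h01]

end AltForm

/-! ### The constant two-form on the model of the path space -/

section PathPairing

variable {k : ℕ} {E : Type*} [NormedAddCommGroup E] [NormedSpace ℝ E]
  {W : Type*} [NormedAddCommGroup W] [NormedSpace ℝ W]

theorem integrable_eval_apply (y : CkCurve k (E →L[ℝ] W)) (x : CkCurve (k + 1) E) :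
    Integrable fun t : I => y.eval t (x.eval t) :=
  integrable_of_continuous_unitInterval (y.continuous_eval.clm_apply x.continuous_eval)

/-- The pairing of vectors and covectors along a path. -/
def pathPairing : (CkCurve (k + 1) E × CkCurve k (E →L[ℝ] W)) →L[ℝ]
    (CkCurve (k + 1) E × CkCurve k (E →L[ℝ] W)) →L[ℝ] W :=
  LinearMap.mkContinuous₂ (LinearMap.mk₂ ℝ (fun p q => ∫ t : I, q.2.eval t (p.1.eval t))
    (fun p p' q => by
      rw [← integral_add (integrable_eval_apply _ _) (integrable_eval_apply _ _)]
      simp)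
    (fun c p q => by rw [← integral_smul]; simp)
    (fun p q q' => by
      rw [← integral_add (integrable_eval_apply _ _) (integrable_eval_apply _ _)]
      simp)
    (fun c p q => by rw [← integral_smul]; simp)) 1 fun p q => by
      rw [one_mul]
      refine (norm_integral_le_of_norm_le_const (C := ‖p‖ * ‖q‖)
        (Filter.Eventually.of_forall fun t => ?_)).trans (by simp)
      rw [mul_comm]
      refine ((q.2.eval t).le_opNorm _).trans ?_
      gcongr
      · exact (q.2.norm_eval_le t).trans (norm_snd_le q)
      · exact (p.1.norm_eval_le t).trans (norm_fst_le p)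

/-- The canonical two-form of the model space of the path space. -/
def canForm : (CkCurve (k + 1) E × CkCurve k (E →L[ℝ] W)) [⋀^Fin 2]→L[ℝ] W := altOfBilinear pathPairing

theorem canForm_apply (p q : CkCurve (k + 1) E × CkCurve k (E →L[ℝ] W)) : canForm ![p, q] =
    ∫ t : I, (q.2.eval t (p.1.eval t) - p.2.eval t (q.1.eval t)) := by
  rw [integral_sub (integrable_eval_apply _ _) (integrable_eval_apply _ _)]
  rfl

end PathPairing

/-! ### Slice charts and the symplectic form of the `S`-paths -/

section SPaths

variable {E : Type u} [NormedAddCommGroup E] [NormedSpace ℝ E]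
  {M : Type v} [TopologicalSpace M] [ChartedSpace E M] [IsManifold 𝓘(ℝ, E) ∞ M]
  {r : ℕ} {S : ∀ x : M, Submodule ℝ (CoVel E M r x)}
  {P : ∀ x : M, S x →ₗ[ℝ] TangentSpace 𝓘(ℝ, E) x} {s k : ℕ}

theorem mem_sCoord_slice {τ : TubeChart E M} {t : ℝ} {p : CoVelSpace E M r}
    (h : (t, p.proj) ∈ τ.toHomeo.source) :
    τ.covCoord t p ∈ sCoord S τ (t, τ.slice t p.proj) ↔ p.2 ∈ S p.proj := by
  rw [mem_sCoord_of_inv_eq (τ.inv_slice h), τ.covCoord_comp_dslice h]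

variable (P s) in
/-- A time-dependent chart around a path with an anchored frame of the subbundle along the path. -/
structure PathFrame [FiniteDimensional ℝ E] (γ : CoPath E M r k) where
  /-- the chart -/
  τ : TubeChart E M
  /-- the frame -/
  Φ : ℝ × E → (Fin s → ℝ) × (Fin (corank E r s) → ℝ) →L[ℝ] E →L[ℝ] (Fin r → ℝ)
  /-- the anchor in the frame -/
  V : ℝ × E → (Fin s → ℝ) →L[ℝ] E
  /-- the domain of the frame -/
  N : Set (ℝ × E)
  isFrame : IsAnchoredFrame (anchorGraph P τ) Φ V N
  subset_target : N ⊆ τ.toHomeo.target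
  mem_source : γ ∈ τ.coSource r k
  mem_graphIn : (τ.coCoord γ).1 ∈ CkCurve.graphIn (k + 1) N

variable [FiniteDimensional ℝ E]

theorem nonempty_pathFrame [T2Space M] (hSP : IsPolyPoisson S P s) (γ : CoPath E M r k) :
    Nonempty (PathFrame P s γ) := by
  have := FiniteDimensional.complete ℝ E
  obtain ⟨τ, hτ⟩ := exists_tubeChart (E := E) γ.continuous_base
  have hτ' : γ ∈ τ.coSource r k := hτ
  obtain ⟨Φ, V, N, h, hN, hu⟩ := exists_anchoredFrame (τ := τ) hSP
    (τ.coCoord γ).1.continuous_eval fun t => by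
      rw [(τ.coCoord_eval hτ' t).1]
      exact τ.mem_target (hτ t)
  exact ⟨⟨τ, Φ, V, N, h, hN, hτ', hu⟩⟩

namespace PathFrame

variable {γ : CoPath E M r k} (f : PathFrame P s γ)

/-- At each time the frame maps exactly the vectors without complementary component into the fibre
of `S`. -/
theorem mem_sPath_iff (hS : IsSubbundle S s) {δ : CoPath E M r k} (hδ : δ ∈ f.τ.coSource r k)
    (hδ' : (f.τ.coCoord δ).1 ∈ CkCurve.graphIn (k + 1) f.N) :
    δ ∈ SPath S k ↔ (f.isFrame.straighten k (f.τ.coCoord δ)).2 = 0 := by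
  rw [CkCurve.ext_iff]
  refine forall_congr' fun t => ?_
  have h1 := f.isFrame.straighten_eval hδ' t
  rw [(f.τ.coCoord_eval hδ t).2] at h1
  rw [← mem_sCoord_slice (hδ t), ← h1, ← (f.τ.coCoord_eval hδ t).1,
    f.isFrame.apply_mem_sCoord_iff hS (hδ' t) (f.subset_target (hδ' t))]
  rfl

variable [T2Space M]

local instance : CompleteSpace E := FiniteDimensional.complete ℝ E

/-- The slice chart of the `S`-paths around a path. -/
def sliceChart (hS : IsSubbundle S s) : SliceChart (CoPathModel E r k)
    (CkCurve (k + 1) E × CkCurve k (Fin s → ℝ)) (CkCurve k (Fin (corank E r s) → ℝ)) (SPath S k) :=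
  SliceChart.ofDiffeo f.τ.coChart_mem_maximalAtlas (f.isFrame.straighten k)
    f.isFrame.contDiffOn_straighten f.isFrame.contDiffOn_straighten_symm
    (f.isFrame.nonempty_splitting (f.mem_graphIn 0)).some
    fun _ hδ hδ' => f.mem_sPath_iff hS hδ hδ'

theorem mem_sliceChart (hS : IsSubbundle S s) : γ ∈ (f.sliceChart hS).e.source :=
  SliceChart.mem_ofDiffeo_source.2 ⟨f.mem_source, f.mem_graphIn⟩

/-- The coordinates of an `S`-path. -/
def coord (δ : CoPath E M r k) : CkCurve (k + 1) E × CkCurve k (Fin s → ℝ) :=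
  (f.isFrame.straighten k (f.τ.coCoord δ)).1

theorem restr_apply (hS : IsSubbundle S s) (z₀ z : SPath S k) :
    (f.sliceChart hS).restr z₀ z = f.coord z :=
  SliceChart.restr_ofDiffeo z₀ z

theorem coord_fst (δ : CoPath E M r k) : (f.coord δ).1 = (f.τ.coCoord δ).1 := rfl

/-- The frame of the subbundle along the path. -/
def frameCurve : CkCurve (k + 1) ((Fin s → ℝ) →L[ℝ] E →L[ℝ] (Fin r → ℝ)) :=
  CkCurve.nemytskii (k + 1) (subFrame f.Φ) (f.coord γ).1

theorem frameCurve_eval (t : I) :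
    f.frameCurve.eval t = subFrame f.Φ (t, (f.coord γ).1.eval t) :=
  CkCurve.nemytskii_eval (f.isFrame.contDiffOn_subFrame.of_le (mod_cast le_top)) f.mem_graphIn t

/-- The curvature term along the path. -/
def curvCurve : CkCurve k (E →L[ℝ] E →L[ℝ] (Fin r → ℝ)) :=
  CkCurve.nemytskii k (fun z => spaceDeriv (subFrame f.Φ) z - (spaceDeriv (subFrame f.Φ) z).flip)
    (pairCurve (f.coord γ))

theorem curvCurve_eval (t : I) : f.curvCurve.eval t =
    spaceDeriv (subFrame f.Φ) (t, ((f.coord γ).1.eval t, (f.coord γ).2.eval t)) -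
    (spaceDeriv (subFrame f.Φ) (t, ((f.coord γ).1.eval t, (f.coord γ).2.eval t))).flip := by
  have h1 : ContDiffOn ℝ ∞ (spaceDeriv (subFrame f.Φ)) (actDom (Fin s → ℝ) f.N) :=
    contDiffOn_spaceDeriv f.isFrame.isOpen f.isFrame.contDiffOn_subFrame
  exact nemytskii_pair_eval (h1.sub (contDiff_flip.comp_contDiffOn h1)) f.mem_graphIn t

theorem frameCurve_injective (t : I) (q : Fin s → ℝ) (h : f.frameCurve.eval t q = 0) : q = 0 := by
  rw [f.frameCurve_eval, subFrame_apply] at h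
  have := f.isFrame.inverse_apply (f.mem_graphIn t) (q, 0)
  rw [coord_fst] at h
  rw [h, map_zero] at this
  exact (congrArg Prod.fst this).symm

theorem frameCurve_annihilator (hSP : IsPolyPoisson S P s) (t : I) (x : E)
    (h : ∀ q, f.frameCurve.eval t q x = 0) : x = 0 := by
  refine anchorGraph_annihilator (P := P) hSP.annihilator (f.subset_target (f.mem_graphIn t))
    fun ζ v hζ => ?_
  have h1 := f.isFrame.apply_inverse (f.mem_graphIn t) ζ
  have h2 := (f.isFrame.apply_mem_sCoord_iff hSP.subbundle (f.mem_graphIn t)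
    (f.subset_target (f.mem_graphIn t)) _).1 (by rw [h1]; exact mem_sCoord_iff.2 ⟨v, hζ⟩)
  have h3 := h ((f.Φ (t, (f.τ.coCoord γ).1.eval t)).inverse ζ).1
  rw [f.frameCurve_eval, subFrame_apply, ← h2] at h3
  rw [← h1]
  exact h3

/-- The canonical form is pulled back by `(u, a) ↦ (u, ε(t, u) a)`. Varying `a` gives the two frame
terms, and varying `u` inside the frame gives the antisymmetrized derivative, which is the curvature
term. -/
theorem symplectic_actCurve (v w : CkCurve (k + 1) E × CkCurve k (Fin s → ℝ)) (t : I) :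
    (fderiv ℝ (actCurve (subFrame f.Φ)) (f.coord γ) w).eval t (v.1.eval t) -
      (fderiv ℝ (actCurve (subFrame f.Φ)) (f.coord γ) v).eval t (w.1.eval t) =
    f.frameCurve.eval t (w.2.eval t) (v.1.eval t) - f.frameCurve.eval t (v.2.eval t) (w.1.eval t) +
      f.curvCurve.eval t (w.1.eval t) (v.1.eval t) := by
  have hd := fun v => fderiv_actCurve_eval (k := k) f.isFrame.isOpen f.isFrame.contDiffOn_subFrame
    (p := f.coord γ) f.mem_graphIn v t
  rw [f.frameCurve_eval, f.curvCurve_eval, hd, hd]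
  simp only [add_apply, sub_apply, ContinuousLinearMap.flip_apply]
  abel

end PathFrame

variable [T2Space M]

local instance : CompleteSpace E := FiniteDimensional.complete ℝ E

theorem exists_sliceChart_sPath (hSP : IsPolyPoisson S P s) (z : SPath S k) :
    ∃ c : SliceChart (CoPathModel E r k) (CkCurve (k + 1) E × CkCurve k (Fin s → ℝ))
      (CkCurve k (Fin (corank E r s) → ℝ)) (SPath S k), (z : CoPath E M r k) ∈ c.e.source := by
  obtain ⟨f⟩ := nonempty_pathFrame (k := k) hSP z
  exact ⟨f.sliceChart hSP.subbundle, f.mem_sliceChart hSP.subbundle⟩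

/-- The smooth structure of the space of `S`-paths. -/
@[reducible] def sPathChartedSpace (hSP : IsPolyPoisson S P s) (k : ℕ) :
    ChartedSpace (CkCurve (k + 1) E × CkCurve k (Fin s → ℝ)) (SPath S k) :=
  SliceChart.chartedSpace (exists_sliceChart_sPath hSP)

theorem PathFrame.mfderiv_coChart_val (hSP : IsPolyPoisson S P s) (z : SPath S k)
    (f : PathFrame P s z.1) :
    letI := sPathChartedSpace hSP k
    ∀ v : TangentSpace 𝓘(ℝ, CkCurve (k + 1) E × CkCurve k (Fin s → ℝ)) z,
      mfderiv 𝓘(ℝ, CoPathModel E r k) 𝓘(ℝ, CoPathModel E r k) (f.τ.coChart r k) z.1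
        (mfderiv 𝓘(ℝ, CkCurve (k + 1) E × CkCurve k (Fin s → ℝ)) 𝓘(ℝ, CoPathModel E r k)
          (Subtype.val : SPath S k → CoPath E M r k) z v) =
      ((mfderiv 𝓘(ℝ, CkCurve (k + 1) E × CkCurve k (Fin s → ℝ))
          𝓘(ℝ, CkCurve (k + 1) E × CkCurve k (Fin s → ℝ))
          ((f.sliceChart hSP.subbundle).restr z) z v).1,
        fderiv ℝ (actCurve (subFrame f.Φ)) (f.coord z.1)
          (mfderiv 𝓘(ℝ, CkCurve (k + 1) E × CkCurve k (Fin s → ℝ))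
            𝓘(ℝ, CkCurve (k + 1) E × CkCurve k (Fin s → ℝ))
            ((f.sliceChart hSP.subbundle).restr z) z v)) := fun v =>
  (SliceChart.mfderiv_comp_val_ofDiffeo (exists_sliceChart_sPath hSP) z f.mem_source f.mem_graphIn
    (f.sliceChart hSP.subbundle) rfl v).trans (f.isFrame.fderiv_straighten_symm f.mem_graphIn _)

theorem PathFrame.sPathForm_eq (hSP : IsPolyPoisson S P s) (z : SPath S k) (f : PathFrame P s z.1) :
    letI := sPathChartedSpace hSP k
    ∀ v w : TangentSpace 𝓘(ℝ, CkCurve (k + 1) E × CkCurve k (Fin s → ℝ)) z,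
      sPathForm (H := CkCurve (k + 1) E × CkCurve k (Fin s → ℝ)) S z v w =
      linForm f.frameCurve f.curvCurve
        (mfderiv 𝓘(ℝ, CkCurve (k + 1) E × CkCurve k (Fin s → ℝ))
          𝓘(ℝ, CkCurve (k + 1) E × CkCurve k (Fin s → ℝ))
          ((f.sliceChart hSP.subbundle).restr z) z v)
        (mfderiv 𝓘(ℝ, CkCurve (k + 1) E × CkCurve k (Fin s → ℝ))
          𝓘(ℝ, CkCurve (k + 1) E × CkCurve k (Fin s → ℝ))
          ((f.sliceChart hSP.subbundle).restr z) z w) := by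
  intro v w
  refine (f.τ.pathForm_eq f.mem_source _ _).trans ?_
  refine integral_congr_ae (Filter.Eventually.of_forall fun t => ?_)
  beta_reduce
  rw [f.mfderiv_coChart_val hSP, f.mfderiv_coChart_val hSP]
  exact f.symplectic_actCurve _ _ t

/-- Near each `S`-path the form is the pullback of the constant canonical form by a path chart
composed with the inclusion, hence smooth and closed. Nondegeneracy is that of the linearized form,
since the differential of a chart is bijective. -/
theorem isWeakPolySymplectic_sPathForm (hSP : IsPolyPoisson S P s) :
    letI := sPathChartedSpace hSP k
    IsWeakPolySymplectic (H := CkCurve (k + 1) E × CkCurve k (Fin s → ℝ))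
      (sPathForm (k := k) S) := by
  let _ := sPathChartedSpace hSP k
  have : IsManifold 𝓘(ℝ, CkCurve (k + 1) E × CkCurve k (Fin s → ℝ)) ∞ (SPath S k) :=
    SliceChart.isManifold (exists_sliceChart_sPath hSP)
  have hval := SliceChart.isSmoothEmbedding (exists_sliceChart_sPath (k := k) hSP)
  refine isWeakPolySymplectic_of_pullback (K := CoPathModel E r k) canForm _ (fun z => ?_)
    fun z v hv => ?_
  · obtain ⟨f⟩ := nonempty_pathFrame hSP z.1
    refine ⟨Subtype.val ⁻¹' (f.τ.coChart r k).source, (f.τ.coChart r k).open_source.preimage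
      continuous_subtype_val, f.mem_source, f.τ.coChart r k ∘ Subtype.val, ?_, fun b hb v w => ?_⟩
    · exact (contMDiffOn_of_mem_maximalAtlas f.τ.coChart_mem_maximalAtlas).comp
        hval.contMDiff.contMDiffOn fun _ h => h
    · have h1 := mfderiv_comp b ((f.τ.contMDiffAt_coChart hb).mdifferentiableAt (by simp))
        (hval.contMDiff.contMDiffAt.mdifferentiableAt (by simp))
      rw [h1]
      exact (f.τ.pathForm_eq hb _ _).trans (canForm_apply (E := E) (k := k) _ _).symm
  · obtain ⟨f⟩ := nonempty_pathFrame hSP z.1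
    obtain ⟨κ, hκ⟩ := SliceChart.exists_mfderiv_restr (exists_sliceChart_sPath hSP)
      (f.sliceChart hSP.subbundle) z (f.mem_sliceChart hSP.subbundle)
    refine κ.injective ?_
    rw [map_zero]
    refine linForm_nondegenerate (ε := f.frameCurve) (B := f.curvCurve)
      (f.frameCurve_annihilator hSP) f.frameCurve_injective fun w => ?_
    have h1 := hv (κ.symm w)
    rw [f.sPathForm_eq hSP z] at h1
    rw [← hκ, ← hκ, κ.apply_symm_apply] at h1
    exact h1

end SPaths

/-! ### The structure equations along the solutions -/

section PathDerivative

variable {E : Type u} [NormedAddCommGroup E] [NormedSpace ℝ E]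
  {M : Type v} [TopologicalSpace M] [ChartedSpace E M]

theorem hasUnitDeriv_comp {φ : M → E} {X : I → M} {t : I}
    (hφ : MDifferentiableAt 𝓘(ℝ, E) 𝓘(ℝ, E) φ (X t)) (hX : MDifferentiableAt (𝓡∂ 1) 𝓘(ℝ, E) X t) :
    HasUnitDeriv (fun t => φ (X t))
      (mfderiv 𝓘(ℝ, E) 𝓘(ℝ, E) φ (X t) (mfderiv (𝓡∂ 1) 𝓘(ℝ, E) X t 1)) t := by
  have h1 : MDifferentiableAt (𝓡∂ 1) 𝓘(ℝ, E) (φ ∘ X) t := hφ.comp t hX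
  have h2 := mdifferentiableWithinAt_comp_projIcc_iff.2 h1
  have h3 : mfderivWithin 𝓘(ℝ, ℝ) 𝓘(ℝ, E) ((φ ∘ X) ∘ projIcc 0 1 zero_le_one) (Icc 0 1) (t : ℝ) 1 =
      mfderiv (𝓡∂ 1) 𝓘(ℝ, E) (φ ∘ X) t 1 := mfderivWithin_comp_projIcc_one
  rw [mfderiv_comp t hφ hX] at h3
  have h4 := (mdifferentiableWithinAt_iff_differentiableWithinAt.1 h2).hasDerivWithinAt
  refine h4.congr_deriv ?_
  rw [mfderivWithin_eq_fderivWithin] at h3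
  refine Eq.trans ?_ h3
  rfl

variable [IsManifold 𝓘(ℝ, E) ∞ M]

/-- The derivative of the coordinates of a path in a time-dependent chart. -/
theorem TubeChart.hasUnitDeriv_slice (τ : TubeChart E M) {X : I → M} {t : I}
    (hX : MDifferentiableAt (𝓡∂ 1) 𝓘(ℝ, E) X t) (h : ((t : ℝ), X t) ∈ τ.toHomeo.source) :
    HasUnitDeriv (fun t => τ.slice t (X t)) (τ.velocity (t, τ.slice t (X t)) +
      τ.dslice t (X t) (mfderiv (𝓡∂ 1) 𝓘(ℝ, E) X t 1)) t := by
  set c := TubeChart.const E (X t) with hc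
  have hcs : ((t : ℝ), X t) ∈ c.toHomeo.source := mem_const_source.2 (mem_chart_source E _)
  have hdom : ((t : ℝ), c.slice t (X t)) ∈ c.transDom τ := slice_mem_transDom hcs h
  have h1 : HasUnitDeriv (fun t' => c.slice t (X t'))
      (c.dslice t (X t) (mfderiv (𝓡∂ 1) 𝓘(ℝ, E) X t 1)) t :=
    hasUnitDeriv_comp (φ := c.slice t) ((c.contMDiffAt_slice hcs).mdifferentiableAt (by simp)) hX
  have h2 : HasDerivWithinAt (fun s : ℝ => (s, c.slice t (X (projIcc 0 1 zero_le_one s))))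
      (1, c.dslice t (X t) (mfderiv (𝓡∂ 1) 𝓘(ℝ, E) X t 1)) (Icc 0 1) t :=
    (hasDerivWithinAt_id (t : ℝ) _).prodMk h1
  have hg := hasFDerivAt_trans_full hdom
  have h3 : HasDerivWithinAt
      (fun s : ℝ => c.trans τ (s, c.slice t (X (projIcc 0 1 zero_le_one s))))
      (fderiv ℝ (c.trans τ) (t, c.slice t (X t))
        (1, c.dslice t (X t) (mfderiv (𝓡∂ 1) 𝓘(ℝ, E) X t 1))) (Icc 0 1) t :=
    HasFDerivAt.comp_hasDerivWithinAt_of_eq (l := c.trans τ) (t : ℝ) hg h2 (by simp)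
  have e : fderiv ℝ (c.trans τ) (t, c.slice t (X t))
        (1, c.dslice t (X t) (mfderiv (𝓡∂ 1) 𝓘(ℝ, E) X t 1)) =
      τ.velocity (t, τ.slice t (X t)) + τ.dslice t (X t) (mfderiv (𝓡∂ 1) 𝓘(ℝ, E) X t 1) := by
    have e1 := velocity_trans hdom
    rw [trans_slice hcs] at e1
    have e2 := DFunLike.congr_fun (dslice_eq hcs h) (mfderiv (𝓡∂ 1) 𝓘(ℝ, E) X t 1)
    refine Eq.trans ?_ (congrArg₂ (· + ·) e1 e2).symm
    refine Eq.trans ?_ (map_add (fderiv ℝ (c.trans τ) (t, c.slice t (X t))) (1, 0)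
      (0, c.dslice t (X t) (mfderiv (𝓡∂ 1) 𝓘(ℝ, E) X t 1)))
    simp
  rw [e] at h3
  refine h3.congr_of_eventuallyEq ?_ (by rw [projIcc_val, trans_slice hcs])
  have hcont : ContinuousAt (fun s : ℝ => X (projIcc 0 1 zero_le_one s)) t :=
    ContinuousAt.comp (g := X) (by rw [projIcc_val]; exact hX.continuousAt)
      continuous_projIcc.continuousAt
  have hnear := hcont.eventually_mem ((chartAt E (X t)).open_source.mem_nhds
    (by rw [projIcc_val]; exact mem_chart_source E _))
  filter_upwards [hnear.filter_mono nhdsWithin_le_nhds, self_mem_nhdsWithin] with s hs hs'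
  rw [projIcc_of_mem zero_le_one hs'] at hs ⊢
  exact (trans_slice (τ := c) (mem_const_source.2 hs)).symm

end PathDerivative

/-! ### The structure equations along a solution -/

section StructureCurve

/-- The derivative of a smooth function along a curve. -/
theorem CkCurve.derivL_eval_of_comp {k : ℕ} {F G : Type*} [NormedAddCommGroup F] [NormedSpace ℝ F]
    [NormedAddCommGroup G] [NormedSpace ℝ G] {g : ℝ × F → G} {u : CkCurve (k + 1) F}
    {f : CkCurve (k + 1) G} (hf : ∀ t : I, f.eval t = g (t, u.eval t)) {t : I}
    (hg : DifferentiableAt ℝ g (t, u.eval t)) :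
    (derivL f).eval t = fderiv ℝ g (t, u.eval t) (1, (derivL u).eval t) := by
  have h1 : HasDerivWithinAt (fun s : ℝ => (s, u.eval (projIcc 0 1 zero_le_one s)))
      (1, (derivL u).eval t) (Icc 0 1) t :=
    (hasDerivWithinAt_id (t : ℝ) _).prodMk (u.hasUnitDeriv t)
  have h2 := HasFDerivAt.comp_hasDerivWithinAt_of_eq (l := g) (t : ℝ) hg.hasFDerivAt h1 (by simp)
  refine derivL_eval_eq f t (h2.congr (fun s hs => ?_) ?_)
  · simp [hf, projIcc_of_mem zero_le_one hs]
  · simp [hf]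

variable {E : Type u} [NormedAddCommGroup E] [NormedSpace ℝ E] [FiniteDimensional ℝ E]
  {M : Type v} [TopologicalSpace M] [T2Space M] [ChartedSpace E M] [IsManifold 𝓘(ℝ, E) ∞ M]
  {r : ℕ} {S : ∀ x : M, Submodule ℝ (CoVel E M r x)}
  {P : ∀ x : M, S x →ₗ[ℝ] TangentSpace 𝓘(ℝ, E) x} {s k : ℕ}

namespace PathFrame

local instance : CompleteSpace E := FiniteDimensional.complete ℝ E

variable {γ : CoPath E M r k} (f : PathFrame P s γ)

/-- The vector field of the equation `X' + P(η) = 0` in coordinates. -/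
def field (z : ℝ × (E × (Fin s → ℝ))) : E := f.τ.velocity (z.1, z.2.1) - act f.V z

/-- The linearization of the vector field. -/
def flow (z : ℝ × (E × (Fin s → ℝ))) : E →L[ℝ] E :=
  (fderiv ℝ f.τ.velocity (z.1, z.2.1)).comp (.inr ℝ ℝ E) - spaceDeriv f.V z

/-- The curvature term. -/
def curv (z : ℝ × (E × (Fin s → ℝ))) : E →L[ℝ] E →L[ℝ] (Fin r → ℝ) :=
  spaceDeriv (subFrame f.Φ) z - (spaceDeriv (subFrame f.Φ) z).flip

theorem contDiffOn_velocity : ContDiffOn ℝ ∞ f.τ.velocity f.N :=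
  TubeChart.contDiffOn_velocity.mono f.subset_target

theorem contDiffOn_field : ContDiffOn ℝ ∞ f.field (actDom (Fin s → ℝ) f.N) :=
  (contDiffOn_base f.contDiffOn_velocity).sub (contDiffOn_act f.isFrame.smooth_anchor)

theorem contDiffOn_flow : ContDiffOn ℝ ∞ f.flow (actDom (Fin s → ℝ) f.N) := by
  have h1 : ContDiffOn ℝ ∞ (fderiv ℝ f.τ.velocity) f.N :=
    f.contDiffOn_velocity.fderiv_of_isOpen f.isFrame.isOpen (by simp)
  have h2 : ContDiffOn ℝ ∞ (fun p => (fderiv ℝ f.τ.velocity p).comp (.inr ℝ ℝ E)) f.N :=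
    h1.clm_comp contDiffOn_const
  exact (contDiffOn_base h2).sub (contDiffOn_spaceDeriv f.isFrame.isOpen f.isFrame.smooth_anchor)

theorem contDiffOn_curv : ContDiffOn ℝ ∞ f.curv (actDom (Fin s → ℝ) f.N) := by
  have h1 : ContDiffOn ℝ ∞ (spaceDeriv (subFrame f.Φ)) (actDom (Fin s → ℝ) f.N) :=
    contDiffOn_spaceDeriv f.isFrame.isOpen f.isFrame.contDiffOn_subFrame
  exact h1.sub (contDiff_flip.comp_contDiffOn h1)

theorem flow_eq {t : ℝ} {y : E} (h : (t, y) ∈ f.N) (a : Fin s → ℝ) :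
    f.flow (t, (y, a)) = fderiv ℝ (fun y => f.τ.velocity (t, y) - f.V (t, y) a) y := by
  have hn := f.isFrame.isOpen.mem_nhds h
  have h1 : DifferentiableAt ℝ f.τ.velocity (t, y) :=
    (f.contDiffOn_velocity.contDiffAt hn).differentiableAt (by simp)
  have h2 : DifferentiableAt ℝ f.V (t, y) :=
    (f.isFrame.smooth_anchor.contDiffAt hn).differentiableAt (by simp)
  have h3 : HasFDerivAt (fun y => (t, y)) (.inr ℝ ℝ E) y := hasFDerivAt_prodMk_right t y
  have h4 : HasFDerivAt (fun y => f.τ.velocity (t, y))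
      ((fderiv ℝ f.τ.velocity (t, y)).comp (.inr ℝ ℝ E)) y :=
    HasFDerivAt.comp (g := f.τ.velocity) y h1.hasFDerivAt h3
  have h5 : DifferentiableAt ℝ (fun y => f.V (t, y) a) y := by
    have := DifferentiableAt.comp (g := f.V) (f := fun y => (t, y)) y h2 h3.differentiableAt
    exact this.clm_apply (differentiableAt_const a)
  rw [fderiv_fun_sub h4.differentiableAt h5, h4.fderiv, ← spaceDeriv_eq_fderiv h2]
  rfl

/-- The defect of the frame from being invariant under the linearized flow. -/
def frameDefect (z : ℝ × (E × (Fin s → ℝ))) : (Fin s → ℝ) →L[ℝ] E →L[ℝ] (Fin r → ℝ) :=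
  fderiv ℝ (subFrame f.Φ) (z.1, z.2.1) (1, f.field z) +
    ((ContinuousLinearMap.compL ℝ E E (Fin r → ℝ)).flip (f.flow z)).comp
      (subFrame f.Φ (z.1, z.2.1)) + (f.curv z).comp (f.V (z.1, z.2.1))

/-- The structure functions. -/
def structureMap (z : ℝ × (E × (Fin s → ℝ))) : (Fin s → ℝ) →L[ℝ] (Fin s → ℝ) :=
  ((ContinuousLinearMap.fst ℝ _ _).comp (f.Φ (z.1, z.2.1)).inverse).comp (f.frameDefect z)

theorem contDiffOn_frameDefect_apply (q : Fin s → ℝ) :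
    ContDiffOn ℝ ∞ (fun z => f.frameDefect z q) (actDom (Fin s → ℝ) f.N) := by
  have hΨ := f.isFrame.contDiffOn_subFrame
  have h1 : ContDiffOn ℝ ∞ (fderiv ℝ (subFrame f.Φ)) f.N :=
    hΨ.fderiv_of_isOpen f.isFrame.isOpen (by simp)
  have h2 : ContDiffOn ℝ ∞ (fun z : ℝ × (E × (Fin s → ℝ)) =>
      fderiv ℝ (subFrame f.Φ) (z.1, z.2.1) (1, f.field z) q) (actDom (Fin s → ℝ) f.N) :=
    ((contDiffOn_base h1).clm_apply (contDiffOn_const.prodMk f.contDiffOn_field)).clm_apply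
      contDiffOn_const
  have h3 : ContDiffOn ℝ ∞ (fun z : ℝ × (E × (Fin s → ℝ)) =>
      (subFrame f.Φ (z.1, z.2.1) q).comp (f.flow z)) (actDom (Fin s → ℝ) f.N) :=
    ((contDiffOn_base hΨ).clm_apply contDiffOn_const).clm_comp f.contDiffOn_flow
  have h4 : ContDiffOn ℝ ∞ (fun z : ℝ × (E × (Fin s → ℝ)) =>
      f.curv z (f.V (z.1, z.2.1) q)) (actDom (Fin s → ℝ) f.N) :=
    f.contDiffOn_curv.clm_apply ((contDiffOn_base f.isFrame.smooth_anchor).clm_apply contDiffOn_const)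
  exact (h2.add h3).add h4

theorem contDiffOn_structureMap :
    ContDiffOn ℝ ∞ f.structureMap (actDom (Fin s → ℝ) f.N) := by
  rw [contDiffOn_clm_apply]
  intro q
  exact contDiff_fst.comp_contDiffOn ((contDiffOn_base f.isFrame.contDiffOn_inverse).clm_apply
    (f.contDiffOn_frameDefect_apply q))

/-- The linearized flow along the path. -/
def flowCurve : CkCurve k (E →L[ℝ] E) := CkCurve.nemytskii k f.flow (pairCurve (f.coord γ))

/-- The anchor along the path. -/
def anchorCurve : CkCurve (k + 1) ((Fin s → ℝ) →L[ℝ] E) :=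
  CkCurve.nemytskii (k + 1) f.V (f.coord γ).1

/-- The structure functions along the path. -/
def structureCurve : CkCurve k ((Fin s → ℝ) →L[ℝ] (Fin s → ℝ)) :=
  CkCurve.nemytskii k f.structureMap (pairCurve (f.coord γ))

theorem flowCurve_eval (t : I) : f.flowCurve.eval t =
    f.flow (t, ((f.coord γ).1.eval t, (f.coord γ).2.eval t)) :=
  nemytskii_pair_eval f.contDiffOn_flow f.mem_graphIn t

theorem structureCurve_eval (t : I) : f.structureCurve.eval t =
    f.structureMap (t, ((f.coord γ).1.eval t, (f.coord γ).2.eval t)) :=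
  nemytskii_pair_eval f.contDiffOn_structureMap f.mem_graphIn t

theorem anchorCurve_eval (t : I) : f.anchorCurve.eval t = f.V (t, (f.coord γ).1.eval t) :=
  CkCurve.nemytskii_eval (f.isFrame.smooth_anchor.of_le (mod_cast le_top)) f.mem_graphIn t

theorem mem_anchorGraph {p : ℝ × E} (hp : p ∈ f.N) (a : Fin s → ℝ) :
    (subFrame f.Φ p a, f.V p a) ∈ anchorGraph P f.τ p := f.isFrame.mem p hp a

/-- The structure equation for constant coefficients `a` and `q`, with the derivatives of applied
frames rewritten as derivatives of the operator-valued frame. It holds at every point of the domain,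
also away from solutions. -/
theorem frameDefect_mem (hSP : IsPolyPoisson S P s) {t : ℝ} {y : E} (h : (t, y) ∈ f.N)
    (a q : Fin s → ℝ) : (f.frameDefect (t, (y, a)) q,
      fderiv ℝ f.V (t, y) (1, f.field (t, (y, a))) q - f.flow (t, (y, a)) (f.V (t, y) q)) ∈
      anchorGraph P f.τ (t, y) := by
  have hn := f.isFrame.isOpen.mem_nhds h
  have h1 : DifferentiableAt ℝ (subFrame f.Φ) (t, y) :=
    (f.isFrame.contDiffOn_subFrame.contDiffAt hn).differentiableAt (by simp)
  have h2 : DifferentiableAt ℝ f.V (t, y) :=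
    (f.isFrame.smooth_anchor.contDiffAt hn).differentiableAt (by simp)
  have h3 := f.isFrame.structure_equation hSP f.subset_target h a q
  have e1 : fderiv ℝ (fun p => f.Φ p (q, 0)) (t, y) = (fderiv ℝ (subFrame f.Φ) (t, y)).flip q := by
    have := (h1.hasFDerivAt.clm_apply (hasFDerivAt_const q (t, y))).fderiv
    exact this.trans (by rw [ContinuousLinearMap.comp_zero, zero_add])
  have e2 : fderiv ℝ (fun p => f.V p q) (t, y) = (fderiv ℝ f.V (t, y)).flip q := by
    have := (h2.hasFDerivAt.clm_apply (hasFDerivAt_const q (t, y))).fderiv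
    exact this.trans (by rw [ContinuousLinearMap.comp_zero, zero_add])
  have e3 : fderiv ℝ (fun y => f.Φ (t, y) (a, 0)) y = spaceDeriv (subFrame f.Φ) (t, (y, a)) :=
    (spaceDeriv_eq_fderiv h1 a).symm
  rw [e1, e2, e3, ← f.flow_eq h] at h3
  exact h3

/-- The defect of the frame lies in the subbundle, so it has no complementary component and is
recovered from its first component in the frame. -/
theorem structureMap_spec (hSP : IsPolyPoisson S P s) {t : ℝ} {y : E} (h : (t, y) ∈ f.N)
    (a q : Fin s → ℝ) :
    subFrame f.Φ (t, y) (f.structureMap (t, (y, a)) q) = f.frameDefect (t, (y, a)) q := by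
  have h1 := f.isFrame.apply_inverse h (f.frameDefect (t, (y, a)) q)
  have h2 := (f.isFrame.apply_mem_sCoord_iff hSP.subbundle h (f.subset_target h) _).1
    (by rw [h1]; exact mem_sCoord_iff.2 ⟨_, f.frameDefect_mem hSP h a q⟩)
  rw [← h1, subFrame_apply, ← h2]
  rfl

/-- Being a solution enters through `u' = T - V a`: the total derivative of the frame along the path
is then its derivative in the direction for which the structure equation was proved. The anchor
equation follows because the anchor of a covector is unique. -/
theorem isStructureCurve (hSP : IsPolyPoisson S P s)
    (hsol : ∀ t, (CkCurve.derivL (f.coord γ).1).eval t =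
      f.field (t, ((f.coord γ).1.eval t, (f.coord γ).2.eval t))) :
    IsStructureCurve f.frameCurve f.anchorCurve f.flowCurve f.curvCurve f.structureCurve where
  frame_eq t q x := by
    have hp := f.mem_graphIn t
    have h1 : DifferentiableAt ℝ (subFrame f.Φ) (t, (f.coord γ).1.eval t) :=
      (f.isFrame.contDiffOn_subFrame.contDiffAt (f.isFrame.isOpen.mem_nhds hp)).differentiableAt
        (by simp)
    rw [CkCurve.derivL_eval_of_comp f.frameCurve_eval h1, hsol, f.frameCurve_eval,
      f.flowCurve_eval, f.anchorCurve_eval, f.structureCurve_eval, f.curvCurve_eval]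
    have h2 := f.structureMap_spec hSP hp ((f.coord γ).2.eval t) q
    exact (DFunLike.congr_fun h2 x).symm
  anchor_eq t q := by
    have hp := f.mem_graphIn t
    have h1 : DifferentiableAt ℝ f.V (t, (f.coord γ).1.eval t) :=
      (f.isFrame.smooth_anchor.contDiffAt (f.isFrame.isOpen.mem_nhds hp)).differentiableAt (by simp)
    rw [CkCurve.derivL_eval_of_comp f.anchorCurve_eval h1, hsol, f.flowCurve_eval,
      f.anchorCurve_eval, f.structureCurve_eval]
    have h2 := f.frameDefect_mem hSP hp ((f.coord γ).2.eval t) q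
    rw [← f.structureMap_spec hSP hp] at h2
    exact anchorGraph_unique h2 (f.mem_anchorGraph hp _)
  skew t x y := by
    rw [f.curvCurve_eval]
    simp
  contraction t q q' := by
    rw [f.frameCurve_eval, f.anchorCurve_eval, add_comm]
    exact anchorGraph_polarized hSP.contraction (f.mem_anchorGraph (f.mem_graphIn t) q)
      (f.mem_anchorGraph (f.mem_graphIn t) q')
  annihilator := f.frameCurve_annihilator hSP
  injective := f.frameCurve_injective

end PathFrame

end StructureCurve

/-! ### The manifold of solutions -/

section LinearEquation

variable {k : ℕ} {E Q : Type*} [NormedAddCommGroup E] [NormedSpace ℝ E] [CompleteSpace E]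
  [NormedAddCommGroup Q] [NormedSpace ℝ Q] [CompleteSpace Q]

/-- The operator of the linearized equation. -/
def linOperator (V : CkCurve (k + 1) (Q →L[ℝ] E)) (A : CkCurve k (E →L[ℝ] E)) :
    CkCurve (k + 1) E × CkCurve k Q →L[ℝ] CkCurve k E :=
  (CkCurve.derivL - (CkCurve.applyL A).comp CkCurve.incl).comp (.fst ℝ _ _) +
    (CkCurve.applyL (CkCurve.incl V)).comp (.snd ℝ _ _)

theorem linOperator_eval (V : CkCurve (k + 1) (Q →L[ℝ] E)) (A : CkCurve k (E →L[ℝ] E))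
    (v : CkCurve (k + 1) E × CkCurve k Q) (t : I) : (linOperator V A v).eval t =
      (CkCurve.derivL v.1).eval t - A.eval t (v.1.eval t) + V.eval t (v.2.eval t) := by
  simp [linOperator]

/-- The linearized equation is solvable for given initial value and second component. -/
def linOperatorEquiv (V : CkCurve (k + 1) (Q →L[ℝ] E)) (A : CkCurve k (E →L[ℝ] E)) :
    (CkCurve (k + 1) E × CkCurve k Q) ≃L[ℝ] (E × CkCurve k Q) × CkCurve k E :=
  ((CkCurve.linearIVP A).prodCongr (.refl ℝ (CkCurve k Q))).trans
    (ContinuousLinearEquiv.equivOfInverse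
      ((((ContinuousLinearMap.fst ℝ E (CkCurve k E)).comp (.fst ℝ _ _)).prod (.snd ℝ _ _)).prod
        ((ContinuousLinearMap.snd ℝ E (CkCurve k E)).comp (.fst ℝ _ _) +
          (CkCurve.applyL (CkCurve.incl V)).comp (.snd ℝ _ _)))
      ((((ContinuousLinearMap.fst ℝ E (CkCurve k Q)).comp (.fst ℝ _ _)).prod
        (.snd ℝ _ _ - (CkCurve.applyL (CkCurve.incl V)).comp
          ((ContinuousLinearMap.snd ℝ E (CkCurve k Q)).comp (.fst ℝ _ _)))).prod
        ((ContinuousLinearMap.snd ℝ E (CkCurve k Q)).comp (.fst ℝ _ _)))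
      (fun p => by simp) (fun p => by simp))

end LinearEquation

/-! ### Slice charts of the solutions and coisotropy -/

section Solutions

variable {E : Type u} [NormedAddCommGroup E] [NormedSpace ℝ E] [FiniteDimensional ℝ E]
  {M : Type v} [TopologicalSpace M] [T2Space M] [ChartedSpace E M] [IsManifold 𝓘(ℝ, E) ∞ M]
  {r : ℕ} {S : ∀ x : M, Submodule ℝ (CoVel E M r x)}
  {P : ∀ x : M, S x →ₗ[ℝ] TangentSpace 𝓘(ℝ, E) x} {s k : ℕ}

local instance : CompleteSpace E := FiniteDimensional.complete ℝ E

namespace PathFrame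

variable {γ : CoPath E M r k} (f : PathFrame P s γ)

theorem mem_sliceChart_source_iff (hS : IsSubbundle S s) {δ : CoPath E M r k} :
    δ ∈ (f.sliceChart hS).e.source ↔
      δ ∈ f.τ.coSource r k ∧ (f.τ.coCoord δ).1 ∈ CkCurve.graphIn (k + 1) f.N :=
  SliceChart.mem_ofDiffeo_source

/-- The coordinate curve has derivative `T(t, u)` plus the image of `X'` under the differential of
the chart, while `V(t, u) a` is the image of `P(η)`. The two equations correspond because this
differential is injective. -/
theorem mem_solutionSpace_iff (hS : IsSubbundle S s) {z : SPath S k}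
    (hz : z.1 ∈ f.τ.coSource r k) (hz' : (f.τ.coCoord z.1).1 ∈ CkCurve.graphIn (k + 1) f.N) :
    z ∈ SolutionSpace S P k ↔ ∀ t, (CkCurve.derivL (f.coord z.1).1).eval t =
      f.field (t, ((f.coord z.1).1.eval t, (f.coord z.1).2.eval t)) := by
  refine forall_congr' fun t => ?_
  have hu : ∀ t : I, (f.coord z.1).1.eval t = f.τ.slice t (z.1.path t).proj := fun t =>
    (f.τ.coCoord_eval hz t).1
  have hX : MDifferentiableAt (𝓡∂ 1) 𝓘(ℝ, E) (fun t => (z.1.path t).proj) t :=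
    (z.1.contMDiff_base t).mdifferentiableAt (by simp)
  have h1 := f.τ.hasUnitDeriv_slice hX (hz t)
  simp only [← hu] at h1
  rw [CkCurve.derivL_eval_eq _ t h1]
  have hp : ((t : ℝ), (f.coord z.1).1.eval t) ∈ f.N := hz' t
  have h2 := mem_anchorGraph_slice (P := P) (hz t) ⟨(z.1.path t).2, z.2 t⟩
  have h3 := f.isFrame.straighten_eval hz' t
  rw [(f.mem_sPath_iff hS hz hz').1 z.2, CkCurve.eval_zero, (f.τ.coCoord_eval hz t).2] at h3
  have h4 := f.mem_anchorGraph hp ((f.coord z.1).2.eval t)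
  have h5 : subFrame f.Φ (t, (f.coord z.1).1.eval t) ((f.coord z.1).2.eval t) =
      f.τ.covCoord t (z.1.path t) := h3
  rw [h5, hu] at h4
  have h6 := anchorGraph_unique h4 h2
  have h7 : f.field (t, ((f.coord z.1).1.eval t, (f.coord z.1).2.eval t)) =
      f.τ.velocity (t, (f.coord z.1).1.eval t) -
        f.τ.dslice t (z.1.path t).proj (P (z.1.path t).proj ⟨(z.1.path t).2, z.2 t⟩) := by
    rw [← h6, hu, ← hu]
    rfl
  rw [h7, sub_eq_add_neg, add_right_inj, eq_neg_iff_add_eq_zero]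
  have h8 := DFunLike.congr_fun (f.τ.dinv_comp_dslice_self (hz t))
    (mfderiv (𝓡∂ 1) 𝓘(ℝ, E) (fun t => (z.1.path t).proj) t 1 +
      P (z.1.path t).proj ⟨(z.1.path t).2, z.2 t⟩)
  have h9 := map_add (f.τ.dslice t (z.1.path t).proj)
    (mfderiv (𝓡∂ 1) 𝓘(ℝ, E) (fun t => (z.1.path t).proj) t 1)
    (P (z.1.path t).proj ⟨(z.1.path t).2, z.2 t⟩)
  constructor
  · intro h
    refine h9.symm.trans ?_
    rw [h]
    exact map_zero _
  · intro h
    have h10 := h9.trans h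
    exact h8.symm.trans ((congrArg (f.τ.dinv t (f.τ.slice t (z.1.path t).proj)) h10).trans
      (map_zero _))

/-- The equation `X' + P(η) = 0` in coordinates. -/
def equation (y : CkCurve (k + 1) E × CkCurve k (Fin s → ℝ)) : CkCurve k E :=
  CkCurve.derivL y.1 - CkCurve.nemytskii k f.field (pairCurve y)

theorem equation_eval {y : CkCurve (k + 1) E × CkCurve k (Fin s → ℝ)}
    (hy : y.1 ∈ CkCurve.graphIn (k + 1) f.N) (t : I) : (f.equation y).eval t =
      (CkCurve.derivL y.1).eval t - f.field (t, (y.1.eval t, y.2.eval t)) := by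
  rw [equation, CkCurve.eval_sub, nemytskii_pair_eval f.contDiffOn_field hy]

theorem contDiffOn_nemytskii_field :
    ContDiffOn ℝ ∞ (CkCurve.nemytskii k f.field) (CkCurve.graphIn k (actDom (Fin s → ℝ) f.N)) := by
  have hO : IsOpen (actDom (Fin s → ℝ) f.N) := isOpen_actDom f.isFrame.isOpen
  have hg := f.contDiffOn_field
  exact CkCurve.contDiffOn_nemytskii hO hg

theorem contDiffOn_equation : ContDiffOn ℝ ∞ f.equation
    (Prod.fst ⁻¹' CkCurve.graphIn (k + 1) f.N) := by
  have h1 : ContDiffOn ℝ ∞ (fun y : CkCurve (k + 1) E × CkCurve k (Fin s → ℝ) =>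
      CkCurve.nemytskii k f.field (pairCurve y)) (Prod.fst ⁻¹' CkCurve.graphIn (k + 1) f.N) :=
    f.contDiffOn_nemytskii_field.comp (f := pairCurve) pairCurve.contDiff.contDiffOn
      fun _ hp => pairCurve_mem_actDom hp
  exact (CkCurve.derivL.contDiff.comp contDiff_fst).contDiffOn.sub h1

theorem fderiv_field {z : ℝ × (E × (Fin s → ℝ))} (hz : (z.1, z.2.1) ∈ f.N) (v : E × (Fin s → ℝ)) :
    fderiv ℝ f.field z (0, v) = f.flow z v.1 - f.V (z.1, z.2.1) v.2 := by
  have hn := f.isFrame.isOpen.mem_nhds hz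
  have hO := (isOpen_actDom (X := Fin s → ℝ) f.isFrame.isOpen).mem_nhds (x := z) hz
  have h1 : DifferentiableAt ℝ f.τ.velocity (z.1, z.2.1) :=
    (f.contDiffOn_velocity.contDiffAt hn).differentiableAt (by simp)
  have h2 : DifferentiableAt ℝ f.V (z.1, z.2.1) :=
    (f.isFrame.smooth_anchor.contDiffAt hn).differentiableAt (by simp)
  let q : ℝ × (E × (Fin s → ℝ)) →L[ℝ] ℝ × E :=
    (ContinuousLinearMap.fst ℝ _ _).prod ((ContinuousLinearMap.fst ℝ _ _).comp (.snd ℝ _ _))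
  have h3 : HasFDerivAt (fun z : ℝ × (E × (Fin s → ℝ)) => f.τ.velocity (z.1, z.2.1))
      ((fderiv ℝ f.τ.velocity (z.1, z.2.1)).comp q) z :=
    HasFDerivAt.comp (g := f.τ.velocity) (f := q) z h1.hasFDerivAt q.hasFDerivAt
  have h4 : DifferentiableAt ℝ (act f.V) z :=
    ((contDiffOn_act f.isFrame.smooth_anchor).contDiffAt hO).differentiableAt (by simp)
  have h5 : fderiv ℝ f.field z = _ := (h3.sub h4.hasFDerivAt).fderiv
  rw [h5, sub_apply, hasFDerivAt_act h2]
  simp only [flow, sub_apply, spaceDeriv_apply, ContinuousLinearMap.comp_apply,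
    ContinuousLinearMap.inr_apply]
  rw [sub_sub]
  rfl

/-- The anchor and flow curves of the frame are exactly the coefficients of the derivative at the
central path, so the nonlinear problem is governed by the linearized equation studied above. -/
theorem hasFDerivAt_equation :
    HasFDerivAt f.equation (linOperator f.anchorCurve f.flowCurve) (f.coord γ) := by
  have hm : pairCurve (f.coord γ) ∈ CkCurve.graphIn k (actDom (Fin s → ℝ) f.N) :=
    pairCurve_mem_actDom f.mem_graphIn
  have hO : IsOpen (actDom (Fin s → ℝ) f.N) := isOpen_actDom f.isFrame.isOpen
  have h1 : DifferentiableAt ℝ (CkCurve.nemytskii k f.field) (pairCurve (f.coord γ)) :=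
    (f.contDiffOn_nemytskii_field.contDiffAt
      ((CkCurve.isOpen_graphIn hO).mem_nhds hm)).differentiableAt (by simp)
  have h2 : HasFDerivAt (fun y => CkCurve.nemytskii k f.field (pairCurve y))
      ((fderiv ℝ (CkCurve.nemytskii k f.field) (pairCurve (f.coord γ))).comp pairCurve) (f.coord γ) :=
    HasFDerivAt.comp (g := CkCurve.nemytskii k f.field) (f := pairCurve) (f.coord γ)
      h1.hasFDerivAt pairCurve.hasFDerivAt
  have h3 : HasFDerivAt (fun y : CkCurve (k + 1) E × CkCurve k (Fin s → ℝ) => CkCurve.derivL y.1)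
      (CkCurve.derivL.comp (.fst ℝ _ _)) (f.coord γ) :=
    (CkCurve.derivL.comp (.fst ℝ (CkCurve (k + 1) E) (CkCurve k (Fin s → ℝ)))).hasFDerivAt
  refine (h3.sub h2).congr_fderiv ?_
  refine ContinuousLinearMap.ext fun v => CkCurve.ext fun t => ?_
  have h4 := CkCurve.fderiv_nemytskii_eval hO f.contDiffOn_field hm (pairCurve v) t
  have hz : ((t : ℝ), (f.coord γ).1.eval t) ∈ f.N := f.mem_graphIn t
  have h5 := f.fderiv_field (z := (t, ((f.coord γ).1.eval t, (f.coord γ).2.eval t))) hz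
    (v.1.eval t, v.2.eval t)
  rw [pairCurve_eval, pairCurve_eval, h5] at h4
  rw [linOperator_eval, f.flowCurve_eval, f.anchorCurve_eval]
  change (CkCurve.derivL v.1).eval t -
    (fderiv ℝ (CkCurve.nemytskii k f.field) (pairCurve (f.coord γ)) (pairCurve v)).eval t = _
  rw [h4]
  abel

/-- Coordinates in which the equation is linear. -/
theorem exists_flatten : ∃ Θ : OpenPartialHomeomorph (CkCurve (k + 1) E × CkCurve k (Fin s → ℝ))
    ((E × CkCurve k (Fin s → ℝ)) × CkCurve k E), f.coord γ ∈ Θ.source ∧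
      ContDiffOn ℝ ∞ Θ Θ.source ∧ ContDiffOn ℝ ∞ Θ.symm Θ.target ∧
      (∀ y, (Θ y).2 = f.equation y) ∧
      ∀ v, (fderiv ℝ Θ (f.coord γ) v).2 = linOperator f.anchorCurve f.flowCurve v := by
  -- The equation is complemented by the initial value and the coefficient curve. The derivative is
  -- then an isomorphism by unique solvability of the linear initial value problem, so no
  -- transversality condition has to be assumed.
  let g : CkCurve (k + 1) E × CkCurve k (Fin s → ℝ) →
      (E × CkCurve k (Fin s → ℝ)) × CkCurve k E := fun y => ((y.1.eval 0, y.2), f.equation y)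
  let l : CkCurve (k + 1) E × CkCurve k (Fin s → ℝ) →L[ℝ] E × CkCurve k (Fin s → ℝ) :=
    ((CkCurve.evalL 0).comp (.fst ℝ _ _)).prod (.snd ℝ _ _)
  have hg : ContDiffOn ℝ ∞ g (Prod.fst ⁻¹' CkCurve.graphIn (k + 1) f.N) :=
    l.contDiff.contDiffOn.prodMk f.contDiffOn_equation
  have hd : HasFDerivAt g (linOperatorEquiv f.anchorCurve f.flowCurve :
      CkCurve (k + 1) E × CkCurve k (Fin s → ℝ) →L[ℝ] (E × CkCurve k (Fin s → ℝ)) × CkCurve k E)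
      (f.coord γ) := l.hasFDerivAt.prodMk f.hasFDerivAt_equation
  obtain ⟨Θ, h1, h2, h3, h4⟩ := exists_smooth_openPartialHomeomorph
    (isOpen_fst_graphIn f.isFrame.isOpen) hg f.mem_graphIn _ hd
  refine ⟨Θ, h1, (hg.mono h2).congr fun x _ => h3 x, h4, fun y => by rw [h3], fun v => ?_⟩
  have h5 : (Θ : _ → _) = g := funext h3
  rw [h5, hd.fderiv]
  rfl

end PathFrame

/-- The flattening diffeomorphism is applied after the chart of the `S`-paths. Its second component
is the equation itself, so its zeros are the solutions, and its derivative at `c` cuts out the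
linearized solutions. -/
theorem exists_sliceChart_solution (hSP : IsPolyPoisson S P s) (c : SolutionSpace S P k)
    (f : PathFrame P s c.1.1) :
    letI := sPathChartedSpace hSP k
    ∃ (Θ : OpenPartialHomeomorph (CkCurve (k + 1) E × CkCurve k (Fin s → ℝ))
      ((E × CkCurve k (Fin s → ℝ)) × CkCurve k E)), f.coord c.1.1 ∈ Θ.source ∧
      ContDiffOn ℝ ∞ Θ Θ.source ∧ ContDiffOn ℝ ∞ Θ.symm Θ.target ∧
      (∀ v, (fderiv ℝ Θ (f.coord c.1.1) v).2 = linOperator f.anchorCurve f.flowCurve v) ∧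
      ∀ b ∈ ((f.sliceChart hSP.subbundle).restr c.1).source,
        (f.sliceChart hSP.subbundle).restr c.1 b ∈ Θ.source → (b ∈ SolutionSpace S P k ↔
          (Θ ((f.sliceChart hSP.subbundle).restr c.1 b)).2 = 0) := by
  let _ := sPathChartedSpace hSP k
  obtain ⟨Θ, h1, h2, h3, h4, h5⟩ := f.exists_flatten
  refine ⟨Θ, h1, h2, h3, h5, fun b hb _ => ?_⟩
  have hb' : b.1 ∈ f.τ.coSource r k ∧ (f.τ.coCoord b.1).1 ∈ CkCurve.graphIn (k + 1) f.N :=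
    (f.mem_sliceChart_source_iff hSP.subbundle).1 hb
  rw [f.mem_solutionSpace_iff hSP.subbundle hb'.1 hb'.2, h4, f.restr_apply, CkCurve.ext_iff]
  refine forall_congr' fun t => ?_
  rw [f.equation_eval hb'.2, CkCurve.eval_zero, sub_eq_zero]

theorem exists_sliceChart_solutionSpace (hSP : IsPolyPoisson S P s) (c : SolutionSpace S P k) :
    letI := sPathChartedSpace hSP k
    ∃ s' : SliceChart (CkCurve (k + 1) E × CkCurve k (Fin s → ℝ)) (E × CkCurve k (Fin s → ℝ))
      (CkCurve k E) (SolutionSpace S P k), c.1 ∈ s'.e.source := by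
  let _ := sPathChartedSpace hSP k
  obtain ⟨f⟩ := nonempty_pathFrame hSP c.1.1
  obtain ⟨Θ, h1, h2, h3, -, h5⟩ := exists_sliceChart_solution hSP c f
  refine ⟨SliceChart.ofDiffeo (SliceChart.restr_mem_maximalAtlas (exists_sliceChart_sPath hSP)
    (f.sliceChart hSP.subbundle) c.1) Θ h2 h3 (linOperatorEquiv f.anchorCurve f.flowCurve) h5,
    SliceChart.mem_ofDiffeo_source.2 ⟨f.mem_sliceChart hSP.subbundle, ?_⟩⟩
  rw [f.restr_apply]
  exact h1

/-- The smooth structure of the space of solutions. -/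
@[reducible] def solutionChartedSpace (hSP : IsPolyPoisson S P s) (k : ℕ) :
    ChartedSpace (E × CkCurve k (Fin s → ℝ)) (SolutionSpace S P k) :=
  letI := sPathChartedSpace hSP k
  SliceChart.chartedSpace (exists_sliceChart_solutionSpace hSP)

/-- The differential `κ` of the chart of `P(S)` takes the form to the linearized form and the
tangent space of the solutions to the kernel of the linearized equation. The linear result is
transported back along it. -/
theorem isCoisotropicOfCodim_solutionSpace (hSP : IsPolyPoisson S P s) (c : SolutionSpace S P k) :
    letI := sPathChartedSpace hSP k
    letI := solutionChartedSpace hSP k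
    IsCoisotropicOfCodim
      (sPathForm (H := CkCurve (k + 1) E × CkCurve k (Fin s → ℝ)) S c.1)
      (LinearMap.range (mfderiv 𝓘(ℝ, E × CkCurve k (Fin s → ℝ))
        𝓘(ℝ, CkCurve (k + 1) E × CkCurve k (Fin s → ℝ))
        (Subtype.val : SolutionSpace S P k → SPath S k) c).toLinearMap)
      (Module.finrank ℝ E + Module.finrank ℝ (Fin s → ℝ)) := by
  let _ := sPathChartedSpace hSP k
  let _ := solutionChartedSpace hSP k
  obtain ⟨f⟩ := nonempty_pathFrame hSP c.1.1
  obtain ⟨Θ, h1, h2, h3, h4, h5⟩ := exists_sliceChart_solution hSP c f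
  obtain ⟨κ, hκ⟩ := SliceChart.exists_mfderiv_restr (exists_sliceChart_sPath hSP)
    (f.sliceChart hSP.subbundle) c.1 (f.mem_sliceChart hSP.subbundle)
  have hsol := (f.mem_solutionSpace_iff hSP.subbundle f.mem_source f.mem_graphIn).1 c.2
  refine (f.isStructureCurve hSP hsol).isCoisotropicOfCodim_linSolutions.of_linearEquiv κ
    (fun v w => ?_) fun v => ?_
  · rw [hκ, hκ]
    exact f.sPathForm_eq hSP c.1 v w
  · have h6 := SliceChart.mem_range_mfderiv_val_ofDiffeo (exists_sliceChart_solutionSpace hSP) c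
      (f.mem_sliceChart hSP.subbundle) (by rw [f.restr_apply]; exact h1)
      (SliceChart.restr_mem_maximalAtlas (exists_sliceChart_sPath hSP)
        (f.sliceChart hSP.subbundle) c.1) h2 h3 (linOperatorEquiv f.anchorCurve f.flowCurve) h5 v
    rw [f.restr_apply] at h6
    refine h6.trans ?_
    rw [hκ]
    exact Eq.congr (h4 _) rfl

end Solutions

end

/-- The codimension does not depend on the solution: it is the dimension of `M`, from initial
values, plus the rank `s`, from end values of gauge parameters. -/
theorem mainTheorem6 {E : Type u} [NormedAddCommGroup E] [NormedSpace ℝ E] [FiniteDimensional ℝ E]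
    {M : Type v} [TopologicalSpace M] [T2Space M] [SecondCountableTopology M]
    [ChartedSpace E M] [IsManifold 𝓘(ℝ, E) ∞ M]
    (r s k : ℕ) (S : ∀ x : M, Submodule ℝ (CoVel E M r x))
    (P : ∀ x : M, S x →ₗ[ℝ] TangentSpace 𝓘(ℝ, E) x) (hSP : IsPolyPoisson S P s) :
    -- the Banach manifold `⊕_r T^*(PM)`
    ∃ (_ : TopologicalSpace (CoPath E M r k))
      (_ : ChartedSpace (CoPathModel E r k) (CoPath E M r k)),
      IsPathManifold E M r k ∧
      -- `P(S)` is a Banach submanifold of it, and weak `r`-symplectic with the restricted form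
      ∃ _ : ChartedSpace (CkCurve (k + 1) E × CkCurve k (Fin s → ℝ)) (SPath S k),
        IsManifold 𝓘(ℝ, CkCurve (k + 1) E × CkCurve k (Fin s → ℝ)) ∞ (SPath S k) ∧
        IsSmoothEmbedding 𝓘(ℝ, CkCurve (k + 1) E × CkCurve k (Fin s → ℝ))
          𝓘(ℝ, CoPathModel E r k) ∞ (Subtype.val : SPath S k → CoPath E M r k) ∧
        IsWeakPolySymplectic (H := CkCurve (k + 1) E × CkCurve k (Fin s → ℝ))
          (sPathForm (k := k) S) ∧
        -- `C_(S,P)` is a coisotropic Banach submanifold of `P(S)`, and its characteristic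
        -- distribution has finite codimension
        ∃ _ : ChartedSpace (E × CkCurve k (Fin s → ℝ)) (SolutionSpace S P k),
          IsManifold 𝓘(ℝ, E × CkCurve k (Fin s → ℝ)) ∞ (SolutionSpace S P k) ∧
          IsSmoothEmbedding 𝓘(ℝ, E × CkCurve k (Fin s → ℝ))
            𝓘(ℝ, CkCurve (k + 1) E × CkCurve k (Fin s → ℝ)) ∞
            (Subtype.val : SolutionSpace S P k → SPath S k) ∧
          ∃ d : ℕ, ∀ c : SolutionSpace S P k,
            IsCoisotropicOfCodim
              (sPathForm (H := CkCurve (k + 1) E × CkCurve k (Fin s → ℝ)) S c.1)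
              (LinearMap.range (mfderiv 𝓘(ℝ, E × CkCurve k (Fin s → ℝ))
                𝓘(ℝ, CkCurve (k + 1) E × CkCurve k (Fin s → ℝ))
                (Subtype.val : SolutionSpace S P k → SPath S k) c).toLinearMap) d := by
  have := FiniteDimensional.complete ℝ E
  let _ := sPathChartedSpace hSP k
  let _ := solutionChartedSpace hSP k
  exact ⟨CoPath.instTopologicalSpace, CoPath.instChartedSpace, isPathManifold_coPath E M r k,
    sPathChartedSpace hSP k, SliceChart.isManifold (exists_sliceChart_sPath hSP),
    SliceChart.isSmoothEmbedding (exists_sliceChart_sPath hSP), isWeakPolySymplectic_sPathForm hSP,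
    solutionChartedSpace hSP k, SliceChart.isManifold (exists_sliceChart_solutionSpace hSP),
    SliceChart.isSmoothEmbedding (exists_sliceChart_solutionSpace hSP),
    Module.finrank ℝ E + Module.finrank ℝ (Fin s → ℝ),
    fun c => isCoisotropicOfCodim_solutionSpace hSP c⟩
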